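/- Let $\mathbb T=\mathbb R/\mathbb Z$, $\mathcal D=\mathbb T\times(0,1)$ with points $(x,z)$, let $A=\sqrt{-\partial_{xx}}$, and for $f\in L^2(\mathcal D)$ with Fourier coefficients $\hat f_k(z)=\int_{\mathbb T}e^{-2\pi i k x}f(x,z)\,dx$ put $$\|A^re^{\tau A}f\|^2=\int_0^1\sum_{k\in\mathbb Z}|2\pi k|^{2r}e^{2\tau|2\pi k|}|\hat f_k(z)|^2dz,\qquad \|f\|_{r,0,\tau}=\big(\|A^re^{\tau A}f\|^2+\|f\|_{L^2}^2\big)^{1/2},\qquad \|f\|_{r,1,\tau}=\|f\|_{r,0,\tau}+\|\partial_zf\|_{r,0,\tau},$$ and let $\mathcal S_{r,s,\tau}$ be the space of $f\in L^2(\mathcal D)$ with $\|f\|_{r,s,\tau}<\infty$. For $\nu>0$ consider, for real-valued $\widetilde u(t,x,z)$, $$\partial_t\widetilde u+\widetilde u\,\partial_x\widetilde u-\partial_x\int_0^1\widetilde u^2\,dz-\Big(\int_0^z\partial_x\widetilde u(x,s)\,ds\Big)\partial_z\widetilde u-\nu\,\partial_{zz}\widetilde u=0,\qquad \partial_z\widetilde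 u|_{z=0,1}=0,\qquad \widetilde u|_{t=0}=\widetilde u_0. \tag{1}$$ A weak solution of (1) on $[0,T]$ with radius $\tau$ is a function $\widetilde u:[0,T]\to L^2(\mathcal D)$ with $\widetilde u(0)=\widetilde u_0$ and $\int_0^1\widetilde u\,dz=0$, where $\tau$ is continuous and positive on $[0,T]$, such that $$\widetilde u\in L^\infty(0,T;\mathcal S_{r,0,\tau(t)})\cap L^2(0,T;H^1(\mathcal D)\cap\mathcal S_{r,1,\tau(t)}\cap\mathcal S_{r+\frac12,0,\tau(t)}),\qquad \partial_t\widetilde u,\ A^{r-\frac12}e^{\tau(t)A}\partial_t\widetilde u\in L^2(0,T;V'),$$ where $V'$ is the dual of the space of $H^1$ velocities (functions of time are identified with their continuous representatives: for every element of the basis $e^{2\pi ikx}\cos(\pi nz)$ the coefficient of $\widetilde u(t)$ is absolutely continuous in $t\in[0,T]$), and (1) holds in the sense of distributions, the boundary condition being imposed through test functions that need not vanish at $z=0,1$. **Theorem.** For every $r>2$ there is a constant $\mathcal C_r>0$, depending only on $r$, such that the following holds for all $\nu>0$ and $\tau_0>0$. Let $\widetilde u_0\in\mathcal S_{r,0,\tau_0}$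 be real-valued with $\int_0^1\widetilde u_0(x,z)\,dz=0$ for almost every $x$, and suppose $$\|\widetilde u_0\|_{r,0,\tau_0}<\frac{\nu\tau_0}{\mathcal C_r}.$$ Then there are $\widetilde u:[0,\infty)\to L^2(\mathcal D)$ and $\tau:[0,\infty)\to(0,\infty)$ such that: 1. (global existence) for every $T>0$, $\widetilde u$ is a weak solution of (1) on $[0,T]$ with radius $\tau$; 2. (radius of analyticity) $\tau(0)=\tau_0$ and $\tau(t)\ge\tau_0-\frac{\mathcal C_r}{\nu}\|\widetilde u_0\|_{r,0,\tau_0}>0$ for all $t\ge0$; 3. (energy inequality) for every $T>0$ there is $\kappa>0$ with $$\|\widetilde u(t)\|_{r,0,\tau(t)}^2+2\int_0^t\Big(\nu\|\partial_z\widetilde u(s)\|^2_{r,0,\tau(s)}+\kappa\|A^{r+\frac12}e^{\tau(s)A}\widetilde u(s)\|^2\Big)ds\le\|\widetilde u_0\|^2_{r,0,\tau_0}\qquad(0\le t\le T),$$ and for some $T>0$ this holds with $\kappa=1$; 4. (decay) for all $t\ge0$, $$e^{\nu t}\|\widetilde u(t)\|_{r,0,\tau(t)}^2+\nu\int_0^te^{\nu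 s}\|\partial_z\widetilde u(s)\|_{r,0,\tau(s)}^2ds\le\|\widetilde u_0\|_{r,0,\tau_0}^2\qquad\text{and}\qquad\|\widetilde u(t)\|_{r,0,\tau(t)}\le e^{-\nu t}\|\widetilde u_0\|_{r,0,\tau_0};$$ 5. (uniqueness) for every $T>0$, every weak solution of (1) on $[0,T]$ with the same initial value, and with any radius, equals $\widetilde u$ on $[0,T]$. -/

import Mathlib

open MeasureTheory Set
open scoped ENNReal ContDiff

namespace HydrostaticNS

/-! The two-dimensional hydrostatic (primitive) equations with vertical viscosity only, on the
channel `𝕋 × (0,1)`: the horizontal variable `x` lives on the torus of length one, the vertical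
variable `z` in `(0,1)`. -/

noncomputable section

/-- Lebesgue measure of the channel `𝕋 × (0,1)`. -/
abbrev channelMeasure : Measure (UnitAddCircle × ℝ) :=
  (volume : Measure UnitAddCircle).prod (volume.restrict (Ioo (0 : ℝ) 1))

/-- The real space `L²(𝕋 × (0,1))`. -/
abbrev ChannelL2 : Type := Lp ℝ 2 channelMeasure

/-- The Fourier coefficient in `x`, of wave number `2πk`, at height `z`. -/
def fourierX (f : ChannelL2) (k : ℤ) (z : ℝ) : ℂ :=
  fourierCoeff (fun x : UnitAddCircle => ((f (x, z) : ℝ) : ℂ)) k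

/-- The absolute value of the wave number `2πk`. -/
def waveNumber (k : ℤ) : ℝ := |2 * Real.pi * (k : ℝ)|

/-- `‖A^r e^{τA} f‖²`, where `A = √(-∂_xx)`; the value is `∞` if `A^r e^{τA} f` is not
in `L²`. -/
def analyticSq (r τ : ℝ) (f : ChannelL2) : ℝ≥0∞ :=
  ∫⁻ z in Ioo (0 : ℝ) 1, ∑' k : ℤ,
    ENNReal.ofReal (waveNumber k ^ (2 * r) * Real.exp (2 * τ * waveNumber k))
      * ‖fourierX f k z‖ₑ ^ 2

/-- The analytic-Sobolev norm `‖f‖_{r,0,τ} = (‖A^r e^{τA} f‖² + ‖f‖²)^{1/2}`.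
The space `S_{r,0,τ}` consists of the `f` for which it is finite. -/
def analyticNorm (r τ : ℝ) (f : ChannelL2) : ℝ≥0∞ :=
  (analyticSq r τ f + ‖f‖ₑ ^ 2) ^ (1 / 2 : ℝ)

/-- The derivative along the torus of a function on the torus. -/
def derivX (g : UnitAddCircle → ℝ) (x : UnitAddCircle) : ℝ :=
  deriv (fun h : ℝ => g (x + (h : UnitAddCircle))) 0

/-- Smooth functions on `𝕋 × (0,1)` supported away from `z = 0` and `z = 1`. -/
structure IsInteriorTest (φ : UnitAddCircle → ℝ → ℝ) : Prop where
  smooth : ContDiff ℝ ∞ (fun q : ℝ × ℝ => φ (q.1 : UnitAddCircle) q.2)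
  support : ∃ a b : ℝ, 0 < a ∧ b < 1 ∧ ∀ x z, z ∉ Icc a b → φ x z = 0

/-- `g` is the weak derivative `∂_x f`. -/
def HasWeakDerivX (f g : ChannelL2) : Prop :=
  ∀ φ : UnitAddCircle → ℝ → ℝ, IsInteriorTest φ →
    ∫ p, f p * derivX (fun x => φ x p.2) p.1 ∂channelMeasure
      = - ∫ p, g p * φ p.1 p.2 ∂channelMeasure

/-- `g` is the weak derivative `∂_z f`. -/
def HasWeakDerivZ (f g : ChannelL2) : Prop :=
  ∀ φ : UnitAddCircle → ℝ → ℝ, IsInteriorTest φ →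
    ∫ p, f p * deriv (φ p.1) p.2 ∂channelMeasure
      = - ∫ p, g p * φ p.1 p.2 ∂channelMeasure

/-- `‖∂_z f‖_{r,0,τ}`. The weak derivative is unique, so the infimum runs over at most one
function; it is `∞` if `f` has no weak derivative `∂_z f` in `L²`. -/
def analyticNormDz (r τ : ℝ) (f : ChannelL2) : ℝ≥0∞ :=
  ⨅ (g : ChannelL2) (_ : HasWeakDerivZ f g), analyticNorm r τ g

/-- The norm `‖f‖_{r,1,τ} = ‖f‖_{r,0,τ} + ‖∂_z f‖_{r,0,τ}` of `S_{r,1,τ}`. -/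
def analyticNormOne (r τ : ℝ) (f : ChannelL2) : ℝ≥0∞ :=
  analyticNorm r τ f + analyticNormDz r τ f

/-- The norm `(‖A f‖² + ‖f‖²)^{1/2} + (2 ‖∂_z f‖²)^{1/2}` of `H¹(𝕋 × (0,1))`. -/
def sobolevNorm (f : ChannelL2) : ℝ≥0∞ :=
  analyticNorm 1 0 f + analyticNormDz 0 0 f

/-- `∫₀¹ f(x,z) dz = 0` for almost every `x`. -/
def ZeroVerticalMean (f : ChannelL2) : Prop :=
  ∀ᵐ x : UnitAddCircle, ∫ z in Ioo (0 : ℝ) 1, f (x, z) = 0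

/-- The orthonormal basis `e^{2πikx}` (for `n = 0`), `√2 e^{2πikx} cos(πnz)` (for `n ≥ 1`). -/
def cosBasis (k : ℤ) (n : ℕ) (p : UnitAddCircle × ℝ) : ℂ :=
  fourier k p.1
    * (if n = 0 then 1 else ((Real.sqrt 2 * Real.cos (Real.pi * n * p.2) : ℝ) : ℂ))

/-- The coefficient of `f` with respect to `cosBasis k n`. -/
def cosCoeff (f : ChannelL2) (k : ℤ) (n : ℕ) : ℂ :=
  ∫ p, ((f p : ℝ) : ℂ) * (starRingEnd ℂ) (cosBasis k n p) ∂channelMeasure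

/-- The square of the norm dual to the `H¹` norm, for a functional with coefficients `b`. -/
def dualSq (b : ℤ → ℕ → ℂ) : ℝ≥0∞ :=
  ∑' (k : ℤ) (n : ℕ), ‖b k n‖ₑ ^ 2
    / ENNReal.ofReal (1 + waveNumber k ^ 2 + (Real.pi * (n : ℝ)) ^ 2)

/-- The coefficients of `A^r e^{τA}` applied to a functional with coefficients `b`. -/
def analyticWeight (r τ : ℝ) (b : ℤ → ℕ → ℂ) (k : ℤ) (n : ℕ) : ℂ :=
  ((waveNumber k ^ r * Real.exp (τ * waveNumber k) : ℝ) : ℂ) * b k n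

/-- `b` is the time derivative of `u` on `[0,T]`: every coefficient of `u` with respect to the
cosine basis is absolutely continuous on `[0,T]`, and its derivative is the coefficient
of `b`. -/
def HasTimeDeriv (T : ℝ) (u : ℝ → ChannelL2) (b : ℝ → ℤ → ℕ → ℂ) : Prop :=
  ∀ k n, IntervalIntegrable (fun t => b t k n) volume 0 T ∧
    ∀ t ∈ Icc (0 : ℝ) T, cosCoeff (u t) k n = cosCoeff (u 0) k n + ∫ s in (0 : ℝ)..t, b s k n

/-- Test functions on `(0,T) × 𝕋 × [0,1]`: smooth, compactly supported in `(0,T)` in time, with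
no restriction at `z = 0` and `z = 1`. -/
structure IsSpaceTimeTest (T : ℝ) (φ : ℝ → UnitAddCircle → ℝ → ℝ) : Prop where
  smooth : ContDiff ℝ ∞ (fun q : ℝ × ℝ × ℝ => φ q.1 (q.2.1 : UnitAddCircle) q.2.2)
  support : ∃ a b : ℝ, 0 < a ∧ b < T ∧ ∀ t x z, t ∉ Icc a b → φ t x z = 0

/-- `u` solves, in the sense of distributions on `(0,T)`,
`∂_t u + u ∂_x u - ∂_x ∫₀¹ u² dz - (∫₀ᶻ ∂_x u ds) ∂_z u - ν ∂_zz u = 0`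
with `∂_z u = 0` at `z = 0` and `z = 1`. The boundary condition is encoded in the usual way:
the viscous term is integrated by parts once, and the test functions need not vanish at
`z = 0, 1`. The functions `ux`, `uz` are the weak derivatives `∂_x u`, `∂_z u`. -/
def SolvesEquation (ν T : ℝ) (u : ℝ → ChannelL2) : Prop :=
  ∃ ux uz : ℝ → ChannelL2,
    (∀ᵐ t ∂(volume.restrict (Ioo 0 T)), HasWeakDerivX (u t) (ux t) ∧ HasWeakDerivZ (u t) (uz t)) ∧
    ∀ φ : ℝ → UnitAddCircle → ℝ → ℝ, IsSpaceTimeTest T φ →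
      ∫ t in Ioo 0 T, ∫ p,
        (- u t p * deriv (fun s => φ s p.1 p.2) t
          + (u t p * ux t p - (∫ s in (0 : ℝ)..p.2, ux t (p.1, s)) * uz t p) * φ t p.1 p.2
          + (∫ s in Ioo (0 : ℝ) 1, u t (p.1, s) ^ 2) * derivX (fun x => φ t x p.2) p.1
          + ν * uz t p * deriv (φ t p.1) p.2) ∂channelMeasure = 0

/-- Weak solutions on `[0,T]` with initial value `u₀`, viscosity `ν`, Sobolev exponent `r` and
radius of analyticity `τ(t)` in `x`: the regularity class and the equation. -/
structure IsWeakSolution (r ν T : ℝ) (u₀ : ChannelL2) (τ : ℝ → ℝ) (u : ℝ → ChannelL2) : Prop where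
  radius_continuous : ContinuousOn τ (Icc 0 T)
  radius_pos : ∀ t ∈ Icc 0 T, 0 < τ t
  initial : u 0 = u₀
  zeroMean : ∀ t ∈ Icc 0 T, ZeroVerticalMean (u t)
  /-- `u ∈ L^∞(0,T; S_{r,0,τ(t)})` -/
  bounded : ∃ M : ℝ≥0∞, M < ⊤ ∧ ∀ᵐ t ∂(volume.restrict (Ioo 0 T)), analyticNorm r (τ t) (u t) ≤ M
  /-- `u ∈ L²(0,T; H¹)` -/
  sqInt_sobolev : ∫⁻ t in Ioo 0 T, sobolevNorm (u t) ^ 2 < ⊤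
  /-- `u ∈ L²(0,T; S_{r,1,τ(t)})` -/
  sqInt_vertical : ∫⁻ t in Ioo 0 T, analyticNormOne r (τ t) (u t) ^ 2 < ⊤
  /-- `u ∈ L²(0,T; S_{r+1/2,0,τ(t)})` -/
  sqInt_horizontal : ∫⁻ t in Ioo 0 T, analyticNorm (r + 1 / 2) (τ t) (u t) ^ 2 < ⊤
  /-- `∂_t u` and `A^{r-1/2} e^{τA} ∂_t u` are in `L²(0,T; V')`, `V'` the dual of the `H¹` space -/
  timeDeriv : ∃ b : ℝ → ℤ → ℕ → ℂ, HasTimeDeriv T u b ∧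
    ∫⁻ t in Ioo 0 T, dualSq (b t) < ⊤ ∧
    ∫⁻ t in Ioo 0 T, dualSq (analyticWeight (r - 1 / 2) (τ t) (b t)) < ⊤
  equation : SolvesEquation ν T u

/-- The energy inequality on `[0,T]`, with coefficient `κ` in front of the analytic dissipation:
`‖u(t)‖²_{r,0,τ(t)} + 2 ∫₀ᵗ (ν ‖∂_z u‖²_{r,0,τ} + κ ‖A^{r+1/2} e^{τA} u‖²) ds ≤ ‖u₀‖²_{r,0,τ₀}`. -/
def EnergyInequality (r ν κ T τ₀ : ℝ) (u₀ : ChannelL2) (τ : ℝ → ℝ) (u : ℝ → ChannelL2) : Prop :=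
  ∀ t ∈ Icc 0 T,
    analyticNorm r (τ t) (u t) ^ 2
      + 2 * ∫⁻ s in Ioo 0 t, (ENNReal.ofReal ν * analyticNormDz r (τ s) (u s) ^ 2
          + ENNReal.ofReal κ * analyticSq (r + 1 / 2) (τ s) (u s))
      ≤ analyticNorm r τ₀ u₀ ^ 2

end

end HydrostaticNS

open HydrostaticNS

/-! The equation is solved in Fourier variables. Reflecting `u` evenly in `z` turns the channel into
a two-dimensional torus and `u` into a family of coefficients `a (k, m)`, even in `m` and
conjugate-symmetric. The derivative `∂_z` multiplies by `iπm` and maps even families to odd ones;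
the vertical primitive divides by `iπm`. The Neumann condition is built into the cosine expansion.
The pressure term only cancels the modes `m = 0`, so the equation becomes `a' = -flux ν a` on modes
with `m ≠ 0`.

The difficulty is that the vertical velocity `-∫₀ᶻ ∂_x u` costs a full horizontal derivative, which
the viscosity cannot pay since it acts only in `z`. An exponential weight with shrinking radius pays
for it: differentiating `e^{2τ|2πk|}` in time produces `2τ' ‖A^{r+1/2} e^{τA} u‖²`. The central
estimate (`l2_weighted_maj_le`, `tsum_trilinear_le`) bounds the nonlinear contribution by `c F
‖A^{r+1/2} e^{τA} u‖²`, where `F` has the size of `‖∂_z u‖_{r,0,τ}`. It rests on Young inequalities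
with different exponents in `k` and `m`: the vertical primitive supplies `1/m ∈ ℓ²`, and `r - 1/2 >
1/2` supplies summability in `k`. In the unweighted `L²` norm the nonlinearity cancels exactly
(`sum_conj_mul_advec`).

Let `K` be the size of the data. Choosing `τ' = -cF - gain` makes the energy inequality close with
an extra dissipation `gain · ‖A^{r+1/2} e^{τA} u‖²`. Vanishing vertical mean gives a Poincaré
inequality, hence exponential decay of the energy, hence `∫ cF ≤ cK/ν` over all times; and `gain` is
chosen positive with total integral `cK/ν`. So the radius never loses more than `2cK/ν`, which the
smallness assumption keeps below `τ₀`. This is `exists_isApprox`, carried out for Galerkin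
truncations, with a continuity argument because the trilinear bound needs `τ ≥ 0`.

The bounds do not depend on the truncation. Coefficients are uniformly Lipschitz in time and the
radii uniformly equicontinuous, so a diagonal subsequence converges (`exists_subseq_tendsto`). The
norms pass to the limit by Fatou's lemma, the quadratic term by a tightness argument
(`tendsto_integral_tsum`). This gives `exists_isSpectralSolution`;
`IsSpectralSolution.isWeakSolution` and `IsSpectralSolution.solvesEquation` translate it back to the
channel.

For uniqueness, testing the weak formulation with single modes shows that every weak solution
satisfies the same integral equations mode by mode (`IsWeakSolution.isCoefSolution`). The difference
of two solutions is measured in a norm with weight `e^{2ρ(1+|2πk|)}`, where `ρ` starts below both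
radii and decreases at a rate given by the dissipation of the two solutions. The loss of `ρ` absorbs
the half derivatives in the estimate, so the difference vanishes while `ρ ≥ 0`. Since that time span
is positive from any starting time, agreement propagates over `[0,T]` (`IsCoefSolution.unique`). -/

namespace HydrostaticNS
noncomputable section

/-! ### Square sums and convolutions of extended nonnegative families -/

section SquareSums

variable {ι κ G A B : Type*}

/-- The `ℓ²` norm of a family of extended nonnegative numbers. -/
def l2 (f : ι → ℝ≥0∞) : ℝ≥0∞ := (∑' i, f i ^ 2) ^ (1 / 2 : ℝ)

lemma rpow_half_sq (x : ℝ≥0∞) : (x ^ (1 / 2 : ℝ)) ^ 2 = x := by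
  rw [← ENNReal.rpow_natCast, ← ENNReal.rpow_mul]; norm_num

lemma sq_rpow_half (x : ℝ≥0∞) : (x ^ 2) ^ (1 / 2 : ℝ) = x := by
  rw [← ENNReal.rpow_natCast, ← ENNReal.rpow_mul]; norm_num

lemma l2_sq (f : ι → ℝ≥0∞) : l2 f ^ 2 = ∑' i, f i ^ 2 := rpow_half_sq _

lemma le_of_sq_le {x y : ℝ≥0∞} (h : x ^ 2 ≤ y ^ 2) : x ≤ y :=
  (ENNReal.pow_le_pow_left_iff two_ne_zero).1 h

/-- Cauchy–Schwarz, as Hölder's inequality for counting measure. Working in `ℝ≥0∞` avoids all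
summability side conditions in the estimates below. -/
lemma tsum_mul_le_l2 (f g : ι → ℝ≥0∞) : ∑' i, f i * g i ≤ l2 f * l2 g := by
  let _ : MeasurableSpace ι := ⊤
  have h := ENNReal.lintegral_mul_le_Lp_mul_Lq (Measure.count : Measure ι)
    Real.HolderConjugate.two_two (f := f) (g := g) measurable_from_top.aemeasurable
    measurable_from_top.aemeasurable
  simp only [lintegral_count, Pi.mul_apply, ENNReal.rpow_ofNat] at h
  exact h

lemma l2_mono {f g : ι → ℝ≥0∞} (h : ∀ i, f i ≤ g i) : l2 f ≤ l2 g :=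
  ENNReal.rpow_le_rpow (ENNReal.tsum_le_tsum fun i => pow_le_pow_left' (h i) 2) (by norm_num)

lemma l2_const_mul (c : ℝ≥0∞) (f : ι → ℝ≥0∞) : l2 (fun i => c * f i) = c * l2 f := by
  simp only [l2, mul_pow]
  rw [ENNReal.tsum_mul_left, ENNReal.mul_rpow_of_nonneg _ _ (by norm_num), sq_rpow_half]

/-- Minkowski's inequality for infinitely many families: the square of the sum is a double sum of
products, and Cauchy–Schwarz applies to each pair. -/
lemma l2_tsum_le (f : κ → ι → ℝ≥0∞) : l2 (fun i => ∑' s, f s i) ≤ ∑' s, l2 (f s) := by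
  apply le_of_sq_le
  rw [l2_sq]
  calc ∑' i, (∑' s, f s i) ^ 2 = ∑' i, ∑' s, ∑' t, f s i * f t i := by
        congr 1 with i
        rw [sq, ← ENNReal.tsum_mul_right]
        congr 1 with s
        rw [ENNReal.tsum_mul_left]
    _ = ∑' s, ∑' t, ∑' i, f s i * f t i := by
        rw [ENNReal.tsum_comm]
        congr 1 with s
        rw [ENNReal.tsum_comm]
    _ ≤ ∑' s, ∑' t, l2 (f s) * l2 (f t) :=
        ENNReal.tsum_le_tsum fun s => ENNReal.tsum_le_tsum fun t => tsum_mul_le_l2 _ _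
    _ = _ := by
        rw [sq, ← ENNReal.tsum_mul_right]
        congr 1 with s
        rw [ENNReal.tsum_mul_left]

lemma l2_add_le (f g : ι → ℝ≥0∞) : l2 (fun i => f i + g i) ≤ l2 f + l2 g := by
  have h := l2_tsum_le (fun (b : Bool) => if b then f else g)
  simpa [tsum_bool, add_comm] using h

lemma l2_comp_equiv (e : ι ≃ κ) (f : κ → ℝ≥0∞) : l2 (fun i => f (e i)) = l2 f := by
  simp only [l2]
  rw [e.tsum_eq (fun i => f i ^ 2)]

lemma l2_prod (f : ι × κ → ℝ≥0∞) : l2 f = l2 fun i => l2 fun k => f (i, k) := by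
  rw [l2, l2, ENNReal.tsum_prod']
  simp only [l2_sq]

lemma le_l2 (f : ι → ℝ≥0∞) (i : ι) : f i ≤ l2 f := by
  apply le_of_sq_le
  rw [l2_sq]
  exact ENNReal.le_tsum (f := fun i => f i ^ 2) i

variable [AddCommGroup G] [AddCommGroup A] [AddCommGroup B]

/-- The convolution of two families indexed by a group. -/
def conv (X Y : G → ℝ≥0∞) (j : G) : ℝ≥0∞ := ∑' i, X i * Y (j - i)

lemma conv_comm (X Y : G → ℝ≥0∞) : conv X Y = conv Y X := by
  ext j
  simp only [conv]
  rw [← (Equiv.subLeft j).tsum_eq]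
  simp [mul_comm]

lemma conv_le_l2 (X Y : G → ℝ≥0∞) (j : G) : conv X Y j ≤ l2 X * l2 Y := by
  refine (tsum_mul_le_l2 _ _).trans_eq ?_
  exact congrArg _ (l2_comp_equiv (Equiv.subLeft j) Y)

/-- Young's inequality `ℓ¹ * ℓ² ⊆ ℓ²`: a convolution is a superposition of translates, and
translation preserves the `ℓ²` norm. -/
lemma l2_conv_le (X Y : G → ℝ≥0∞) : l2 (conv X Y) ≤ (∑' i, X i) * l2 Y := by
  refine (l2_tsum_le (fun i j => X i * Y (j - i))).trans ?_
  rw [← ENNReal.tsum_mul_right]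
  refine ENNReal.tsum_le_tsum fun i => ?_
  rw [l2_const_mul]
  exact (congrArg _ (l2_comp_equiv (Equiv.subRight i) Y)).le

lemma conv_prod (X Y : A × B → ℝ≥0∞) (k : A) (m : B) :
    conv X Y (k, m) = ∑' i, conv (fun n => X (i, n)) (fun n => Y (k - i, n)) m := by
  simp only [conv]
  rw [ENNReal.tsum_prod']
  rfl

/-- The norm `ℓ¹` in the first and `ℓ²` in the second variable. -/
def l12 (X : ι × κ → ℝ≥0∞) : ℝ≥0∞ := ∑' k, l2 fun m => X (k, m)

/-- The norm `ℓ²` in the first and `ℓ¹` in the second variable. -/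
def l21 (X : ι × κ → ℝ≥0∞) : ℝ≥0∞ := l2 fun k => ∑' m, X (k, m)

/-- Young's inequality in each variable separately, with the roles of the factors exchanged between
the two. One factor may thus supply summability in `k` while the other supplies it in `m`. -/
lemma l2_conv_mixed (X Y : A × B → ℝ≥0∞) : l2 (conv X Y) ≤ l12 X * l21 Y := by
  rw [l2_prod]
  refine le_trans (l2_mono (g := conv (fun k => l2 fun m => X (k, m))
    (fun k => ∑' m, Y (k, m))) fun k => ?_) (l2_conv_le _ _)
  simp only [conv_prod]
  refine (l2_tsum_le _).trans (ENNReal.tsum_le_tsum fun i => ?_)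
  rw [conv_comm, mul_comm]
  exact l2_conv_le _ _

/-- Cauchy–Schwarz in the second variable leaves a bound without decay there; the factor `p`
restores square summability. It is used with `p = 1/m`, the gain of the dual norm. -/
lemma l2_conv_dual (p : B → ℝ≥0∞) (X Y : A × B → ℝ≥0∞) :
    l2 (fun j => p j.2 * conv X Y j) ≤ l2 p * (l12 X * l2 Y) := by
  have h : ∀ j : A × B, p j.2 * conv X Y j
      ≤ p j.2 * conv (fun k => l2 fun m => X (k, m)) (fun k => l2 fun m => Y (k, m)) j.1 := by
    rintro ⟨k, m⟩
    gcongr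
    rw [conv_prod]
    exact ENNReal.tsum_le_tsum fun i => conv_le_l2 _ _ _
  refine (l2_mono h).trans ?_
  rw [l2_prod]
  have h2 : ∀ k : A, (l2 fun m : B => p m * conv (fun k => l2 fun m => X (k, m))
      (fun k => l2 fun m => Y (k, m)) k)
      = l2 p * conv (fun k => l2 fun m => X (k, m)) (fun k => l2 fun m => Y (k, m)) k := by
    intro k
    simp_rw [mul_comm (p _)]
    rw [l2_const_mul, mul_comm]
  simp only [h2]
  rw [l2_const_mul, l2_prod Y]
  gcongr
  exact l2_conv_le _ _

end SquareSums

/-! ### Weights in Fourier space -/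

/-- The horizontal wave number, as an extended nonnegative number. -/
def wv (k : ℤ) : ℝ≥0∞ := ENNReal.ofReal (waveNumber k)

/-- The larger of `1` and the horizontal wave number. -/
def qv (k : ℤ) : ℝ≥0∞ := max 1 (wv k)

/-- The modulus of the vertical wave number. -/
def em (m : ℤ) : ℝ≥0∞ := ‖m‖ₑ

/-- The inverse modulus of the vertical wave number, `0` for the wave number `0`. -/
def im (m : ℤ) : ℝ≥0∞ := if m = 0 then 0 else (em m)⁻¹

lemma waveNumber_nonneg (k : ℤ) : 0 ≤ waveNumber k := abs_nonneg _

lemma waveNumber_eq (k : ℤ) : waveNumber k = 2 * Real.pi * |(k : ℝ)| := by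
  rw [waveNumber, abs_mul, abs_of_nonneg (by positivity)]

lemma waveNumber_zero : waveNumber 0 = 0 := by simp [waveNumber]

lemma waveNumber_neg (k : ℤ) : waveNumber (-k) = waveNumber k := by simp [waveNumber]

lemma one_le_waveNumber {k : ℤ} (hk : k ≠ 0) : 1 ≤ waveNumber k := by
  rw [waveNumber_eq]
  have h1 : (1 : ℝ) ≤ |(k : ℝ)| := by exact_mod_cast Int.one_le_abs hk
  nlinarith [Real.pi_gt_three]

lemma waveNumber_le (k i : ℤ) : waveNumber k ≤ waveNumber i + waveNumber (k - i) := by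
  simp only [waveNumber_eq]
  rw [← mul_add]
  gcongr
  push_cast
  calc |(k : ℝ)| = |(i : ℝ) + (k - i)| := by ring_nf
    _ ≤ _ := abs_add_le _ _

lemma wv_le (k i : ℤ) : wv k ≤ wv i + wv (k - i) := by
  rw [wv, wv, wv, ← ENNReal.ofReal_add (waveNumber_nonneg _) (waveNumber_nonneg _)]
  exact ENNReal.ofReal_le_ofReal (waveNumber_le k i)

lemma wv_zero : wv 0 = 0 := by simp [wv, waveNumber_zero]

lemma wv_ne_top (k : ℤ) : wv k ≠ ⊤ := ENNReal.ofReal_ne_top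

lemma one_le_qv (k : ℤ) : 1 ≤ qv k := le_max_left _ _

lemma wv_le_qv (k : ℤ) : wv k ≤ qv k := le_max_right _ _

lemma qv_ne_top (k : ℤ) : qv k ≠ ⊤ := by simp [qv, wv_ne_top]

lemma qv_zero : qv 0 = 1 := by simp [qv, wv_zero]

lemma one_le_wv {k : ℤ} (hk : k ≠ 0) : 1 ≤ wv k := by
  rw [wv, ← ENNReal.ofReal_one]
  exact ENNReal.ofReal_le_ofReal (one_le_waveNumber hk)

lemma qv_eq {k : ℤ} (hk : k ≠ 0) : qv k = wv k := max_eq_right (one_le_wv hk)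

/-- One factor `wv` annihilates the mode `k = 0`, so the inhomogeneous weight may be replaced by the
homogeneous one. This lets the top-order factor be bounded by `A^{r+1/2}` alone, which is what the
loss of radius controls. -/
lemma wv_mul_qv_rpow (k : ℤ) {s : ℝ} (hs : 0 ≤ s) : wv k * qv k ^ s = wv k ^ (s + 1) := by
  rcases eq_or_ne k 0 with rfl | hk
  · simp [wv_zero, ENNReal.zero_rpow_of_pos (by linarith : 0 < s + 1)]
  · rw [qv_eq hk, ENNReal.rpow_add_of_nonneg _ _ hs zero_le_one, ENNReal.rpow_one, mul_comm]

lemma qv_rpow_mono (k : ℤ) {s t : ℝ} (h : s ≤ t) : qv k ^ s ≤ qv k ^ t :=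
  ENNReal.rpow_le_rpow_of_exponent_le (one_le_qv k) h

lemma wv_rpow_le (k : ℤ) {s : ℝ} (hs : 0 ≤ s) : wv k ^ s ≤ qv k ^ s :=
  ENNReal.rpow_le_rpow (wv_le_qv k) hs

lemma em_ne_top (m : ℤ) : em m ≠ ⊤ := by simp [em]

lemma one_le_em {m : ℤ} (hm : m ≠ 0) : 1 ≤ em m := by
  have h : (1 : ℝ) ≤ ‖m‖ := by
    rw [Int.norm_eq_abs]; exact_mod_cast Int.one_le_abs hm
  rw [em, ← ofReal_norm, ← ENNReal.ofReal_one]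
  exact ENNReal.ofReal_le_ofReal h

lemma em_le (m i : ℤ) : em (m - i) ≤ em m + em i := enorm_sub_le

lemma im_mul_em_le (m : ℤ) : im m * em m ≤ 1 := by
  unfold im
  split_ifs
  · simp
  · exact ENNReal.inv_mul_le_one _

lemma im_mul_em {m : ℤ} (hm : m ≠ 0) : im m * em m = 1 := by
  rw [im, if_neg hm]
  exact ENNReal.inv_mul_cancel (fun h => by simpa [h] using one_le_em hm) (em_ne_top m)

lemma im_le_one (m : ℤ) : im m ≤ 1 := by
  unfold im
  split_ifs with h
  · simp
  · exact ENNReal.inv_le_one.2 (one_le_em h)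

/-- The `ℓ²` norm of `1/m`. -/
def cV : ℝ≥0∞ := l2 im

/-- The `ℓ²` norm of `q^{-s}`, where `q` is the horizontal weight. -/
def cH (s : ℝ) : ℝ≥0∞ := l2 fun k : ℤ => qv k ^ (-s)

lemma l2_ne_top_of_summable {ι : Type*} {f : ι → ℝ≥0∞} {g : ι → ℝ} (hg : Summable g)
    (h : ∀ i, f i ^ 2 ≤ ENNReal.ofReal (g i)) : l2 f ≠ ⊤ := by
  refine ENNReal.rpow_ne_top_of_nonneg (by norm_num) ?_
  exact ne_top_of_le_ne_top hg.tsum_ofReal_ne_top (ENNReal.tsum_le_tsum h)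

lemma cV_ne_top : cV ≠ ⊤ := by
  refine l2_ne_top_of_summable (g := fun m : ℤ => |(m : ℝ)| ^ (-2 : ℝ))
    (Real.summable_abs_int_rpow (by norm_num)) fun m => ?_
  rcases eq_or_ne m 0 with rfl | hm
  · simp [im]
  · have h0 : 0 < |(m : ℝ)| := by positivity
    rw [im, if_neg hm, em, ← ofReal_norm, Int.norm_eq_abs,
      ← ENNReal.ofReal_inv_of_pos h0, ← ENNReal.ofReal_pow (by positivity)]
    apply ENNReal.ofReal_le_ofReal
    rw [Real.rpow_neg h0.le, inv_pow]
    norm_cast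

lemma cH_ne_top {s : ℝ} (hs : 1 / 2 < s) : cH s ≠ ⊤ := by
  -- The real power `|0| ^ (-2s)` is `0`, whereas the weight equals `1` at `k = 0`; the indicator
  -- corrects the majorant there.
  have h1 : Summable (fun k : ℤ => (if k = 0 then (1 : ℝ) else 0)) :=
    (hasSum_ite_eq (0 : ℤ) (1 : ℝ)).summable
  refine l2_ne_top_of_summable (g := fun k : ℤ => |(k : ℝ)| ^ (-(2 * s))
    + (if k = 0 then (1 : ℝ) else 0))
    ((Real.summable_abs_int_rpow (by linarith)).add h1) fun k => ?_
  rcases eq_or_ne k 0 with rfl | hk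
  · rw [qv_zero]
    simp [Real.zero_rpow (by linarith : -(2 * s) ≠ 0)]
  · have h0 : 1 ≤ |(k : ℝ)| := by exact_mod_cast Int.one_le_abs hk
    have h2 : |(k : ℝ)| ≤ waveNumber k := by
      rw [waveNumber_eq]; nlinarith [Real.pi_gt_three]
    rw [qv_eq hk, wv, ENNReal.ofReal_rpow_of_pos (by linarith),
      ← ENNReal.ofReal_pow (Real.rpow_nonneg (waveNumber_nonneg k) _)]
    apply ENNReal.ofReal_le_ofReal
    simp only [hk, if_false, add_zero]
    rw [← Real.rpow_natCast, ← Real.rpow_mul (waveNumber_nonneg _)]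
    have h3 : -s * ((2 : ℕ) : ℝ) = -(2 * s) := by push_cast; ring
    rw [h3]
    exact Real.rpow_le_rpow_of_nonpos (by linarith) h2 (by linarith)

end
end HydrostaticNS

namespace HydrostaticNS
noncomputable section

/-! ### Product estimates in mixed norms -/

section Estimates

variable {D E U : ℤ × ℤ → ℝ≥0∞} {r s : ℝ}

/-- With no modes at `m = 0`, dividing and multiplying by `m` is harmless. This is how vanishing
vertical mean enters the product estimates. -/
lemma em_mul_im_mul (hD : ∀ k, D (k, 0) = 0) (k m : ℤ) :
    im m * (em m * D (k, m)) = D (k, m) := by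
  rcases eq_or_ne m 0 with rfl | hm
  · simp [hD]
  · rw [← mul_assoc, im_mul_em hm, one_mul]

lemma le_em_mul (hD : ∀ k, D (k, 0) = 0) (j : ℤ × ℤ) : D j ≤ em j.2 * D j := by
  obtain ⟨k, m⟩ := j
  rcases eq_or_ne m 0 with rfl | hm
  · simp [hD]
  · exact le_mul_of_one_le_left' (one_le_em hm)

lemma l21_im_le (X : ℤ × ℤ → ℝ≥0∞) : l21 (fun j => im j.2 * X j) ≤ cV * l2 X := by
  rw [l2_prod X, ← l2_const_mul]
  exact l2_mono fun k => tsum_mul_le_l2 _ _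

/-- One vertical derivative buys summability in `m`, since `1/m` is square summable: the embedding
of `H¹` into bounded functions in one dimension. -/
lemma l21_le (hD : ∀ k, D (k, 0) = 0) : l21 D ≤ cV * l2 fun j => em j.2 * D j := by
  refine le_trans (le_of_eq ?_) (l21_im_le _)
  congr 1 with ⟨k, m⟩
  exact (em_mul_im_mul hD k m).symm

lemma tsum_le_l12 (X : ℤ × ℤ → ℝ≥0∞) : ∑' j : ℤ × ℤ, im j.2 * X j ≤ cV * l12 X := by
  rw [ENNReal.tsum_prod', l12, ← ENNReal.tsum_mul_left]
  exact ENNReal.tsum_le_tsum fun k => tsum_mul_le_l2 _ _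

lemma tsum_le (hD : ∀ k, D (k, 0) = 0) : ∑' j, D j ≤ cV * l12 fun j => em j.2 * D j := by
  refine le_trans (le_of_eq ?_) (tsum_le_l12 _)
  congr 1 with ⟨k, m⟩
  exact (em_mul_im_mul hD k m).symm

/-- The horizontal counterpart: `s` derivatives buy summability in `k`, useful when `s > 1/2`. -/
lemma l12_le (s : ℝ) (X : ℤ × ℤ → ℝ≥0∞) : l12 X ≤ cH s * l2 fun j => qv j.1 ^ s * X j := by
  rw [l2_prod]
  refine le_trans (le_of_eq ?_) (tsum_mul_le_l2 _ _)
  simp only [l12, l2_const_mul]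
  congr 1 with k
  rw [← mul_assoc, ← ENNReal.rpow_add _ _ (by simpa using (one_pos.trans_le (one_le_qv k)).ne')
    (qv_ne_top k)]
  simp

/-- Bounding a sum by twice its maximum works for `s` below and above `1` alike, at the price of the
constant `2 ^ s`. -/
lemma wv_rpow_le_add (hs : 0 ≤ s) (k i : ℤ) :
    wv k ^ s ≤ 2 ^ s * wv i ^ s + 2 ^ s * wv (k - i) ^ s := by
  have h : wv k ≤ 2 * max (wv i) (wv (k - i)) := by
    rw [two_mul]
    exact (wv_le k i).trans (add_le_add (le_max_left _ _) (le_max_right _ _))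
  refine (ENNReal.rpow_le_rpow h hs).trans ?_
  rw [ENNReal.mul_rpow_of_nonneg _ _ hs, ← mul_add]
  gcongr
  rcases max_cases (wv i) (wv (k - i)) with ⟨h, -⟩ | ⟨h, -⟩ <;> rw [h]
  · exact le_self_add
  · exact le_add_self

/-- A fractional Leibniz rule at the level of moduli: horizontal derivatives of a product fall on
one factor or the other. -/
lemma wv_rpow_mul_conv_le (hs : 0 ≤ s) (X Y : ℤ × ℤ → ℝ≥0∞) (j : ℤ × ℤ) :
    wv j.1 ^ s * conv X Y j ≤ 2 ^ s * conv (fun i => wv i.1 ^ s * X i) Y j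
      + 2 ^ s * conv X (fun i => wv i.1 ^ s * Y i) j := by
  simp only [conv]
  rw [← ENNReal.tsum_mul_left, ← ENNReal.tsum_mul_left, ← ENNReal.tsum_mul_left,
    ← ENNReal.tsum_add]
  refine ENNReal.tsum_le_tsum fun i => ?_
  refine (mul_le_mul_left (wv_rpow_le_add hs j.1 i.1) _).trans_eq ?_
  rw [Prod.fst_sub]
  ring

/-- A majorant of the moduli of the coefficients of the bilinear advection term. -/
def maj (D E : ℤ × ℤ → ℝ≥0∞) (j : ℤ × ℤ) : ℝ≥0∞ :=
  conv D (fun i => wv i.1 * E i) j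
    + conv (fun i => wv i.1 * (im i.2 * D i)) (fun i => em i.2 * E i) j

lemma l12_le_of (s : ℝ) {X Y : ℤ × ℤ → ℝ≥0∞} (h : ∀ j, qv j.1 ^ s * X j ≤ Y j) :
    l12 X ≤ cH s * l2 Y :=
  (l12_le s X).trans (mul_le_mul_right (l2_mono h) _)

lemma qv_rpow_mul_wv_le {t : ℝ} (h : s + 1 ≤ t) (k : ℤ) : qv k ^ s * wv k ≤ qv k ^ t := by
  calc qv k ^ s * wv k ≤ qv k ^ s * qv k ^ (1 : ℝ) := by
        rw [ENNReal.rpow_one]; gcongr; exact wv_le_qv k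
    _ = qv k ^ (s + 1) := (ENNReal.rpow_add _ _
        (by simpa using (one_pos.trans_le (one_le_qv k)).ne') (qv_ne_top k)).symm
    _ ≤ _ := qv_rpow_mono k h

/-- The four products that make up the weighted majorant. -/
lemma wv_rpow_mul_maj_le (hs : 0 ≤ s) (j : ℤ × ℤ) :
    wv j.1 ^ s * maj D D j ≤ 2 ^ s * (
      conv (fun i => wv i.1 * D i) (fun i => wv i.1 ^ s * D i) j
      + conv D (fun i => wv i.1 ^ (s + 1) * D i) j
      + conv (fun i => em i.2 * D i) (fun i => im i.2 * (wv i.1 ^ (s + 1) * D i)) j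
      + conv (fun i => im i.2 * (wv i.1 * D i)) (fun i => wv i.1 ^ s * (em i.2 * D i)) j) := by
  have hw : ∀ k, wv k ^ s * wv k = wv k ^ (s + 1) := fun k => by
    rw [ENNReal.rpow_add_of_nonneg _ _ hs zero_le_one, ENNReal.rpow_one]
  rw [maj, mul_add]
  refine (add_le_add (wv_rpow_mul_conv_le hs _ _ j) (wv_rpow_mul_conv_le hs _ _ j)).trans_eq ?_
  rw [conv_comm (fun i => wv i.1 * D i) (fun i => wv i.1 ^ s * D i),
    conv_comm (fun i => em i.2 * D i)]
  simp only [← mul_assoc, hw]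
  simp only [mul_comm (im _)]
  ring

lemma l2_add4_le {ι : Type*} (f g h k : ι → ℝ≥0∞) :
    l2 (fun i => f i + g i + h i + k i) ≤ l2 f + l2 g + l2 h + l2 k :=
  (l2_add_le _ _).trans (add_le_add_left ((l2_add_le _ _).trans
    (add_le_add_left (l2_add_le _ _) _)) _)

/-- The core of the a priori estimate. In each of the four products one factor carries a vertical
derivative and is measured by the viscous norm, the other is measured by the homogeneous norm of
order `r + 1/2`. Where the vertical derivative and the primitive sit on different factors, the
factor `1/m` of the primitive gives `ℓ¹` in `m` and the differentiated factor needs only `ℓ²` there.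
Horizontal summability costs `s = r - 1/2` derivatives, so `r > 1` suffices. -/
lemma l2_weighted_maj_le (hr : 1 < r) (hD : ∀ k, D (k, 0) = 0) :
    l2 (fun j => wv j.1 ^ (r - 1 / 2) * maj D D j) ≤
      2 ^ (r - 1 / 2) * (4 * (cV * cH (r - 1 / 2))) *
        ((l2 fun j => qv j.1 ^ r * (em j.2 * D j)) * l2 fun j => wv j.1 ^ (r + 1 / 2) * D j) := by
  set s := r - 1 / 2 with hs
  have hs0 : 0 ≤ s := by linarith
  have hs1 : r + 1 / 2 = s + 1 := by rw [hs]; ring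
  rw [hs1]
  set Z := l2 fun j : ℤ × ℤ => qv j.1 ^ r * (em j.2 * D j)
  set X := l2 fun j : ℤ × ℤ => wv j.1 ^ (s + 1) * D j
  have hq : ∀ k : ℤ, qv k ^ s ≤ qv k ^ r := fun k => qv_rpow_mono k (by linarith)
  -- Exactly the `s + 1 = r + 1/2` derivatives of `X` are used: one in the factor itself and `s` for
  -- summability.
  have hwX : l12 (fun i => wv i.1 * D i) ≤ cH s * X := l12_le_of s fun j => by
    rw [← mul_assoc, mul_comm (qv _ ^ s), wv_mul_qv_rpow _ hs0]
  have hemZ : l12 (fun i => em i.2 * D i) ≤ cH s * Z := l12_le_of s fun j =>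
    mul_le_mul_left (hq _) _
  have hsZ : l2 (fun j => wv j.1 ^ s * (em j.2 * D j)) ≤ Z := l2_mono fun j => by
    gcongr; exact (wv_rpow_le _ hs0).trans (hq _)
  refine (l2_mono fun j => wv_rpow_mul_maj_le hs0 j).trans ?_
  rw [l2_const_mul, mul_assoc]
  gcongr
  refine (l2_add4_le _ _ _ _).trans ?_
  have e : 4 * (cV * cH s) * (Z * X) = cV * cH s * (Z * X) + cV * cH s * (Z * X)
    + cV * cH s * (Z * X) + cV * cH s * (Z * X) := by ring
  rw [e]
  refine add_le_add (add_le_add (add_le_add ?_ ?_) ?_) ?_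
  · refine (l2_conv_mixed _ _).trans ?_
    have h : l21 (fun i => wv i.1 ^ s * D i) ≤ cV * Z := by
      refine (l21_le fun k => by simp [hD]).trans (mul_le_mul_right (le_trans ?_ hsZ) _)
      exact l2_mono fun j => le_of_eq (by ring)
    calc _ ≤ cH s * X * (cV * Z) := mul_le_mul' hwX h
      _ = _ := by ring
  · refine (l2_conv_le _ _).trans ?_
    calc _ ≤ cV * (cH s * Z) * X :=
          mul_le_mul' ((tsum_le hD).trans (mul_le_mul_right hemZ _)) le_rfl
      _ = _ := by ring
  · refine (l2_conv_mixed _ _).trans ?_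
    calc _ ≤ cH s * Z * (cV * X) := mul_le_mul' hemZ (l21_im_le _)
      _ = _ := by ring
  · refine (l2_conv_le _ _).trans ?_
    calc _ ≤ cV * (cH s * X) * Z :=
          mul_le_mul' ((tsum_le_l12 _).trans (mul_le_mul_right hwX _)) hsZ
      _ = _ := by ring

/-- An unweighted bound, with one factor bounded in time and the other square integrable in time.
One full horizontal derivative must be summed in `ℓ¹`, whence `r - 1 > 1/2`. -/
lemma l2_maj_le (hr : 3 / 2 < r) (hD : ∀ k, D (k, 0) = 0) :
    l2 (maj D D) ≤ 2 * (cV * cH (r - 1)) *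
        ((l2 fun j => qv j.1 ^ r * D j) * l2 fun j => qv j.1 ^ r * (em j.2 * D j)) := by
  set Y := l2 fun j : ℤ × ℤ => qv j.1 ^ r * D j
  set Z := l2 fun j : ℤ × ℤ => qv j.1 ^ r * (em j.2 * D j)
  refine (l2_add_le _ _).trans ?_
  have e : 2 * (cV * cH (r - 1)) * (Y * Z) = cV * cH (r - 1) * (Y * Z)
    + cV * cH (r - 1) * (Y * Z) := by ring
  rw [e]
  have h1 : ∀ k : ℤ, 1 ≤ qv k ^ r := fun k => ENNReal.one_le_rpow (one_le_qv k) (by linarith)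
  have h2 : ∀ k : ℤ, wv k ≤ qv k ^ r := fun k =>
    (le_of_eq (by simp)).trans (qv_rpow_mul_wv_le (s := 0) (t := r) (by linarith) k)
  refine add_le_add ?_ ?_
  · refine (l2_conv_le _ _).trans ?_
    have hZ : l12 (fun i => em i.2 * D i) ≤ cH (r - 1) * Z := l12_le_of _ fun j => by
      gcongr
      · exact one_le_qv _
      · linarith
    have hY : l2 (fun i => wv i.1 * D i) ≤ Y := l2_mono fun j => by gcongr; exact h2 _
    calc _ ≤ cV * (cH (r - 1) * Z) * Y :=
          mul_le_mul' ((tsum_le hD).trans (mul_le_mul_right hZ _)) hY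
      _ = _ := by ring
  · refine (l2_conv_le _ _).trans ?_
    have hY : l12 (fun i => wv i.1 * D i) ≤ cH (r - 1) * Y := l12_le_of _ fun j => by
      rw [← mul_assoc]; gcongr; exact qv_rpow_mul_wv_le (by linarith) _
    have hZ : l2 (fun i => em i.2 * D i) ≤ Z := l2_mono fun j => le_mul_of_one_le_left' (h1 _)
    have e2 : (fun i : ℤ × ℤ => wv i.1 * (im i.2 * D i)) = fun i => im i.2 * (wv i.1 * D i) := by
      ext i; ring
    rw [e2]
    calc _ ≤ cV * (cH (r - 1) * Y) * Z :=
          mul_le_mul' ((tsum_le_l12 _).trans (mul_le_mul_right hY _)) hZ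
      _ = _ := by ring

/-- A discrete integration by parts in `z`: the vertical wave number of one factor is at most the
output wave number plus that of the other factor. The first is cancelled by the dual weight, the
second by the primitive. -/
lemma im_mul_conv_le (X Y : ℤ × ℤ → ℝ≥0∞) (j : ℤ × ℤ) :
    im j.2 * conv (fun i => em i.2 * Y i) (fun i => im i.2 * X i) j ≤
      conv Y (fun i => im i.2 * X i) j + im j.2 * conv Y X j := by
  simp only [conv]
  rw [← ENNReal.tsum_mul_left, ← ENNReal.tsum_mul_left, ← ENNReal.tsum_add]
  refine ENNReal.tsum_le_tsum fun i => ?_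
  have h : em i.2 ≤ em j.2 + em (j - i).2 := by
    have := em_le j.2 (j - i).2
    simpa using this
  calc im j.2 * (em i.2 * Y i * (im (j - i).2 * X (j - i)))
      ≤ im j.2 * ((em j.2 + em (j - i).2) * Y i * (im (j - i).2 * X (j - i))) := by gcongr
    _ = (im j.2 * em j.2) * (Y i * (im (j - i).2 * X (j - i)))
        + im j.2 * (Y i * ((im (j - i).2 * em (j - i).2) * X (j - i))) := by ring
    _ ≤ 1 * (Y i * (im (j - i).2 * X (j - i))) + im j.2 * (Y i * (1 * X (j - i))) := by
        gcongr
        · exact im_mul_em_le _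
        · exact im_mul_em_le _
    _ = _ := by ring

/-- `l2_weighted_maj_le` bounds the advection by a product of two quantities that are only square
integrable in time, which is not enough for the time derivative. In the dual norm the vertical
derivative can be moved off, so one factor is the energy norm, bounded in time, and the other the
dissipation. -/
lemma l2_dual_maj_le (hr : 3 / 2 < r) (hD : ∀ k, D (k, 0) = 0) :
    l2 (fun j => im j.2 * (wv j.1 ^ (r - 1 / 2) * maj D D j)) ≤
      2 ^ (r - 1 / 2) * (5 * (cV * cH (r - 1))) * ((l2 fun j => qv j.1 ^ r * D j) *
        ((l2 fun j => qv j.1 ^ r * (em j.2 * D j)) + l2 fun j => wv j.1 ^ (r + 1 / 2) * D j)) := by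
  set s := r - 1 / 2 with hs
  have hs0 : 0 ≤ s := by linarith
  have hs1 : r + 1 / 2 = s + 1 := by rw [hs]; ring
  rw [hs1]
  set Y := l2 fun j : ℤ × ℤ => qv j.1 ^ r * D j
  set Z := l2 fun j : ℤ × ℤ => qv j.1 ^ r * (em j.2 * D j)
  set X := l2 fun j : ℤ × ℤ => wv j.1 ^ (s + 1) * D j
  have hq : ∀ k : ℤ, qv k ^ s ≤ qv k ^ r := fun k => qv_rpow_mono k (by linarith)
  have hwq : ∀ k : ℤ, wv k ^ s ≤ qv k ^ r := fun k => (wv_rpow_le k hs0).trans (hq k)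
  have hD12 : l12 D ≤ cH (r - 1) * Y := l12_le_of _ fun j => by
    gcongr
    · exact one_le_qv _
    · linarith
  have hwY : l12 (fun i => wv i.1 * D i) ≤ cH (r - 1) * Y := l12_le_of _ fun j => by
    rw [← mul_assoc]; gcongr; exact qv_rpow_mul_wv_le (by linarith) _
  have hwZ : l12 (fun i => em i.2 * (wv i.1 * D i)) ≤ cH (r - 1) * Z := l12_le_of _ fun j => by
    calc qv j.1 ^ (r - 1) * (em j.2 * (wv j.1 * D j))
        = (qv j.1 ^ (r - 1) * wv j.1) * (em j.2 * D j) := by ring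
      _ ≤ _ := by gcongr; exact qv_rpow_mul_wv_le (by linarith) _
  have hpt : ∀ j : ℤ × ℤ, im j.2 * (wv j.1 ^ s * maj D D j) ≤ 2 ^ s * (
      conv (fun i => wv i.1 * D i) (fun i => wv i.1 ^ s * D i) j
      + (2 * (im j.2 * conv D (fun i => wv i.1 ^ (s + 1) * D i) j))
      + conv D (fun i => im i.2 * (wv i.1 ^ (s + 1) * D i)) j
      + conv (fun i => im i.2 * (wv i.1 * D i)) (fun i => wv i.1 ^ s * (em i.2 * D i)) j) := by
    intro j
    refine (mul_le_mul_right (wv_rpow_mul_maj_le hs0 j) _).trans ?_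
    rw [mul_left_comm]
    gcongr
    simp only [mul_add]
    calc _ ≤ 1 * conv (fun i => wv i.1 * D i) (fun i => wv i.1 ^ s * D i) j
          + im j.2 * conv D (fun i => wv i.1 ^ (s + 1) * D i) j
          + (conv D (fun i => im i.2 * (wv i.1 ^ (s + 1) * D i)) j
            + im j.2 * conv D (fun i => wv i.1 ^ (s + 1) * D i) j)
          + 1 * conv (fun i => im i.2 * (wv i.1 * D i))
              (fun i => wv i.1 ^ s * (em i.2 * D i)) j := by
          gcongr
          · exact im_le_one _
          · exact im_mul_conv_le _ _ j
          · exact im_le_one _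
      _ = _ := by ring
  refine (l2_mono hpt).trans ?_
  rw [l2_const_mul, mul_assoc]
  gcongr
  refine (l2_add4_le _ _ _ _).trans ?_
  have h1 : l2 (conv (fun i => wv i.1 * D i) (fun i => wv i.1 ^ s * D i))
      ≤ cV * cH (r - 1) * (Y * Z) := by
    refine (l2_conv_le _ _).trans ?_
    calc _ ≤ cV * (cH (r - 1) * Z) * Y := mul_le_mul'
          ((tsum_le fun k => by simp [hD]).trans (mul_le_mul_right hwZ _))
          (l2_mono fun j => by gcongr; exact hwq _)
      _ = _ := by ring
  have h2 : l2 (fun j : ℤ × ℤ => 2 * (im j.2 * conv D (fun i => wv i.1 ^ (s + 1) * D i) j))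
      ≤ 2 * (cV * cH (r - 1) * (Y * X)) := by
    rw [l2_const_mul]
    gcongr
    refine (l2_conv_dual im _ _).trans ?_
    calc _ ≤ cV * (cH (r - 1) * Y * X) := mul_le_mul_right (mul_le_mul' hD12 le_rfl) _
      _ = _ := by ring
  have h3 : l2 (conv D (fun i => im i.2 * (wv i.1 ^ (s + 1) * D i)))
      ≤ cV * cH (r - 1) * (Y * X) := by
    refine (l2_conv_mixed _ _).trans ?_
    calc _ ≤ cH (r - 1) * Y * (cV * X) := mul_le_mul' hD12 (l21_im_le _)
      _ = _ := by ring
  have h4 : l2 (conv (fun i => im i.2 * (wv i.1 * D i))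
      (fun i => wv i.1 ^ s * (em i.2 * D i))) ≤ cV * cH (r - 1) * (Y * Z) := by
    refine (l2_conv_le _ _).trans ?_
    calc _ ≤ cV * (cH (r - 1) * Y) * Z :=
          mul_le_mul' ((tsum_le_l12 _).trans (mul_le_mul_right hwY _))
            (l2_mono fun j => by gcongr; exact hwq _)
      _ = _ := by ring
  refine (add_le_add (add_le_add (add_le_add h1 h2) h3) h4).trans ?_
  have e : 5 * (cV * cH (r - 1)) * (Y * (Z + X)) =
      cV * cH (r - 1) * (Y * Z) + 2 * (cV * cH (r - 1) * (Y * X)) + cV * cH (r - 1) * (Y * X)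
      + cV * cH (r - 1) * (Y * Z) + (3 * (cV * cH (r - 1)) * (Y * Z)
      + 2 * (cV * cH (r - 1)) * (Y * X)) := by ring
  rw [e]
  exact le_self_add

/-- A full derivative is split into two halves, one of which may be moved to the output or to the
other factor. The estimate for differences of solutions must not lose more than half a derivative on
each occurrence of the difference. -/
lemma wv_half_le (k i : ℤ) : wv k ≤ wv k ^ (1 / 2 : ℝ) * (wv i ^ (1 / 2 : ℝ)
    + wv (i - k) ^ (1 / 2 : ℝ)) := by
  have h1 : wv k = wv k ^ (1 / 2 : ℝ) * wv k ^ (1 / 2 : ℝ) := by rw [← sq, rpow_half_sq]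
  have h2 : wv k ≤ wv i + wv (i - k) := by
    have h := wv_le k i
    have e : wv (k - i) = wv (i - k) := by rw [wv, wv, ← waveNumber_neg, neg_sub]
    rwa [e] at h
  calc wv k = wv k ^ (1 / 2 : ℝ) * wv k ^ (1 / 2 : ℝ) := h1
    _ ≤ wv k ^ (1 / 2 : ℝ) * (wv i + wv (i - k)) ^ (1 / 2 : ℝ) := by gcongr
    _ ≤ _ := by
      gcongr
      exact ENNReal.rpow_add_le_add_rpow _ _ (by norm_num) (by norm_num)

lemma wv_half_mul_conv_le (X Y : ℤ × ℤ → ℝ≥0∞) (j : ℤ × ℤ) :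
    conv (fun i => wv i.1 * X i) Y j ≤
      wv j.1 ^ (1 / 2 : ℝ) * conv (fun i => wv i.1 ^ (1 / 2 : ℝ) * X i) Y j
      + conv (fun i => wv i.1 ^ (1 / 2 : ℝ) * X i) (fun i => wv i.1 ^ (1 / 2 : ℝ) * Y i) j := by
  simp only [conv]
  rw [← ENNReal.tsum_mul_left, ← ENNReal.tsum_add]
  refine ENNReal.tsum_le_tsum fun i => ?_
  refine (mul_le_mul_left (mul_le_mul_left (wv_half_le i.1 j.1) _) _).trans_eq ?_
  rw [Prod.fst_sub]
  ring

/-- Here the difference `D` is the transporting field. Its vertical velocity contains a full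
derivative `∂_x D`, which `wv_half_mul_conv_le` distributes so that only half derivatives of `D`
appear. -/
lemma tsum_mul_maj_left_le (hU : ∀ k, U (k, 0) = 0) :
    ∑' j, D j * maj D U j ≤ 3 * (cV * (cH (r - 1) + cH (r - 1 / 2))) *
      ((l2 fun j => qv j.1 ^ r * (em j.2 * U j)) * l2 (fun j => qv j.1 ^ (1 / 2 : ℝ) * D j) ^ 2) := by
  set F := l2 fun j : ℤ × ℤ => qv j.1 ^ r * (em j.2 * U j)
  set Q := l2 fun j : ℤ × ℤ => qv j.1 ^ (1 / 2 : ℝ) * D j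
  have hq1 : ∀ k : ℤ, 1 ≤ qv k ^ (1 / 2 : ℝ) := fun k =>
    ENNReal.one_le_rpow (one_le_qv k) (by norm_num)
  have hDQ : l2 D ≤ Q := l2_mono fun j => le_mul_of_one_le_left' (hq1 _)
  have hwQ : l2 (fun j => wv j.1 ^ (1 / 2 : ℝ) * D j) ≤ Q := l2_mono fun j => by
    gcongr; exact wv_le_qv _
  have hU1 : ∑' j : ℤ × ℤ, wv j.1 * U j ≤ cV * (cH (r - 1) * F) := by
    refine (tsum_le fun k => by simp [hU]).trans ?_
    gcongr
    refine l12_le_of _ fun j => ?_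
    calc _ = (qv j.1 ^ (r - 1) * wv j.1) * (em j.2 * U j) := by ring
      _ ≤ _ := by gcongr; exact qv_rpow_mul_wv_le (by linarith) _
  have hU2 : l12 (fun i => em i.2 * U i) ≤ cH (r - 1 / 2) * F := l12_le_of _ fun j => by
    gcongr
    · exact one_le_qv _
    · linarith
  have hU3 : l12 (fun i => wv i.1 ^ (1 / 2 : ℝ) * (em i.2 * U i)) ≤ cH (r - 1 / 2) * F :=
    l12_le_of _ fun j => by
      rw [← mul_assoc]
      gcongr
      calc _ ≤ qv j.1 ^ (r - 1 / 2) * qv j.1 ^ (1 / 2 : ℝ) := by gcongr; exact wv_le_qv _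
        _ = _ := by
          rw [← ENNReal.rpow_add _ _ (by simpa using (one_pos.trans_le (one_le_qv j.1)).ne')
            (qv_ne_top _)]
          ring_nf
  have hD1 : l21 (fun i => wv i.1 ^ (1 / 2 : ℝ) * (im i.2 * D i)) ≤ cV * Q := by
    refine le_trans (le_of_eq ?_) ((l21_im_le _).trans (mul_le_mul_right hwQ _))
    congr 1 with i
    ring
  have hpt : ∀ j, D j * maj D U j ≤ D j * conv D (fun i => wv i.1 * U i) j
      + ((wv j.1 ^ (1 / 2 : ℝ) * D j) * conv (fun i => wv i.1 ^ (1 / 2 : ℝ) * (im i.2 * D i))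
          (fun i => em i.2 * U i) j
        + D j * conv (fun i => wv i.1 ^ (1 / 2 : ℝ) * (im i.2 * D i))
          (fun i => wv i.1 ^ (1 / 2 : ℝ) * (em i.2 * U i)) j) := by
    intro j
    rw [maj, mul_add]
    gcongr
    refine (mul_le_mul_right (wv_half_mul_conv_le _ _ j) _).trans_eq ?_
    ring
  refine (ENNReal.tsum_le_tsum hpt).trans ?_
  rw [ENNReal.tsum_add, ENNReal.tsum_add]
  have h1 : ∑' j, D j * conv D (fun i => wv i.1 * U i) j ≤ cV * cH (r - 1) * (F * Q ^ 2) := by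
    refine (tsum_mul_le_l2 _ _).trans ?_
    rw [conv_comm]
    calc _ ≤ Q * (cV * (cH (r - 1) * F) * Q) :=
          mul_le_mul' hDQ ((l2_conv_le _ _).trans (mul_le_mul' hU1 hDQ))
      _ = _ := by ring
  have h2 : ∑' j : ℤ × ℤ, (wv j.1 ^ (1 / 2 : ℝ) * D j) *
      conv (fun i => wv i.1 ^ (1 / 2 : ℝ) * (im i.2 * D i)) (fun i => em i.2 * U i) j
      ≤ cV * cH (r - 1 / 2) * (F * Q ^ 2) := by
    refine (tsum_mul_le_l2 _ _).trans ?_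
    rw [conv_comm]
    calc _ ≤ Q * (cH (r - 1 / 2) * F * (cV * Q)) :=
          mul_le_mul' hwQ ((l2_conv_mixed _ _).trans (mul_le_mul' hU2 hD1))
      _ = _ := by ring
  have h3 : ∑' j : ℤ × ℤ, D j * conv (fun i => wv i.1 ^ (1 / 2 : ℝ) * (im i.2 * D i))
      (fun i => wv i.1 ^ (1 / 2 : ℝ) * (em i.2 * U i)) j
      ≤ cV * cH (r - 1 / 2) * (F * Q ^ 2) := by
    refine (tsum_mul_le_l2 _ _).trans ?_
    rw [conv_comm]
    calc _ ≤ Q * (cH (r - 1 / 2) * F * (cV * Q)) :=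
          mul_le_mul' hDQ ((l2_conv_mixed _ _).trans (mul_le_mul' hU3 hD1))
      _ = _ := by ring
  refine (add_le_add h1 (add_le_add h2 h3)).trans ?_
  have e : 3 * (cV * (cH (r - 1) + cH (r - 1 / 2))) * (F * Q ^ 2) =
      cV * cH (r - 1) * (F * Q ^ 2) + (cV * cH (r - 1 / 2) * (F * Q ^ 2)
        + cV * cH (r - 1 / 2) * (F * Q ^ 2))
      + (2 * (cV * cH (r - 1)) + cV * cH (r - 1 / 2)) * (F * Q ^ 2) := by ring
  rw [e]
  exact le_self_add

/-- Here the difference is the transported quantity. Horizontal transport is treated by half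
derivatives again; vertical transport contributes a vertical derivative of `D`, later absorbed by
the viscosity. -/
lemma tsum_mul_maj_right_le (hU : ∀ k, U (k, 0) = 0) :
    ∑' j, D j * maj U D j ≤ 3 * (cV * (cH (r - 1) + cH (r - 1 / 2))) *
      ((l2 fun j => qv j.1 ^ r * (em j.2 * U j)) *
        (l2 (fun j => qv j.1 ^ (1 / 2 : ℝ) * D j) ^ 2 + l2 D * l2 fun j => em j.2 * D j)) := by
  set F := l2 fun j : ℤ × ℤ => qv j.1 ^ r * (em j.2 * U j)
  set Q := l2 fun j : ℤ × ℤ => qv j.1 ^ (1 / 2 : ℝ) * D j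
  set P := l2 fun j : ℤ × ℤ => em j.2 * D j
  have hq1 : ∀ k : ℤ, 1 ≤ qv k ^ (1 / 2 : ℝ) := fun k =>
    ENNReal.one_le_rpow (one_le_qv k) (by norm_num)
  have hDQ : l2 D ≤ Q := l2_mono fun j => le_mul_of_one_le_left' (hq1 _)
  have hwQ : l2 (fun j => wv j.1 ^ (1 / 2 : ℝ) * D j) ≤ Q := l2_mono fun j => by
    gcongr; exact wv_le_qv _
  have hU1 : ∑' j : ℤ × ℤ, wv j.1 * (im j.2 * U j) ≤ cV * (cH (r - 1) * F) := by
    have e : ∀ j : ℤ × ℤ, wv j.1 * (im j.2 * U j) = im j.2 * (wv j.1 * U j) := fun j => by ring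
    simp only [e]
    refine (tsum_le_l12 _).trans ?_
    gcongr
    refine l12_le_of _ fun j => ?_
    rw [← mul_assoc]
    gcongr
    · exact qv_rpow_mul_wv_le (by linarith) _
    · exact le_em_mul hU j
  have hU2 : ∑' j, U j ≤ cV * (cH (r - 1 / 2) * F) := by
    refine (tsum_le hU).trans ?_
    gcongr
    refine l12_le_of _ fun j => ?_
    gcongr
    · exact one_le_qv _
    · linarith
  have hU3 : ∑' j : ℤ × ℤ, wv j.1 ^ (1 / 2 : ℝ) * U j ≤ cV * (cH (r - 1 / 2) * F) := by
    refine (tsum_le fun k => by simp [hU]).trans ?_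
    gcongr
    refine l12_le_of _ fun j => ?_
    rw [mul_left_comm (em _), ← mul_assoc]
    gcongr
    calc _ ≤ qv j.1 ^ (r - 1 / 2) * qv j.1 ^ (1 / 2 : ℝ) := by gcongr; exact wv_le_qv _
      _ = _ := by
        rw [← ENNReal.rpow_add _ _ (by simpa using (one_pos.trans_le (one_le_qv j.1)).ne')
          (qv_ne_top _)]
        ring_nf
  have hpt : ∀ j, D j * maj U D j ≤
      ((wv j.1 ^ (1 / 2 : ℝ) * D j) * conv U (fun i => wv i.1 ^ (1 / 2 : ℝ) * D i) j
        + D j * conv (fun i => wv i.1 ^ (1 / 2 : ℝ) * U i) (fun i => wv i.1 ^ (1 / 2 : ℝ) * D i) j)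
      + D j * conv (fun i => wv i.1 * (im i.2 * U i)) (fun i => em i.2 * D i) j := by
    intro j
    rw [maj, mul_add]
    gcongr
    rw [conv_comm]
    refine (mul_le_mul_right (wv_half_mul_conv_le _ _ j) _).trans_eq ?_
    rw [conv_comm _ U, conv_comm _ (fun i => wv i.1 ^ (1 / 2 : ℝ) * U i)]
    ring
  refine (ENNReal.tsum_le_tsum hpt).trans ?_
  rw [ENNReal.tsum_add, ENNReal.tsum_add]
  have h1 : ∑' j : ℤ × ℤ, (wv j.1 ^ (1 / 2 : ℝ) * D j) *
      conv U (fun i => wv i.1 ^ (1 / 2 : ℝ) * D i) j ≤ cV * cH (r - 1 / 2) * (F * Q ^ 2) := by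
    refine (tsum_mul_le_l2 _ _).trans ?_
    calc _ ≤ Q * (cV * (cH (r - 1 / 2) * F) * Q) :=
          mul_le_mul' hwQ ((l2_conv_le _ _).trans (mul_le_mul' hU2 hwQ))
      _ = _ := by ring
  have h2 : ∑' j : ℤ × ℤ, D j * conv (fun i => wv i.1 ^ (1 / 2 : ℝ) * U i)
      (fun i => wv i.1 ^ (1 / 2 : ℝ) * D i) j ≤ cV * cH (r - 1 / 2) * (F * Q ^ 2) := by
    refine (tsum_mul_le_l2 _ _).trans ?_
    calc _ ≤ Q * (cV * (cH (r - 1 / 2) * F) * Q) :=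
          mul_le_mul' hDQ ((l2_conv_le _ _).trans (mul_le_mul' hU3 hwQ))
      _ = _ := by ring
  have h3 : ∑' j : ℤ × ℤ, D j * conv (fun i => wv i.1 * (im i.2 * U i))
      (fun i => em i.2 * D i) j ≤ cV * cH (r - 1) * (F * (l2 D * P)) := by
    refine (tsum_mul_le_l2 _ _).trans ?_
    calc _ ≤ l2 D * (cV * (cH (r - 1) * F) * P) :=
          mul_le_mul' le_rfl ((l2_conv_le _ _).trans (mul_le_mul' hU1 le_rfl))
      _ = _ := by ring
  refine (add_le_add (add_le_add h1 h2) h3).trans ?_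
  have e : 3 * (cV * (cH (r - 1) + cH (r - 1 / 2))) * (F * (Q ^ 2 + l2 D * P)) =
      (cV * cH (r - 1 / 2) * (F * Q ^ 2) + cV * cH (r - 1 / 2) * (F * Q ^ 2))
        + cV * cH (r - 1) * (F * (l2 D * P))
      + ((cV * cH (r - 1 / 2) + 3 * (cV * cH (r - 1))) * (F * Q ^ 2)
        + (3 * (cV * cH (r - 1 / 2)) + 2 * (cV * cH (r - 1))) * (F * (l2 D * P))) := by ring
  rw [e]
  exact le_self_add

end Estimates

end
end HydrostaticNS

namespace HydrostaticNS
noncomputable section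

/-! ### Fourier series on the two-dimensional torus -/

lemma haarAddCircle_eq_volume : (AddCircle.haarAddCircle : Measure UnitAddCircle) = volume := by
  rw [AddCircle.volume_eq_smul_haarAddCircle]; simp

instance : IsProbabilityMeasure (volume : Measure UnitAddCircle) := by
  rw [← haarAddCircle_eq_volume]; infer_instance

lemma fourierCoeff_eq (G : UnitAddCircle → ℂ) (k : ℤ) :
    fourierCoeff G k = ∫ x, G x * fourier (-k) x := by
  simp only [fourierCoeff, haarAddCircle_eq_volume, smul_eq_mul, mul_comm]

/-- Parseval's identity on the circle. -/
lemma tsum_enorm_fourierCoeff_sq {G : UnitAddCircle → ℂ} (hG : MemLp G 2 volume) :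
    ∑' k, ‖fourierCoeff G k‖ₑ ^ 2 = ∫⁻ x, ‖G x‖ₑ ^ 2 := by
  have hG' : MemLp G 2 AddCircle.haarAddCircle := by rwa [haarAddCircle_eq_volume]
  have h := hasSum_sq_fourierCoeff hG'.toLp
  have hc : ∀ k, fourierCoeff (hG'.toLp : UnitAddCircle → ℂ) k = fourierCoeff G k := fun k =>
    congrFun (fourierCoeff_congr_ae hG'.coeFn_toLp) k
  have hi : ∫ t, ‖(hG'.toLp : UnitAddCircle → ℂ) t‖ ^ 2 ∂AddCircle.haarAddCircle
      = ∫ t, ‖G t‖ ^ 2 := by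
    rw [← haarAddCircle_eq_volume]
    apply integral_congr_ae
    filter_upwards [hG'.coeFn_toLp] with t ht
    rw [ht]
  rw [hi] at h
  simp only [hc] at h
  have hint : Integrable (fun t => ‖G t‖ ^ 2) volume := hG.integrable_norm_pow two_ne_zero
  have e : ∀ x, ‖G x‖ₑ ^ 2 = ENNReal.ofReal (‖G x‖ ^ 2) := fun x => by
    rw [ENNReal.ofReal_pow (norm_nonneg _), ofReal_norm]
  have e2 : ∀ k, ‖fourierCoeff G k‖ₑ ^ 2 = ENNReal.ofReal (‖fourierCoeff G k‖ ^ 2) := fun x => by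
    rw [ENNReal.ofReal_pow (norm_nonneg _), ofReal_norm]
  simp only [e, e2]
  rw [← ofReal_integral_eq_lintegral_ofReal hint (Filter.Eventually.of_forall fun x => by positivity),
    ← h.tsum_eq, ENNReal.ofReal_tsum_of_nonneg (fun k => by positivity) h.summable]

/-- The two-dimensional torus. -/
abbrev T2 : Type := UnitAddCircle × UnitAddCircle

/-- The characters of the two-dimensional torus. -/
def chr (j : ℤ × ℤ) (p : T2) : ℂ := fourier j.1 p.1 * fourier j.2 p.2

lemma norm_fourier_apply (n : ℤ) (x : UnitAddCircle) : ‖(fourier n x : ℂ)‖ = 1 := by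
  rw [fourier_apply]; exact Circle.norm_coe _

@[fun_prop] lemma continuous_chr (j : ℤ × ℤ) : Continuous (chr j) := by
  unfold chr; fun_prop

lemma norm_chr (j : ℤ × ℤ) (p : T2) : ‖chr j p‖ = 1 := by
  rw [chr, norm_mul, norm_fourier_apply, norm_fourier_apply, one_mul]

lemma chr_add (i j : ℤ × ℤ) (p : T2) : chr (i + j) p = chr i p * chr j p := by
  simp only [chr, Prod.fst_add, Prod.snd_add, fourier_add]; ring

lemma chr_neg (j : ℤ × ℤ) (p : T2) : chr (-j) p = (starRingEnd ℂ) (chr j p) := by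
  simp only [chr, Prod.fst_neg, Prod.snd_neg, fourier_neg, map_mul]

/-- The Fourier coefficients on the two-dimensional torus. -/
def tc (F : T2 → ℂ) (j : ℤ × ℤ) : ℂ := ∫ p, F p * chr (-j) p

lemma tc_congr {F G : T2 → ℂ} (h : F =ᵐ[volume] G) (j : ℤ × ℤ) : tc F j = tc G j :=
  integral_congr_ae (h.mono fun p hp => by simp only [hp])

lemma _root_.MeasureTheory.Integrable.mul_chr {F : T2 → ℂ} (hF : Integrable F) (j : ℤ × ℤ) :
    Integrable (fun p => F p * chr j p) :=
  hF.mul_bdd (c := 1) (continuous_chr j).aestronglyMeasurable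
    (Filter.Eventually.of_forall fun p => (norm_chr j p).le)

lemma _root_.MeasureTheory.MemLp.mul_chr {F : T2 → ℂ} (hF : MemLp F 2) (j : ℤ × ℤ) :
    MemLp (fun p => F p * chr j p) 2 := by
  refine hF.mono (hF.1.mul (continuous_chr j).aestronglyMeasurable)
    (Filter.Eventually.of_forall fun p => ?_)
  simp [norm_chr]

lemma tc_eq_iterated {F : T2 → ℂ} (hF : Integrable F) (k m : ℤ) :
    tc F (k, m) = fourierCoeff (fun y => fourierCoeff (fun x => F (x, y)) k) m := by
  rw [tc, fourierCoeff_eq]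
  have h := integral_prod_symm _ (hF.mul_chr (-(k, m)))
  rw [← Measure.volume_eq_prod] at h
  rw [h]
  congr 1 with y
  rw [fourierCoeff_eq, ← integral_mul_const]
  congr 1 with x
  simp only [chr, Prod.fst_neg, Prod.snd_neg]
  ring

lemma aestronglyMeasurable_fourierCoeff_slice {F : T2 → ℂ} (hF : AEStronglyMeasurable F)
    (k : ℤ) : AEStronglyMeasurable (fun y => fourierCoeff (fun x => F (x, y)) k) := by
  simp only [fourierCoeff_eq]
  have h : AEStronglyMeasurable (fun p : T2 => F p.swap * fourier (-k) p.2) := by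
    refine AEStronglyMeasurable.mul ?_ (by fun_prop)
    exact hF.comp_quasiMeasurePreserving (Measure.measurePreserving_swap).quasiMeasurePreserving
  exact AEStronglyMeasurable.integral_prod_right' h

lemma lintegral_enorm_sq_lt_top {α : Type*} [MeasurableSpace α] {μ : Measure α} {F : α → ℂ}
    (hF : MemLp F 2 μ) : ∫⁻ p, ‖F p‖ₑ ^ 2 ∂μ < ⊤ := by
  have h := (lintegral_rpow_enorm_lt_top_of_eLpNorm_lt_top two_ne_zero ENNReal.ofNat_ne_top
    hF.2)
  simpa using h

lemma memLp_two_of_lintegral {α : Type*} [MeasurableSpace α] {μ : Measure α} {F : α → ℂ}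
    (h : AEStronglyMeasurable F μ) (hF : ∫⁻ p, ‖F p‖ₑ ^ 2 ∂μ < ⊤) : MemLp F 2 μ := by
  refine ⟨h, ?_⟩
  rw [eLpNorm_lt_top_iff_lintegral_rpow_enorm_lt_top two_ne_zero ENNReal.ofNat_ne_top]
  simpa using hF

lemma ae_memLp_slice {F : T2 → ℂ} (hF : MemLp F 2) :
    ∀ᵐ y : UnitAddCircle, MemLp (fun x => F (x, y)) 2 := by
  have hs : AEStronglyMeasurable (fun p : T2 => F p.swap) :=
    hF.1.comp_quasiMeasurePreserving (Measure.measurePreserving_swap).quasiMeasurePreserving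
  have h1 := lintegral_enorm_sq_lt_top hF
  rw [Measure.volume_eq_prod, lintegral_prod_symm _ (hF.1.enorm.pow_const 2)] at h1
  have h2 := ae_lt_top' (AEMeasurable.lintegral_prod_left'
    (μ := (volume : Measure UnitAddCircle)) (ν := (volume : Measure UnitAddCircle))
    (hF.1.enorm.pow_const 2)) h1.ne
  filter_upwards [h2, hs.prodMk_left] with y hy hm
  exact memLp_two_of_lintegral hm hy

/-- Parseval's identity on the torus, slice by slice. -/
lemma tsum_enorm_tc_sq_slice {F : T2 → ℂ} (hF : MemLp F 2) (k : ℤ) :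
    ∑' m, ‖tc F (k, m)‖ₑ ^ 2 = ∫⁻ y, ‖fourierCoeff (fun x => F (x, y)) k‖ₑ ^ 2 := by
  have hm := aestronglyMeasurable_fourierCoeff_slice hF.1 k
  have hle : ∫⁻ y, ‖fourierCoeff (fun x => F (x, y)) k‖ₑ ^ 2 ≤ ∫⁻ p, ‖F p‖ₑ ^ 2 := by
    rw [Measure.volume_eq_prod, lintegral_prod_symm _ (hF.1.enorm.pow_const 2)]
    refine lintegral_mono_ae ?_
    filter_upwards [ae_memLp_slice hF] with y hy
    rw [← tsum_enorm_fourierCoeff_sq hy]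
    exact ENNReal.le_tsum (f := fun k => ‖fourierCoeff (fun x => F (x, y)) k‖ₑ ^ 2) k
  rw [← tsum_enorm_fourierCoeff_sq
    (memLp_two_of_lintegral hm (hle.trans_lt (lintegral_enorm_sq_lt_top hF)))]
  simp only [tc_eq_iterated (hF.integrable one_le_two)]

lemma tsum_enorm_tc_sq {F : T2 → ℂ} (hF : MemLp F 2) :
    ∑' j, ‖tc F j‖ₑ ^ 2 = ∫⁻ p, ‖F p‖ₑ ^ 2 := by
  rw [ENNReal.tsum_prod']
  simp only [tsum_enorm_tc_sq_slice hF]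
  rw [← lintegral_tsum fun k =>
    ((aestronglyMeasurable_fourierCoeff_slice hF.1 k).enorm.pow_const 2),
    Measure.volume_eq_prod, lintegral_prod_symm _ (hF.1.enorm.pow_const 2)]
  refine lintegral_congr_ae ?_
  filter_upwards [ae_memLp_slice hF] with y hy
  exact tsum_enorm_fourierCoeff_sq hy

lemma memLp_chr (j : ℤ × ℤ) : MemLp (chr j) 2 (volume : Measure T2) := by
  have := (memLp_const (μ := (volume : Measure T2)) (p := 2) (1 : ℂ)).mul_chr j
  simpa using this

/-- The characters as elements of `L²`. -/
def chrL (j : ℤ × ℤ) : Lp ℂ 2 (volume : Measure T2) := (memLp_chr j).toLp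

lemma inner_chrL (j : ℤ × ℤ) (F : Lp ℂ 2 (volume : Measure T2)) :
    inner ℂ (chrL j) F = tc F j := by
  rw [L2.inner_def, tc]
  apply integral_congr_ae
  filter_upwards [(memLp_chr j).coeFn_toLp] with p hp
  rw [chrL, hp, RCLike.inner_apply, chr_neg]

lemma tc_chr (i j : ℤ × ℤ) : tc (chr i) j = if i = j then 1 else 0 := by
  have h1 : ∀ n l : ℤ, fourierCoeff (fun x : UnitAddCircle => (fourier n x : ℂ)) l
      = if n = l then 1 else 0 := fun n l => by
    have h := fourierCoeff_fourier (T := 1) n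
    rw [h, Pi.single_apply]
    simp [eq_comm]
  obtain ⟨a, b⟩ := i
  obtain ⟨k, m⟩ := j
  rw [tc_eq_iterated ((memLp_chr _).integrable one_le_two)]
  simp only [chr]
  have h2 : ∀ y : UnitAddCircle, fourierCoeff (fun x : UnitAddCircle => (fourier a x : ℂ) * fourier b y) k
      = (if a = k then 1 else 0) * fourier b y := fun y => by
    rw [← h1, fourierCoeff_eq, fourierCoeff_eq, ← integral_mul_const]
    congr 1 with x
    ring
  simp only [h2]
  rw [fourierCoeff.const_mul, h1]
  by_cases h : a = k <;> by_cases h' : b = m <;> simp [h, h']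

lemma orthonormal_chrL : Orthonormal ℂ chrL := by
  rw [orthonormal_iff_ite]
  intro i j
  rw [inner_chrL, chrL, tc_congr (memLp_chr j).coeFn_toLp, tc_chr]
  simp [eq_comm]

/-- Completeness from Parseval's identity: a function orthogonal to every character has zero norm.
-/
lemma span_chrL : (Submodule.span ℂ (Set.range chrL))ᗮ = ⊥ := by
  rw [Submodule.eq_bot_iff]
  intro F hF
  have h : ∀ j, tc F j = 0 := fun j => by
    rw [← inner_chrL]
    exact (Submodule.mem_orthogonal _ _).1 hF _ (Submodule.subset_span ⟨j, rfl⟩)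
  have h2 := tsum_enorm_tc_sq (Lp.memLp F)
  simp only [h, enorm_zero, zero_pow two_ne_zero, tsum_zero] at h2
  have h3 := (lintegral_eq_zero_iff' ((Lp.memLp F).1.enorm.pow_const 2)).1 h2.symm
  rw [Lp.eq_zero_iff_ae_eq_zero]
  filter_upwards [h3] with p hp
  simpa using hp

/-- The Fourier basis of the two-dimensional torus. -/
def torusBasis : HilbertBasis (ℤ × ℤ) ℂ (Lp ℂ 2 (volume : Measure T2)) :=
  HilbertBasis.mkOfOrthogonalEqBot orthonormal_chrL span_chrL

lemma torusBasis_apply (j : ℤ × ℤ) : torusBasis j = chrL j := by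
  simp [torusBasis]

lemma exists_tc_eq {a : ℤ × ℤ → ℂ} (ha : ∑' j, ‖a j‖ₑ ^ 2 ≠ ⊤) :
    ∃ F : T2 → ℂ, StronglyMeasurable F ∧ MemLp F 2 ∧ ∀ j, tc F j = a j := by
  have hm : Memℓp a 2 := by
    apply memℓp_gen
    have h := ENNReal.summable_toReal ha
    refine h.congr fun j => ?_
    simp
  let F := torusBasis.repr.symm ⟨a, hm⟩
  refine ⟨F, Lp.stronglyMeasurable F, Lp.memLp F, fun j => ?_⟩
  rw [← inner_chrL, ← torusBasis_apply, ← HilbertBasis.repr_apply_apply]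
  simp [F]

lemma ae_eq_of_tc_eq {F G : T2 → ℂ} (hF : MemLp F 2) (hG : MemLp G 2)
    (h : ∀ j, tc F j = tc G j) : F =ᵐ[volume] G := by
  have h2 := tsum_enorm_tc_sq (hF.sub hG)
  have h4 : ∀ j, tc (F - G) j = 0 := fun j => by
    simp only [tc, Pi.sub_apply, sub_mul]
    rw [integral_sub ((hF.mul_chr _).integrable one_le_two) ((hG.mul_chr _).integrable one_le_two)]
    exact sub_eq_zero.2 (h j)
  simp only [h4, enorm_zero, zero_pow two_ne_zero, tsum_zero] at h2
  have h3 := (lintegral_eq_zero_iff' ((hF.sub hG).1.enorm.pow_const 2)).1 h2.symm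
  filter_upwards [h3] with p hp
  simpa [sub_eq_zero] using hp

/-- The integral of a product in terms of the Fourier coefficients. -/
lemma hasSum_tc_mul_tc_neg {F G : T2 → ℂ} (hF : MemLp F 2) (hG : MemLp G 2) :
    HasSum (fun i => tc F i * tc G (-i)) (∫ p, F p * G p) := by
  have hGs : MemLp (fun p => (starRingEnd ℂ) (G p)) 2 := hG.star
  have h := torusBasis.hasSum_inner_mul_inner hGs.toLp hF.toLp
  have e : inner ℂ hGs.toLp hF.toLp = ∫ p, F p * G p := by
    rw [L2.inner_def]
    apply integral_congr_ae
    filter_upwards [hGs.coeFn_toLp, hF.coeFn_toLp] with p h1 h2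
    rw [h1, h2, RCLike.inner_apply]
    simp
  rw [e] at h
  refine h.congr_fun ?_ |> fun h' => h'
  intro i
  rw [torusBasis_apply, inner_chrL, tc_congr hF.coeFn_toLp, mul_comm, ← inner_conj_symm,
    inner_chrL, tc_congr hGs.coeFn_toLp]
  congr 1
  rw [tc, tc, ← integral_conj]
  congr 1 with p
  simp [chr_neg]

lemma tc_mul_chr (G : T2 → ℂ) (i j : ℤ × ℤ) : tc (fun p => G p * chr j p) i = tc G (i - j) := by
  simp only [tc]
  congr 1 with p
  rw [mul_assoc, ← chr_add]
  congr 2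
  abel

/-- The Fourier coefficients of a product. -/
lemma hasSum_tc_mul {F G : T2 → ℂ} (hF : MemLp F 2) (hG : MemLp G 2) (j : ℤ × ℤ) :
    HasSum (fun i => tc F i * tc G (j - i)) (tc (fun p => F p * G p) j) := by
  have h := hasSum_tc_mul_tc_neg hF (hG.mul_chr (-j))
  simp only [tc_mul_chr] at h
  have e : tc (fun p => F p * G p) j = ∫ p, F p * (G p * chr (-j) p) := by
    simp only [tc, mul_assoc]
  rw [e]
  convert h using 4
  abel

/-- The integral of a triple product in terms of the Fourier coefficients. -/
lemma integral_triple {F G H : T2 → ℂ} (hF : MemLp F 2) (hG : MemLp G 2) (hH : MemLp H 2)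
    (hGH : MemLp (fun p => G p * H p) 2)
    (hs : ∑' j, ‖tc H (-j)‖ₑ * conv (fun i => ‖tc F i‖ₑ) (fun i => ‖tc G i‖ₑ) j ≠ ⊤) :
    ∫ p, F p * (G p * H p) = ∑' j, tc H (-j) * ∑' i, tc F i * tc G (j - i) := by
  have hsum : Summable fun q : (ℤ × ℤ) × (ℤ × ℤ) => tc F q.1 * (tc G (q.2 - q.1) * tc H (-q.2)) := by
    rw [← summable_norm_iff]
    have h0 : ∑' q : (ℤ × ℤ) × (ℤ × ℤ),
        ‖tc F q.1 * (tc G (q.2 - q.1) * tc H (-q.2))‖ₑ ≠ ⊤ := by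
      rw [ENNReal.tsum_prod', ENNReal.tsum_comm]
      convert hs using 3 with j
      rw [conv, ← ENNReal.tsum_mul_left]
      congr 1 with i
      rw [enorm_mul, enorm_mul]
      ring
    have h1 := ENNReal.summable_toReal h0
    simpa using h1
  have h1 := (hasSum_tc_mul_tc_neg hF hGH).tsum_eq
  rw [← h1]
  have h2 : ∀ i, tc (fun p => G p * H p) (-i) = ∑' j, tc G (j - i) * tc H (-j) := fun i => by
    rw [← (hasSum_tc_mul hG hH (-i)).tsum_eq, ← (Equiv.subRight i).tsum_eq]
    congr 1 with j
    simp only [Equiv.subRight_apply]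
    congr 2
    abel
  simp only [h2, ← tsum_mul_left]
  rw [← Summable.tsum_comm (f := fun i j => tc F i * (tc G (j - i) * tc H (-j))) hsum]
  congr 1 with j
  congr 1 with i
  ring

lemma tc_conj (F : T2 → ℂ) (j : ℤ × ℤ) :
    tc (fun p => (starRingEnd ℂ) (F p)) j = (starRingEnd ℂ) (tc F (-j)) := by
  rw [tc, tc, ← integral_conj]
  congr 1 with p
  simp [chr_neg]

/-- The reflection of the torus in the second variable. -/
def refl (p : T2) : T2 := (p.1, -p.2)

lemma measurePreserving_refl : MeasurePreserving refl (volume : Measure T2) volume :=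
  (MeasurePreserving.id _).prod (Measure.measurePreserving_neg _)

lemma tc_refl (F : T2 → ℂ) (j : ℤ × ℤ) : tc (fun p => F (refl p)) j = tc F (j.1, -j.2) := by
  rw [tc, tc]
  have he : MeasurableEmbedding refl :=
    ((MeasurableEquiv.refl UnitAddCircle).prodCongr (MeasurableEquiv.neg _)).measurableEmbedding
  rw [← measurePreserving_refl.integral_comp he]
  congr 1 with p
  simp only [chr, refl, Prod.fst_neg, Prod.snd_neg, neg_neg]
  congr 2
  rw [fourier_apply, fourier_apply, smul_neg, neg_smul, neg_neg]

end
end HydrostaticNS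

namespace HydrostaticNS
noncomputable section

/-! ### Even and odd extensions from the channel to the torus -/

lemma exists_rep (y : UnitAddCircle) : ∃ x : ℝ, x ∈ Ioc (-(1 / 2) : ℝ) (1 / 2) ∧
    (x : UnitAddCircle) = y ∧ ‖y‖ = |x| := by
  obtain ⟨x, hx, rfl⟩ := (AddCircle.coe_image_Ioc_eq (1 : ℝ) (-(1 / 2))).symm ▸ mem_univ y
  have h2 : x ∈ Ioc (-(1 / 2) : ℝ) (1 / 2) := ⟨hx.1, hx.2.trans (by norm_num)⟩
  refine ⟨x, h2, rfl, ?_⟩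
  rw [AddCircle.norm_coe_eq_abs_iff _ one_ne_zero, abs_le]
  constructor <;> norm_num <;> linarith [h2.1, h2.2]

lemma norm_coe_of_mem {x : ℝ} (hx : x ∈ Icc (-(1 / 2) : ℝ) (1 / 2)) :
    ‖(x : UnitAddCircle)‖ = |x| := by
  rw [AddCircle.norm_coe_eq_abs_iff _ one_ne_zero, abs_le]
  constructor <;> norm_num <;> linarith [hx.1, hx.2]

/-- The map `y ↦ 2‖y‖` from the circle to the vertical interval. -/
lemma measurePreserving_two_mul_norm : MeasurePreserving (fun y : UnitAddCircle => 2 * ‖y‖)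
    volume (volume.restrict (Ioo (0 : ℝ) 1)) := by
  refine ⟨by fun_prop, ?_⟩
  have h0 := AddCircle.measurePreserving_mk 1 (-(1 / 2))
  have hmk : Measurable (QuotientAddGroup.mk : ℝ → UnitAddCircle) := h0.measurable
  rw [← h0.map_eq, Measure.map_map (by fun_prop) hmk]
  -- The circle is cut at its origin. The map is affine with slope `-2` on one half and `2` on the
  -- other, each half covers the unit interval once, and each contributes half of Lebesgue measure.
  have h1 : (volume : Measure ℝ).restrict (Ioc (-(1 / 2) : ℝ) (-(1 / 2) + 1))
      = volume.restrict (Ioc (-(1 / 2)) 0) + volume.restrict (Ioc 0 (1 / 2)) := by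
    rw [← Measure.restrict_union, Ioc_union_Ioc_eq_Ioc] <;> norm_num
  rw [h1, Measure.map_add _ _ ((by fun_prop : Measurable fun y : UnitAddCircle => 2 * ‖y‖).comp hmk)]
  have hm1 : Measure.map ((fun y : UnitAddCircle => 2 * ‖y‖) ∘ QuotientAddGroup.mk)
      ((volume : Measure ℝ).restrict (Ioc (-(1 / 2)) 0))
      = Measure.map (fun x => (-2) * x) (volume.restrict (Ioc (-(1 / 2)) 0)) := by
    refine Measure.map_congr ((ae_restrict_iff' measurableSet_Ioc).2 (.of_forall fun x hx => ?_))
    have := norm_coe_of_mem (x := x) ⟨hx.1.le, by linarith [hx.2]⟩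
    change 2 * ‖(x : UnitAddCircle)‖ = _
    rw [this, abs_of_nonpos hx.2]; ring
  have hm2 : Measure.map ((fun y : UnitAddCircle => 2 * ‖y‖) ∘ QuotientAddGroup.mk)
      ((volume : Measure ℝ).restrict (Ioc 0 (1 / 2)))
      = Measure.map (fun x => 2 * x) (volume.restrict (Ioc 0 (1 / 2))) := by
    refine Measure.map_congr ((ae_restrict_iff' measurableSet_Ioc).2 (.of_forall fun x hx => ?_))
    have := norm_coe_of_mem (x := x) ⟨by linarith [hx.1], hx.2⟩
    change 2 * ‖(x : UnitAddCircle)‖ = _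
    rw [this, abs_of_pos hx.1]
  have hp1 : Ioc (-(1 / 2) : ℝ) 0 = (fun x => (-2) * x) ⁻¹' (Ico 0 1) := by
    ext x; simp only [mem_Ioc, mem_preimage, mem_Ico]
    constructor <;> rintro ⟨h1, h2⟩ <;> constructor <;> linarith
  have hp2 : Ioc (0 : ℝ) (1 / 2) = (fun x => 2 * x) ⁻¹' (Ioc 0 1) := by
    ext x; simp only [mem_Ioc, mem_preimage]
    constructor <;> rintro ⟨h1, h2⟩ <;> constructor <;> linarith
  rw [hm1, hm2, hp1, hp2, ← Measure.restrict_map (by fun_prop) measurableSet_Ico,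
    ← Measure.restrict_map (by fun_prop) measurableSet_Ioc,
    Real.map_volume_mul_left (by norm_num), Real.map_volume_mul_left (by norm_num),
    Measure.restrict_smul, Measure.restrict_smul, restrict_Ico_eq_restrict_Ioc, ← add_smul,
    restrict_Ioo_eq_restrict_Ioc]
  have : ENNReal.ofReal |(-2 : ℝ)⁻¹| + ENNReal.ofReal |(2 : ℝ)⁻¹| = 1 := by
    rw [← ENNReal.ofReal_add (abs_nonneg _) (abs_nonneg _)]
    norm_num [abs_of_pos, abs_of_neg]
  rw [this, one_smul]

/-- The folding map from the torus to the channel. -/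
def fold (p : T2) : UnitAddCircle × ℝ := (p.1, 2 * ‖p.2‖)

lemma measurePreserving_fold : MeasurePreserving fold (volume : Measure T2) channelMeasure :=
  (MeasurePreserving.id _).prod measurePreserving_two_mul_norm

lemma integral_fold {h : UnitAddCircle × ℝ → ℂ} (hh : AEStronglyMeasurable h channelMeasure) :
    ∫ p, h (fold p) = ∫ q, h q ∂channelMeasure := by
  rw [← measurePreserving_fold.map_eq] at hh ⊢
  exact (integral_map measurePreserving_fold.measurable.aemeasurable hh).symm

lemma fold_refl (p : T2) : fold (refl p) = fold p := by simp [fold, refl]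

/-- The sign of the second variable on the torus. -/
def sg (p : T2) : ℝ := Real.sign (fourier 1 p.2 : ℂ).im

lemma measurable_sign : Measurable Real.sign := by
  unfold Real.sign
  exact Measurable.ite measurableSet_Iio measurable_const
    (Measurable.ite measurableSet_Ioi measurable_const measurable_const)

@[fun_prop] lemma measurable_sg : Measurable sg :=
  measurable_sign.comp (Complex.measurable_im.comp
    (((fourier 1).continuous.comp continuous_snd).measurable))

lemma fourier_coe (m : ℤ) (x : ℝ) : (fourier m (x : UnitAddCircle) : ℂ)
    = Real.cos (2 * Real.pi * m * x) + Real.sin (2 * Real.pi * m * x) * Complex.I := by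
  rw [fourier_coe_apply, Complex.ofReal_cos, Complex.ofReal_sin, ← Complex.exp_mul_I]
  congr 1
  push_cast
  ring

lemma sg_refl (p : T2) : sg (refl p) = -sg p := by
  obtain ⟨x, -, hx, -⟩ := exists_rep p.2
  simp only [sg, refl, ← hx]
  have h : -(x : UnitAddCircle) = ((-x : ℝ) : UnitAddCircle) := by simp
  rw [h, fourier_coe, fourier_coe]
  simp [Real.sign_neg, -Complex.ofReal_mul, -Complex.ofReal_sin,
    Complex.ofReal_re, -Complex.ofReal_cos, mul_neg, Real.sin_neg]

lemma sg_coe {x : ℝ} (y : UnitAddCircle) (hx : x ∈ Ioc (-(1 / 2) : ℝ) (1 / 2)) :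
    (x < 0 → sg (y, (x : UnitAddCircle)) = -1) ∧
      (0 < x → x < 1 / 2 → sg (y, (x : UnitAddCircle)) = 1) := by
  have e : (fourier 1 (x : UnitAddCircle) : ℂ).im = Real.sin (2 * Real.pi * x) := by
    rw [fourier_coe]
    simp only [Complex.add_im, Complex.ofReal_im, Complex.mul_im, Complex.ofReal_re, Complex.I_im,
      Complex.I_re]
    simp
  simp only [sg, e]
  have hp := Real.pi_pos
  constructor
  · intro h
    apply Real.sign_of_neg
    apply Real.sin_neg_of_neg_of_neg_pi_lt
    · nlinarith
    · nlinarith [hx.1]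
  · intro h h2
    apply Real.sign_of_pos
    apply Real.sin_pos_of_pos_of_lt_pi
    · positivity
    · nlinarith

lemma fourier_add_fourier_neg (m : ℤ) (y : UnitAddCircle) :
    (fourier m y + fourier (-m) y : ℂ) = 2 * (Real.cos (Real.pi * m * (2 * ‖y‖)) : ℝ) := by
  obtain ⟨x, -, rfl, hn⟩ := exists_rep y
  rw [fourier_coe, fourier_coe, hn]
  have h : Real.cos (Real.pi * m * (2 * |x|)) = Real.cos (2 * Real.pi * m * x) := by
    rcases abs_choice x with h | h <;> rw [h]
    · ring_nf
    · rw [← Real.cos_neg]; ring_nf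
  have h1 : 2 * Real.pi * ((-m : ℤ) : ℝ) * x = -(2 * Real.pi * m * x) := by push_cast; ring
  rw [h, h1, Real.cos_neg, Real.sin_neg]
  push_cast
  ring

lemma fourier_sub_fourier_neg (m : ℤ) (p : T2) :
    (fourier m p.2 - fourier (-m) p.2 : ℂ)
      = 2 * Complex.I * (sg p * Real.sin (Real.pi * m * (2 * ‖p.2‖)) : ℝ) := by
  obtain ⟨p1, y⟩ := p
  obtain ⟨x, hx, rfl, hn⟩ := exists_rep y
  have h : sg (p1, (x : UnitAddCircle)) * Real.sin (Real.pi * m * (2 * |x|))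
      = Real.sin (2 * Real.pi * m * x) := by
    rcases lt_trichotomy x 0 with h0 | rfl | h0
    · rw [(sg_coe p1 hx).1 h0, abs_of_neg h0, neg_one_mul, ← Real.sin_neg]
      ring_nf
    · simp
    -- At the antipodal point the value of `sg` is not the one on the upper half, but `sin (πm)`
    -- vanishes there.
    · rcases eq_or_lt_of_le hx.2 with rfl | h2
      · have e1 : Real.pi * m * (2 * |(1 / 2 : ℝ)|) = m * Real.pi := by
          rw [abs_of_pos (by norm_num)]; ring
        have e2 : 2 * Real.pi * m * (1 / 2) = m * Real.pi := by ring
        rw [e1, e2, Real.sin_int_mul_pi, mul_zero]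
      · rw [(sg_coe p1 hx).2 h0 h2, abs_of_pos h0]
        ring_nf
  simp only [hn, h]
  rw [fourier_coe, fourier_coe]
  have h1 : 2 * Real.pi * ((-m : ℤ) : ℝ) * x = -(2 * Real.pi * m * x) := by push_cast; ring
  rw [h1, Real.cos_neg, Real.sin_neg]
  push_cast
  ring

lemma ae_snd_norm : ∀ᵐ p : T2, fold p ∈ (univ : Set UnitAddCircle) ×ˢ Ioo (0 : ℝ) 1 := by
  have h : ∀ᵐ q ∂channelMeasure, q ∈ (univ : Set UnitAddCircle) ×ˢ Ioo (0 : ℝ) 1 := by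
    have e : channelMeasure = (volume : Measure (UnitAddCircle × ℝ)).restrict (univ ×ˢ Ioo 0 1) := by
      rw [Measure.volume_eq_prod, ← Measure.prod_restrict, Measure.restrict_univ]
    rw [e]
    exact ae_restrict_mem (MeasurableSet.univ.prod measurableSet_Ioo)
  exact measurePreserving_fold.quasiMeasurePreserving.ae h

lemma sg_sq {p : T2} (hp : fold p ∈ (univ : Set UnitAddCircle) ×ˢ Ioo (0 : ℝ) 1) :
    sg p * sg p = 1 := by
  obtain ⟨p1, y⟩ := p
  obtain ⟨x, hx, rfl, hn⟩ := exists_rep y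
  have h1 := hp.2
  simp only [fold, hn, mem_Ioo] at h1
  rcases lt_or_gt_of_ne (abs_pos.1 (by linarith [h1.1] : 0 < |x|)) with h0 | h0
  · rw [(sg_coe p1 hx).1 h0]; norm_num
  · rw [(sg_coe p1 hx).2 h0 (by rw [abs_of_pos h0] at h1; linarith [h1.2])]; norm_num

lemma abs_sg_le (p : T2) : |sg p| ≤ 1 := by
  unfold sg
  rcases Real.sign_apply_eq (fourier 1 p.2 : ℂ).im with h | h | h <;> rw [h] <;> norm_num

/-- The even extension to the torus. -/
def ev (h : UnitAddCircle × ℝ → ℂ) (p : T2) : ℂ := h (fold p)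

/-- The odd extension to the torus. -/
def od (h : UnitAddCircle × ℝ → ℂ) (p : T2) : ℂ := sg p * h (fold p)

/-- The Fourier coefficients of the even extension. -/
def coefE (h : UnitAddCircle × ℝ → ℂ) (j : ℤ × ℤ) : ℂ := tc (ev h) j

/-- The Fourier coefficients of the odd extension. -/
def coefO (h : UnitAddCircle × ℝ → ℂ) (j : ℤ × ℤ) : ℂ := tc (od h) j

lemma memLp_ev {h : UnitAddCircle × ℝ → ℂ} {q : ℝ≥0∞} (hh : MemLp h q channelMeasure) :
    MemLp (ev h) q :=
  hh.comp_measurePreserving measurePreserving_fold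

lemma measurable_od {h : UnitAddCircle × ℝ → ℂ} (hh : AEStronglyMeasurable h channelMeasure) :
    AEStronglyMeasurable (od h) (volume : Measure T2) :=
  (Complex.measurable_ofReal.comp measurable_sg).aestronglyMeasurable.mul
    (hh.comp_measurePreserving measurePreserving_fold)

lemma norm_od_le (h : UnitAddCircle × ℝ → ℂ) (p : T2) : ‖od h p‖ ≤ ‖ev h p‖ := by
  rw [od, ev, norm_mul, Complex.norm_real]
  exact mul_le_of_le_one_left (norm_nonneg _) (abs_sg_le p)

lemma memLp_od {h : UnitAddCircle × ℝ → ℂ} {q : ℝ≥0∞} (hh : MemLp h q channelMeasure) :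
    MemLp (od h) q :=
  (memLp_ev hh).mono (measurable_od hh.1) (.of_forall (norm_od_le h))

lemma od_mul_od {p : T2} (g h : UnitAddCircle × ℝ → ℂ)
    (hp : fold p ∈ (univ : Set UnitAddCircle) ×ˢ Ioo (0 : ℝ) 1) :
    od g p * od h p = ev (fun q => g q * h q) p := by
  have := sg_sq hp
  simp only [od, ev]
  calc _ = ((sg p * sg p : ℝ) : ℂ) * (g (fold p) * h (fold p)) := by push_cast; ring
    _ = _ := by rw [this]; simp

lemma integral_ev {h : UnitAddCircle × ℝ → ℂ} (hh : AEStronglyMeasurable h channelMeasure) :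
    ∫ p, ev h p = ∫ q, h q ∂channelMeasure := integral_fold hh

lemma integral_od_mul_od {g h : UnitAddCircle × ℝ → ℂ} (hg : AEStronglyMeasurable g channelMeasure)
    (hh : AEStronglyMeasurable h channelMeasure) :
    ∫ p, od g p * od h p = ∫ q, g q * h q ∂channelMeasure := by
  rw [← integral_ev (h := fun q => g q * h q) (hg.mul hh)]
  refine integral_congr_ae ?_
  filter_upwards [ae_snd_norm] with p hp
  exact od_mul_od g h hp

lemma coefE_neg_snd (h : UnitAddCircle × ℝ → ℂ) (k m : ℤ) :
    coefE h (k, -m) = coefE h (k, m) := by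
  have h1 := tc_refl (ev h) (k, m)
  simp only [ev, fold_refl] at h1
  exact h1.symm

lemma coefO_neg_snd (h : UnitAddCircle × ℝ → ℂ) (k m : ℤ) :
    coefO h (k, -m) = -coefO h (k, m) := by
  have h1 := tc_refl (od h) (k, m)
  simp only [od, fold_refl, sg_refl] at h1
  rw [coefO, coefO, show tc (od h) (k, -m) = _ from h1.symm, tc, tc, ← integral_neg]
  congr 1 with p
  simp [od]

lemma coefO_zero (h : UnitAddCircle × ℝ → ℂ) (k : ℤ) : coefO h (k, 0) = 0 := by
  have := coefO_neg_snd h k 0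
  rw [neg_zero] at this
  exact self_eq_neg.1 this

lemma integrable_fold {h : UnitAddCircle × ℝ → ℂ} (hh : Integrable h channelMeasure) :
    Integrable (fun p => h (fold p)) :=
  measurePreserving_fold.integrable_comp_of_integrable hh

/-- Averaging over `m` and `-m`, which does not change the coefficient of an even extension, turns
the character into a cosine. -/
lemma coefE_eq {h : UnitAddCircle × ℝ → ℂ} (hh : Integrable h channelMeasure) (k m : ℤ) :
    coefE h (k, m) = ∫ q, h q * (fourier (-k) q.1 * (Real.cos (Real.pi * m * q.2) : ℝ))
      ∂channelMeasure := by
  have h1 : coefE h (k, m) = (coefE h (k, m) + coefE h (k, -m)) / 2 := by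
    rw [coefE_neg_snd]; ring
  have hev : Integrable (ev h) := integrable_fold hh
  rw [h1, coefE, coefE, tc, tc, ← integral_add (hev.mul_chr _) (hev.mul_chr _), ← integral_div, ← integral_fold]
  · congr 1 with p
    have h2 := fourier_add_fourier_neg m p.2
    simp only [chr, ev, fold, Prod.fst_neg, Prod.snd_neg, neg_neg]
    linear_combination (h (p.1, 2 * ‖p.2‖) * fourier (-k) p.1 / 2) * h2
  · exact hh.1.mul (Continuous.aestronglyMeasurable (by fun_prop))

lemma coefO_eq {h : UnitAddCircle × ℝ → ℂ} (hh : Integrable h channelMeasure) (k m : ℤ) :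
    coefO h (k, m) = -Complex.I * ∫ q, h q *
      (fourier (-k) q.1 * (Real.sin (Real.pi * m * q.2) : ℝ)) ∂channelMeasure := by
  have h1 : coefO h (k, m) = (coefO h (k, m) - coefO h (k, -m)) / 2 := by
    rw [coefO_neg_snd]; ring
  have hod : Integrable (od h) :=
    memLp_one_iff_integrable.1 (memLp_od (memLp_one_iff_integrable.2 hh))
  rw [h1, coefO, coefO, tc, tc, ← integral_sub (hod.mul_chr _) (hod.mul_chr _), ← integral_div,
    ← integral_fold, ← integral_const_mul]
  · refine integral_congr_ae ?_
    filter_upwards [ae_snd_norm] with p hp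
    have h2 := fourier_sub_fourier_neg m p
    have h3 : (sg p : ℂ) * sg p = 1 := by
      rw [← Complex.ofReal_mul, sg_sq hp, Complex.ofReal_one]
    simp only [chr, od, fold, Prod.fst_neg, Prod.snd_neg, neg_neg]
    push_cast at h2 ⊢
    linear_combination (-(sg p : ℂ) * h (p.1, 2 * ‖p.2‖) * fourier (-k) p.1 / 2) * h2
      - Complex.I * (h (p.1, 2 * ‖p.2‖) * fourier (-k) p.1
        * Complex.sin (Real.pi * m * (2 * ‖p.2‖))) * h3
  · exact hh.1.mul (Continuous.aestronglyMeasurable (by fun_prop))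

/-- A real function on the channel, as a complex function. -/
def cx (f : UnitAddCircle × ℝ → ℝ) (p : UnitAddCircle × ℝ) : ℂ := (f p : ℂ)

lemma coefE_neg_cx (f : UnitAddCircle × ℝ → ℝ) (j : ℤ × ℤ) :
    coefE (cx f) (-j) = (starRingEnd ℂ) (coefE (cx f) j) := by
  have h := tc_conj (ev (cx f)) (-j)
  simp only [neg_neg, ev, cx, Complex.conj_ofReal] at h
  exact h

lemma memLp_cx {f : UnitAddCircle × ℝ → ℝ} {q : ℝ≥0∞} (hf : MemLp f q channelMeasure) :
    MemLp (cx f) q channelMeasure := hf.ofReal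

lemma memLp_cxL (f : ChannelL2) : MemLp (cx f) 2 channelMeasure := memLp_cx (Lp.memLp f)

lemma integrable_cxL (f : ChannelL2) : Integrable (cx f) channelMeasure :=
  (memLp_cxL f).integrable one_le_two

lemma eq_of_ae_fold {f g : ChannelL2} (h : ∀ᵐ p : T2, f (fold p) = g (fold p)) : f = g := by
  have hm : MeasurableSet {q | f q = g q} :=
    measurableSet_eq_fun (Lp.stronglyMeasurable f).measurable (Lp.stronglyMeasurable g).measurable
  have h2 := (ae_map_iff (μ := (volume : Measure T2))
    measurePreserving_fold.measurable.aemeasurable (p := fun q => f q = g q) hm).2 h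
  rw [measurePreserving_fold.map_eq] at h2
  exact Lp.ext h2

lemma eq_of_coefE_eq {f g : ChannelL2} (h : ∀ j, coefE (cx f) j = coefE (cx g) j) : f = g := by
  apply eq_of_ae_fold
  filter_upwards [ae_eq_of_tc_eq (memLp_ev (memLp_cxL f)) (memLp_ev (memLp_cxL g)) h] with p hp
  exact Complex.ofReal_injective hp

lemma eq_of_coefO_eq {f g : ChannelL2} (h : ∀ j, coefO (cx f) j = coefO (cx g) j) : f = g := by
  apply eq_of_ae_fold
  filter_upwards [ae_eq_of_tc_eq (memLp_od (memLp_cxL f)) (memLp_od (memLp_cxL g)) h,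
    ae_snd_norm] with p hp h1
  have h2 : (sg p : ℂ) ≠ 0 := by
    intro h0
    have := sg_sq h1
    rw [Complex.ofReal_eq_zero.1 h0] at this
    norm_num at this
  exact Complex.ofReal_injective (mul_left_cancel₀ h2 hp)

/-- The section `(x, z) ↦ (x, z/2)` of the folding map. -/
def unfold (q : UnitAddCircle × ℝ) : T2 := (q.1, ((q.2 / 2 : ℝ) : UnitAddCircle))

@[fun_prop] lemma continuous_unfold : Continuous unfold := by
  unfold unfold
  exact continuous_fst.prodMk
    ((AddCircle.continuous_mk' 1).comp (continuous_snd.div_const 2))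

/-- Folding and unfolding is the identity or the reflection. A function on the torus that is even or
odd under the reflection is therefore recovered from its restriction to the channel. -/
lemma unfold_fold (p : T2) :
    (unfold (fold p) = p ∧ (fold p ∈ (univ : Set UnitAddCircle) ×ˢ Ioo (0 : ℝ) 1 → sg p = 1)) ∨
      (unfold (fold p) = refl p ∧
        (fold p ∈ (univ : Set UnitAddCircle) ×ˢ Ioo (0 : ℝ) 1 → sg p = -1)) := by
  obtain ⟨p1, y⟩ := p
  obtain ⟨x, hx, rfl, hn⟩ := exists_rep y
  rcases lt_or_ge x 0 with h0 | h0
  · right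
    refine ⟨?_, fun _ => (sg_coe p1 hx).1 h0⟩
    simp only [unfold, fold, refl, hn, abs_of_neg h0]
    congr 1
    rw [← AddCircle.coe_neg]
    congr 1
    ring
  · left
    refine ⟨?_, fun h => ?_⟩
    · simp only [unfold, fold, hn, abs_of_nonneg h0]
      congr 2
      ring
    · have h1 := h.2
      simp only [fold, hn, abs_of_nonneg h0, mem_Ioo] at h1
      exact (sg_coe p1 hx).2 (by linarith [h1.1]) (by linarith [h1.2])

lemma memLp_of_fold {f : UnitAddCircle × ℝ → ℝ} (hf : Measurable f)
    (h : MemLp (fun p : T2 => f (fold p)) 2) : MemLp f 2 channelMeasure := by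
  rw [← measurePreserving_fold.map_eq,
    memLp_map_measure_iff hf.aestronglyMeasurable measurePreserving_fold.measurable.aemeasurable]
  exact h

lemma ae_real_of_tc {F : T2 → ℂ} (hF : MemLp F 2)
    (h : ∀ j, tc F (-j) = (starRingEnd ℂ) (tc F j)) :
    ∀ᵐ p, (starRingEnd ℂ) (F p) = F p :=
  ae_eq_of_tc_eq hF.star hF fun j => by
    have h1 := tc_conj F j
    rw [h, Complex.conj_conj] at h1
    exact h1

/-- Riesz–Fischer on the torus; the two symmetries of the coefficients force the function to be real
and even, so that it descends to the channel. -/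
lemma exists_coefE_eq {a : ℤ × ℤ → ℂ} (ha : ∑' j, ‖a j‖ₑ ^ 2 ≠ ⊤)
    (he : ∀ k m, a (k, -m) = a (k, m)) (hr : ∀ j, a (-j) = (starRingEnd ℂ) (a j)) :
    ∃ f : ChannelL2, ∀ j, coefE (cx f) j = a j := by
  obtain ⟨F, hFm, hF, hFa⟩ := exists_tc_eq ha
  have h1 := ae_real_of_tc hF fun j => by rw [hFa, hFa, hr]
  have h2 : (fun p => F (refl p)) =ᵐ[volume] F :=
    ae_eq_of_tc_eq (hF.comp_measurePreserving measurePreserving_refl) hF fun j => by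
      rw [tc_refl, hFa, hFa, he]
  have hfm : Measurable fun q => (F (unfold q)).re :=
    Complex.measurable_re.comp (hFm.measurable.comp continuous_unfold.measurable)
  have h3 : ∀ᵐ p, ((F (unfold (fold p))).re : ℂ) = F p := by
    filter_upwards [h1, h2] with p hp hp2
    have hre : ((F p).re : ℂ) = F p := Complex.conj_eq_iff_re.1 hp
    rcases unfold_fold p with ⟨e, -⟩ | ⟨e, -⟩ <;> rw [e]
    · exact hre
    · rw [hp2, hre]
  have hL : MemLp (fun q => (F (unfold q)).re) 2 channelMeasure := by
    refine memLp_of_fold hfm (hF.re.ae_eq ?_)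
    filter_upwards [h3] with p hp
    rw [← hp]
    simp
  refine ⟨hL.toLp, fun j => ?_⟩
  rw [← hFa, coefE]
  refine tc_congr ?_ j
  filter_upwards [h3, measurePreserving_fold.quasiMeasurePreserving.ae hL.coeFn_toLp] with p hp hp2
  simp only [ev, cx, hp2, hp]

lemma exists_coefO_eq {a : ℤ × ℤ → ℂ} (ha : ∑' j, ‖a j‖ₑ ^ 2 ≠ ⊤)
    (he : ∀ k m, a (k, -m) = -a (k, m)) (hr : ∀ j, a (-j) = (starRingEnd ℂ) (a j)) :
    ∃ f : ChannelL2, ∀ j, coefO (cx f) j = a j := by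
  obtain ⟨F, hFm, hF, hFa⟩ := exists_tc_eq ha
  have h1 := ae_real_of_tc hF fun j => by rw [hFa, hFa, hr]
  have h2 : (fun p => F (refl p)) =ᵐ[volume] fun p => -F p :=
    ae_eq_of_tc_eq (hF.comp_measurePreserving measurePreserving_refl) hF.neg fun j => by
      rw [tc_refl, hFa, he]
      simp only [tc, neg_mul, integral_neg]
      rw [← hFa, tc]
  have hfm : Measurable fun q => (F (unfold q)).re :=
    Complex.measurable_re.comp (hFm.measurable.comp continuous_unfold.measurable)
  have h3 : ∀ᵐ p, (sg p : ℂ) * ((F (unfold (fold p))).re : ℂ) = F p := by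
    filter_upwards [h1, h2, ae_snd_norm] with p hp hp2 hp3
    have hre : ((F p).re : ℂ) = F p := Complex.conj_eq_iff_re.1 hp
    rcases unfold_fold p with ⟨e, e2⟩ | ⟨e, e2⟩ <;> rw [e, e2 hp3]
    · simpa using hre
    · rw [hp2, Complex.neg_re]
      push_cast
      rw [hre]
      ring
  have hL : MemLp (fun q => (F (unfold q)).re) 2 channelMeasure := by
    refine memLp_of_fold hfm (hF.norm.mono
      (hfm.comp measurePreserving_fold.measurable).aestronglyMeasurable ?_)
    filter_upwards [h3, ae_snd_norm] with p hp hp3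
    have h4 := sg_sq hp3
    rw [← hp, norm_mul, Complex.norm_real, Complex.norm_real]
    have h5 : ‖sg p‖ = 1 := by
      have : ‖sg p‖ * ‖sg p‖ = 1 := by rw [← norm_mul, h4, norm_one]
      nlinarith [norm_nonneg (sg p)]
    rw [h5, one_mul, norm_norm]
  refine ⟨hL.toLp, fun j => ?_⟩
  rw [← hFa, coefO]
  refine tc_congr ?_ j
  filter_upwards [h3, measurePreserving_fold.quasiMeasurePreserving.ae hL.coeFn_toLp] with p hp hp2
  simp only [od, cx, hp2, hp]

end
end HydrostaticNS

namespace HydrostaticNS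
noncomputable section

/-! ### The analytic norms in terms of Fourier coefficients -/

lemma aemeasurable_fourierX (f : ChannelL2) (k : ℤ) : Measurable (fourierX f k) := by
  have h : StronglyMeasurable fun q : UnitAddCircle × ℝ => cx f q * fourier (-k) q.1 :=
    (Complex.continuous_ofReal.comp_stronglyMeasurable (Lp.stronglyMeasurable f)).mul
      (Continuous.stronglyMeasurable (by fun_prop))
  have h2 := h.integral_prod_left' (μ := (volume : Measure UnitAddCircle))
  have e : fourierX f k = fun z => ∫ x, cx f (x, z) * fourier (-k) (x, z).1 := by
    ext z
    rw [fourierX, fourierCoeff_eq]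
    rfl
  rw [e]
  exact h2.measurable

lemma lintegral_fourierX (f : ChannelL2) (k : ℤ) :
    ∫⁻ z in Ioo (0 : ℝ) 1, ‖fourierX f k z‖ₑ ^ 2 = ∑' m, ‖coefE (cx f) (k, m)‖ₑ ^ 2 := by
  simp only [coefE]
  rw [tsum_enorm_tc_sq_slice (memLp_ev (memLp_cxL f)),
    ← measurePreserving_two_mul_norm.lintegral_comp
      ((aemeasurable_fourierX f k).enorm.pow_const 2)]
  rfl

/-- The odd extension differs from the even one by a sign that depends on `z` only, so the moduli of
the horizontal coefficients agree. The analytic norms may thus be computed from either expansion;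
the odd one is the natural one for `∂_z u`. -/
lemma lintegral_fourierX_odd (f : ChannelL2) (k : ℤ) :
    ∫⁻ z in Ioo (0 : ℝ) 1, ‖fourierX f k z‖ₑ ^ 2 = ∑' m, ‖coefO (cx f) (k, m)‖ₑ ^ 2 := by
  simp only [coefO]
  rw [tsum_enorm_tc_sq_slice (memLp_od (memLp_cxL f)),
    ← measurePreserving_two_mul_norm.lintegral_comp
      ((aemeasurable_fourierX f k).enorm.pow_const 2)]
  have h := measurePreserving_two_mul_norm.quasiMeasurePreserving.ae
    (ae_restrict_mem (measurableSet_Ioo (a := (0 : ℝ)) (b := 1)))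
  refine lintegral_congr_ae ?_
  filter_upwards [h] with y hy
  have h1 : ∀ x : UnitAddCircle, sg (x, y) * sg (x, y) = 1 := fun x => sg_sq ⟨mem_univ _, hy⟩
  have e : (fun x => od (cx f) (x, y)) = fun x => (sg ((0 : UnitAddCircle), y) : ℂ) * ev (cx f) (x, y) := by
    ext x
    rfl
  rw [e, fourierCoeff.const_mul, enorm_mul, mul_pow]
  have h2 : ‖(sg ((0 : UnitAddCircle), y) : ℂ)‖ₑ ^ 2 = 1 := by
    rw [← enorm_pow, sq, ← Complex.ofReal_mul, h1]
    simp
  rw [h2, one_mul]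
  rfl

/-- The weight of `A^r e^{τA}`, squared. -/
def gw (r τ : ℝ) (k : ℤ) : ℝ≥0∞ :=
  ENNReal.ofReal (waveNumber k ^ (2 * r) * Real.exp (2 * τ * waveNumber k))

lemma analyticSq_eq_tsum_lintegral (r τ : ℝ) (f : ChannelL2) :
    analyticSq r τ f = ∑' k, gw r τ k * ∫⁻ z in Ioo (0 : ℝ) 1, ‖fourierX f k z‖ₑ ^ 2 := by
  rw [analyticSq, lintegral_tsum]
  · congr 1 with k
    rw [lintegral_const_mul _ ((aemeasurable_fourierX f k).enorm.pow_const 2)]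
    rfl
  · exact fun k => (((aemeasurable_fourierX f k).enorm.pow_const 2).const_mul _).aemeasurable

lemma analyticSq_eq (r τ : ℝ) (f : ChannelL2) :
    analyticSq r τ f = ∑' j : ℤ × ℤ, gw r τ j.1 * ‖coefE (cx f) j‖ₑ ^ 2 := by
  rw [analyticSq_eq_tsum_lintegral, ENNReal.tsum_prod']
  simp only [lintegral_fourierX, ENNReal.tsum_mul_left]

lemma analyticSq_eq_odd (r τ : ℝ) (f : ChannelL2) :
    analyticSq r τ f = ∑' j : ℤ × ℤ, gw r τ j.1 * ‖coefO (cx f) j‖ₑ ^ 2 := by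
  rw [analyticSq_eq_tsum_lintegral, ENNReal.tsum_prod']
  simp only [lintegral_fourierX_odd, ENNReal.tsum_mul_left]

lemma enorm_sq_eq_lintegral (f : ChannelL2) : ‖f‖ₑ ^ 2 = ∫⁻ q, ‖cx f q‖ₑ ^ 2 ∂channelMeasure := by
  rw [Lp.enorm_def, eLpNorm_eq_lintegral_rpow_enorm_toReal two_ne_zero ENNReal.ofNat_ne_top,
    ENNReal.toReal_ofNat, rpow_half_sq]
  congr 1 with q
  rw [cx, ← ofReal_norm, ← ofReal_norm, Complex.norm_real, ENNReal.rpow_ofNat]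

lemma analyticSq_zero (f : ChannelL2) : analyticSq 0 0 f = ‖f‖ₑ ^ 2 := by
  have h : ∀ k, gw 0 0 k = 1 := fun k => by simp [gw]
  simp only [analyticSq_eq, h, one_mul, coefE]
  rw [tsum_enorm_tc_sq (memLp_ev (memLp_cxL f)), enorm_sq_eq_lintegral,
    ← measurePreserving_fold.lintegral_comp]
  · rfl
  · exact (Complex.measurable_ofReal.comp (Lp.stronglyMeasurable f).measurable).enorm.pow_const 2

/-- The weight of the norm `‖·‖_{r,0,τ}`, squared. -/
def aw (r τ : ℝ) (k : ℤ) : ℝ≥0∞ := gw r τ k + 1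

lemma analyticNorm_sq (r τ : ℝ) (f : ChannelL2) :
    analyticNorm r τ f ^ 2 = ∑' j : ℤ × ℤ, aw r τ j.1 * ‖coefE (cx f) j‖ₑ ^ 2 := by
  have h : ∀ k, gw 0 0 k = 1 := fun k => by simp [gw]
  rw [analyticNorm, rpow_half_sq, ← analyticSq_zero, analyticSq_eq, analyticSq_eq,
    ← ENNReal.tsum_add]
  simp only [h, aw, add_mul]

lemma analyticNorm_sq_odd (r τ : ℝ) (f : ChannelL2) :
    analyticNorm r τ f ^ 2 = ∑' j : ℤ × ℤ, aw r τ j.1 * ‖coefO (cx f) j‖ₑ ^ 2 := by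
  have h : ∀ k, gw 0 0 k = 1 := fun k => by simp [gw]
  rw [analyticNorm, rpow_half_sq, ← analyticSq_zero, analyticSq_eq_odd, analyticSq_eq_odd,
    ← ENNReal.tsum_add]
  simp only [h, aw, add_mul]

lemma tsum_coefE_sq_ne_top (f : ChannelL2) : ∑' j, ‖coefE (cx f) j‖ₑ ^ 2 ≠ ⊤ := by
  simp only [coefE]
  rw [tsum_enorm_tc_sq (memLp_ev (memLp_cxL f))]
  exact (lintegral_enorm_sq_lt_top (memLp_ev (memLp_cxL f))).ne

/-- The factor `√2` normalises the cosine; on the torus the modes `n` and `-n` share its mass. -/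
lemma cosCoeff_eq (f : ChannelL2) (k : ℤ) (n : ℕ) :
    cosCoeff f k n = (if n = 0 then 1 else (Real.sqrt 2 : ℂ)) * coefE (cx f) (k, (n : ℤ)) := by
  rw [coefE_eq (integrable_cxL f), ← integral_const_mul, cosCoeff]
  congr 1 with q
  simp only [cosBasis, map_mul, fourier_neg, cx]
  rcases eq_or_ne n 0 with rfl | hn
  · simp
  · simp only [hn, if_false, Complex.conj_ofReal]
    push_cast
    ring

/-! ### Vertical mean -/

lemma coefE_zero_of_zeroVerticalMean {f : ChannelL2} (h : ZeroVerticalMean f) (k : ℤ) :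
    coefE (cx f) (k, 0) = 0 := by
  rw [coefE_eq (integrable_cxL f)]
  have hi : Integrable (fun q : UnitAddCircle × ℝ => cx f q *
      (fourier (-k) q.1 * (Real.cos (Real.pi * (0 : ℤ) * q.2) : ℝ))) channelMeasure := by
    simp only [Int.cast_zero, mul_zero, zero_mul, Real.cos_zero, Complex.ofReal_one, mul_one]
    exact (integrable_cxL f).mul_bdd (c := 1) (Continuous.aestronglyMeasurable (by fun_prop))
      (.of_forall fun q => (norm_fourier_apply _ _).le)
  rw [integral_prod _ hi]
  refine integral_eq_zero_of_ae ?_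
  filter_upwards [h] with x hx
  simp only [Int.cast_zero, mul_zero, zero_mul, Real.cos_zero, Complex.ofReal_one, mul_one]
  rw [integral_mul_const]
  have : ∫ z in Ioo (0 : ℝ) 1, cx f (x, z) = 0 := by
    simp only [cx]
    rw [integral_complex_ofReal, hx, Complex.ofReal_zero]
  simp [this]

lemma ae_eq_zero_of_fourierCoeff {G : UnitAddCircle → ℂ} (hG : MemLp G 2 volume)
    (h : ∀ k, fourierCoeff G k = 0) : ∀ᵐ x, G x = 0 := by
  have h1 := tsum_enorm_fourierCoeff_sq hG
  simp only [h, enorm_zero, zero_pow two_ne_zero, tsum_zero] at h1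
  have h3 := (lintegral_eq_zero_iff' (hG.1.enorm.pow_const 2)).1 h1.symm
  filter_upwards [h3] with p hp
  simpa using hp

lemma enorm_sq_integral_le {α : Type*} [MeasurableSpace α] (μ : Measure α)
    (hμ : μ univ ≤ 1) {h : α → ℂ} (hm : AEStronglyMeasurable h μ) :
    ‖∫ z, h z ∂μ‖ₑ ^ 2 ≤ ∫⁻ z, ‖h z‖ₑ ^ 2 ∂μ := by
  have h1 := ENNReal.lintegral_mul_le_Lp_mul_Lq μ Real.HolderConjugate.two_two
    hm.enorm (aemeasurable_const (b := (1 : ℝ≥0∞)))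
  simp only [Pi.mul_apply, mul_one, one_pow, lintegral_const, one_mul,
    ENNReal.rpow_ofNat] at h1
  calc ‖∫ z, h z ∂μ‖ₑ ^ 2 ≤ (∫⁻ z, ‖h z‖ₑ ∂μ) ^ 2 := by gcongr; exact enorm_integral_le_lintegral_enorm _
    _ ≤ ((∫⁻ z, ‖h z‖ₑ ^ 2 ∂μ) ^ (1 / 2 : ℝ) * (1 : ℝ≥0∞) ^ (1 / 2 : ℝ)) ^ 2 := by
        gcongr
        exact h1.trans (by gcongr)
    _ = _ := by rw [ENNReal.one_rpow, mul_one, rpow_half_sq]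

instance : IsProbabilityMeasure ((volume : Measure ℝ).restrict (Ioo 0 1)) :=
  ⟨by simp⟩

lemma memLp_vertical_integral {h : UnitAddCircle × ℝ → ℂ} (hh : MemLp h 2 channelMeasure) :
    MemLp (fun x => ∫ z in Ioo (0 : ℝ) 1, h (x, z)) 2 volume := by
  refine memLp_two_of_lintegral hh.1.integral_prod_right' ?_
  have h1 := lintegral_enorm_sq_lt_top hh
  rw [lintegral_prod _ (hh.1.enorm.pow_const 2)] at h1
  refine lt_of_le_of_lt (lintegral_mono_ae ?_) h1
  filter_upwards [hh.1.prodMk_left] with x hx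
  exact enorm_sq_integral_le _ (by simp) hx

lemma ae_vertical_integral_eq_zero {h : UnitAddCircle × ℝ → ℂ} (hh : MemLp h 2 channelMeasure)
    (h0 : ∀ k, coefE h (k, 0) = 0) : ∀ᵐ x : UnitAddCircle, ∫ z in Ioo (0 : ℝ) 1, h (x, z) = 0 := by
  refine ae_eq_zero_of_fourierCoeff (memLp_vertical_integral hh) fun k => ?_
  rw [← h0 k, coefE_eq (hh.integrable one_le_two), fourierCoeff_eq]
  have hi : Integrable (fun q : UnitAddCircle × ℝ => h q *
      (fourier (-k) q.1 * (Real.cos (Real.pi * (0 : ℤ) * q.2) : ℝ))) channelMeasure := by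
    simp only [Int.cast_zero, mul_zero, zero_mul, Real.cos_zero, Complex.ofReal_one, mul_one]
    exact (hh.integrable one_le_two).mul_bdd (c := 1) (Continuous.aestronglyMeasurable (by fun_prop))
      (.of_forall fun q => (norm_fourier_apply _ _).le)
  rw [integral_prod _ hi]
  congr 1 with x
  simp only [Int.cast_zero, mul_zero, zero_mul, Real.cos_zero, Complex.ofReal_one, mul_one]
  rw [integral_mul_const]

lemma zeroVerticalMean_iff {f : ChannelL2} :
    ZeroVerticalMean f ↔ ∀ k, coefE (cx f) (k, 0) = 0 := by
  refine ⟨coefE_zero_of_zeroVerticalMean, fun h => ?_⟩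
  filter_upwards [ae_vertical_integral_eq_zero (memLp_cxL f) h] with x hx
  simp only [cx] at hx
  rw [integral_complex_ofReal] at hx
  exact_mod_cast hx

end
end HydrostaticNS

namespace HydrostaticNS
noncomputable section

/-! ### Smooth functions on the channel -/

section Smooth

variable {φ : UnitAddCircle → ℝ → ℝ}

/-- Smooth functions on `𝕋 × ℝ`. -/
abbrev SmoothT (φ : UnitAddCircle → ℝ → ℝ) : Prop :=
  ContDiff ℝ ∞ (fun q : ℝ × ℝ => φ (q.1 : UnitAddCircle) q.2)

lemma isOpenQuotientMap_lift :
    IsOpenQuotientMap (Prod.map ((↑) : ℝ → UnitAddCircle) (id : ℝ → ℝ)) :=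
  QuotientAddGroup.isOpenQuotientMap_mk.prodMap .id

/-- Differentiability and continuity are checked on the universal cover, since the definitions of
smoothness refer to it. -/
lemma continuous_of_lift {X : Type*} [TopologicalSpace X] {g : UnitAddCircle × ℝ → X}
    (h : Continuous fun q : ℝ × ℝ => g (q.1, q.2)) : Continuous g :=
  isOpenQuotientMap_lift.isQuotientMap.continuous_iff.2 h

lemma SmoothT.continuous_uncurry (hφ : SmoothT φ) :
    Continuous fun q : UnitAddCircle × ℝ => φ q.1 q.2 :=
  continuous_of_lift (g := fun q => φ q.1 q.2) hφ.continuous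

lemma SmoothT.hasDerivAt_fst (hφ : SmoothT φ) (s z : ℝ) :
    HasDerivAt (fun h : ℝ => φ (h : UnitAddCircle) z)
      (fderiv ℝ (fun q : ℝ × ℝ => φ (q.1 : UnitAddCircle) q.2) (s, z) (1, 0)) s := by
  have h1 : HasFDerivAt (fun q : ℝ × ℝ => φ (q.1 : UnitAddCircle) q.2) _ (s, z) :=
    ((hφ.differentiable (by simp)) (s, z)).hasFDerivAt
  exact h1.comp_hasDerivAt s ((hasDerivAt_id s).prodMk (hasDerivAt_const s z))

lemma SmoothT.hasDerivAt_snd (hφ : SmoothT φ) (s z : ℝ) :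
    HasDerivAt (φ (s : UnitAddCircle))
      (fderiv ℝ (fun q : ℝ × ℝ => φ (q.1 : UnitAddCircle) q.2) (s, z) (0, 1)) z := by
  have h1 : HasFDerivAt (fun q : ℝ × ℝ => φ (q.1 : UnitAddCircle) q.2) _ (s, z) :=
    ((hφ.differentiable (by simp)) (s, z)).hasFDerivAt
  exact h1.comp_hasDerivAt z ((hasDerivAt_const z s).prodMk (hasDerivAt_id z))

lemma derivX_coe (g : UnitAddCircle → ℝ) {d s : ℝ} (h : HasDerivAt (fun h : ℝ => g h) d s) :
    derivX g s = d := by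
  have h1 : HasDerivAt (fun h : ℝ => g ((s : UnitAddCircle) + (h : UnitAddCircle))) d 0 := by
    have h2 : HasDerivAt (fun h : ℝ => g h) d (s + 0) := by simpa using h
    simpa [Function.comp_def] using h2.comp_const_add s 0
  exact h1.deriv

lemma SmoothT.derivX_eq (hφ : SmoothT φ) (s z : ℝ) :
    derivX (fun x => φ x z) (s : UnitAddCircle)
      = fderiv ℝ (fun q : ℝ × ℝ => φ (q.1 : UnitAddCircle) q.2) (s, z) (1, 0) :=
  derivX_coe (fun x => φ x z) (hφ.hasDerivAt_fst s z)

lemma SmoothT.continuous_derivX (hφ : SmoothT φ) :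
    Continuous fun q : UnitAddCircle × ℝ => derivX (fun x => φ x q.2) q.1 := by
  apply continuous_of_lift
  simp only [hφ.derivX_eq]
  exact (hφ.continuous_fderiv (by simp)).clm_apply continuous_const

lemma SmoothT.continuous_deriv (hφ : SmoothT φ) :
    Continuous fun q : UnitAddCircle × ℝ => deriv (φ q.1) q.2 := by
  apply continuous_of_lift
  simp only [(hφ.hasDerivAt_snd _ _).deriv]
  exact (hφ.continuous_fderiv (by simp)).clm_apply continuous_const

lemma continuous_cx {f : UnitAddCircle × ℝ → ℝ} (hf : Continuous f) : Continuous (cx f) :=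
  Complex.continuous_ofReal.comp hf

lemma ae_channel_mem : ∀ᵐ q ∂channelMeasure, q ∈ (univ : Set UnitAddCircle) ×ˢ Ioo (0 : ℝ) 1 := by
  have e : channelMeasure = (volume : Measure (UnitAddCircle × ℝ)).restrict (univ ×ˢ Ioo 0 1) := by
    rw [Measure.volume_eq_prod, ← Measure.prod_restrict, Measure.restrict_univ]
  rw [e]
  exact ae_restrict_mem (MeasurableSet.univ.prod measurableSet_Ioo)

lemma memLp_of_continuous {E : Type*} [NormedAddCommGroup E] {g : UnitAddCircle × ℝ → E}
    [SecondCountableTopologyEither (UnitAddCircle × ℝ) E]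
    (hg : Continuous g) (p : ℝ≥0∞) : MemLp g p channelMeasure := by
  obtain ⟨M, hM⟩ := (isCompact_univ.prod (isCompact_Icc (a := (0 : ℝ)) (b := 1))
    : IsCompact ((univ : Set UnitAddCircle) ×ˢ Icc (0 : ℝ) 1)).exists_bound_of_continuousOn
    hg.continuousOn
  refine MemLp.of_bound hg.aestronglyMeasurable M ?_
  filter_upwards [ae_channel_mem] with q hq
  exact hM q ⟨mem_univ _, hq.2.1.le, hq.2.2.le⟩

lemma integrable_of_continuous {g : UnitAddCircle × ℝ → ℂ} (hg : Continuous g) :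
    Integrable g channelMeasure :=
  memLp_one_iff_integrable.1 (memLp_of_continuous hg 1)

lemma fourierCoeff_deriv {g d : UnitAddCircle → ℂ}
    (h : ∀ s : ℝ, HasDerivAt (fun s : ℝ => g s) (d s) s) (hd : Continuous d) (k : ℤ) :
    fourierCoeff d k = 2 * Real.pi * Complex.I * k * fourierCoeff g k := by
  rw [fourierCoeff_eq_intervalIntegral d k 0, fourierCoeff_eq_intervalIntegral g k 0]
  have h1 := intervalIntegral.integral_mul_deriv_eq_deriv_mul (a := 0) (b := 0 + 1)
    (u := fun x : ℝ => (fourier (-k) (x : UnitAddCircle) : ℂ)) (v := fun x : ℝ => g x)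
    (u' := fun x : ℝ => -2 * Real.pi * Complex.I * k / (1 : ℝ) * fourier (-k) (x : UnitAddCircle))
    (v' := fun x : ℝ => d x)
    (fun x _ => by simpa using hasDerivAt_fourier_neg 1 k x) (fun x _ => h x)
    (by
      apply Continuous.intervalIntegrable
      exact continuous_const.mul ((fourier (-k)).continuous.comp (AddCircle.continuous_mk' 1)))
    (by
      apply Continuous.intervalIntegrable
      exact hd.comp (AddCircle.continuous_mk' 1))
  simp only [smul_eq_mul]
  rw [h1]
  have e : ((0 + 1 : ℝ) : UnitAddCircle) = ((0 : ℝ) : UnitAddCircle) := by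
    rw [zero_add, AddCircle.coe_period]; simp
  rw [e, sub_self, zero_sub]
  simp only [mul_assoc]
  rw [intervalIntegral.integral_const_mul]
  simp
  ring

lemma coefE_eq_integral_fst {h : UnitAddCircle × ℝ → ℂ} (hh : Continuous h) (k m : ℤ) :
    coefE h (k, m) = ∫ z in Ioo (0 : ℝ) 1,
      fourierCoeff (fun x => h (x, z)) k * (Real.cos (Real.pi * m * z) : ℝ) := by
  rw [coefE_eq (integrable_of_continuous hh), integral_prod_symm _
    (integrable_of_continuous (by fun_prop))]
  congr 1 with z
  rw [fourierCoeff_eq, ← integral_mul_const]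
  simp only [mul_assoc]

lemma coefE_eq_integral_snd {h : UnitAddCircle × ℝ → ℂ} (hh : Continuous h) (k m : ℤ) :
    coefE h (k, m) = ∫ x : UnitAddCircle, fourier (-k) x *
      ∫ z in (0 : ℝ)..1, (Real.cos (Real.pi * m * z) : ℝ) * h (x, z) := by
  rw [coefE_eq (integrable_of_continuous hh), integral_prod _
    (integrable_of_continuous (by fun_prop))]
  congr 1 with x
  rw [intervalIntegral.integral_of_le zero_le_one, ← restrict_Ioo_eq_restrict_Ioc,
    ← integral_const_mul]
  congr 1 with z
  ring

lemma coefO_eq_integral_snd {h : UnitAddCircle × ℝ → ℂ} (hh : Continuous h) (k m : ℤ) :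
    coefO h (k, m) = -Complex.I * ∫ x : UnitAddCircle, fourier (-k) x *
      ∫ z in (0 : ℝ)..1, (Real.sin (Real.pi * m * z) : ℝ) * h (x, z) := by
  rw [coefO_eq (integrable_of_continuous hh), integral_prod _
    (integrable_of_continuous (by fun_prop))]
  congr 2 with x
  rw [intervalIntegral.integral_of_le zero_le_one, ← restrict_Ioo_eq_restrict_Ioc,
    ← integral_const_mul]
  congr 1 with z
  ring

lemma SmoothT.coefE_derivX (hφ : SmoothT φ) (k m : ℤ) :
    coefE (cx fun q => derivX (fun x => φ x q.2) q.1) (k, m)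
      = 2 * Real.pi * Complex.I * k * coefE (cx fun q => φ q.1 q.2) (k, m) := by
  rw [coefE_eq_integral_fst (continuous_cx hφ.continuous_derivX),
    coefE_eq_integral_fst (continuous_cx hφ.continuous_uncurry),
    ← integral_const_mul]
  congr 1 with z
  rw [fourierCoeff_deriv (g := fun x => cx (fun q => φ q.1 q.2) (x, z))]
  · ring
  · intro s
    simp only [cx]
    rw [hφ.derivX_eq]
    exact (hφ.hasDerivAt_fst s z).ofReal_comp
  · exact Complex.continuous_ofReal.comp (hφ.continuous_derivX.comp (by fun_prop))

lemma hasDerivAt_cos_mul (c z : ℝ) :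
    HasDerivAt (fun z : ℝ => ((Real.cos (c * z) : ℝ) : ℂ)) (-c * (Real.sin (c * z) : ℝ)) z := by
  have h := (Real.hasDerivAt_cos (c * z)).comp z ((hasDerivAt_id z).const_mul c)
  refine h.ofReal_comp.congr_deriv ?_
  push_cast
  ring

lemma hasDerivAt_sin_mul (c z : ℝ) :
    HasDerivAt (fun z : ℝ => ((Real.sin (c * z) : ℝ) : ℂ)) (c * (Real.cos (c * z) : ℝ)) z := by
  have h := (Real.hasDerivAt_sin (c * z)).comp z ((hasDerivAt_id z).const_mul c)
  refine h.ofReal_comp.congr_deriv ?_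
  push_cast
  ring

lemma SmoothT.hasDerivAt_cx_snd (hφ : SmoothT φ) (x : UnitAddCircle) (z : ℝ) :
    HasDerivAt (fun z : ℝ => (φ x z : ℂ)) (deriv (φ x) z : ℝ) z := by
  obtain ⟨s, -, rfl, -⟩ := exists_rep x
  have h := hφ.hasDerivAt_snd s z
  rw [h.deriv]
  exact h.ofReal_comp

lemma SmoothT.continuous_deriv_slice (hφ : SmoothT φ) (x : UnitAddCircle) :
    Continuous fun z : ℝ => ((deriv (φ x) z : ℝ) : ℂ) :=
  Complex.continuous_ofReal.comp (hφ.continuous_deriv.comp (by fun_prop : Continuous fun z : ℝ => (x, z)))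

/-- Integration by parts against `sin (πmz)`, which vanishes at both ends. No boundary condition on
`φ` is needed, and this is why unrestricted test functions encode the Neumann condition. -/
lemma SmoothT.coefO_deriv (hφ : SmoothT φ) (k m : ℤ) :
    coefO (cx fun q => deriv (φ q.1) q.2) (k, m)
      = Complex.I * Real.pi * m * coefE (cx fun q => φ q.1 q.2) (k, m) := by
  rw [coefO_eq_integral_snd (continuous_cx hφ.continuous_deriv),
    coefE_eq_integral_snd (continuous_cx hφ.continuous_uncurry),
    ← integral_const_mul, ← integral_const_mul]
  congr 1 with x
  have h1 := intervalIntegral.integral_mul_deriv_eq_deriv_mul (a := 0) (b := 1)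
    (fun z _ => hasDerivAt_sin_mul (Real.pi * m) z) (fun z _ => hφ.hasDerivAt_cx_snd x z)
    (Continuous.intervalIntegrable (by fun_prop) _ _)
    ((hφ.continuous_deriv_slice x).intervalIntegrable _ _)
  simp only [cx]
  rw [h1]
  have e1 : Real.sin (Real.pi * m * 1) = 0 := by rw [mul_one, mul_comm, Real.sin_int_mul_pi]
  simp only [e1, mul_zero, Real.sin_zero, Complex.ofReal_zero, zero_mul, sub_self, zero_sub]
  simp only [mul_assoc]
  push_cast
  simp only [mul_assoc, intervalIntegral.integral_const_mul]
  ring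

/-- The cosines do not vanish at the ends, so here the boundary values of `φ` have to. -/
lemma SmoothT.coefE_deriv (hφ : SmoothT φ) (h0 : ∀ x, φ x 0 = 0) (h1 : ∀ x, φ x 1 = 0) (k m : ℤ) :
    coefE (cx fun q => deriv (φ q.1) q.2) (k, m)
      = Complex.I * Real.pi * m * coefO (cx fun q => φ q.1 q.2) (k, m) := by
  rw [coefE_eq_integral_snd (continuous_cx hφ.continuous_deriv),
    coefO_eq_integral_snd (continuous_cx hφ.continuous_uncurry),
    ← mul_assoc, ← integral_const_mul]
  congr 1 with x
  have h2 := intervalIntegral.integral_mul_deriv_eq_deriv_mul (a := 0) (b := 1)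
    (fun z _ => hasDerivAt_cos_mul (Real.pi * m) z) (fun z _ => hφ.hasDerivAt_cx_snd x z)
    (Continuous.intervalIntegrable (by fun_prop) _ _)
    ((hφ.continuous_deriv_slice x).intervalIntegrable _ _)
  simp only [cx]
  rw [h2]
  simp only [h0, h1, mul_zero, Complex.ofReal_zero, sub_self, zero_sub]
  push_cast
  simp only [mul_assoc, neg_mul, intervalIntegral.integral_neg, intervalIntegral.integral_const_mul]
  linear_combination ((fourier (-k) x : ℂ) * (Real.pi * (m * ∫ z in (0 : ℝ)..1,
    Complex.sin (Real.pi * (m * z)) * (φ x z : ℂ)))) * Complex.I_mul_I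

end Smooth

end
end HydrostaticNS

namespace HydrostaticNS
noncomputable section

/-! ### Weak derivatives in terms of Fourier coefficients -/

lemma integral_cx (f : UnitAddCircle × ℝ → ℝ) :
    ∫ q, cx f q ∂channelMeasure = ((∫ q, f q ∂channelMeasure : ℝ) : ℂ) := by
  simp only [cx]; exact integral_complex_ofReal

lemma integral_mul_eq_tsum_even {f g : UnitAddCircle × ℝ → ℝ} (hf : MemLp f 2 channelMeasure)
    (hg : MemLp g 2 channelMeasure) :
    HasSum (fun j => coefE (cx f) j * coefE (cx g) (-j))
      ((∫ q, f q * g q ∂channelMeasure : ℝ) : ℂ) := by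
  have h := hasSum_tc_mul_tc_neg (memLp_ev (memLp_cx hf)) (memLp_ev (memLp_cx hg))
  have e : ∫ p, ev (cx f) p * ev (cx g) p = ((∫ q, f q * g q ∂channelMeasure : ℝ) : ℂ) := by
    rw [← integral_cx, ← integral_ev ((memLp_cx hf).1.mul (memLp_cx hg).1 |>.congr
      (.of_forall fun q => by simp [cx]))]
    congr 1 with p
    simp [ev, cx]
  rw [e] at h
  exact h

lemma integral_mul_eq_tsum_odd {f g : UnitAddCircle × ℝ → ℝ} (hf : MemLp f 2 channelMeasure)
    (hg : MemLp g 2 channelMeasure) :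
    HasSum (fun j => coefO (cx f) j * coefO (cx g) (-j))
      ((∫ q, f q * g q ∂channelMeasure : ℝ) : ℂ) := by
  have h := hasSum_tc_mul_tc_neg (memLp_od (memLp_cx hf)) (memLp_od (memLp_cx hg))
  have e : ∫ p, od (cx f) p * od (cx g) p = ((∫ q, f q * g q ∂channelMeasure : ℝ) : ℂ) := by
    rw [← integral_cx, integral_od_mul_od (memLp_cx hf).1 (memLp_cx hg).1]
    congr 1 with p
    simp [cx]
  rw [e] at h
  exact h

section Interior

variable {φ : UnitAddCircle → ℝ → ℝ}

lemma IsInteriorTest.eq_zero (hφ : IsInteriorTest φ) (x : UnitAddCircle) :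
    φ x 0 = 0 ∧ φ x 1 = 0 := by
  obtain ⟨a, b, ha, hb, h⟩ := hφ.support
  exact ⟨h x 0 fun hm => by linarith [hm.1], h x 1 fun hm => by linarith [hm.2]⟩

lemma hasWeakDerivX_of_coefE {f g : ChannelL2}
    (h : ∀ k m, coefE (cx g) (k, m) = 2 * Real.pi * Complex.I * k * coefE (cx f) (k, m)) :
    HasWeakDerivX f g := by
  intro φ hφ
  have hs : SmoothT φ := hφ.smooth
  have h1 := integral_mul_eq_tsum_even (Lp.memLp f) (memLp_of_continuous hs.continuous_derivX 2)
  have h2 := integral_mul_eq_tsum_even (Lp.memLp g) (memLp_of_continuous hs.continuous_uncurry 2)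
  have e : (fun j : ℤ × ℤ => coefE (cx f) j * coefE (cx fun q => derivX (fun x => φ x q.2) q.1) (-j))
      = fun j => -(coefE (cx g) j * coefE (cx fun q => φ q.1 q.2) (-j)) := by
    ext ⟨k, m⟩
    rw [Prod.neg_mk, hs.coefE_derivX, h]
    push_cast
    ring
  rw [e] at h1
  exact_mod_cast h1.unique h2.neg

lemma hasWeakDerivZ_of_coefO {f g : ChannelL2}
    (h : ∀ k m, coefO (cx g) (k, m) = Complex.I * Real.pi * m * coefE (cx f) (k, m)) :
    HasWeakDerivZ f g := by
  intro φ hφ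
  have hs : SmoothT φ := hφ.smooth
  have h1 := integral_mul_eq_tsum_even (Lp.memLp f) (memLp_of_continuous hs.continuous_deriv 2)
  have h2 := integral_mul_eq_tsum_odd (Lp.memLp g) (memLp_of_continuous hs.continuous_uncurry 2)
  have e : (fun j : ℤ × ℤ => coefE (cx f) j * coefE (cx fun q => deriv (φ q.1) q.2) (-j))
      = fun j => -(coefO (cx g) j * coefO (cx fun q => φ q.1 q.2) (-j)) := by
    ext ⟨k, m⟩
    rw [Prod.neg_mk, hs.coefE_deriv (fun x => (hφ.eq_zero x).1) (fun x => (hφ.eq_zero x).2), h]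
    push_cast
    ring
  rw [e] at h1
  exact_mod_cast h1.unique h2.neg

end Interior

/-! Cutoff functions in the vertical direction. -/

lemma deriv_smoothTransition_eq_zero {y : ℝ} (hy : y < 0 ∨ 1 < y) :
    deriv Real.smoothTransition y = 0 := by
  rcases hy with hy | hy
  · have : Real.smoothTransition =ᶠ[nhds y] fun _ => 0 := by
      filter_upwards [Iio_mem_nhds hy] with t ht
      exact Real.smoothTransition.zero_of_nonpos ht.le
    rw [this.deriv_eq, deriv_const]
  · have : Real.smoothTransition =ᶠ[nhds y] fun _ => 1 := by
      filter_upwards [Ioi_mem_nhds hy] with t ht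
      exact Real.smoothTransition.one_of_one_le ht.le
    rw [this.deriv_eq, deriv_const]

/-- In `cutoff` the argument is `N z (1 - z) - 1`, so `y + 1` is `N z (1 - z)`: this is a bound for
the derivative that does not see the scale `N`. -/
lemma exists_bound_deriv_smoothTransition :
    ∃ M : ℝ, 0 ≤ M ∧ ∀ y, |deriv Real.smoothTransition y| * |y + 1| ≤ M := by
  have hc : Continuous fun y => |deriv Real.smoothTransition y| * |y + 1| := by
    have h := (Real.smoothTransition.contDiff (n := 1)).continuous_deriv le_rfl
    fun_prop
  obtain ⟨M, hM⟩ := (isCompact_Icc (a := (0 : ℝ)) (b := 1)).exists_bound_of_continuousOn hc.continuousOn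
  refine ⟨max M 0, le_max_right _ _, fun y => ?_⟩
  by_cases hy : y ∈ Icc (0 : ℝ) 1
  · exact ((le_abs_self _).trans (hM y hy)).trans (le_max_left _ _)
  · have : y < 0 ∨ 1 < y := by
      by_contra! h
      exact hy h
    rw [deriv_smoothTransition_eq_zero this]
    simp

/-- A cutoff function that equals `1` where `z (1 - z) ≥ 2 / N`. -/
def cutoff (N : ℕ) (z : ℝ) : ℝ := Real.smoothTransition (N * (z * (1 - z)) - 1)

lemma contDiff_cutoff (N : ℕ) : ContDiff ℝ ∞ (cutoff N) :=
  Real.smoothTransition.contDiff.comp (by fun_prop)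

lemma abs_cutoff_le (N : ℕ) (z : ℝ) : |cutoff N z| ≤ 1 := by
  rw [cutoff, abs_of_nonneg (Real.smoothTransition.nonneg _)]
  exact Real.smoothTransition.le_one _

lemma hasDerivAt_cutoff (N : ℕ) (z : ℝ) : HasDerivAt (cutoff N)
    (deriv Real.smoothTransition (N * (z * (1 - z)) - 1) * (N * (1 - 2 * z))) z := by
  have h1 : HasDerivAt Real.smoothTransition _ (N * (z * (1 - z)) - 1) :=
    ((Real.smoothTransition.contDiff (n := 1)).differentiable (by simp) _).hasDerivAt
  refine h1.comp z ?_
  have h2 := ((((hasDerivAt_id z).mul ((hasDerivAt_id z).const_sub 1)).const_mul (N : ℝ)).sub_const 1)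
  refine h2.congr_deriv ?_
  simp only [id]
  ring

/-- The derivative of the cutoff is of size `N`, but lives where `z (1 - z)` is of size `1/N`. -/
lemma exists_bound_cutoff : ∃ M : ℝ, 0 ≤ M ∧ ∀ N, ∀ z ∈ Ioo (0 : ℝ) 1,
    |deriv (cutoff N) z| * (z * (1 - z)) ≤ M := by
  obtain ⟨M, h0, hM⟩ := exists_bound_deriv_smoothTransition
  refine ⟨M, h0, fun N z hz => ?_⟩
  rw [(hasDerivAt_cutoff N z).deriv, abs_mul]
  have h1 := hM (N * (z * (1 - z)) - 1)
  have hu : 0 ≤ z * (1 - z) := mul_nonneg hz.1.le (by linarith [hz.2])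
  rw [sub_add_cancel, abs_of_nonneg (by positivity : 0 ≤ (N : ℝ) * (z * (1 - z)))] at h1
  have h2 : |(N : ℝ) * (1 - 2 * z)| ≤ N := by
    rw [abs_mul, abs_of_nonneg (Nat.cast_nonneg N)]
    have : |1 - 2 * z| ≤ 1 := abs_le.2 ⟨by linarith [hz.2], by linarith [hz.1]⟩
    exact mul_le_of_le_one_right (Nat.cast_nonneg N) this
  calc _ ≤ |deriv Real.smoothTransition (N * (z * (1 - z)) - 1)| * N * (z * (1 - z)) := by gcongr
    _ = _ := by ring
    _ ≤ M := h1

lemma eventually_cutoff {z : ℝ} (hz : z ∈ Ioo (0 : ℝ) 1) :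
    ∀ᶠ N in Filter.atTop, cutoff N z = 1 ∧ deriv (cutoff N) z = 0 := by
  have hu : 0 < z * (1 - z) := mul_pos hz.1 (by linarith [hz.2])
  have h : Filter.Tendsto (fun N : ℕ => (N : ℝ) * (z * (1 - z))) Filter.atTop Filter.atTop :=
    tendsto_natCast_atTop_atTop.atTop_mul_const hu
  filter_upwards [h.eventually_gt_atTop 2] with N hN
  refine ⟨Real.smoothTransition.one_of_one_le (by linarith), ?_⟩
  rw [(hasDerivAt_cutoff N z).deriv, deriv_smoothTransition_eq_zero (Or.inr (by linarith)), zero_mul]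

lemma cutoff_support (N : ℕ) : ∃ a b : ℝ, 0 < a ∧ b < 1 ∧ ∀ z, z ∉ Icc a b → cutoff N z = 0 := by
  refine ⟨1 / (N + 1), 1 - 1 / (N + 1), by positivity, by
    have : (0 : ℝ) < 1 / (N + 1) := by positivity
    linarith, fun z hz => Real.smoothTransition.zero_of_nonpos ?_⟩
  have hN : (0 : ℝ) < N + 1 := by positivity
  by_contra! h
  apply hz
  have hN0 : (0 : ℝ) ≤ N := Nat.cast_nonneg N
  have h3 : 0 < z * (1 - z) := by
    by_contra! h4
    nlinarith
  have hz0 : 0 < z := by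
    by_contra! h4
    nlinarith
  have hz1 : 0 < 1 - z := by
    by_contra! h4
    nlinarith
  constructor
  · rw [div_le_iff₀ hN]
    nlinarith [mul_nonneg hN0 hz0.le, mul_nonneg (mul_nonneg hN0 hz0.le) hz0.le]
  · have : 1 / ((N : ℝ) + 1) ≤ 1 - z := by
      rw [div_le_iff₀ hN]
      nlinarith [mul_nonneg hN0 hz1.le, mul_nonneg (mul_nonneg hN0 hz1.le) hz1.le]
    linarith

/-- The linear vanishing of the sine at both ends compensates the growth of the cutoff's derivative.
-/
lemma abs_sin_le (m : ℤ) {z : ℝ} (hz : z ∈ Ioo (0 : ℝ) 1) :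
    |Real.sin (Real.pi * m * z)| ≤ 2 * Real.pi * |(m : ℝ)| * (z * (1 - z)) := by
  have hp := Real.pi_pos
  have hm := abs_nonneg (m : ℝ)
  rcases le_total z (1 / 2) with h | h
  · calc |Real.sin (Real.pi * m * z)| ≤ |Real.pi * m * z| := Real.abs_sin_le_abs
      _ = Real.pi * |(m : ℝ)| * z := by rw [abs_mul, abs_mul, abs_of_pos hp, abs_of_pos hz.1]
      _ ≤ Real.pi * |(m : ℝ)| * (2 * (z * (1 - z))) := by
        gcongr
        nlinarith [hz.1]
      _ = _ := by ring
  · have e : |Real.sin (Real.pi * m * z)| = |Real.sin (Real.pi * m * (1 - z))| := by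
      have e1 : Real.pi * m * (1 - z) = m * Real.pi - Real.pi * m * z := by ring
      rw [e1, Real.sin_int_mul_pi_sub, abs_neg, abs_mul]
      rcases Int.even_or_odd m with hm | hm
      · simp [hm.neg_one_zpow]
      · simp [hm.neg_one_zpow]
    rw [e]
    calc |Real.sin (Real.pi * m * (1 - z))| ≤ |Real.pi * m * (1 - z)| := Real.abs_sin_le_abs
      _ = Real.pi * |(m : ℝ)| * (1 - z) := by
        rw [abs_mul, abs_mul, abs_of_pos hp, abs_of_pos (by linarith [hz.2] : 0 < 1 - z)]
      _ ≤ Real.pi * |(m : ℝ)| * (2 * (z * (1 - z))) := by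
        gcongr
        nlinarith [hz.2]
      _ = _ := by ring

/-! Products of a trigonometric function of `x` and a function of `z`. -/

lemma hasDerivAt_fourier_re (k : ℤ) (s : ℝ) :
    HasDerivAt (fun s : ℝ => (fourier k (s : UnitAddCircle) : ℂ).re)
      (-(2 * Real.pi * k) * (fourier k (s : UnitAddCircle) : ℂ).im) s := by
  have e : (fun s : ℝ => (fourier k (s : UnitAddCircle) : ℂ).re)
      = fun s => Real.cos (2 * Real.pi * k * s) := by
    ext s; rw [fourier_coe]; simp [-Complex.ofReal_mul, -Complex.ofReal_sin, -Complex.ofReal_cos]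
  have e2 : (fourier k (s : UnitAddCircle) : ℂ).im = Real.sin (2 * Real.pi * k * s) := by
    rw [fourier_coe]; simp [-Complex.ofReal_mul, -Complex.ofReal_sin, -Complex.ofReal_cos]
  rw [e, e2]
  refine ((Real.hasDerivAt_cos _).comp s ((hasDerivAt_id s).const_mul _)).congr_deriv ?_
  simp only [id]
  ring

lemma hasDerivAt_fourier_im (k : ℤ) (s : ℝ) :
    HasDerivAt (fun s : ℝ => (fourier k (s : UnitAddCircle) : ℂ).im)
      (2 * Real.pi * k * (fourier k (s : UnitAddCircle) : ℂ).re) s := by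
  have e : (fun s : ℝ => (fourier k (s : UnitAddCircle) : ℂ).im)
      = fun s => Real.sin (2 * Real.pi * k * s) := by
    ext s; rw [fourier_coe]; simp [-Complex.ofReal_mul, -Complex.ofReal_sin, -Complex.ofReal_cos]
  have e2 : (fourier k (s : UnitAddCircle) : ℂ).re = Real.cos (2 * Real.pi * k * s) := by
    rw [fourier_coe]; simp [-Complex.ofReal_mul, -Complex.ofReal_sin, -Complex.ofReal_cos]
  rw [e, e2]
  refine ((Real.hasDerivAt_sin _).comp s ((hasDerivAt_id s).const_mul _)).congr_deriv ?_
  simp only [id]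
  ring

lemma contDiff_fourier_re (k : ℤ) :
    ContDiff ℝ ∞ fun s : ℝ => (fourier k (s : UnitAddCircle) : ℂ).re := by
  have e : (fun s : ℝ => (fourier k (s : UnitAddCircle) : ℂ).re)
      = fun s => Real.cos (2 * Real.pi * k * s) := by
    ext s; rw [fourier_coe]; simp [-Complex.ofReal_mul, -Complex.ofReal_sin, -Complex.ofReal_cos]
  rw [e]
  fun_prop

lemma contDiff_fourier_im (k : ℤ) :
    ContDiff ℝ ∞ fun s : ℝ => (fourier k (s : UnitAddCircle) : ℂ).im := by
  have e : (fun s : ℝ => (fourier k (s : UnitAddCircle) : ℂ).im)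
      = fun s => Real.sin (2 * Real.pi * k * s) := by
    ext s; rw [fourier_coe]; simp [-Complex.ofReal_mul, -Complex.ofReal_sin, -Complex.ofReal_cos]
  rw [e]
  fun_prop

lemma derivX_fourier_re (k : ℤ) (c : ℝ) (x : UnitAddCircle) :
    derivX (fun x => (fourier k x : ℂ).re * c) x = -(2 * Real.pi * k) * (fourier k x : ℂ).im * c := by
  obtain ⟨s, -, rfl, -⟩ := exists_rep x
  exact derivX_coe _ ((hasDerivAt_fourier_re k s).mul_const c)

lemma derivX_fourier_im (k : ℤ) (c : ℝ) (x : UnitAddCircle) :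
    derivX (fun x => (fourier k x : ℂ).im * c) x = 2 * Real.pi * k * (fourier k x : ℂ).re * c := by
  obtain ⟨s, -, rfl, -⟩ := exists_rep x
  exact derivX_coe _ ((hasDerivAt_fourier_im k s).mul_const c)

lemma isInteriorTest_mul {A : UnitAddCircle → ℝ} {B : ℝ → ℝ} (N : ℕ)
    (hA : ContDiff ℝ ∞ fun s : ℝ => A s) (hB : ContDiff ℝ ∞ B) :
    IsInteriorTest fun x z => A x * (cutoff N z * B z) := by
  refine ⟨?_, ?_⟩
  · exact (hA.comp contDiff_fst).mul (((contDiff_cutoff N).comp contDiff_snd).mul (hB.comp contDiff_snd))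
  · obtain ⟨a, b, ha, hb, h⟩ := cutoff_support N
    exact ⟨a, b, ha, hb, fun x z hz => by rw [h z hz]; simp⟩

lemma integral_mul_fourier {f : UnitAddCircle × ℝ → ℝ} {B : ℝ → ℝ} (k : ℤ)
    (h : Integrable (fun q => f q * B q.2) channelMeasure) :
    ∫ q, cx f q * (fourier k q.1 * B q.2) ∂channelMeasure
      = ((∫ q, f q * ((fourier k q.1 : ℂ).re * B q.2) ∂channelMeasure : ℝ) : ℂ)
        + ((∫ q, f q * ((fourier k q.1 : ℂ).im * B q.2) ∂channelMeasure : ℝ) : ℂ) * Complex.I := by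
  have hi : Integrable (fun q => cx f q * (fourier k q.1 * B q.2)) channelMeasure := by
    have := (h.ofReal (𝕜 := ℂ)).mul_bdd (c := 1) (g := fun q : UnitAddCircle × ℝ => (fourier k q.1 : ℂ))
      (Continuous.aestronglyMeasurable (by fun_prop))
      (.of_forall fun q => (norm_fourier_apply _ _).le)
    refine this.congr (.of_forall fun q => ?_)
    simp [cx]
    ring
  have h1 := integral_re_add_im hi
  rw [← h1]
  simp only [RCLike.re_to_complex, RCLike.im_to_complex, RCLike.I_to_complex]
  congr 3
  · congr 1 with q
    simp [cx]
  · congr 1 with q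
    simp [cx]

lemma tendsto_integral_cutoff {f : UnitAddCircle × ℝ → ℂ} (hf : Integrable f channelMeasure) (k : ℤ)
    {B : ℝ → ℝ} (hB : Continuous B) {M : ℝ} (hM : ∀ z ∈ Ioo (0 : ℝ) 1, |B z| ≤ M) :
    Filter.Tendsto (fun N => ∫ q, f q * (fourier k q.1 * (cutoff N q.2 * B q.2 : ℝ)) ∂channelMeasure)
      Filter.atTop (nhds (∫ q, f q * (fourier k q.1 * (B q.2 : ℝ)) ∂channelMeasure)) := by
  refine tendsto_integral_of_dominated_convergence (fun q => ‖f q‖ * M) ?_ (hf.norm.mul_const M) ?_ ?_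
  · intro N
    have hc := (contDiff_cutoff N).continuous
    exact hf.1.mul (Continuous.aestronglyMeasurable (by fun_prop))
  · intro N
    filter_upwards [ae_channel_mem] with q hq
    rw [norm_mul, norm_mul, norm_fourier_apply, one_mul, Complex.norm_real, norm_mul]
    gcongr
    calc _ ≤ 1 * M := mul_le_mul (abs_cutoff_le _ _) (hM _ hq.2) (abs_nonneg _) zero_le_one
      _ = M := one_mul M
  · filter_upwards [ae_channel_mem] with q hq
    refine tendsto_const_nhds.congr' ?_
    filter_upwards [eventually_cutoff hq.2] with N hN
    rw [hN.1, one_mul]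

/-- The functions `e^{-2πikx} cos (πmz)` are not admissible as tests, since they do not vanish near
`z = 0, 1`. They are cut off in `z`, which does not interfere with `∂_x`, and the cutoff is removed
by dominated convergence. -/
lemma HasWeakDerivX.coefE_eq {f g : ChannelL2} (h : HasWeakDerivX f g) (k m : ℤ) :
    coefE (cx g) (k, m) = 2 * Real.pi * Complex.I * k * coefE (cx f) (k, m) := by
  have hB : ContDiff ℝ ∞ fun z : ℝ => Real.cos (Real.pi * m * z) := by fun_prop
  have hM : ∀ z ∈ Ioo (0 : ℝ) 1, |Real.cos (Real.pi * m * z)| ≤ 1 := fun z _ => Real.abs_cos_le_one _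
  have key : ∀ N : ℕ, ∫ q, cx g q * (fourier (-k) q.1 *
        (cutoff N q.2 * Real.cos (Real.pi * m * q.2) : ℝ)) ∂channelMeasure
      = 2 * Real.pi * Complex.I * k * ∫ q, cx f q * (fourier (-k) q.1 *
        (cutoff N q.2 * Real.cos (Real.pi * m * q.2) : ℝ)) ∂channelMeasure := by
    intro N
    have hi : ∀ f : ChannelL2, Integrable (fun q => f q * (cutoff N q.2 * Real.cos (Real.pi * m * q.2)))
        channelMeasure := fun f => by
      have hc := (contDiff_cutoff N).continuous
      exact ((Lp.memLp f).integrable_mul (q := 2) (memLp_of_continuous (by fun_prop) 2))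
    have h1 := h _ (isInteriorTest_mul (A := fun x => (fourier (-k) x : ℂ).re) N
      (contDiff_fourier_re (-k)) hB)
    have h2 := h _ (isInteriorTest_mul (A := fun x => (fourier (-k) x : ℂ).im) N
      (contDiff_fourier_im (-k)) hB)
    simp only [derivX_fourier_re, derivX_fourier_im] at h1 h2
    rw [integral_mul_fourier (B := fun z => cutoff N z * Real.cos (Real.pi * m * z)) _ (hi g),
      integral_mul_fourier (B := fun z => cutoff N z * Real.cos (Real.pi * m * z)) _ (hi f)]
    have e1 : ∫ q, f q * (-(2 * Real.pi * ((-k : ℤ) : ℝ)) * (fourier (-k) q.1 : ℂ).im *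
        (cutoff N q.2 * Real.cos (Real.pi * m * q.2))) ∂channelMeasure = 2 * Real.pi * k *
        ∫ q, f q * ((fourier (-k) q.1 : ℂ).im * (cutoff N q.2 * Real.cos (Real.pi * m * q.2)))
          ∂channelMeasure := by
      rw [← integral_const_mul]
      congr 1 with q
      push_cast
      ring
    have e2 : ∫ q, f q * (2 * Real.pi * ((-k : ℤ) : ℝ) * (fourier (-k) q.1 : ℂ).re *
        (cutoff N q.2 * Real.cos (Real.pi * m * q.2))) ∂channelMeasure = -(2 * Real.pi * k) *
        ∫ q, f q * ((fourier (-k) q.1 : ℂ).re * (cutoff N q.2 * Real.cos (Real.pi * m * q.2)))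
          ∂channelMeasure := by
      rw [← integral_const_mul]
      congr 1 with q
      push_cast
      ring
    rw [e1] at h1
    rw [e2] at h2
    have h1' := congrArg (fun x : ℝ => (x : ℂ)) h1
    have h2' := congrArg (fun x : ℝ => (x : ℂ)) h2
    push_cast at h1' h2' ⊢
    linear_combination h1' + Complex.I * h2' - (2 * Real.pi * k * (∫ q, f q * ((fourier (-k) q.1 : ℂ).im *
      (cutoff N q.2 * Real.cos (Real.pi * m * q.2))) ∂channelMeasure : ℝ)) * Complex.I_mul_I
  have t1 := tendsto_integral_cutoff (integrable_cxL g) (-k) hB.continuous hM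
  have t2 := (tendsto_integral_cutoff (integrable_cxL f) (-k) hB.continuous hM).const_mul
    (2 * Real.pi * Complex.I * k)
  simp only [key] at t1
  rw [HydrostaticNS.coefE_eq (integrable_cxL g), HydrostaticNS.coefE_eq (integrable_cxL f)]
  exact tendsto_nhds_unique t1 t2

/-- The derivative falling on the cutoff, multiplied by the sine, stays bounded by
`exists_bound_cutoff` and `abs_sin_le` and tends to zero pointwise, so no boundary term survives. -/
lemma tendsto_integral_deriv_cutoff {f : UnitAddCircle × ℝ → ℂ} (hf : Integrable f channelMeasure)
    (k m : ℤ) :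
    Filter.Tendsto (fun N => ∫ q, f q * (fourier k q.1 *
        (deriv (fun z => cutoff N z * Real.sin (Real.pi * m * z)) q.2 : ℝ)) ∂channelMeasure)
      Filter.atTop (nhds (∫ q, f q * (fourier k q.1 * (Real.pi * m * Real.cos (Real.pi * m * q.2) : ℝ))
        ∂channelMeasure)) := by
  obtain ⟨M, hM0, hM⟩ := exists_bound_cutoff
  have hd : ∀ N z, deriv (fun z => cutoff N z * Real.sin (Real.pi * m * z)) z
      = deriv (cutoff N) z * Real.sin (Real.pi * m * z)
        + cutoff N z * (Real.pi * m * Real.cos (Real.pi * m * z)) := fun N z => by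
    have h1 := (hasDerivAt_cutoff N z).differentiableAt.hasDerivAt
    have h2 := (Real.hasDerivAt_sin (Real.pi * m * z)).comp z ((hasDerivAt_id z).const_mul (Real.pi * m))
    refine (h1.mul h2).deriv.trans ?_
    simp only [Function.comp]
    ring
  simp only [hd]
  refine tendsto_integral_of_dominated_convergence
    (fun q => ‖f q‖ * (2 * Real.pi * |(m : ℝ)| * M + Real.pi * |(m : ℝ)|)) ?_ (hf.norm.mul_const _) ?_ ?_
  · intro N
    have hc := (contDiff_cutoff N).continuous
    have hc' := (contDiff_cutoff N).continuous_deriv (by simp)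
    exact hf.1.mul (Continuous.aestronglyMeasurable (by fun_prop))
  · intro N
    filter_upwards [ae_channel_mem] with q hq
    rw [norm_mul, norm_mul, norm_fourier_apply, one_mul, Complex.norm_real]
    gcongr
    refine (norm_add_le _ _).trans (add_le_add ?_ ?_)
    · rw [norm_mul]
      calc _ ≤ |deriv (cutoff N) q.2| * (2 * Real.pi * |(m : ℝ)| * (q.2 * (1 - q.2))) :=
            mul_le_mul_of_nonneg_left (abs_sin_le m hq.2) (abs_nonneg _)
        _ = 2 * Real.pi * |(m : ℝ)| * (|deriv (cutoff N) q.2| * (q.2 * (1 - q.2))) := by ring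
        _ ≤ _ := by
          gcongr
          exact hM N q.2 hq.2
    · rw [norm_mul, norm_mul, norm_mul, Real.norm_of_nonneg Real.pi_pos.le]
      calc _ ≤ 1 * (Real.pi * |(m : ℝ)| * 1) := by
            gcongr
            · exact abs_cutoff_le _ _
            · exact le_rfl
            · exact Real.abs_cos_le_one _
        _ = _ := by ring
  · filter_upwards [ae_channel_mem] with q hq
    refine tendsto_const_nhds.congr' ?_
    filter_upwards [eventually_cutoff hq.2] with N hN
    rw [hN.1, hN.2, one_mul, zero_mul, zero_add]

lemma HasWeakDerivZ.coefO_eq {f g : ChannelL2} (h : HasWeakDerivZ f g) (k m : ℤ) :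
    coefO (cx g) (k, m) = Complex.I * Real.pi * m * coefE (cx f) (k, m) := by
  have hB : ContDiff ℝ ∞ fun z : ℝ => Real.sin (Real.pi * m * z) := by fun_prop
  have hM : ∀ z ∈ Ioo (0 : ℝ) 1, |Real.sin (Real.pi * m * z)| ≤ 1 := fun z _ => Real.abs_sin_le_one _
  have key : ∀ N : ℕ, ∫ q, cx f q * (fourier (-k) q.1 *
        (deriv (fun z => cutoff N z * Real.sin (Real.pi * m * z)) q.2 : ℝ)) ∂channelMeasure
      = - ∫ q, cx g q * (fourier (-k) q.1 *
        (cutoff N q.2 * Real.sin (Real.pi * m * q.2) : ℝ)) ∂channelMeasure := by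
    intro N
    have hc : ContDiff ℝ ∞ fun z => cutoff N z * Real.sin (Real.pi * m * z) :=
      (contDiff_cutoff N).mul hB
    have hc0 := (contDiff_cutoff N).continuous
    have hc1 := hc.continuous_deriv (by simp)
    have hi : Integrable (fun q => g q * (cutoff N q.2 * Real.sin (Real.pi * m * q.2)))
        channelMeasure :=
      ((Lp.memLp g).integrable_mul (q := 2) (memLp_of_continuous (by fun_prop) 2))
    have hi' : Integrable (fun q => f q * deriv (fun z => cutoff N z * Real.sin (Real.pi * m * z)) q.2)
        channelMeasure :=
      ((Lp.memLp f).integrable_mul (q := 2) (memLp_of_continuous (by fun_prop) 2))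
    have h1 := h _ (isInteriorTest_mul (A := fun x => (fourier (-k) x : ℂ).re) N
      (contDiff_fourier_re (-k)) hB)
    have h2 := h _ (isInteriorTest_mul (A := fun x => (fourier (-k) x : ℂ).im) N
      (contDiff_fourier_im (-k)) hB)
    have hd : ∀ (c : ℝ) (z : ℝ), deriv (fun z => c * (cutoff N z * Real.sin (Real.pi * m * z))) z
        = c * deriv (fun z => cutoff N z * Real.sin (Real.pi * m * z)) z := fun c z =>
      deriv_const_mul c (hc.differentiable (by simp) z)
    simp only [hd] at h1 h2
    rw [integral_mul_fourier (B := fun z => cutoff N z * Real.sin (Real.pi * m * z)) _ hi,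
      integral_mul_fourier
        (B := fun z => deriv (fun z => cutoff N z * Real.sin (Real.pi * m * z)) z) _ hi', h1, h2]
    push_cast
    ring
  have t1 := tendsto_integral_deriv_cutoff (integrable_cxL f) (-k) m
  have t2 := (tendsto_integral_cutoff (integrable_cxL g) (-k) hB.continuous hM).neg
  simp only [key] at t1
  have h3 := tendsto_nhds_unique t1 t2
  rw [HydrostaticNS.coefO_eq (integrable_cxL g), HydrostaticNS.coefE_eq (integrable_cxL f)]
  have h4 : ∫ q, cx f q * (fourier (-k) q.1 * (Real.pi * m * Real.cos (Real.pi * m * q.2) : ℝ))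
      ∂channelMeasure = Real.pi * m * ∫ q, cx f q * (fourier (-k) q.1 *
        (Real.cos (Real.pi * m * q.2) : ℝ)) ∂channelMeasure := by
    rw [← integral_const_mul]
    congr 1 with q
    push_cast
    ring
  rw [h4] at h3
  linear_combination (-Complex.I) * h3

end
end HydrostaticNS

namespace HydrostaticNS
noncomputable section

/-! ### The norm of the vertical derivative -/

/-- The number `π`, as an extended nonnegative number. -/
def piE : ℝ≥0∞ := ENNReal.ofReal Real.pi

lemma enorm_pi_mul (m : ℤ) (c : ℂ) : ‖Complex.I * Real.pi * m * c‖ₑ = piE * (em m * ‖c‖ₑ) := by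
  rw [enorm_mul, enorm_mul, enorm_mul, piE, em]
  have h1 : ‖Complex.I‖ₑ = 1 := by rw [← ofReal_norm, Complex.norm_I, ENNReal.ofReal_one]
  have h2 : ‖(Real.pi : ℂ)‖ₑ = ENNReal.ofReal Real.pi := by
    rw [← ofReal_norm, Complex.norm_real, Real.norm_of_nonneg Real.pi_pos.le]
  have h3 : ‖(m : ℂ)‖ₑ = ‖m‖ₑ := by
    rw [← ofReal_norm, ← ofReal_norm, Complex.norm_intCast, Int.norm_eq_abs]
  rw [h1, h2, h3, one_mul, mul_assoc]

lemma exists_hasWeakDerivZ {f : ChannelL2} (h : ∑' j : ℤ × ℤ, (em j.2 * ‖coefE (cx f) j‖ₑ) ^ 2 ≠ ⊤) :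
    ∃ g : ChannelL2, HasWeakDerivZ f g := by
  obtain ⟨g, hg⟩ := exists_coefO_eq
    (a := fun j => Complex.I * Real.pi * j.2 * coefE (cx f) j) (by
      simp only [enorm_pi_mul, mul_pow piE]
      rw [ENNReal.tsum_mul_left]
      exact ENNReal.mul_ne_top (by simp [piE]) h)
    (fun k m => by rw [coefE_neg_snd]; push_cast; ring)
    (fun j => by
      rw [coefE_neg_cx]
      simp)
  exact ⟨g, hasWeakDerivZ_of_coefO fun k m => hg (k, m)⟩

lemma exists_hasWeakDerivX {f : ChannelL2} (h : ∑' j : ℤ × ℤ, (wv j.1 * ‖coefE (cx f) j‖ₑ) ^ 2 ≠ ⊤) :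
    ∃ g : ChannelL2, HasWeakDerivX f g := by
  have hw : ∀ j : ℤ × ℤ, ‖2 * Real.pi * Complex.I * j.1 * coefE (cx f) j‖ₑ
      = wv j.1 * ‖coefE (cx f) j‖ₑ := fun j => by
    rw [enorm_mul, wv, waveNumber, ← ofReal_norm]
    congr 2
    simp [abs_mul]
  obtain ⟨g, hg⟩ := exists_coefE_eq
    (a := fun j => 2 * Real.pi * Complex.I * j.1 * coefE (cx f) j) (by simpa only [hw] using h)
    (fun k m => by rw [coefE_neg_snd])
    (fun j => by
      rw [coefE_neg_cx]
      simp [Complex.conj_ofNat])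
  exact ⟨g, hasWeakDerivX_of_coefE fun k m => hg (k, m)⟩

lemma analyticNorm_sq_of_hasWeakDerivZ (r τ : ℝ) {f g : ChannelL2} (h : HasWeakDerivZ f g) :
    analyticNorm r τ g ^ 2 =
      piE ^ 2 * ∑' j : ℤ × ℤ, aw r τ j.1 * (em j.2 * ‖coefE (cx f) j‖ₑ) ^ 2 := by
  rw [analyticNorm_sq_odd, ← ENNReal.tsum_mul_left]
  congr 1 with ⟨k, m⟩
  rw [h.coefO_eq, enorm_pi_mul]
  ring

lemma one_le_aw (r τ : ℝ) (k : ℤ) : 1 ≤ aw r τ k := le_add_self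

/-- If a weak derivative exists it is unique, and its odd coefficients are `iπm` times those of `f`.
If none exists the infimum over the empty set is `∞`, and so is the sum, for otherwise Riesz–Fischer
would produce a derivative. -/
lemma analyticNormDz_sq (r τ : ℝ) (f : ChannelL2) :
    analyticNormDz r τ f ^ 2 =
      piE ^ 2 * ∑' j : ℤ × ℤ, aw r τ j.1 * (em j.2 * ‖coefE (cx f) j‖ₑ) ^ 2 := by
  by_cases h : ∃ g, HasWeakDerivZ f g
  · obtain ⟨g, hg⟩ := h
    have hu : ∀ g', HasWeakDerivZ f g' → g' = g := fun g' hg' =>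
      eq_of_coefO_eq fun ⟨k, m⟩ => by rw [hg'.coefO_eq, hg.coefO_eq]
    rw [← analyticNorm_sq_of_hasWeakDerivZ r τ hg]
    congr 1
    refine le_antisymm (iInf₂_le g hg) (le_iInf₂ fun g' hg' => ?_)
    rw [hu g' hg']
  · have h1 : analyticNormDz r τ f = ⊤ := by
      rw [analyticNormDz, iInf₂_eq_top]
      exact fun g hg => absurd ⟨g, hg⟩ h
    have h2 : ∑' j : ℤ × ℤ, (em j.2 * ‖coefE (cx f) j‖ₑ) ^ 2 = ⊤ := by
      by_contra h3
      exact h (exists_hasWeakDerivZ h3)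
    have h3 : ∑' j : ℤ × ℤ, aw r τ j.1 * (em j.2 * ‖coefE (cx f) j‖ₑ) ^ 2 = ⊤ := by
      rw [eq_top_iff, ← h2]
      exact ENNReal.tsum_le_tsum fun j => le_mul_of_one_le_left' (one_le_aw _ _ _)
    rw [h1, h3, ENNReal.mul_top]
    · simp
    · simp [piE, Real.pi_pos]

/-! ### The vertical primitive -/

/-- The vertical primitive `∫₀ᶻ f(x,s) ds`. -/
def vint (f : ChannelL2) (q : UnitAddCircle × ℝ) : ℝ := ∫ s in (0 : ℝ)..q.2, f (q.1, s)

/-- Writing the primitive as an integral over a fixed interval of a jointly measurable function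
yields its measurability by Fubini. -/
lemma vint_eq (f : ChannelL2) {q : UnitAddCircle × ℝ} (hq : q.2 ∈ Ioo (0 : ℝ) 1) :
    vint f q = ∫ s in Ioo (0 : ℝ) 1, if s ≤ q.2 then f (q.1, s) else 0 := by
  have e : (fun s => if s ≤ q.2 then f (q.1, s) else 0)
      = (Iic q.2).indicator fun s => f (q.1, s) := by
    ext s; simp [indicator]
  rw [e, integral_indicator measurableSet_Iic, Measure.restrict_restrict measurableSet_Iic, vint,
    intervalIntegral.integral_of_le hq.1.le]
  congr 2
  ext s
  simp only [mem_Ioc, mem_inter_iff, mem_Iic, mem_Ioo]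
  constructor
  · rintro ⟨h1, h2⟩
    exact ⟨h2, h1, h2.trans_lt hq.2⟩
  · rintro ⟨h1, h2, -⟩
    exact ⟨h2, h1⟩

lemma aestronglyMeasurable_vint (f : ChannelL2) :
    AEStronglyMeasurable (vint f) channelMeasure := by
  have h1 : StronglyMeasurable fun p : (UnitAddCircle × ℝ) × ℝ =>
      if p.2 ≤ p.1.2 then f (p.1.1, p.2) else 0 :=
    StronglyMeasurable.ite (measurableSet_le (by fun_prop) (by fun_prop))
      ((Lp.stronglyMeasurable f).comp_measurable (by fun_prop)) stronglyMeasurable_const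
  have h2 := h1.integral_prod_right' (ν := (volume : Measure ℝ).restrict (Ioo 0 1))
  refine h2.aestronglyMeasurable.congr ?_
  filter_upwards [ae_channel_mem] with q hq
  exact (vint_eq f hq.2).symm

lemma ae_slice_memLp (f : ChannelL2) :
    ∀ᵐ x : UnitAddCircle, MemLp (fun z => cx f (x, z)) 2 (volume.restrict (Ioo (0 : ℝ) 1)) := by
  have hf := memLp_cxL f
  have h1 := lintegral_enorm_sq_lt_top hf
  rw [lintegral_prod _ (hf.1.enorm.pow_const 2)] at h1
  have h2 := ae_lt_top' (AEMeasurable.lintegral_prod_right' (hf.1.enorm.pow_const 2)) h1.ne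
  filter_upwards [h2, hf.1.prodMk_left] with x hx hm
  exact memLp_two_of_lintegral hm hx

lemma enorm_cx_vint_sq_le (f : ChannelL2) {x : UnitAddCircle} {z : ℝ} (hz : z ∈ Ioo (0 : ℝ) 1) :
    ‖cx (vint f) (x, z)‖ₑ ^ 2 ≤ ∫⁻ s in Ioo (0 : ℝ) 1, ‖cx f (x, s)‖ₑ ^ 2 := by
  have hm : StronglyMeasurable fun s => cx f (x, s) :=
    (Complex.continuous_ofReal.comp_stronglyMeasurable (Lp.stronglyMeasurable f)).comp_measurable
      (by fun_prop)
  have e : cx (vint f) (x, z) = ∫ s in Ioo (0 : ℝ) 1, if s ≤ z then cx f (x, s) else 0 := by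
    rw [cx, vint_eq f hz, ← integral_complex_ofReal]
    congr 1 with s
    split_ifs <;> simp [cx]
  rw [e]
  refine (enorm_sq_integral_le _ (by simp) ?_).trans (lintegral_mono fun s => ?_)
  · exact (StronglyMeasurable.ite measurableSet_Iic hm stronglyMeasurable_const).aestronglyMeasurable
  · split_ifs
    · exact le_rfl
    · simp

lemma memLp_vint (f : ChannelL2) : MemLp (vint f) 2 channelMeasure := by
  have h : MemLp (cx (vint f)) 2 channelMeasure := by
    have hm : AEStronglyMeasurable (cx (vint f)) channelMeasure :=
      Complex.continuous_ofReal.comp_aestronglyMeasurable (aestronglyMeasurable_vint f)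
    refine memLp_two_of_lintegral hm ?_
    have h1 := lintegral_enorm_sq_lt_top (memLp_cxL f)
    refine lt_of_le_of_lt ?_ h1
    rw [lintegral_prod _ (hm.enorm.pow_const 2),
      lintegral_prod _ ((memLp_cxL f).1.enorm.pow_const 2)]
    refine lintegral_mono fun x => ?_
    calc ∫⁻ z in Ioo (0 : ℝ) 1, ‖cx (vint f) (x, z)‖ₑ ^ 2
        ≤ ∫⁻ _ in Ioo (0 : ℝ) 1, ∫⁻ s in Ioo (0 : ℝ) 1, ‖cx f (x, s)‖ₑ ^ 2 :=
          setLIntegral_mono' measurableSet_Ioo fun z hz => enorm_cx_vint_sq_le f hz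
      _ = _ := by simp
  exact h.re

/-- Integration by parts for the absolutely continuous primitive, which vanishes at `0` by
construction and at `1` because `h` has mean zero. -/
lemma integral_primitive_mul_sin {h : ℝ → ℝ} (hh : IntervalIntegrable h volume 0 1)
    (h0 : ∫ s in (0 : ℝ)..1, h s = 0) (c : ℝ) :
    c * ∫ z in (0 : ℝ)..1, (∫ s in (0 : ℝ)..z, h s) * Real.sin (c * z)
      = ∫ z in (0 : ℝ)..1, h z * Real.cos (c * z) := by
  have hF := hh.absolutelyContinuousOnInterval_intervalIntegral (c := 0) (by simp)
  have hG : AbsolutelyContinuousOnInterval (fun z => Real.cos (c * z)) 0 1 :=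
    (ContDiff.contDiffOn (by fun_prop)).absolutelyContinuousOnInterval
  have h1 := hF.integral_mul_deriv_eq_deriv_mul hG
  simp only [intervalIntegral.integral_same, zero_mul, h0, sub_zero, zero_sub] at h1
  have hd : ∀ z, deriv (fun z => Real.cos (c * z)) z = -(c * Real.sin (c * z)) := fun z => by
    have := (Real.hasDerivAt_cos (c * z)).comp z ((hasDerivAt_id z).const_mul c)
    refine this.deriv.trans ?_
    ring
  simp only [hd] at h1
  have h2 : ∫ z in (0 : ℝ)..1, deriv (fun z => ∫ s in (0 : ℝ)..z, h s) z * Real.cos (c * z)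
      = ∫ z in (0 : ℝ)..1, h z * Real.cos (c * z) := by
    apply intervalIntegral.integral_congr_ae
    filter_upwards [hh.ae_hasDerivAt_integral] with z hz hz2
    rw [(hz (uIoc_subset_uIcc hz2) 0 (by simp)).deriv]
  rw [h2] at h1
  rw [← intervalIntegral.integral_const_mul]
  have h3 : ∀ z, c * ((∫ s in (0 : ℝ)..z, h s) * Real.sin (c * z))
      = -((∫ s in (0 : ℝ)..z, h s) * -(c * Real.sin (c * z))) := fun z => by ring
  simp only [h3, intervalIntegral.integral_neg, h1, neg_neg]

lemma integrable_mul_continuous {f : UnitAddCircle × ℝ → ℂ} (hf : MemLp f 2 channelMeasure)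
    {g : UnitAddCircle × ℝ → ℂ} (hg : Continuous g) : Integrable (fun q => f q * g q) channelMeasure :=
  hf.integrable_mul (memLp_of_continuous hg 2)

lemma coefO_vint {f : ChannelL2} (h0 : ∀ k, coefE (cx f) (k, 0) = 0) (k m : ℤ) :
    Complex.I * Real.pi * m * coefO (cx (vint f)) (k, m) = coefE (cx f) (k, m) := by
  have hv := memLp_cx (memLp_vint f)
  rw [coefO_eq (hv.integrable one_le_two), coefE_eq (integrable_cxL f),
    integral_prod _ (integrable_mul_continuous hv (by fun_prop)),
    integral_prod _ (integrable_mul_continuous (memLp_cxL f) (by fun_prop)), ← mul_assoc,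
    ← integral_const_mul]
  refine integral_congr_ae ?_
  filter_upwards [ae_slice_memLp f, zeroVerticalMean_iff.2 h0] with x hx h0x
  have hi : IntervalIntegrable (fun z => f (x, z)) volume 0 1 := by
    rw [intervalIntegrable_iff_integrableOn_Ioo_of_le zero_le_one]
    exact (hx.integrable one_le_two).re
  have h0' : ∫ s in (0 : ℝ)..1, f (x, s) = 0 := by
    rw [intervalIntegral.integral_of_le zero_le_one, ← restrict_Ioo_eq_restrict_Ioc, h0x]
  have key := integral_primitive_mul_sin hi h0' (Real.pi * m)
  rw [intervalIntegral.integral_of_le zero_le_one, intervalIntegral.integral_of_le zero_le_one,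
    ← restrict_Ioo_eq_restrict_Ioc] at key
  have e1 : ∫ z in Ioo (0 : ℝ) 1, cx (vint f) (x, z) * (fourier (-k) x * (Real.sin (Real.pi * m * z) : ℝ))
      = fourier (-k) x * ((∫ z in Ioo (0 : ℝ) 1, (∫ s in (0 : ℝ)..z, f (x, s)) *
        Real.sin (Real.pi * m * z) : ℝ) : ℂ) := by
    rw [← integral_complex_ofReal, ← integral_const_mul]
    congr 1 with z
    simp only [cx, vint]
    push_cast
    ring
  have e2 : ∫ z in Ioo (0 : ℝ) 1, cx f (x, z) * (fourier (-k) x * (Real.cos (Real.pi * m * z) : ℝ))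
      = fourier (-k) x * ((∫ z in Ioo (0 : ℝ) 1, f (x, z) * Real.cos (Real.pi * m * z) : ℝ) : ℂ) := by
    rw [← integral_complex_ofReal, ← integral_const_mul]
    congr 1 with z
    simp only [cx]
    push_cast
    ring
  rw [e1, e2, ← key]
  push_cast
  linear_combination (-(Real.pi * m * (fourier (-k) x * ((∫ z in Ioo (0 : ℝ) 1, (∫ s in (0 : ℝ)..z, f (x, s)) *
        Real.sin (Real.pi * m * z) : ℝ) : ℂ)))) * Complex.I_mul_I

end
end HydrostaticNS

namespace HydrostaticNS
noncomputable section


/-! ### The advection term in Fourier variables -/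

/-- A summand of the advection term. -/
def advTerm (a b : ℤ × ℤ → ℂ) (j i : ℤ × ℤ) : ℂ :=
  2 * Real.pi * Complex.I * ((j - i).1 - i.1 * (j - i).2 / i.2) * (a i * b (j - i))

/-- The Fourier coefficients of `u ∂_x v - ∂_x ∫ u v - (∫ ∂_x u) ∂_z v`, for `u` with
coefficients `a` and `v` with coefficients `b`. -/
def advec (a b : ℤ × ℤ → ℂ) (j : ℤ × ℤ) : ℂ := if j.2 = 0 then 0 else ∑' i, advTerm a b j i

/-- The moduli of a family of coefficients. -/
abbrev moduli (a : ℤ × ℤ → ℂ) (j : ℤ × ℤ) : ℝ≥0∞ := ‖a j‖ₑ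

lemma enorm_two_pi_I_mul (k : ℤ) : ‖2 * Real.pi * Complex.I * (k : ℂ)‖ₑ = wv k := by
  rw [wv, waveNumber, ← ofReal_norm]
  congr 1
  simp [abs_mul]

lemma enorm_intCast (m : ℤ) : ‖(m : ℂ)‖ₑ = em m := by
  rw [em, ← ofReal_norm, ← ofReal_norm, Complex.norm_intCast, Int.norm_eq_abs]

lemma enorm_inv_intCast (m : ℤ) : ‖(m : ℂ)⁻¹‖ₑ = im m := by
  rcases eq_or_ne m 0 with rfl | hm
  · simp [im]
  · rw [enorm_inv (by exact_mod_cast hm), enorm_intCast, im, if_neg hm]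

lemma enorm_advTerm_le (a b : ℤ × ℤ → ℂ) (j i : ℤ × ℤ) :
    ‖advTerm a b j i‖ₑ ≤ ‖a i‖ₑ * (wv (j - i).1 * ‖b (j - i)‖ₑ)
      + wv i.1 * (im i.2 * ‖a i‖ₑ) * (em (j - i).2 * ‖b (j - i)‖ₑ) := by
  have e : advTerm a b j i = a i * (2 * Real.pi * Complex.I * ((j - i).1 : ℤ) * b (j - i))
      - 2 * Real.pi * Complex.I * (i.1 : ℤ) * (((i.2 : ℤ) : ℂ)⁻¹ * a i) *
        (((j - i).2 : ℤ) * b (j - i)) := by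
    rw [advTerm, div_eq_mul_inv]; ring
  rw [e]
  refine enorm_sub_le.trans (le_of_eq ?_)
  rw [enorm_mul, enorm_mul (2 * Real.pi * Complex.I * ((j - i).1 : ℂ)), enorm_two_pi_I_mul,
    enorm_mul (2 * Real.pi * Complex.I * (i.1 : ℂ) * ((i.2 : ℂ)⁻¹ * a i)),
    enorm_mul (2 * Real.pi * Complex.I * (i.1 : ℂ)), enorm_two_pi_I_mul, enorm_mul (i.2 : ℂ)⁻¹,
    enorm_inv_intCast, enorm_mul ((j - i).2 : ℂ), enorm_intCast]

lemma tsum_enorm_advTerm_le (a b : ℤ × ℤ → ℂ) (j : ℤ × ℤ) :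
    ∑' i, ‖advTerm a b j i‖ₑ ≤ maj (moduli a) (moduli b) j := by
  rw [maj, conv, conv, ← ENNReal.tsum_add]
  exact ENNReal.tsum_le_tsum fun i => enorm_advTerm_le a b j i

lemma summable_of_tsum_enorm {ι : Type*} {f : ι → ℂ} (h : ∑' i, ‖f i‖ₑ ≠ ⊤) : Summable f := by
  rw [← summable_norm_iff]
  have := ENNReal.summable_toReal h
  simpa only [toReal_enorm] using this

lemma enorm_tsum_le {ι : Type*} (f : ι → ℂ) : ‖∑' i, f i‖ₑ ≤ ∑' i, ‖f i‖ₑ := by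
  by_cases h : ∑' i, ‖f i‖ₑ = ⊤
  · rw [h]; exact le_top
  · have h1 := ENNReal.summable_toReal h
    simp only [toReal_enorm] at h1
    rw [← ofReal_norm]
    refine (ENNReal.ofReal_le_ofReal (norm_tsum_le_tsum_norm h1)).trans (le_of_eq ?_)
    rw [ENNReal.ofReal_tsum_of_nonneg (fun _ => norm_nonneg _) h1]
    simp only [ofReal_norm]

lemma enorm_advec_le (a b : ℤ × ℤ → ℂ) (j : ℤ × ℤ) :
    ‖advec a b j‖ₑ ≤ maj (moduli a) (moduli b) j := by
  rw [advec]
  split_ifs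
  · simp
  · exact (enorm_tsum_le _).trans (tsum_enorm_advTerm_le a b j)

/-! ### Triple products in the channel -/

lemma _root_.MeasureTheory.MemLp.mul_continuous {f g : UnitAddCircle × ℝ → ℝ}
    (hf : MemLp f 2 channelMeasure) (hg : Continuous g) :
    MemLp (fun q => f q * g q) 2 channelMeasure :=
  (memLp_of_continuous hg ⊤).mul' (r := 2) hf

lemma tsum_triple_ne_top {H : ℤ × ℤ → ℂ} (hH : ∑' j, ‖H j‖ₑ ^ 2 ≠ ⊤) {C : ℤ × ℤ → ℝ≥0∞}
    (hC : l2 C ≠ ⊤) : ∑' j, ‖H (-j)‖ₑ * C j ≠ ⊤ := by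
  refine ne_top_of_le_ne_top ?_ (tsum_mul_le_l2 _ _)
  refine ENNReal.mul_ne_top ?_ hC
  have e := l2_comp_equiv (Equiv.neg (ℤ × ℤ)) fun j => ‖H j‖ₑ
  simp only [Equiv.neg_apply] at e
  rw [e]
  exact ENNReal.rpow_ne_top_of_nonneg (by norm_num) hH

lemma summable_triple {F G H : ℤ × ℤ → ℂ}
    (hs : ∑' j, ‖H (-j)‖ₑ * conv (moduli F) (moduli G) j ≠ ⊤) :
    Summable fun j => H (-j) * ∑' i, F i * G (j - i) := by
  refine summable_of_tsum_enorm (ne_top_of_le_ne_top hs (ENNReal.tsum_le_tsum fun j => ?_))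
  rw [enorm_mul]
  gcongr
  refine (enorm_tsum_le _).trans (le_of_eq ?_)
  simp only [enorm_mul, conv]

lemma hasSum_triple_even {f g h : UnitAddCircle × ℝ → ℝ} (hf : MemLp f 2 channelMeasure)
    (hg : MemLp g 2 channelMeasure) (hh : Continuous h)
    (hs : ∑' j, ‖coefE (cx h) (-j)‖ₑ * conv (moduli (coefE (cx f))) (moduli (coefE (cx g))) j ≠ ⊤) :
    HasSum (fun j => coefE (cx h) (-j) * ∑' i, coefE (cx f) i * coefE (cx g) (j - i))
      ((∫ q, f q * (g q * h q) ∂channelMeasure : ℝ) : ℂ) := by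
  have hgh := hg.mul_continuous hh
  have h1 := integral_triple (memLp_ev (memLp_cx hf)) (memLp_ev (memLp_cx hg))
    (memLp_ev (memLp_cx (memLp_of_continuous hh 2))) (by
      refine (memLp_ev (memLp_cx hgh)).ae_eq (.of_forall fun p => ?_)
      simp [ev, cx]) hs
  have h2 : ∫ p, ev (cx f) p * (ev (cx g) p * ev (cx h) p)
      = ((∫ q, f q * (g q * h q) ∂channelMeasure : ℝ) : ℂ) := by
    have hi : Integrable (fun q => f q * (g q * h q)) channelMeasure := hf.integrable_mul hgh
    rw [← integral_cx, ← integral_ev (memLp_cx (memLp_one_iff_integrable.2 hi)).1]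
    congr 1 with p
    simp [ev, cx]
  rw [← h2, h1]
  exact (summable_triple hs).hasSum

/-- A product of two odd extensions is the even extension of the product, because the sign squares
to `1` almost everywhere. This handles `(∫₀ᶻ ∂_x u) ∂_z u`, both of whose factors are odd. -/
lemma hasSum_triple_odd {f g h : UnitAddCircle × ℝ → ℝ} (hf : MemLp f 2 channelMeasure)
    (hg : MemLp g 2 channelMeasure) (hh : Continuous h)
    (hs : ∑' j, ‖coefE (cx h) (-j)‖ₑ * conv (moduli (coefO (cx f))) (moduli (coefO (cx g))) j ≠ ⊤) :
    HasSum (fun j => coefE (cx h) (-j) * ∑' i, coefO (cx f) i * coefO (cx g) (j - i))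
      ((∫ q, f q * (g q * h q) ∂channelMeasure : ℝ) : ℂ) := by
  have hgh := hg.mul_continuous hh
  have h1 := integral_triple (memLp_od (memLp_cx hf)) (memLp_od (memLp_cx hg))
    (memLp_ev (memLp_cx (memLp_of_continuous hh 2))) (by
      refine (memLp_od (memLp_cx hgh)).ae_eq (.of_forall fun p => ?_)
      simp [od, ev, cx, mul_assoc]) hs
  have h2 : ∫ p, od (cx f) p * (od (cx g) p * ev (cx h) p)
      = ((∫ q, f q * (g q * h q) ∂channelMeasure : ℝ) : ℂ) := by
    have hi : Integrable (fun q => f q * (g q * h q)) channelMeasure := hf.integrable_mul hgh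
    rw [← integral_cx, ← integral_ev (memLp_cx (memLp_one_iff_integrable.2 hi)).1]
    refine integral_congr_ae ?_
    filter_upwards [ae_snd_norm] with p hp
    have := sg_sq hp
    simp only [od, ev, cx]
    calc _ = ((sg p * sg p : ℝ) : ℂ) * (f (fold p) * (g (fold p) * h (fold p)) : ℝ) := by
          push_cast; ring
      _ = _ := by rw [this]; simp
  rw [← h2, h1]
  exact (summable_triple hs).hasSum

/-! ### The horizontal mean of the momentum flux -/

/-- The vertical average of the horizontal derivative. -/
def meanDerivX (φ : UnitAddCircle → ℝ → ℝ) (q : UnitAddCircle × ℝ) : ℝ :=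
  ∫ z in (0 : ℝ)..1, derivX (fun x => φ x z) q.1

variable {φ : UnitAddCircle → ℝ → ℝ}

lemma SmoothT.continuous_meanDerivX (hφ : SmoothT φ) : Continuous (meanDerivX φ) := by
  unfold meanDerivX
  refine intervalIntegral.continuous_parametric_intervalIntegral_of_continuous' ?_ 0 1
  exact hφ.continuous_derivX.comp
    (by fun_prop : Continuous fun p : (UnitAddCircle × ℝ) × ℝ => (p.1.1, p.2))

lemma integral_cos_eq_zero {m : ℤ} (hm : m ≠ 0) :
    ∫ z in (0 : ℝ)..1, Real.cos (Real.pi * m * z) = 0 := by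
  have hc : Real.pi * m ≠ 0 := mul_ne_zero Real.pi_ne_zero (by exact_mod_cast hm)
  rw [intervalIntegral.integral_comp_mul_left _ hc, integral_cos]
  simp [mul_comm Real.pi, Real.sin_int_mul_pi]

/-- A function independent of `z` has only modes with `m = 0`: the pressure acts on those alone. -/
lemma SmoothT.coefE_meanDerivX (hφ : SmoothT φ) (k m : ℤ) :
    coefE (cx (meanDerivX φ)) (k, m)
      = if m = 0 then 2 * Real.pi * Complex.I * k * coefE (cx fun q => φ q.1 q.2) (k, 0) else 0 := by
  rw [coefE_eq_integral_snd (continuous_cx hφ.continuous_meanDerivX)]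
  have e1 : ∀ x : UnitAddCircle, ∫ z in (0 : ℝ)..1,
      ((Real.cos (Real.pi * m * z) : ℝ) : ℂ) * cx (meanDerivX φ) (x, z)
      = ((∫ z in (0 : ℝ)..1, Real.cos (Real.pi * m * z) : ℝ) : ℂ) * cx (meanDerivX φ) (x, 0) :=
    fun x => by
      have : ∀ z, cx (meanDerivX φ) (x, z) = cx (meanDerivX φ) (x, 0) := fun z => rfl
      simp only [this]
      rw [intervalIntegral.integral_mul_const, intervalIntegral.integral_ofReal]
  simp only [e1]
  split_ifs with hm
  · subst hm
    rw [← hφ.coefE_derivX, coefE_eq_integral_snd (continuous_cx hφ.continuous_derivX)]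
    congr 1 with x
    congr 1
    simp only [cx, meanDerivX, Int.cast_zero, mul_zero, zero_mul, Real.cos_zero,
      Complex.ofReal_one, one_mul]
    rw [intervalIntegral.integral_ofReal]
    simp
  · rw [integral_cos_eq_zero hm]
    simp

/-! ### The weak formulation in Fourier variables -/

/-- The coefficients of the advection and viscous terms. -/
def flux (ν : ℝ) (a : ℤ × ℤ → ℂ) (j : ℤ × ℤ) : ℂ :=
  advec a a j + ν * (Real.pi * j.2) ^ 2 * a j

lemma wv_mul_conv_self_le (D : ℤ × ℤ → ℝ≥0∞) (j : ℤ × ℤ) :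
    wv j.1 * conv D D j ≤ 2 * conv D (fun i => wv i.1 * D i) j := by
  rw [two_mul]
  nth_rewrite 3 [conv_comm]
  rw [conv, conv, conv, ← ENNReal.tsum_mul_left, ← ENNReal.tsum_add]
  refine ENNReal.tsum_le_tsum fun i => ?_
  calc wv j.1 * (D i * D (j - i)) ≤ (wv i.1 + wv (j.1 - i.1)) * (D i * D (j - i)) := by
        gcongr; exact wv_le _ _
    _ = _ := by rw [Prod.fst_sub]; ring

/-- By Fubini the vertical average moves from `f²` to the test function, so that the pressure term
becomes a triple product like the others. -/
lemma integral_verticalEnergy_mul (f : ChannelL2) {φ : UnitAddCircle → ℝ → ℝ} (hφ : SmoothT φ) :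
    Integrable (fun p : UnitAddCircle × ℝ => (∫ s in Ioo (0 : ℝ) 1, f (p.1, s) ^ 2) *
        derivX (fun x => φ x p.2) p.1) channelMeasure ∧
    ∫ p, (∫ s in Ioo (0 : ℝ) 1, f (p.1, s) ^ 2) * derivX (fun x => φ x p.2) p.1 ∂channelMeasure
      = ∫ p, f p * (f p * meanDerivX φ p) ∂channelMeasure := by
  have h2 : Integrable (fun p => f p ^ 2) channelMeasure := (Lp.memLp f).integrable_sq
  have hU : Integrable (fun p : UnitAddCircle × ℝ => ∫ s in Ioo (0 : ℝ) 1, f (p.1, s) ^ 2)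
      channelMeasure := h2.integral_prod_left.comp_fst _
  have h1 : Integrable (fun p : UnitAddCircle × ℝ => (∫ s in Ioo (0 : ℝ) 1, f (p.1, s) ^ 2) *
        derivX (fun x => φ x p.2) p.1) channelMeasure :=
    memLp_one_iff_integrable.1 ((memLp_of_continuous hφ.continuous_derivX ⊤).mul' (r := 1)
      (memLp_one_iff_integrable.2 hU))
  refine ⟨h1, ?_⟩
  have h3 : Integrable (fun p => f p * (f p * meanDerivX φ p)) channelMeasure :=
    (Lp.memLp f).integrable_mul ((Lp.memLp f).mul_continuous hφ.continuous_meanDerivX)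
  rw [integral_prod _ h1, integral_prod _ h3]
  congr 1 with x
  simp only [integral_const_mul]
  have e : ∀ z, f (x, z) * (f (x, z) * meanDerivX φ (x, z)) = f (x, z) ^ 2 * meanDerivX φ (x, 0) :=
    fun z => by rw [show meanDerivX φ (x, z) = meanDerivX φ (x, 0) from rfl]; ring
  simp only [e, integral_mul_const]
  rw [meanDerivX, intervalIntegral.integral_of_le zero_le_one, ← restrict_Ioo_eq_restrict_Ioc]

/-- Parseval applied to each term of the weak formulation. Finiteness of the majorant in `ℓ²`
justifies every rearrangement of the triple products. The two functions `χ` and `ψ` stand for `∂_t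
φ` and `φ` at a fixed time. -/
lemma hasSum_weak_formulation {ν : ℝ} {u ux uz : ChannelL2} (hx : HasWeakDerivX u ux)
    (hz : HasWeakDerivZ u uz) (h0 : ∀ k, coefE (cx u) (k, 0) = 0)
    (hm : l2 (maj (moduli (coefE (cx u))) (moduli (coefE (cx u)))) ≠ ⊤)
    {χ ψ : UnitAddCircle → ℝ → ℝ} (hχ : Continuous fun q : UnitAddCircle × ℝ => χ q.1 q.2)
    (hψ : SmoothT ψ) :
    HasSum (fun j => -(coefE (cx u) j * coefE (cx fun q => χ q.1 q.2) (-j))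
        + flux ν (coefE (cx u)) j * coefE (cx fun q => ψ q.1 q.2) (-j))
      ((∫ p, (- u p * χ p.1 p.2
          + (u p * ux p - (∫ s in (0 : ℝ)..p.2, ux (p.1, s)) * uz p) * ψ p.1 p.2
          + (∫ s in Ioo (0 : ℝ) 1, u (p.1, s) ^ 2) * derivX (fun x => ψ x p.2) p.1
          + ν * uz p * deriv (ψ p.1) p.2) ∂channelMeasure : ℝ) : ℂ) := by
  set a := coefE (cx u) with ha
  have hψc := hψ.continuous_uncurry
  have hψ2 : ∑' j, ‖coefE (cx fun q => ψ q.1 q.2) j‖ₑ ^ 2 ≠ ⊤ := by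
    refine ne_of_eq_of_ne (tsum_enorm_tc_sq (memLp_ev (memLp_cx (memLp_of_continuous hψc 2)))) ?_
    exact (lintegral_enorm_sq_lt_top (memLp_ev (memLp_cx (memLp_of_continuous hψc 2)))).ne
  have hc1 : l2 (conv (moduli a) fun i => wv i.1 * ‖a i‖ₑ) ≠ ⊤ :=
    ne_top_of_le_ne_top hm (l2_mono fun j => le_self_add)
  have hc2 : l2 (conv (fun i => wv i.1 * (im i.2 * ‖a i‖ₑ)) fun i => em i.2 * ‖a i‖ₑ) ≠ ⊤ :=
    ne_top_of_le_ne_top hm (l2_mono fun j => le_add_self)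
  have hux : ∀ i : ℤ × ℤ, coefE (cx ux) i = 2 * Real.pi * Complex.I * i.1 * a i := fun ⟨k, m⟩ => hx.coefE_eq k m
  have huz : ∀ i : ℤ × ℤ, coefO (cx uz) i = Complex.I * Real.pi * i.2 * a i := fun ⟨k, m⟩ => hz.coefO_eq k m
  have hux0 : ∀ k, coefE (cx ux) (k, 0) = 0 := fun k => by rw [hux, h0, mul_zero]
  -- The quotient of `2πik` by `iπm`. At `m = 0` the odd coefficient vanishes, in agreement with
  -- division by zero.
  have hW : ∀ i : ℤ × ℤ, coefO (cx (vint ux)) i = 2 * i.1 / i.2 * a i := fun ⟨k, m⟩ => by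
    rcases eq_or_ne m 0 with rfl | hm'
    · rw [coefO_zero]; simp
    · have h1 := coefO_vint hux0 k m
      rw [hux] at h1
      have hm'' : (m : ℂ) ≠ 0 := by exact_mod_cast hm'
      have hpi : (Real.pi : ℂ) ≠ 0 := by exact_mod_cast Real.pi_ne_zero
      field_simp at h1 ⊢
      linear_combination h1
  -- the time derivative
  have t1 := integral_mul_eq_tsum_even (Lp.memLp u) (memLp_of_continuous hχ 2)
  -- the horizontal transport term
  have t2 := hasSum_triple_even (Lp.memLp u) (Lp.memLp ux) hψc (by
    refine tsum_triple_ne_top hψ2 ?_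
    convert hc1 using 4 with i
    rw [moduli, hux, enorm_mul, enorm_two_pi_I_mul])
  -- the vertical transport term
  have hprod : ∀ j i : ℤ × ℤ, coefO (cx (vint ux)) i * coefO (cx uz) (j - i)
      = 2 * Real.pi * Complex.I * (i.1 : ℤ) * (((i.2 : ℤ) : ℂ)⁻¹ * a i) *
        (((j - i).2 : ℤ) * a (j - i)) := fun j i => by
    rw [hW, huz, div_eq_mul_inv]; ring
  have hprodn : ∀ j i : ℤ × ℤ, ‖coefO (cx (vint ux)) i‖ₑ * ‖coefO (cx uz) (j - i)‖ₑ
      = wv i.1 * (im i.2 * ‖a i‖ₑ) * (em (j - i).2 * ‖a (j - i)‖ₑ) := fun j i => by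
    rw [← enorm_mul, hprod, enorm_mul (2 * Real.pi * Complex.I * (i.1 : ℂ) * ((i.2 : ℂ)⁻¹ * a i)),
      enorm_mul (2 * Real.pi * Complex.I * (i.1 : ℂ)), enorm_two_pi_I_mul, enorm_mul (i.2 : ℂ)⁻¹,
      enorm_inv_intCast, enorm_mul ((j - i).2 : ℂ), enorm_intCast]
  have t3 := hasSum_triple_odd (memLp_vint ux) (Lp.memLp uz) hψc (by
    refine tsum_triple_ne_top hψ2 ?_
    refine ne_of_eq_of_ne (congrArg l2 (funext fun j => ?_)) hc2
    simp only [conv, moduli, hprodn])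
  -- the pressure term
  have hP : ∀ j : ℤ × ℤ, coefE (cx (meanDerivX ψ)) (-j)
      = if j.2 = 0 then -(2 * Real.pi * Complex.I * j.1 * coefE (cx fun q => ψ q.1 q.2) (-j)) else 0 :=
    fun ⟨k, m⟩ => by
      rw [Prod.neg_mk, hψ.coefE_meanDerivX]
      simp only [neg_eq_zero]
      split_ifs with h
      · subst h; push_cast; simp
      · rfl
  have t4 := hasSum_triple_even (Lp.memLp u) (Lp.memLp u) hψ.continuous_meanDerivX (by
    have h1 : ∑' j, ‖coefE (cx fun q => ψ q.1 q.2) (-j)‖ₑ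
        * (2 * conv (moduli a) (fun i => wv i.1 * ‖a i‖ₑ) j) ≠ ⊤ := by
      refine tsum_triple_ne_top hψ2 ?_
      rw [l2_const_mul]
      exact ENNReal.mul_ne_top (by simp) hc1
    refine ne_top_of_le_ne_top h1 (ENNReal.tsum_le_tsum fun j => ?_)
    rw [hP]
    split_ifs
    · rw [enorm_neg, enorm_mul, enorm_two_pi_I_mul, mul_comm (wv j.1), mul_assoc]
      refine mul_le_mul_right ?_ _
      exact wv_mul_conv_self_le _ _
    · simp)
  -- the viscous term
  have t5 := (integral_mul_eq_tsum_odd (Lp.memLp uz) (memLp_of_continuous hψ.continuous_deriv 2)).mul_left (ν : ℂ)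
  have I1 : Integrable (fun p => u p * χ p.1 p.2) channelMeasure :=
    (Lp.memLp u).integrable_mul (memLp_of_continuous hχ 2)
  have I2 : Integrable (fun p => u p * (ux p * ψ p.1 p.2)) channelMeasure :=
    (Lp.memLp u).integrable_mul ((Lp.memLp ux).mul_continuous hψc)
  have I3 : Integrable (fun p => vint ux p * (uz p * ψ p.1 p.2)) channelMeasure :=
    (memLp_vint ux).integrable_mul ((Lp.memLp uz).mul_continuous hψc)
  obtain ⟨I4, e4⟩ := integral_verticalEnergy_mul u hψ
  have I5 : Integrable (fun p => uz p * deriv (ψ p.1) p.2) channelMeasure :=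
    (Lp.memLp uz).integrable_mul (memLp_of_continuous hψ.continuous_deriv 2)
  have eI : ∫ p, (- u p * χ p.1 p.2
          + (u p * ux p - (∫ s in (0 : ℝ)..p.2, ux (p.1, s)) * uz p) * ψ p.1 p.2
          + (∫ s in Ioo (0 : ℝ) 1, u (p.1, s) ^ 2) * derivX (fun x => ψ x p.2) p.1
          + ν * uz p * deriv (ψ p.1) p.2) ∂channelMeasure
      = -(∫ p, u p * χ p.1 p.2 ∂channelMeasure) + (∫ p, u p * (ux p * ψ p.1 p.2) ∂channelMeasure)
        - (∫ p, vint ux p * (uz p * ψ p.1 p.2) ∂channelMeasure)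
        + (∫ p, u p * (u p * meanDerivX ψ p) ∂channelMeasure)
        + ν * ∫ p, uz p * deriv (ψ p.1) p.2 ∂channelMeasure := by
    have J1 : Integrable (fun p => -(u p * χ p.1 p.2)) channelMeasure := I1.neg
    have J2 : Integrable (fun p => -(u p * χ p.1 p.2) + u p * (ux p * ψ p.1 p.2)) channelMeasure :=
      J1.add I2
    have J3 : Integrable (fun p => -(u p * χ p.1 p.2) + u p * (ux p * ψ p.1 p.2)
        - vint ux p * (uz p * ψ p.1 p.2)) channelMeasure := J2.sub I3
    have J4 : Integrable (fun p => -(u p * χ p.1 p.2) + u p * (ux p * ψ p.1 p.2)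
        - vint ux p * (uz p * ψ p.1 p.2)
        + (∫ s in Ioo (0 : ℝ) 1, u (p.1, s) ^ 2) * derivX (fun x => ψ x p.2) p.1) channelMeasure :=
      J3.add I4
    rw [← e4, ← integral_const_mul, ← integral_neg, ← integral_add J1 I2,
      ← integral_sub J2 I3, ← integral_add J3 I4, ← integral_add J4 (I5.const_mul _)]
    refine integral_congr_ae (.of_forall fun p => ?_)
    simp only [vint]
    ring
  rw [eI]
  push_cast
  have t := (((t1.neg.add t2).sub t3).add t4).add t5
  refine Eq.mpr (congrArg (fun F => HasSum F _) (funext fun j => ?_)) t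
  have s2 : Summable fun i => coefE (cx u) i * coefE (cx ux) (j - i) := by
    refine summable_of_tsum_enorm (ne_top_of_le_ne_top hc1 (le_trans (le_of_eq ?_) (le_l2 _ j)))
    simp only [conv, enorm_mul]
    congr 1 with i
    rw [hux, enorm_mul, enorm_two_pi_I_mul]
  have s3 : Summable fun i => coefO (cx (vint ux)) i * coefO (cx uz) (j - i) := by
    refine summable_of_tsum_enorm (ne_top_of_le_ne_top hc2 (le_trans (le_of_eq ?_) (le_l2 _ j)))
    simp only [conv, enorm_mul, hprodn]
  have s4 : Summable fun i => a i * a (j - i) := by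
    refine summable_of_tsum_enorm (ne_top_of_le_ne_top (ENNReal.mul_ne_top ?_ ?_)
      (le_trans (le_of_eq ?_) (conv_le_l2 (moduli a) (moduli a) j)))
    · exact ENNReal.rpow_ne_top_of_nonneg (by norm_num) (tsum_coefE_sq_ne_top u)
    · exact ENNReal.rpow_ne_top_of_nonneg (by norm_num) (tsum_coefE_sq_ne_top u)
    · simp only [conv, enorm_mul]
  -- For `j.2 = 0` one has `(j - i).2 = -i.2`, so the two advection terms add up to `2πi j.1` times
  -- the convolution of `a` with itself, which is `∂_x` of the mean of `u²`. The pressure cancels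
  -- it, which justifies the value `0` in `advec`.
  have key : advec a a j = ∑' i, coefE (cx u) i * coefE (cx ux) (j - i)
      - ∑' i, coefO (cx (vint ux)) i * coefO (cx uz) (j - i)
      + (if j.2 = 0 then -(2 * Real.pi * Complex.I * j.1) else 0) * ∑' i, a i * a (j - i) := by
    rw [← s2.tsum_sub s3, advec]
    split_ifs with hj
    · rw [← tsum_mul_left, ← (s2.sub s3).tsum_add (s4.mul_left _), ← tsum_zero]
      congr 1 with i
      rw [hprod, hux]
      simp only [Prod.snd_sub, Prod.fst_sub, hj]
      rcases eq_or_ne i.2 0 with hi | hi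
      · have : a i = 0 := by rw [← h0 i.1, ← hi]
        rw [← ha, this]; ring
      · have hi' : (i.2 : ℂ) ≠ 0 := by exact_mod_cast hi
        rw [← ha]
        push_cast
        field_simp
        ring
    · rw [zero_mul, add_zero]
      congr 1 with i
      rw [hprod, hux, advTerm, ← ha]
      ring
  have e5 : coefO (cx uz) j * coefO (cx fun q => deriv (ψ q.1) q.2) (-j)
      = (Real.pi * j.2) ^ 2 * a j * coefE (cx fun q => ψ q.1 q.2) (-j) := by
    obtain ⟨k, m⟩ := j
    rw [huz, Prod.neg_mk, hψ.coefO_deriv]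
    push_cast
    linear_combination (-(Real.pi * m) ^ 2 * a (k, m) * coefE (cx fun q => ψ q.1 q.2) (-k, -m)) * Complex.I_mul_I
  rw [e5, hP, flux, key, ← ha]
  split_ifs <;> ring

end
end HydrostaticNS

namespace HydrostaticNS
noncomputable section


/-! ### Ordinary differential equations with bounded Lipschitz fields -/

section ODE

variable {E : Type*} [NormedAddCommGroup E] [NormedSpace ℝ E]

lemma exists_solution_of_lipschitz [CompleteSpace E] {f : ℝ → E → E} {K L : NNReal}
    (hL : ∀ t, LipschitzWith K (f t)) (hc : ∀ x, Continuous fun t => f t x)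
    (hb : ∀ t x, ‖f t x‖ ≤ L) (x₀ : E) {T : ℝ} (hT : 0 ≤ T) :
    ∃ α : ℝ → E, α 0 = x₀ ∧ ∀ t ∈ Icc 0 T, HasDerivAt α (f t (α t)) t := by
  -- The field is solved on a larger interval so that derivatives at `0` and `T` are two-sided.
  have h0 : (0 : ℝ) ∈ Icc (-1) (T + 1) := ⟨by norm_num, by linarith⟩
  have hp : IsPicardLindelof f (⟨0, h0⟩ : Icc (-1 : ℝ) (T + 1)) x₀
      (L * (T + 1).toNNReal) 0 L K := by
    refine ⟨fun t _ => (hL t).lipschitzOnWith, fun x _ => (hc x).continuousOn, fun t _ x _ => hb t x, ?_⟩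
    have : max (T + 1 - 0) (0 - (-1 : ℝ)) = T + 1 := by
      rw [max_eq_left]
      · ring
      · linarith
    simp only [this]
    rw [NNReal.coe_zero, sub_zero, NNReal.coe_mul, Real.coe_toNNReal _ (by linarith)]
  obtain ⟨α, h1, h2⟩ := hp.exists_eq_forall_mem_Icc_hasDerivWithinAt₀
  refine ⟨α, h1, fun t ht => ?_⟩
  exact (h2 t ⟨by linarith [ht.1], by linarith [ht.2]⟩).hasDerivAt
    (Icc_mem_nhds (by linarith [ht.1]) (by linarith [ht.2]))

/-- If `S` commutes with the field, then `S ∘ α` solves the same equation with the same initial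
value, and uniqueness applies. -/
lemma solution_invariant {f : E → E} {K : NNReal} (hL : LipschitzWith K f) (S : E →L[ℝ] E)
    (hS : ∀ x, f (S x) = S (f x)) {α : ℝ → E} {T : ℝ}
    (hα : ∀ t ∈ Icc 0 T, HasDerivAt α (f (α t)) t) (h0 : S (α 0) = α 0) :
    ∀ t ∈ Icc 0 T, S (α t) = α t := by
  have hd : ∀ t ∈ Icc 0 T, HasDerivAt (fun t => S (α t)) (f (S (α t))) t := fun t ht => by
    rw [hS]
    exact S.hasFDerivAt.comp_hasDerivAt t (hα t ht)
  exact ODE_solution_unique_of_mem_Icc_right (v := fun _ => f) (s := fun _ => univ) (K := K)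
    (fun t _ => hL.lipschitzOnWith)
    (fun t ht => (hd t ht).continuousAt.continuousWithinAt)
    (fun t ht => (hd t ⟨ht.1, ht.2.le⟩).hasDerivWithinAt) (fun _ _ => mem_univ _)
    (fun t ht => (hα t ht).continuousAt.continuousWithinAt)
    (fun t ht => (hα t ⟨ht.1, ht.2.le⟩).hasDerivWithinAt) (fun _ _ => mem_univ _) h0

end ODE

/-! ### Symmetries and cancellation in the advection term -/

lemma advTerm_conj (a b : ℤ × ℤ → ℂ) (j i : ℤ × ℤ) :
    advTerm (fun j => (starRingEnd ℂ) (a (-j))) (fun j => (starRingEnd ℂ) (b (-j))) j i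
      = (starRingEnd ℂ) (advTerm a b (-j) (-i)) := by
  simp only [advTerm, map_mul, Complex.conj_I, Complex.conj_ofReal, map_sub, map_div₀,
    Complex.conj_ofNat, Prod.fst_sub, Prod.snd_sub, Prod.fst_neg, Prod.snd_neg,
    map_intCast]
  rw [show -(j - i) = -j - -i by abel]
  push_cast
  rw [div_neg]
  ring

lemma advec_conj (a b : ℤ × ℤ → ℂ) (j : ℤ × ℤ) :
    advec (fun j => (starRingEnd ℂ) (a (-j))) (fun j => (starRingEnd ℂ) (b (-j))) j
      = (starRingEnd ℂ) (advec a b (-j)) := by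
  simp only [advec, Prod.snd_neg, neg_eq_zero]
  split_ifs
  · simp
  · simp only [advTerm_conj]
    rw [Complex.conj_tsum]
    exact (Equiv.neg (ℤ × ℤ)).tsum_eq fun i => (starRingEnd ℂ) (advTerm a b (-j) i)

lemma advec_refl (a b : ℤ × ℤ → ℂ) (j : ℤ × ℤ) :
    advec (fun j => a (j.1, -j.2)) (fun j => b (j.1, -j.2)) j = advec a b (j.1, -j.2) := by
  simp only [advec, neg_eq_zero]
  split_ifs
  · rfl
  · rw [← ((Equiv.refl ℤ).prodCongr (Equiv.neg ℤ)).tsum_eq]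
    congr 1 with i
    simp only [advTerm, Equiv.prodCongr_apply, Prod.map, Equiv.refl_apply, Equiv.neg_apply,
      Prod.fst_sub, Prod.snd_sub, neg_neg, Prod.mk.eta]
    rw [show (((j.1 - i.1, -(j.2 - -i.2)) : ℤ × ℤ)) = (j.1, -j.2) - i by
      ext <;> simp; ring]
    push_cast
    rw [div_neg]
    ring_nf

/-- The velocity `(u, -∫₀ᶻ ∂_x u)` is divergence free, so transport is skew-symmetric. In
coefficients: for each fixed transporting mode `i` the substitution `j ↦ i - j` changes the sign of
the summand. Reality of `u` turns `conj (a j)` into `a (-j)`. -/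
lemma sum_conj_mul_advec {J : Finset (ℤ × ℤ)} {a : ℤ × ℤ → ℂ} (hs : ∀ j, j ∉ J → a j = 0)
    (h0 : ∀ k, a (k, 0) = 0) (hr : ∀ j, a (-j) = (starRingEnd ℂ) (a j)) :
    ∑ j ∈ J, (starRingEnd ℂ) (a j) * advec a a j = 0 := by
  have h1 : ∀ j, (starRingEnd ℂ) (a j) * advec a a j = ∑ i ∈ J, a (-j) * advTerm a a j i := fun j => by
    rw [← hr, ← Finset.mul_sum, advec]
    split_ifs with hj
    · have : a (-j) = 0 := by
        rw [show -j = (-j.1, 0) by ext <;> simp [hj]]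
        exact h0 _
      rw [this, zero_mul, zero_mul]
    · rw [tsum_eq_sum]
      intro i hi
      rw [advTerm, hs i hi, zero_mul, mul_zero]
  simp only [h1]
  rw [Finset.sum_comm]
  refine Finset.sum_eq_zero fun i _ => ?_
  have h2 : ∀ j, j ∉ J → a (-j) * advTerm a a j i = 0 := fun j hj => by
    rw [hr, hs j hj, map_zero, zero_mul]
  rw [← tsum_eq_sum (L := SummationFilter.unconditional _) h2]
  have h3 : ∀ j, a (-(i - j)) * advTerm a a (i - j) i = -(a (-j) * advTerm a a j i) := fun j => by
    rcases eq_or_ne i.2 0 with hi | hi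
    · have : a i = 0 := by rw [← h0 i.1, ← hi]
      simp [advTerm, this]
    · have hi' : (i.2 : ℂ) ≠ 0 := by exact_mod_cast hi
      simp only [advTerm, neg_sub, sub_sub_cancel_left]
      push_cast [Prod.fst_neg, Prod.snd_neg, Prod.fst_sub, Prod.snd_sub]
      field_simp
      ring
  have h4 := (Equiv.subLeft i).tsum_eq fun j => a (-j) * advTerm a a j i
  simp only [Equiv.subLeft_apply, h3, tsum_neg] at h4
  exact self_eq_neg.1 h4.symm

/-! ### Galerkin approximations -/

section Galerkin

variable {J : Finset (ℤ × ℤ)}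

/-- Extension by zero of finitely many coefficients. -/
def extZ (x : J → ℂ) (j : ℤ × ℤ) : ℂ := if h : j ∈ J then x ⟨j, h⟩ else 0

lemma extZ_coe (x : J → ℂ) (j : J) : extZ x j = x j := by simp [extZ]

lemma extZ_of_notMem (x : J → ℂ) {j : ℤ × ℤ} (h : j ∉ J) : extZ x j = 0 := by simp [extZ, h]

lemma contDiff_extZ (j : ℤ × ℤ) : ContDiff ℝ ∞ fun x : J → ℂ => extZ x j := by
  by_cases h : j ∈ J
  · simp only [extZ, h, dite_true]; fun_prop
  · simp only [extZ, h, dite_false]; fun_prop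

lemma advec_extZ (x : J → ℂ) {j : ℤ × ℤ} (hj : j.2 ≠ 0) :
    advec (extZ x) (extZ x) j = ∑ i ∈ J, advTerm (extZ x) (extZ x) j i := by
  rw [advec, if_neg hj, tsum_eq_sum]
  intro i hi
  rw [advTerm, extZ_of_notMem x hi, zero_mul, mul_zero]

/-- A smooth cutoff of the ball of radius `R` in the space of coefficients. -/
def ballCutoff (R : ℝ) (x : J → ℂ) : ℝ := Real.smoothTransition (2 - (∑ j, ‖x j‖ ^ 2) / R ^ 2)

/-- The Galerkin vector field, cut off outside a ball. -/
def galerkinField (J : Finset (ℤ × ℤ)) (ν R : ℝ) (x : J → ℂ) (j : J) : ℂ :=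
  (ballCutoff R x : ℂ) * -flux ν (extZ x) j

lemma contDiff_galerkinField (hJ : ∀ j ∈ J, j.2 ≠ 0) (ν R : ℝ) :
    ContDiff ℝ ∞ (galerkinField J ν R) := by
  have h1 : ContDiff ℝ ∞ (ballCutoff R (J := J)) := by
    unfold ballCutoff
    refine Real.smoothTransition.contDiff.comp (contDiff_const.sub (ContDiff.div_const ?_ _))
    exact ContDiff.sum fun j _ => (contDiff_apply ℝ ℂ j).norm_sq ℝ
  refine contDiff_pi.2 fun j => ?_
  unfold galerkinField
  refine (Complex.ofRealCLM.contDiff.comp h1).mul (ContDiff.neg ?_)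
  simp only [flux, advec_extZ _ (hJ j j.2)]
  refine ContDiff.add (ContDiff.sum fun i _ => ?_) (contDiff_const.mul (contDiff_extZ _))
  unfold advTerm
  exact contDiff_const.mul ((contDiff_extZ _).mul (contDiff_extZ _))

lemma hasCompactSupport_galerkinField (ν : ℝ) {R : ℝ} (hR : 0 < R) :
    HasCompactSupport (galerkinField J ν R) := by
  refine HasCompactSupport.intro (isCompact_closedBall 0 (2 * R)) fun x hx => ?_
  have h1 : ∃ j, 2 * R < ‖x j‖ := by
    by_contra! h
    exact hx (by simpa using (pi_norm_le_iff_of_nonneg (by positivity)).2 h)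
  obtain ⟨j, hj⟩ := h1
  have h2 : ‖x j‖ ^ 2 ≤ ∑ j, ‖x j‖ ^ 2 :=
    Finset.single_le_sum (f := fun j => ‖x j‖ ^ 2) (fun _ _ => by positivity) (Finset.mem_univ j)
  have h3 : ballCutoff R x = 0 := by
    refine Real.smoothTransition.zero_of_nonpos ?_
    rw [sub_nonpos, le_div_iff₀ (by positivity)]
    nlinarith
  ext i
  simp [galerkinField, h3]

/-- The polynomial field is made globally Lipschitz by a cutoff. The `ℓ²` energy of the solution is
nonincreasing, because the advection cancels and the viscosity has a sign, so the region where the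
cutoff acts is never reached. Reality and evenness are preserved because the field commutes with the
two symmetries. -/
lemma exists_galerkin {ν : ℝ} (hν : 0 ≤ ν) (hJn : ∀ j ∈ J, -j ∈ J)
    (hJr : ∀ j ∈ J, (j.1, -j.2) ∈ J) (hJ0 : ∀ j ∈ J, j.2 ≠ 0) {a₀ : ℤ × ℤ → ℂ}
    (hs : ∀ j, j ∉ J → a₀ j = 0) (hn : ∀ j, a₀ (-j) = (starRingEnd ℂ) (a₀ j))
    (hr : ∀ k m, a₀ (k, -m) = a₀ (k, m)) {T : ℝ} (hT : 0 ≤ T) :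
    ∃ a : ℝ → ℤ × ℤ → ℂ, a 0 = a₀ ∧ (∀ t j, j ∉ J → a t j = 0) ∧
      ∀ t ∈ Icc 0 T, (∀ j, a t (-j) = (starRingEnd ℂ) (a t j)) ∧ (∀ k m, a t (k, -m) = a t (k, m)) ∧
        ∀ j ∈ J, HasDerivAt (fun t => a t j) (-flux ν (a t) j) t := by
  set x₀ : J → ℂ := fun j => a₀ j with hx₀
  -- The cutoff equals `1` where the energy is at most `R²`, hence wherever it is at most its
  -- initial value. Adding `1` keeps `R` positive for zero data.
  set R : ℝ := Real.sqrt (∑ j : J, ‖x₀ j‖ ^ 2 + 1) with hR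
  have hR2 : R ^ 2 = ∑ j : J, ‖x₀ j‖ ^ 2 + 1 := Real.sq_sqrt (by positivity)
  have hRpos : 0 < R := Real.sqrt_pos.2 (by positivity)
  have hsm := contDiff_galerkinField hJ0 ν R
  obtain ⟨K, hK⟩ := hsm.lipschitzWith_of_hasCompactSupport
    (hasCompactSupport_galerkinField ν hRpos) (by simp)
  obtain ⟨L, hL⟩ := hsm.continuous.bounded_above_of_compact_support
    (hasCompactSupport_galerkinField ν hRpos)
  obtain ⟨x, hx0, hx⟩ := exists_solution_of_lipschitz (f := fun _ => galerkinField J ν R)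
    (L := L.toNNReal) (fun _ => hK) (fun _ => continuous_const)
    (fun _ x => (hL x).trans (Real.le_coe_toNNReal L)) x₀ hT
  have hext0 : extZ x₀ = a₀ := by
    ext j
    by_cases h : j ∈ J
    · simp [extZ, h, hx₀]
    · rw [extZ_of_notMem _ h, hs j h]
  -- invariance under conjugation
  let σ : J ≃ J := ⟨fun j => ⟨-j, hJn j j.2⟩, fun j => ⟨-j, hJn j j.2⟩, fun j => by simp, fun j => by simp⟩
  let ρ : J ≃ J := ⟨fun j => ⟨(j.1.1, -j.1.2), hJr j j.2⟩, fun j => ⟨(j.1.1, -j.1.2), hJr j j.2⟩,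
    fun j => by simp, fun j => by simp⟩
  let S : (J → ℂ) →L[ℝ] (J → ℂ) := LinearMap.toContinuousLinearMap
    { toFun := fun x j => (starRingEnd ℂ) (x (σ j))
      map_add' := fun x y => by ext j; simp
      map_smul' := fun c x => by ext j; simp }
  let P : (J → ℂ) →L[ℝ] (J → ℂ) := LinearMap.toContinuousLinearMap
    { toFun := fun x j => x (ρ j)
      map_add' := fun x y => by ext j; simp
      map_smul' := fun c x => by ext j; simp }
  have hSx : ∀ x j, S x j = (starRingEnd ℂ) (x (σ j)) := fun _ _ => rfl
  have hPx : ∀ x j, P x j = x (ρ j) := fun _ _ => rfl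
  have hSe : ∀ x, extZ (S x) = fun j => (starRingEnd ℂ) (extZ x (-j)) := fun x => by
    ext j
    by_cases h : j ∈ J
    · have h' := hJn j h
      simp only [extZ, h, h', dite_true]
      rfl
    · have h' : -j ∉ J := fun h' => h (by simpa using hJn _ h')
      simp [extZ, h, h']
  have hPe : ∀ x, extZ (P x) = fun j => extZ x (j.1, -j.2) := fun x => by
    ext j
    by_cases h : j ∈ J
    · have h' := hJr j h
      simp only [extZ, h, h', dite_true]
      rfl
    · have h' : (j.1, -j.2) ∉ J := fun h' => h (by simpa using hJr _ h')
      simp [extZ, h, h']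
  have hSc : ∀ x, ballCutoff R (S x) = ballCutoff R x := fun x => by
    simp only [ballCutoff, hSx, RCLike.norm_conj]
    rw [σ.sum_comp fun j => ‖x j‖ ^ 2]
  have hPc : ∀ x, ballCutoff R (P x) = ballCutoff R x := fun x => by
    simp only [ballCutoff, hPx]
    rw [ρ.sum_comp fun j => ‖x j‖ ^ 2]
  have hSF : ∀ x, galerkinField J ν R (S x) = S (galerkinField J ν R x) := fun x => by
    ext j
    simp only [galerkinField, hSc, hSx, hSe, flux, advec_conj, map_mul, map_neg, map_add, map_pow,
      Complex.conj_ofReal]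
    simp [σ]
  have hPF : ∀ x, galerkinField J ν R (P x) = P (galerkinField J ν R x) := fun x => by
    ext j
    simp only [galerkinField, hPc, hPx, hPe, flux, advec_refl]
    simp [ρ]
  have iS := solution_invariant hK S hSF hx (by
    ext j
    rw [hSx, hx0, hx₀]
    exact (by simpa [σ] using (congrArg (starRingEnd ℂ) (hn j)) : _))
  have iP := solution_invariant hK P hPF hx (by
    ext j
    rw [hPx, hx0, hx₀]
    exact hr j.1.1 j.1.2)
  have hn' : ∀ t ∈ Icc 0 T, ∀ j, extZ (x t) (-j) = (starRingEnd ℂ) (extZ (x t) j) := fun t ht j => by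
    have := congrFun (hSe (x t)) j
    rw [iS t ht] at this
    rw [this]; simp
  have hr' : ∀ t ∈ Icc 0 T, ∀ k m, extZ (x t) (k, -m) = extZ (x t) (k, m) := fun t ht k m => by
    have := congrFun (hPe (x t)) (k, m)
    rw [iP t ht] at this
    exact this.symm
  -- the ball is never left
  have hd : ∀ t ∈ Icc 0 T, ∀ j : J, HasDerivAt (fun t => x t j) (galerkinField J ν R (x t) j) t :=
    fun t ht j => (hasDerivAt_pi.1 (hx t ht)) j
  have hE : ∀ t ∈ Icc 0 T, HasDerivAt (fun t => ∑ j, ‖x t j‖ ^ 2)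
      (∑ j, 2 * ((starRingEnd ℂ) (x t j) * galerkinField J ν R (x t) j).re) t := fun t ht => by
    refine HasDerivAt.fun_sum fun j _ => ?_
    have := (hd t ht j).norm_sq
    refine this.congr_deriv ?_
    rw [Complex.inner, mul_comm (galerkinField J ν R (x t) j)]
  have hneg : ∀ t ∈ Icc 0 T, ∑ j, 2 * ((starRingEnd ℂ) (x t j) * galerkinField J ν R (x t) j).re ≤ 0 :=
    fun t ht => by
    have h1 := sum_conj_mul_advec (J := J) (fun j hj => extZ_of_notMem (x t) hj)
      (fun k => extZ_of_notMem (x t) fun h => hJ0 _ h rfl) (hn' t ht)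
    rw [← Finset.sum_coe_sort] at h1
    have h2 : ∀ j : J, (starRingEnd ℂ) (x t j) * galerkinField J ν R (x t) j
        = (ballCutoff R (x t) : ℂ) * (-((starRingEnd ℂ) (extZ (x t) j) * advec (extZ (x t)) (extZ (x t)) j)
          - ((ν * (Real.pi * j.1.2) ^ 2 * ‖x t j‖ ^ 2 : ℝ) : ℂ)) := fun j => by
      have : (starRingEnd ℂ) (x t j) * x t j = ((‖x t j‖ ^ 2 : ℝ) : ℂ) := by
        rw [mul_comm, Complex.mul_conj, Complex.normSq_eq_norm_sq]
      rw [galerkinField, flux, extZ_coe]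
      push_cast at this ⊢
      linear_combination (-(ballCutoff R (x t) : ℂ) * ν * (Real.pi * j.1.2) ^ 2) * this
    rw [← Finset.mul_sum, ← Complex.re_sum]
    simp only [h2]
    rw [← Finset.mul_sum, Finset.sum_sub_distrib, Finset.sum_neg_distrib, h1, neg_zero, zero_sub,
      ← Complex.ofReal_sum, ← Complex.ofReal_neg, ← Complex.ofReal_mul, Complex.ofReal_re]
    have h3 : 0 ≤ ballCutoff R (x t) := Real.smoothTransition.nonneg _
    have h4 : 0 ≤ ∑ j : J, ν * (Real.pi * j.1.2) ^ 2 * ‖x t j‖ ^ 2 :=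
      Finset.sum_nonneg fun j _ => by positivity
    nlinarith [mul_nonneg h3 h4]
  have hanti : AntitoneOn (fun t => ∑ j, ‖x t j‖ ^ 2) (Icc 0 T) := by
    refine antitoneOn_of_deriv_nonpos (convex_Icc 0 T)
      (fun t ht => (hE t ht).continuousAt.continuousWithinAt)
      (fun t ht => ?_) (fun t ht => ?_)
    · exact (hE t (interior_subset ht)).differentiableAt.differentiableWithinAt
    · rw [(hE t (interior_subset ht)).deriv]
      exact hneg t (interior_subset ht)
  have hcut : ∀ t ∈ Icc 0 T, ballCutoff R (x t) = 1 := fun t ht => by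
    refine Real.smoothTransition.one_of_one_le ?_
    have h1 := hanti ⟨le_rfl, hT⟩ ht ht.1
    simp only [hx0] at h1
    have : (∑ j, ‖x t j‖ ^ 2) / R ^ 2 ≤ 1 := by
      rw [div_le_one (by positivity), hR2]
      linarith
    linarith
  refine ⟨fun t => extZ (x t), by simp only [hx0, hext0], fun t j hj => extZ_of_notMem _ hj,
    fun t ht => ⟨hn' t ht, hr' t ht, fun j hj => ?_⟩⟩
  have h1 := hd t ht ⟨j, hj⟩
  have h2 : (fun t => extZ (x t) j) = fun t => x t ⟨j, hj⟩ := by ext t; simp [extZ, hj]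
  rw [h2]
  convert h1 using 1
  rw [galerkinField, hcut t ht]
  simp

end Galerkin

end
end HydrostaticNS

namespace HydrostaticNS
noncomputable section


/-! ### Exponential weights -/

/-- The exponential weight `e^{τ 2π|k|}`. -/
def ew (τ : ℝ) (k : ℤ) : ℝ≥0∞ := ENNReal.ofReal (Real.exp (τ * waveNumber k))

lemma one_le_ew {τ : ℝ} (hτ : 0 ≤ τ) (k : ℤ) : 1 ≤ ew τ k := by
  rw [ew, ← ENNReal.ofReal_one]
  exact ENNReal.ofReal_le_ofReal (Real.one_le_exp (mul_nonneg hτ (waveNumber_nonneg k)))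

lemma ew_le {τ : ℝ} (hτ : 0 ≤ τ) (k i : ℤ) : ew τ k ≤ ew τ i * ew τ (k - i) := by
  rw [ew, ew, ew, ← ENNReal.ofReal_mul (Real.exp_pos _).le, ← Real.exp_add, ← mul_add]
  exact ENNReal.ofReal_le_ofReal (Real.exp_le_exp.2
    (mul_le_mul_of_nonneg_left (waveNumber_le k i) hτ))

/-- By the triangle inequality for wave numbers the exponential weight is submultiplicative, so
analytic estimates follow from the Sobolev ones applied to weighted moduli. This is where a
nonnegative radius is indispensable. -/
lemma ew_mul_conv_le {τ : ℝ} (hτ : 0 ≤ τ) (X Y : ℤ × ℤ → ℝ≥0∞) (j : ℤ × ℤ) :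
    ew τ j.1 * conv X Y j ≤ conv (fun i => ew τ i.1 * X i) (fun i => ew τ i.1 * Y i) j := by
  rw [conv, conv, ← ENNReal.tsum_mul_left]
  refine ENNReal.tsum_le_tsum fun i => ?_
  calc ew τ j.1 * (X i * Y (j - i)) ≤ ew τ i.1 * ew τ (j.1 - i.1) * (X i * Y (j - i)) := by
        gcongr; exact ew_le hτ _ _
    _ = _ := by rw [Prod.fst_sub]; ring

lemma ew_mul_maj_le {τ : ℝ} (hτ : 0 ≤ τ) (D E : ℤ × ℤ → ℝ≥0∞) (j : ℤ × ℤ) :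
    ew τ j.1 * maj D E j ≤ maj (fun i => ew τ i.1 * D i) (fun i => ew τ i.1 * E i) j := by
  rw [maj, mul_add, maj]
  refine add_le_add ((ew_mul_conv_le hτ _ _ j).trans (le_of_eq ?_))
    ((ew_mul_conv_le hτ _ _ j).trans (le_of_eq ?_))
  · congr 2 with i; ring
  · congr 2 with i
    · ring
    · ring

lemma gw_eq (r τ : ℝ) (k : ℤ) (hr : 0 ≤ r) : gw r τ k = (wv k ^ r * ew τ k) ^ 2 := by
  rw [gw, wv, ew, ENNReal.ofReal_rpow_of_nonneg (waveNumber_nonneg k) hr,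
    ← ENNReal.ofReal_mul (Real.rpow_nonneg (waveNumber_nonneg k) _), ← ENNReal.ofReal_pow
      (mul_nonneg (Real.rpow_nonneg (waveNumber_nonneg k) _) (Real.exp_pos _).le), mul_pow,
    ← Real.exp_nat_mul, ← Real.rpow_natCast, ← Real.rpow_mul (waveNumber_nonneg k)]
  congr 3
  · push_cast; ring
  · push_cast; ring

/-! ### Real weights and finite sums -/

/-- The weight of `‖·‖²_{r,0,τ}`. -/
def cE (r τ : ℝ) (j : ℤ × ℤ) : ℝ := waveNumber j.1 ^ (2 * r) * Real.exp (2 * τ * waveNumber j.1) + 1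

/-- The weight of `‖∂_z ·‖²_{r,0,τ}`. -/
def cZ (r τ : ℝ) (j : ℤ × ℤ) : ℝ := cE r τ j * (Real.pi * j.2) ^ 2

/-- The weight of `‖A^{r+1/2} e^{τA} ·‖²`. -/
def cX (r τ : ℝ) (j : ℤ × ℤ) : ℝ :=
  waveNumber j.1 ^ (2 * (r + 1 / 2)) * Real.exp (2 * τ * waveNumber j.1)

/-- The weight of the quantity that controls the loss of analyticity. -/
def cF (r τ : ℝ) (j : ℤ × ℤ) : ℝ :=
  (max 1 (waveNumber j.1) ^ r * Real.exp (τ * waveNumber j.1) * j.2) ^ 2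

lemma cE_nonneg (r τ : ℝ) (j : ℤ × ℤ) : 0 ≤ cE r τ j :=
  add_nonneg (mul_nonneg (Real.rpow_nonneg (waveNumber_nonneg _) _) (Real.exp_pos _).le) zero_le_one

lemma cZ_nonneg (r τ : ℝ) (j : ℤ × ℤ) : 0 ≤ cZ r τ j := mul_nonneg (cE_nonneg r τ j) (sq_nonneg _)

lemma cX_nonneg (r τ : ℝ) (j : ℤ × ℤ) : 0 ≤ cX r τ j :=
  mul_nonneg (Real.rpow_nonneg (waveNumber_nonneg _) _) (Real.exp_pos _).le

lemma cF_nonneg (r τ : ℝ) (j : ℤ × ℤ) : 0 ≤ cF r τ j := sq_nonneg _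

lemma one_le_pi_mul_sq {m : ℤ} (hm : m ≠ 0) : (1 : ℝ) ≤ (Real.pi * m) ^ 2 := by
  have h1 : (1 : ℝ) ≤ |(m : ℝ)| := by exact_mod_cast Int.one_le_abs hm
  rw [mul_pow, ← sq_abs (m : ℝ)]
  have h2 : 1 ≤ Real.pi := by linarith [Real.pi_gt_three]
  nlinarith [mul_self_nonneg (Real.pi - 1), mul_self_nonneg (|(m : ℝ)| - 1)]

lemma cE_le_cZ (r τ : ℝ) {j : ℤ × ℤ} (hj : j.2 ≠ 0) : cE r τ j ≤ cZ r τ j :=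
  le_mul_of_one_le_right (cE_nonneg r τ j) (one_le_pi_mul_sq hj)

lemma cF_le_cZ (r τ : ℝ) (j : ℤ × ℤ) : cF r τ j ≤ cZ r τ j := by
  have h1 : (max 1 (waveNumber j.1) ^ r * Real.exp (τ * waveNumber j.1)) ^ 2 ≤ cE r τ j := by
    rw [cE]
    rcases eq_or_ne j.1 0 with hk | hk
    · rw [hk, waveNumber_zero]
      simp only [mul_zero, Real.exp_zero, mul_one, zero_le_one, max_eq_left, Real.one_rpow, one_pow]
      have : 0 ≤ (0 : ℝ) ^ (2 * r) := Real.rpow_nonneg le_rfl _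
      linarith
    · rw [max_eq_right (one_le_waveNumber hk), mul_pow, ← Real.exp_nat_mul, ← Real.rpow_natCast,
        ← Real.rpow_mul (waveNumber_nonneg _)]
      refine le_trans (le_of_eq ?_) (le_add_of_nonneg_right zero_le_one)
      push_cast
      congr 2
      · ring
      · ring
  rw [cF, cZ, mul_pow _ (j.2 : ℝ), mul_pow Real.pi]
  refine mul_le_mul h1 ?_ (sq_nonneg _) (cE_nonneg r τ j)
  refine le_mul_of_one_le_left (sq_nonneg _) ?_
  nlinarith [Real.pi_gt_three]

/-- A finite weighted sum of squares of coefficients. -/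
def wsum (J : Finset (ℤ × ℤ)) (c : ℤ × ℤ → ℝ) (a : ℤ × ℤ → ℂ) : ℝ := ∑ j ∈ J, c j * ‖a j‖ ^ 2

lemma wsum_nonneg {J : Finset (ℤ × ℤ)} {c : ℤ × ℤ → ℝ} (hc : ∀ j, 0 ≤ c j) (a : ℤ × ℤ → ℂ) :
    0 ≤ wsum J c a := Finset.sum_nonneg fun j _ => mul_nonneg (hc j) (sq_nonneg _)

lemma wsum_mono {J : Finset (ℤ × ℤ)} {c d : ℤ × ℤ → ℝ} (h : ∀ j ∈ J, c j ≤ d j) (a : ℤ × ℤ → ℂ) :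
    wsum J c a ≤ wsum J d a :=
  Finset.sum_le_sum fun j hj => mul_le_mul_of_nonneg_right (h j hj) (sq_nonneg _)

lemma ofReal_wsum {J : Finset (ℤ × ℤ)} {c : ℤ × ℤ → ℝ} (hc : ∀ j, 0 ≤ c j) {a : ℤ × ℤ → ℂ}
    (hs : ∀ j, j ∉ J → a j = 0) :
    ENNReal.ofReal (wsum J c a) = ∑' j, ENNReal.ofReal (c j) * ‖a j‖ₑ ^ 2 := by
  rw [wsum, ENNReal.ofReal_sum_of_nonneg fun j _ => mul_nonneg (hc j) (sq_nonneg _), tsum_eq_sum]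
  · refine Finset.sum_congr rfl fun j _ => ?_
    rw [ENNReal.ofReal_mul (hc j), ENNReal.ofReal_pow (norm_nonneg _), ofReal_norm]
  · intro j hj
    rw [hs j hj]; simp

/-- The constant in the trilinear estimate. -/
def triE (r : ℝ) : ℝ≥0∞ := 2 ^ (r - 1 / 2) * (4 * (cV * cH (r - 1 / 2)))

lemma triE_ne_top {r : ℝ} (hr : 1 < r) : triE r ≠ ⊤ := by
  refine ENNReal.mul_ne_top (ENNReal.rpow_ne_top_of_nonneg (by linarith) (by simp))
    (ENNReal.mul_ne_top (by simp) (ENNReal.mul_ne_top cV_ne_top (cH_ne_top (by linarith))))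

/-- The weight of order `2r` is divided unequally, `r + 1/2` on `a` and `r - 1/2` on the advection.
Each of the two lower-order factors then involves no more than `A^{r+1/2}`. -/
lemma tsum_trilinear_le {r τ : ℝ} (hr : 1 < r) (hτ : 0 ≤ τ) {a : ℤ × ℤ → ℂ}
    (h0 : ∀ k, a (k, 0) = 0) :
    ∑' j, gw r τ j.1 * (‖a j‖ₑ * ‖advec a a j‖ₑ) ≤ triE r *
      ((l2 fun j => qv j.1 ^ r * (em j.2 * (ew τ j.1 * ‖a j‖ₑ))) *
        ∑' j, gw (r + 1 / 2) τ j.1 * ‖a j‖ₑ ^ 2) := by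
  set D : ℤ × ℤ → ℝ≥0∞ := fun j => ew τ j.1 * ‖a j‖ₑ with hD
  have hD0 : ∀ k, D (k, 0) = 0 := fun k => by simp [hD, h0]
  have hX : ∑' j, gw (r + 1 / 2) τ j.1 * ‖a j‖ₑ ^ 2 = l2 (fun j => wv j.1 ^ (r + 1 / 2) * D j) ^ 2 := by
    rw [l2_sq]
    congr 1 with j
    rw [gw_eq _ _ _ (by linarith)]
    simp only [hD]; ring
  rw [hX]
  calc ∑' j, gw r τ j.1 * (‖a j‖ₑ * ‖advec a a j‖ₑ)
      ≤ ∑' j, (wv j.1 ^ (r + 1 / 2) * D j) * (wv j.1 ^ (r - 1 / 2) * maj D D j) := by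
        refine ENNReal.tsum_le_tsum fun j => ?_
        have e1 : wv j.1 ^ r * wv j.1 ^ r = wv j.1 ^ (r + 1 / 2) * wv j.1 ^ (r - 1 / 2) := by
          rw [← ENNReal.rpow_add_of_nonneg _ _ (by linarith) (by linarith),
            ← ENNReal.rpow_add_of_nonneg _ _ (by linarith) (by linarith)]
          congr 1; ring
        have e2 : ew τ j.1 * ‖advec a a j‖ₑ ≤ maj D D j :=
          (mul_le_mul_right (enorm_advec_le a a j) _).trans (ew_mul_maj_le hτ _ _ j)
        rw [gw_eq _ _ _ (by linarith)]
        calc _ = wv j.1 ^ r * wv j.1 ^ r * D j * (ew τ j.1 * ‖advec a a j‖ₑ) := by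
              simp only [hD]; ring
          _ ≤ wv j.1 ^ r * wv j.1 ^ r * D j * maj D D j := by gcongr
          _ = _ := by rw [e1]; ring
    _ ≤ _ := tsum_mul_le_l2 _ _
    _ ≤ l2 (fun j => wv j.1 ^ (r + 1 / 2) * D j) * (triE r * ((l2 fun j => qv j.1 ^ r * (em j.2 * D j))
          * l2 fun j => wv j.1 ^ (r + 1 / 2) * D j)) := by
        gcongr
        exact l2_weighted_maj_le hr hD0
    _ = _ := by ring

lemma ofReal_cF {r : ℝ} (hr : 0 ≤ r) (τ : ℝ) (j : ℤ × ℤ) :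
    ENNReal.ofReal (cF r τ j) = (qv j.1 ^ r * (em j.2 * ew τ j.1)) ^ 2 := by
  have hq : qv j.1 = ENNReal.ofReal (max 1 (waveNumber j.1)) := by
    rw [qv, wv, ← ENNReal.ofReal_one, ENNReal.ofReal_max]
  have hm : em j.2 = ENNReal.ofReal |(j.2 : ℝ)| := by
    rw [em, ← ofReal_norm, Int.norm_eq_abs]
  have hm0 : (0 : ℝ) ≤ max 1 (waveNumber j.1) := zero_le_one.trans (le_max_left _ _)
  rw [hq, hm, ew, ENNReal.ofReal_rpow_of_nonneg hm0 hr, ← ENNReal.ofReal_mul (abs_nonneg _),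
    ← ENNReal.ofReal_mul (Real.rpow_nonneg hm0 _), ← ENNReal.ofReal_pow (by positivity), cF]
  congr 1
  rw [mul_pow, mul_pow, mul_pow, mul_pow, sq_abs]
  ring

lemma l2_eq_ofReal_sqrt {r : ℝ} (hr : 0 ≤ r) (τ : ℝ) {J : Finset (ℤ × ℤ)} {a : ℤ × ℤ → ℂ}
    (hs : ∀ j, j ∉ J → a j = 0) :
    (l2 fun j => qv j.1 ^ r * (em j.2 * (ew τ j.1 * ‖a j‖ₑ)))
      = ENNReal.ofReal (Real.sqrt (wsum J (cF r τ) a)) := by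
  rw [l2, Real.sqrt_eq_rpow, ← ENNReal.ofReal_rpow_of_nonneg (wsum_nonneg (cF_nonneg r τ) a)
    (by norm_num), ofReal_wsum (cF_nonneg r τ) hs]
  congr 2 with j
  rw [ofReal_cF hr]
  ring

lemma abs_sum_trilinear_le {r τ : ℝ} (hr : 1 < r) (hτ : 0 ≤ τ) {J : Finset (ℤ × ℤ)}
    {a : ℤ × ℤ → ℂ} (hs : ∀ j, j ∉ J → a j = 0) (h0 : ∀ k, a (k, 0) = 0) :
    |∑ j ∈ J, waveNumber j.1 ^ (2 * r) * Real.exp (2 * τ * waveNumber j.1) *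
        ((starRingEnd ℂ) (a j) * advec a a j).re| ≤
      (triE r).toReal * Real.sqrt (wsum J (cF r τ) a) * wsum J (cX r τ) a := by
  have hX0 := wsum_nonneg (J := J) (cX_nonneg r τ) a
  have h1 := tsum_trilinear_le hr hτ h0
  rw [l2_eq_ofReal_sqrt (by linarith) τ hs, show (∑' j : ℤ × ℤ, gw (r + 1 / 2) τ j.1 * ‖a j‖ₑ ^ 2)
    = ENNReal.ofReal (wsum J (cX r τ) a) from (ofReal_wsum (cX_nonneg r τ) hs).symm,
    ← ENNReal.ofReal_toReal (triE_ne_top hr), ← ENNReal.ofReal_mul (Real.sqrt_nonneg _),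
    ← ENNReal.ofReal_mul ENNReal.toReal_nonneg, ← mul_assoc] at h1
  rw [← ENNReal.ofReal_le_ofReal_iff (by positivity)]
  refine le_trans ?_ h1
  refine le_trans ?_ (ENNReal.sum_le_tsum J)
  refine (ENNReal.ofReal_le_ofReal (Finset.abs_sum_le_sum_abs _ _)).trans ?_
  rw [ENNReal.ofReal_sum_of_nonneg fun _ _ => abs_nonneg _]
  refine Finset.sum_le_sum fun j _ => ?_
  have hw : 0 ≤ waveNumber j.1 ^ (2 * r) * Real.exp (2 * τ * waveNumber j.1) :=
    mul_nonneg (Real.rpow_nonneg (waveNumber_nonneg _) _) (Real.exp_pos _).le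
  rw [abs_mul, abs_of_nonneg hw, ENNReal.ofReal_mul hw, gw]
  gcongr
  refine (ENNReal.ofReal_le_ofReal (Complex.abs_re_le_norm _)).trans ?_
  rw [ofReal_norm, enorm_mul, ← ofReal_norm ((starRingEnd ℂ) (a j)), RCLike.norm_conj, ofReal_norm]

/-! ### The radius of analyticity of a Galerkin approximation -/

lemma abs_exp_sub_exp_le {x y b : ℝ} (hx : x ≤ b) (hy : y ≤ b) :
    |Real.exp x - Real.exp y| ≤ Real.exp b * |x - y| := by
  wlog h : y ≤ x generalizing x y
  · rw [abs_sub_comm, abs_sub_comm x]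
    exact this hy hx (le_of_not_ge h)
  rw [abs_of_nonneg (sub_nonneg.2 (Real.exp_le_exp.2 h)), abs_of_nonneg (sub_nonneg.2 h)]
  have h1 := Real.add_one_le_exp (y - x)
  have h2 : Real.exp y = Real.exp x * Real.exp (y - x) := by rw [← Real.exp_add]; ring_nf
  have h3 := Real.exp_le_exp.2 hx
  nlinarith [Real.exp_pos x, sub_nonneg.2 h]

/-- Reading the square root as a Euclidean norm makes it Lipschitz even at zero, which the square
root by itself is not. -/
lemma abs_sqrt_sum_sq_sub_le {ι : Type*} (s : Finset ι) (x y : ι → ℝ) :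
    |Real.sqrt (∑ j ∈ s, x j ^ 2) - Real.sqrt (∑ j ∈ s, y j ^ 2)| ≤ ∑ j ∈ s, |x j - y j| := by
  let X : EuclideanSpace ℝ s := WithLp.toLp 2 fun j => x j
  let Y : EuclideanSpace ℝ s := WithLp.toLp 2 fun j => y j
  have hX : ‖X‖ = Real.sqrt (∑ j ∈ s, x j ^ 2) := by
    rw [EuclideanSpace.norm_eq, ← Finset.sum_coe_sort s]
    simp [X]
  have hY : ‖Y‖ = Real.sqrt (∑ j ∈ s, y j ^ 2) := by
    rw [EuclideanSpace.norm_eq, ← Finset.sum_coe_sort s]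
    simp [Y]
  rw [← hX, ← hY]
  refine (abs_norm_sub_norm_le X Y).trans ?_
  rw [EuclideanSpace.norm_eq, ← Finset.sum_coe_sort s]
  refine Real.sqrt_le_iff.2 ⟨Finset.sum_nonneg fun _ _ => abs_nonneg _, ?_⟩
  have := Finset.sum_sq_le_sq_sum_of_nonneg (s := (Finset.univ : Finset s))
    (f := fun j : s => |x j - y j|) fun _ _ => abs_nonneg _
  simpa [X, Y] using this

lemma sqrt_wsum_cF_eq (r τ : ℝ) (J : Finset (ℤ × ℤ)) (a : ℤ × ℤ → ℂ) :
    Real.sqrt (wsum J (cF r τ) a) = Real.sqrt (∑ j ∈ J,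
      (max 1 (waveNumber j.1) ^ r * Real.exp (τ * waveNumber j.1) * j.2 * ‖a j‖) ^ 2) := by
  simp only [wsum, cF, mul_pow]

/-- The equation for the radius is scalar with a known Galerkin solution `a`. Truncating the radius
at `τ₀` inside the exponential makes the right side bounded and globally Lipschitz; the truncation
turns out to be inactive once the radius is known to decrease. -/
lemma exists_radius {r c τ₀ T : ℝ} (hc : 0 ≤ c) (hT : 0 ≤ T) (J : Finset (ℤ × ℤ))
    {a : ℝ → ℤ × ℤ → ℂ} (ha : ∀ j, ContinuousOn (fun t => a t j) (Icc 0 T)) {g : ℝ → ℝ}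
    (hg : Continuous g) {M : ℝ} (hgM : ∀ t, |g t| ≤ M) :
    ∃ τ : ℝ → ℝ, τ 0 = τ₀ ∧ ∀ t ∈ Icc 0 T, HasDerivAt τ
      (-(c * Real.sqrt (wsum J (cF r (min (τ t) τ₀)) (a t))) - g t) t := by
  obtain ⟨B, hB⟩ : ∃ B : ℝ, ∀ t ∈ Icc 0 T, ∀ j ∈ J, ‖a t j‖ ≤ B := by
    obtain ⟨B, hB⟩ := (isCompact_Icc (a := (0 : ℝ)) (b := T)).exists_bound_of_continuousOn
      (continuousOn_finsetSum J fun j _ => (ha j).norm)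
    refine ⟨B, fun t ht j hj => ?_⟩
    exact (Finset.single_le_sum (f := fun j => ‖a t j‖) (fun _ _ => norm_nonneg _) hj).trans
      ((le_abs_self _).trans (hB t ht))
  -- Time is projected onto `[0,T]`, outside of which nothing is known about `a`.
  set p : ℝ → ℝ := fun t => max 0 (min t T) with hp
  have hpm : ∀ t, p t ∈ Icc 0 T := fun t => ⟨le_max_left _ _, max_le hT (min_le_right _ _)⟩
  have hpc : Continuous p := by fun_prop
  have hB0 : J.Nonempty → 0 ≤ B := fun ⟨j, hj⟩ => (norm_nonneg _).trans (hB (p 0) (hpm 0) j hj)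
  set Z : ℝ → ℝ → ℝ := fun t τ => Real.sqrt (wsum J (cF r (min τ τ₀)) (a (p t))) with hZ
  set d : ℤ × ℤ → ℝ := fun j => max 1 (waveNumber j.1) ^ r with hd
  have hd0 : ∀ j, 0 ≤ d j := fun j => Real.rpow_nonneg (zero_le_one.trans (le_max_left _ _)) _
  set L : ℝ := ∑ j ∈ J, d j * (waveNumber j.1 * Real.exp (τ₀ * waveNumber j.1)) * |(j.2 : ℝ)| * B with hL
  have hL0 : 0 ≤ L := Finset.sum_nonneg fun j hj => by
    have := hd0 j
    have := waveNumber_nonneg j.1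
    have := hB0 ⟨j, hj⟩
    positivity
  have hlip : ∀ t σ τ, |Z t σ - Z t τ| ≤ L * |σ - τ| := fun t σ τ => by
    simp only [hZ, sqrt_wsum_cF_eq]
    refine (abs_sqrt_sum_sq_sub_le _ _ _).trans ?_
    rw [hL, Finset.sum_mul]
    refine Finset.sum_le_sum fun j hj => ?_
    have hw := waveNumber_nonneg j.1
    have h1 := abs_exp_sub_exp_le (mul_le_mul_of_nonneg_right (min_le_right σ τ₀) hw)
      (mul_le_mul_of_nonneg_right (min_le_right τ τ₀) hw)
    have h2 : |min σ τ₀ * waveNumber j.1 - min τ τ₀ * waveNumber j.1| ≤ waveNumber j.1 * |σ - τ| := by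
      rw [← sub_mul, abs_mul, abs_of_nonneg hw, mul_comm]
      refine mul_le_mul_of_nonneg_left ?_ hw
      simpa using abs_min_sub_min_le_max σ τ₀ τ τ₀
    have h3 := hB _ (hpm t) j hj
    rw [← sub_mul, ← sub_mul, ← mul_sub, abs_mul, abs_mul, abs_mul, abs_of_nonneg (hd0 j), abs_norm]
    calc d j * |Real.exp (min σ τ₀ * waveNumber j.1) - Real.exp (min τ τ₀ * waveNumber j.1)|
          * |(j.2 : ℝ)| * ‖a (p t) j‖
        ≤ d j * (Real.exp (τ₀ * waveNumber j.1) * (waveNumber j.1 * |σ - τ|)) * |(j.2 : ℝ)| * B := by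
          have := hd0 j
          gcongr
          exact h1.trans (by gcongr)
      _ = _ := by ring
  have hcont : ∀ τ, Continuous fun t => Z t τ := fun τ => by
    simp only [hZ, wsum]
    refine Real.continuous_sqrt.comp (continuous_finsetSum _ fun j _ => continuous_const.mul ?_)
    exact (((ha j).comp_continuous hpc hpm).norm).pow 2
  have hbd : ∀ t τ, |Z t τ| ≤ ∑ j ∈ J, d j * Real.exp (τ₀ * waveNumber j.1) * |(j.2 : ℝ)| * B := fun t τ => by
    simp only [hZ, sqrt_wsum_cF_eq]
    have h0 := abs_sqrt_sum_sq_sub_le J (fun j => max 1 (waveNumber j.1) ^ r *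
      Real.exp (min τ τ₀ * waveNumber j.1) * j.2 * ‖a (p t) j‖) (fun _ => 0)
    simp only [zero_pow two_ne_zero, Finset.sum_const_zero, Real.sqrt_zero, sub_zero] at h0
    refine h0.trans (Finset.sum_le_sum fun j hj => ?_)
    have hw := waveNumber_nonneg j.1
    have h3 := hB _ (hpm t) j hj
    rw [abs_mul, abs_mul, abs_mul, abs_of_nonneg (hd0 j), abs_norm, abs_of_pos (Real.exp_pos _)]
    have := hd0 j
    gcongr
    exact min_le_right _ _
  have hM : 0 ≤ M := (abs_nonneg _).trans (hgM 0)
  obtain ⟨τ, h1, h2⟩ := exists_solution_of_lipschitz (f := fun t τ => -(c * Z t τ) - g t)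
    (K := (c * L).toNNReal)
    (L := (c * (∑ j ∈ J, d j * Real.exp (τ₀ * waveNumber j.1) * |(j.2 : ℝ)| * B) + M).toNNReal)
    (fun t => LipschitzWith.of_dist_le_mul fun σ τ => by
      rw [Real.coe_toNNReal _ (mul_nonneg hc hL0), Real.dist_eq, Real.dist_eq]
      calc |-(c * Z t σ) - g t - (-(c * Z t τ) - g t)| = c * |Z t σ - Z t τ| := by
            rw [← abs_of_nonneg hc, ← abs_mul, ← abs_neg, abs_of_nonneg hc]; ring_nf
        _ ≤ c * (L * |σ - τ|) := mul_le_mul_of_nonneg_left (hlip t σ τ) hc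
        _ = _ := by ring)
    (fun τ => ((hcont τ).const_mul c |>.neg).sub hg)
    (fun t τ => by
      refine le_trans ?_ (Real.le_coe_toNNReal _)
      rw [Real.norm_eq_abs]
      refine (abs_sub _ _).trans (add_le_add ?_ (hgM t))
      rw [abs_neg, abs_mul, abs_of_nonneg hc]
      exact mul_le_mul_of_nonneg_left (hbd t τ) hc) τ₀ hT
  refine ⟨τ, h1, fun t ht => ?_⟩
  have h3 := h2 t ht
  have hpt : p t = t := by simp [hp, ht.1, ht.2]
  simpa only [hZ, hpt] using h3

end
end HydrostaticNS

namespace HydrostaticNS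
noncomputable section


/-! ### Energy estimates for Galerkin approximations -/

lemma ofReal_add_lintegral_le {F F' q : ℝ → ℝ} {T : ℝ}
    (hF : ∀ t ∈ Icc 0 T, HasDerivAt F (F' t) t) (hq : ContinuousOn q (Icc 0 T))
    (hq0 : ∀ t ∈ Icc 0 T, 0 ≤ q t) (h : ∀ t ∈ Icc 0 T, F' t ≤ -q t)
    (hF0 : ∀ t ∈ Icc 0 T, 0 ≤ F t) {t : ℝ} (ht : t ∈ Icc 0 T) :
    ENNReal.ofReal (F t) + ∫⁻ s in Ioo 0 t, ENNReal.ofReal (q s) ≤ ENNReal.ofReal (F 0) := by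
  have hsub : Icc 0 t ⊆ Icc 0 T := Icc_subset_Icc_right ht.2
  have hqi : IntegrableOn q (Icc 0 t) := (hq.mono hsub).integrableOn_Icc
  have h1 := intervalIntegral.sub_le_integral_of_hasDeriv_right_of_le ht.1
    (fun s hs => (hF s (hsub hs)).continuousAt.continuousWithinAt)
    (fun s hs => (hF s (hsub (Ioo_subset_Icc_self hs))).hasDerivWithinAt) hqi.neg
    (fun s hs => h s (hsub (Ioo_subset_Icc_self hs)))
  rw [← ofReal_integral_eq_lintegral_ofReal (hqi.mono_set Ioo_subset_Icc_self)
    ((ae_restrict_iff' measurableSet_Ioo).2 (.of_forall fun s hs => hq0 s (hsub (Ioo_subset_Icc_self hs)))),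
    ← ENNReal.ofReal_add (hF0 t ht) (setIntegral_nonneg measurableSet_Ioo
      fun s hs => hq0 s (hsub (Ioo_subset_Icc_self hs)))]
  refine ENNReal.ofReal_le_ofReal ?_
  rw [← integral_Ioc_eq_integral_Ioo, ← intervalIntegral.integral_of_le ht.1]
  simp only [Pi.neg_apply, intervalIntegral.integral_neg] at h1
  linarith

section

variable {J : Finset (ℤ × ℤ)} {a : ℝ → ℤ × ℤ → ℂ} {τ : ℝ → ℝ} {r ν : ℝ}

/-- Differentiating the exponential weight produces the term with `τ'`, of half a derivative more.
The summand `1` in the weight `cE` is the `L²` part, for which the advection cancels. -/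
lemma hasDerivAt_energy (hr : 0 ≤ r) {τ' t : ℝ}
    (ha : ∀ j ∈ J, HasDerivAt (fun t => a t j) (-flux ν (a t) j) t) (hτ : HasDerivAt τ τ' t)
    (hs : ∀ j, j ∉ J → a t j = 0) (h0 : ∀ k, a t (k, 0) = 0)
    (hn : ∀ j, a t (-j) = (starRingEnd ℂ) (a t j)) :
    HasDerivAt (fun t => wsum J (cE r (τ t)) (a t))
      (2 * τ' * wsum J (cX r (τ t)) (a t) - 2 * ν * wsum J (cZ r (τ t)) (a t)
        - 2 * ∑ j ∈ J, waveNumber j.1 ^ (2 * r) * Real.exp (2 * τ t * waveNumber j.1) *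
        ((starRingEnd ℂ) (a t j) * advec (a t) (a t) j).re) t := by
  have h1 : ∀ j ∈ J, HasDerivAt (fun t => cE r (τ t) j * ‖a t j‖ ^ 2)
      (2 * τ' * (cX r (τ t) j * ‖a t j‖ ^ 2) - 2 * ν * (cZ r (τ t) j * ‖a t j‖ ^ 2)
        - 2 * (waveNumber j.1 ^ (2 * r) * Real.exp (2 * τ t * waveNumber j.1) *
        ((starRingEnd ℂ) (a t j) * advec (a t) (a t) j).re)
        - 2 * ((starRingEnd ℂ) (a t j) * advec (a t) (a t) j).re) t := fun j hj => by
    have d1 : HasDerivAt (fun t => cE r (τ t) j)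
        (waveNumber j.1 ^ (2 * r) * (Real.exp (2 * τ t * waveNumber j.1) * (2 * τ' * waveNumber j.1))) t :=
      ((((hτ.const_mul 2).mul_const _).exp).const_mul _).add_const 1
    have d2 := (ha j hj).norm_sq
    refine (d1.mul d2).congr_deriv ?_
    have e1 : waveNumber j.1 ^ (2 * (r + 1 / 2)) = waveNumber j.1 ^ (2 * r) * waveNumber j.1 := by
      rw [show 2 * (r + 1 / 2) = 2 * r + 1 by ring,
        Real.rpow_add_of_nonneg (waveNumber_nonneg _) (by linarith) zero_le_one, Real.rpow_one]
    have e2 : (-flux ν (a t) j * (starRingEnd ℂ) (a t j)).re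
        = -((starRingEnd ℂ) (a t j) * advec (a t) (a t) j).re - ν * (Real.pi * j.2) ^ 2 * ‖a t j‖ ^ 2 := by
      have e3 : a t j * (starRingEnd ℂ) (a t j) = ((‖a t j‖ ^ 2 : ℝ) : ℂ) := by
        rw [Complex.mul_conj, Complex.normSq_eq_norm_sq]
      have e4 : -flux ν (a t) j * (starRingEnd ℂ) (a t j)
          = -((starRingEnd ℂ) (a t j) * advec (a t) (a t) j)
            - ((ν * (Real.pi * j.2) ^ 2 * ‖a t j‖ ^ 2 : ℝ) : ℂ) := by
        rw [flux]
        push_cast at e3 ⊢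
        linear_combination (-(ν : ℂ) * (Real.pi * j.2) ^ 2) * e3
      rw [e4, Complex.sub_re, Complex.neg_re, Complex.ofReal_re]
    rw [Complex.inner, e2, cX, e1, cZ, cE]
    ring
  have h2 := HasDerivAt.fun_sum h1
  refine h2.congr_deriv ?_
  have h3 : ∑ j ∈ J, ((starRingEnd ℂ) (a t j) * advec (a t) (a t) j).re = 0 := by
    rw [← Complex.re_sum, sum_conj_mul_advec hs h0 hn, Complex.zero_re]
  rw [Finset.sum_sub_distrib, Finset.sum_sub_distrib, Finset.sum_sub_distrib, ← Finset.mul_sum,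
    ← Finset.mul_sum, ← Finset.mul_sum, ← Finset.mul_sum, h3, wsum, wsum]
  ring

lemma continuousOn_wsum {c : ℝ → ℤ × ℤ → ℝ} {s : Set ℝ} (hc : ∀ j, Continuous fun σ => c σ j)
    (ha : ∀ j ∈ J, ContinuousOn (fun t => a t j) s) (hτ : ContinuousOn τ s) :
    ContinuousOn (fun t => wsum J (c (τ t)) (a t)) s :=
  continuousOn_finsetSum J fun j hj => ((hc j).comp_continuousOn hτ).mul ((ha j hj).norm.pow 2)

end

lemma continuous_cZ (r : ℝ) (j : ℤ × ℤ) : Continuous fun σ => cZ r σ j := by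
  unfold cZ cE; fun_prop

lemma continuous_cX (r : ℝ) (j : ℤ × ℤ) : Continuous fun σ => cX r σ j := by
  unfold cX; fun_prop

/-- The constant in the equation for the radius of analyticity. -/
def triR (r : ℝ) : ℝ := (triE r).toReal + 1

lemma triR_pos (r : ℝ) : 0 < triR r := add_pos_of_nonneg_of_pos ENNReal.toReal_nonneg one_pos

/-- The additional dissipation rate. -/
def gain (G t : ℝ) : ℝ := 2 * Real.exp (-(2 * t / G))

lemma gain_pos (G t : ℝ) : 0 < gain G t := by unfold gain; positivity

lemma continuous_gain (G : ℝ) : Continuous (gain G) := by unfold gain; fun_prop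

/-- A Galerkin approximation on `[0,T]` together with its radius of analyticity, and the
estimates that are uniform in the dimension. -/
structure IsApprox (r ν τ₀ K T : ℝ) (J : Finset (ℤ × ℤ)) (a₀ : ℤ × ℤ → ℂ)
    (a : ℝ → ℤ × ℤ → ℂ) (τ : ℝ → ℝ) : Prop where
  initial : a 0 = a₀
  support : ∀ t j, j ∉ J → a t j = 0
  conj : ∀ t ∈ Icc 0 T, ∀ j, a t (-j) = (starRingEnd ℂ) (a t j)
  even : ∀ t ∈ Icc 0 T, ∀ k m, a t (k, -m) = a t (k, m)
  hasDerivAt : ∀ t ∈ Icc 0 T, ∀ j ∈ J, HasDerivAt (fun t => a t j) (-flux ν (a t) j) t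
  continuousOn : ContinuousOn τ (Icc 0 T)
  radius_zero : τ 0 = τ₀
  radius_ge : ∀ t ∈ Icc 0 T, τ₀ - 2 * (triR r * K / ν) ≤ τ t
  radius_modulus : ∀ μ > 0, ∀ s ∈ Icc 0 T, ∀ t ∈ Icc s T, τ t ≤ τ s ∧
    τ s - τ t ≤ triR r * K ^ 2 / (4 * ν * μ) + (triR r * μ / 2 + 2) * (t - s)
  energy : ∀ t ∈ Icc 0 T, ENNReal.ofReal (wsum J (cE r (τ t)) (a t)) + ∫⁻ s in Ioo 0 t,
    ENNReal.ofReal (2 * (ν * wsum J (cZ r (τ s)) (a s)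
      + gain (triR r * K / ν) s * wsum J (cX r (τ s)) (a s))) ≤ ENNReal.ofReal (K ^ 2)
  decay : ∀ t ∈ Icc 0 T, ENNReal.ofReal (Real.exp (ν * t) * wsum J (cE r (τ t)) (a t))
    + ∫⁻ s in Ioo 0 t, ENNReal.ofReal (ν * (Real.exp (ν * s) * wsum J (cZ r (τ s)) (a s)))
      ≤ ENNReal.ofReal (K ^ 2)
  decay' : ∀ t ∈ Icc 0 T, wsum J (cE r (τ t)) (a t) ≤ Real.exp (-(2 * ν * t)) * K ^ 2

/-- Only square integrability in time of the vertical derivative is available, while the radius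
equation contains its first power; `μ` is chosen differently for the two uses. -/
lemma mul_le_young {z μ : ℝ} (hμ : 0 < μ) : z ≤ (μ + z ^ 2 / μ) / 2 := by
  rw [le_div_iff₀ two_pos, ← sub_nonneg]
  have : μ + z ^ 2 / μ - z * 2 = (z - μ) ^ 2 / μ := by field_simp; ring
  rw [this]; positivity

lemma antitoneOn_of_hasDerivAt_nonpos {F F' : ℝ → ℝ} {T : ℝ}
    (hF : ∀ t ∈ Icc 0 T, HasDerivAt F (F' t) t) (h : ∀ t ∈ Icc 0 T, F' t ≤ 0) :
    AntitoneOn F (Icc 0 T) := by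
  refine antitoneOn_of_deriv_nonpos (convex_Icc 0 T)
    (fun t ht => (hF t ht).continuousAt.continuousWithinAt) (fun t ht => ?_) (fun t ht => ?_)
  · exact (hF t (interior_subset ht)).differentiableAt.differentiableWithinAt
  · rw [(hF t (interior_subset ht)).deriv]
    exact h t (interior_subset ht)

/-- While `τ ≥ 0`, the trilinear estimate and the equation for `τ` give a differential inequality
for the energy with dissipation `2(νZ + gain · X)`. Since `Z` dominates both the energy and `F²`,
this bounds the total decrease of `τ` by `2G`, less than `τ₀`; hence `τ` can never reach zero. All
remaining bounds integrate the same inequality against suitable factors in time. -/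
lemma exists_isApprox {r ν τ₀ K T : ℝ} (hr : 1 < r) (hν : 0 < ν) (hK : 0 < K)
    (hsmall : 2 * (triR r * K / ν) < τ₀) (hT : 0 ≤ T) {J : Finset (ℤ × ℤ)}
    (hJn : ∀ j ∈ J, -j ∈ J) (hJr : ∀ j ∈ J, (j.1, -j.2) ∈ J) (hJ0 : ∀ j ∈ J, j.2 ≠ 0)
    {a₀ : ℤ × ℤ → ℂ} (hs : ∀ j, j ∉ J → a₀ j = 0) (hn : ∀ j, a₀ (-j) = (starRingEnd ℂ) (a₀ j))
    (hev : ∀ k m, a₀ (k, -m) = a₀ (k, m)) (hE : wsum J (cE r τ₀) a₀ ≤ K ^ 2) :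
    ∃ a τ, IsApprox r ν τ₀ K T J a₀ a τ := by
  obtain ⟨a, ha0, has, ha⟩ := exists_galerkin hν.le hJn hJr hJ0 hs hn hev hT
  set c := triR r with hc
  have hcpos : 0 < c := triR_pos r
  set G := c * K / ν with hG
  have hGpos : 0 < G := by positivity
  have hac : ∀ j, ContinuousOn (fun t => a t j) (Icc 0 T) := fun j => by
    by_cases hj : j ∈ J
    · exact fun t ht => ((ha t ht).2.2 j hj).continuousAt.continuousWithinAt
    · simp only [has _ j hj]
      exact continuousOn_const
  -- the radius; the gain is made bounded by evaluating it at nonnegative times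
  have hgb : ∀ t, |gain G (max 0 t)| ≤ 2 := fun t => by
    rw [abs_of_pos (gain_pos _ _), gain]
    have : Real.exp (-(2 * max 0 t / G)) ≤ 1 := by
      rw [Real.exp_le_one_iff, neg_nonpos]
      have := le_max_left 0 t
      positivity
    linarith
  obtain ⟨τ, hτ0, hτ⟩ := exists_radius (r := r) (c := c) (τ₀ := τ₀) hcpos.le hT J hac
    ((continuous_gain G).comp (continuous_const.max continuous_id)) hgb
  have hτ' : ∀ t ∈ Icc 0 T, HasDerivAt τ
      (-(c * Real.sqrt (wsum J (cF r (min (τ t) τ₀)) (a t))) - gain G t) t := fun t ht => by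
    have := hτ t ht
    simpa [max_eq_right ht.1] using this
  have hτc : ContinuousOn τ (Icc 0 T) := fun t ht => (hτ' t ht).continuousAt.continuousWithinAt
  have hanti : AntitoneOn τ (Icc 0 T) := antitoneOn_of_hasDerivAt_nonpos hτ' fun t ht => by
    have := gain_pos G t
    have := Real.sqrt_nonneg (wsum J (cF r (min (τ t) τ₀)) (a t))
    nlinarith
  have hτle : ∀ t ∈ Icc 0 T, τ t ≤ τ₀ := fun t ht => by
    rw [← hτ0]; exact hanti ⟨le_rfl, hT⟩ ht ht.1
  -- The truncation at `τ₀` may now be dropped, since the radius decreases from `τ₀`.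
  replace hτ : ∀ t ∈ Icc 0 T, HasDerivAt τ
      (-(c * Real.sqrt (wsum J (cF r (τ t)) (a t))) - gain G t) t := fun t ht => by
    have := hτ' t ht
    rwa [min_eq_left (hτle t ht)] at this
  have h0 : ∀ t k, a t (k, 0) = 0 := fun t k => has t _ fun h => hJ0 _ h rfl
  set E : ℝ → ℝ := fun t => wsum J (cE r (τ t)) (a t) with hEdef
  set Z : ℝ → ℝ := fun t => wsum J (cZ r (τ t)) (a t) with hZdef
  set X : ℝ → ℝ := fun t => wsum J (cX r (τ t)) (a t) with hXdef
  set F : ℝ → ℝ := fun t => Real.sqrt (wsum J (cF r (τ t)) (a t)) with hFdef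
  have hE0 : ∀ t, 0 ≤ E t := fun t => wsum_nonneg (cE_nonneg _ _) _
  have hZ0 : ∀ t, 0 ≤ Z t := fun t => wsum_nonneg (cZ_nonneg _ _) _
  have hX0 : ∀ t, 0 ≤ X t := fun t => wsum_nonneg (cX_nonneg _ _) _
  -- The Poincaré inequality: every mode in `J` has `m ≠ 0`, so `(πm)² ≥ 1`.
  have hEZ : ∀ t, E t ≤ Z t := fun t => wsum_mono (fun j hj => cE_le_cZ _ _ (hJ0 j hj)) _
  have hFZ : ∀ t, F t ^ 2 ≤ Z t := fun t => by
    rw [hFdef, Real.sq_sqrt (wsum_nonneg (cF_nonneg _ _) _)]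
    exact wsum_mono (fun j _ => cF_le_cZ _ _ j) _
  have hZc : ContinuousOn Z (Icc 0 T) := continuousOn_wsum (continuous_cZ r) (fun j _ => hac j) hτc
  have hXc : ContinuousOn X (Icc 0 T) := continuousOn_wsum (continuous_cX r) (fun j _ => hac j) hτc
  have hEK : E 0 ≤ K ^ 2 := by simp only [hEdef, hτ0, ha0]; exact hE
  -- the energy inequality as long as the radius is nonnegative
  have hdE : ∀ t ∈ Icc 0 T, ∃ E', HasDerivAt E E' t ∧
      (0 ≤ τ t → E' ≤ -(2 * (ν * Z t + gain G t * X t))) := fun t ht => by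
    have h1 := hasDerivAt_energy (by linarith : (0 : ℝ) ≤ r) (ha t ht).2.2 (hτ t ht) (has t) (h0 t) (ha t ht).1
    refine ⟨_, h1, fun hp => ?_⟩
    have h2 := abs_sum_trilinear_le hr hp (has t) (h0 t)
    have h3 : (triE r).toReal * F t * X t ≤ c * F t * X t := by
      have : 0 ≤ F t := Real.sqrt_nonneg _
      have := hX0 t
      have : (triE r).toReal ≤ c := by rw [hc, triR]; linarith
      gcongr
    have h4 := neg_abs_le (∑ j ∈ J, waveNumber j.1 ^ (2 * r) * Real.exp (2 * τ t * waveNumber j.1) *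
        ((starRingEnd ℂ) (a t j) * advec (a t) (a t) j).re)
    simp only [hFdef, hXdef, hZdef] at h3 ⊢
    linarith
  choose! E' hE' hE'le using hdE
  -- a lower bound of the radius, as long as it is nonnegative
  have hlow : ∀ t₁ ∈ Icc 0 T, (∀ t ∈ Icc 0 t₁, 0 ≤ τ t) → τ₀ - 2 * G ≤ τ t₁ := fun t₁ ht₁ hp => by
    -- A Lyapunov function that does not increase. The energy term pays for `e^{νt} F²/K`, the
    -- exponential `e^{-νt}` for the other half of Young's inequality, and the last term is the
    -- primitive of `-gain`. At time zero the three added terms are at most `G/2`, `G/2` and `G`,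
    -- which gives the loss `2G`.
    have hd : ∀ t ∈ Icc 0 t₁, HasDerivAt (fun t => -(τ t) + c / (2 * K * ν) * (Real.exp (ν * t) * E t)
          + c * K / (2 * ν) * Real.exp (-(ν * t)) + G * Real.exp (-(2 * t / G)))
        (-(-(c * F t) - gain G t) + c / (2 * K * ν) * (Real.exp (ν * t) * (ν * 1) * E t
          + Real.exp (ν * t) * E' t) + c * K / (2 * ν) * (Real.exp (-(ν * t)) * -(ν * 1))
          + G * (Real.exp (-(2 * t / G)) * -(2 * 1 / G))) t := fun t ht => by
      have ht' : t ∈ Icc 0 T := ⟨ht.1, ht.2.trans ht₁.2⟩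
      refine (((hτ t ht').neg.add ?_).add ?_).add ?_
      · exact (((hasDerivAt_id t).const_mul ν).exp.mul (hE' t ht')).const_mul _
      · exact (((hasDerivAt_id t).const_mul ν).neg.exp).const_mul _
      · exact ((((hasDerivAt_id t).const_mul 2).div_const G).neg.exp).const_mul _
    have hmono := antitoneOn_of_hasDerivAt_nonpos hd fun t ht => by
      have ht' : t ∈ Icc 0 T := ⟨ht.1, ht.2.trans ht₁.2⟩
      have h1 := hE'le t ht' (hp t ht)
      have h2 := hEZ t
      have h3 := mul_nonneg (gain_pos G t).le (hX0 t)
      have h4 : ν * E t + E' t ≤ -(ν * F t ^ 2) := by nlinarith [hFZ t]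
      have hep := Real.exp_pos (ν * t)
      -- Young's inequality with `μ = K e^{-νt}`, the expected size of `F`: then both halves have
      -- integral bounded by a multiple of `K/ν`.
      have h5 : F t ≤ (K * Real.exp (-(ν * t)) + F t ^ 2 / (K * Real.exp (-(ν * t)))) / 2 :=
        mul_le_young (by positivity)
      have h6 : F t ^ 2 / (K * Real.exp (-(ν * t))) = Real.exp (ν * t) * F t ^ 2 / K := by
        rw [Real.exp_neg]; field_simp
      rw [h6] at h5
      have h7 : c / (2 * K * ν) * (Real.exp (ν * t) * (ν * E t + E' t))
          ≤ c / (2 * K * ν) * (Real.exp (ν * t) * -(ν * F t ^ 2)) := by gcongr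
      have h8 : c / (2 * K * ν) * (Real.exp (ν * t) * -(ν * F t ^ 2))
          = -(c * (Real.exp (ν * t) * F t ^ 2 / K) / 2) := by field_simp
      have h9 : G * (Real.exp (-(2 * t / G)) * -(2 * 1 / G)) = -gain G t := by
        rw [gain]; field_simp
      have h10 : c * K / (2 * ν) * (Real.exp (-(ν * t)) * -(ν * 1)) = -(c * (K * Real.exp (-(ν * t))) / 2) := by
        field_simp
      rw [h9, h10]
      have h11 := mul_le_mul_of_nonneg_left h5 hcpos.le
      nlinarith
    have h1 := hmono ⟨le_rfl, ht₁.1⟩ ⟨ht₁.1, le_rfl⟩ ht₁.1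
    simp only [mul_zero, Real.exp_zero, zero_div, neg_zero, one_mul, mul_one, hτ0] at h1
    have h2 : c / (2 * K * ν) * E 0 ≤ G / 2 := by
      calc c / (2 * K * ν) * E 0 ≤ c / (2 * K * ν) * K ^ 2 := by gcongr
        _ = G / 2 := by rw [hG]; field_simp
    have h3 : c * K / (2 * ν) = G / 2 := by rw [hG]; field_simp
    have h4 : 0 ≤ c / (2 * K * ν) * (Real.exp (ν * t₁) * E t₁) := by
      have := hE0 t₁; positivity
    have h5 : 0 ≤ c * K / (2 * ν) * Real.exp (-(ν * t₁)) := by positivity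
    have h6 : 0 ≤ G * Real.exp (-(2 * t₁ / G)) := by positivity
    linarith
  -- At the first time where `τ ≤ 0` the lower bound is still valid, because `τ ≥ 0` up to then; but
  -- that bound is strictly positive.
  have hpos : ∀ t ∈ Icc 0 T, 0 ≤ τ t := by
    by_contra! hcon
    obtain ⟨t₂, ht₂, hneg⟩ := hcon
    have hcl : IsCompact (Icc 0 T ∩ τ ⁻¹' Iic 0) :=
      isCompact_Icc.of_isClosed_subset (hτc.preimage_isClosed_of_isClosed isClosed_Icc isClosed_Iic)
        inter_subset_left
    obtain ⟨t₁, ht₁, hmin⟩ := hcl.exists_isLeast ⟨t₂, ht₂, hneg.le⟩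
    have hall : ∀ t ∈ Icc 0 t₁, 0 ≤ τ t := fun t ht => by
      by_contra! hlt
      have h1 := hmin ⟨⟨ht.1, ht.2.trans ht₁.1.2⟩, hlt.le⟩
      have h2 : t = t₁ := le_antisymm ht.2 h1
      subst h2
      -- the radius is negative at its first nonpositive value: use continuity
      have hc0 : ContinuousOn τ (Icc 0 t) := hτc.mono (Icc_subset_Icc_right ht₁.1.2)
      have h3 : (0 : ℝ) ∈ Icc (τ t) (τ 0) := ⟨hlt.le, by rw [hτ0]; linarith⟩
      obtain ⟨s, hs, hs0⟩ := intermediate_value_Icc' ht₁.1.1 hc0 h3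
      have h4 := hmin ⟨⟨hs.1, hs.2.trans ht₁.1.2⟩, (by simp [hs0] : s ∈ τ ⁻¹' Iic 0)⟩
      have h5 : s = t := le_antisymm hs.2 h4
      rw [h5] at hs0
      linarith
    have h1 := hlow t₁ ht₁.1 hall
    have h2 : τ t₁ ≤ 0 := ht₁.2
    linarith
  have hEd : ∀ t ∈ Icc 0 T, E' t ≤ -(2 * (ν * Z t + gain G t * X t)) := fun t ht => hE'le t ht (hpos t ht)
  have hEd2 : ∀ t ∈ Icc 0 T, E' t ≤ -(2 * (ν * Z t)) := fun t ht => by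
    have h1 := hEd t ht
    have h3 := mul_nonneg (gain_pos G t).le (hX0 t)
    linarith
  have hEanti : AntitoneOn E (Icc 0 T) := antitoneOn_of_hasDerivAt_nonpos hE' fun t ht => by
    have := hEd2 t ht
    have := mul_nonneg hν.le (hZ0 t)
    linarith
  refine ⟨a, τ, ha0, has, fun t ht => (ha t ht).1, fun t ht => (ha t ht).2.1, fun t ht => (ha t ht).2.2,
    hτc, hτ0, fun t ht => hlow t ht fun s hs => hpos s ⟨hs.1, hs.2.trans ht.2⟩,
    fun μ hμ s hs t ht => ⟨hanti hs ⟨hs.1.trans ht.1, ht.2⟩ ht.1, ?_⟩, fun t ht => ?_, fun t ht => ?_,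
    fun t ht => ?_⟩
  -- Young's inequality with a constant `μ`: the part `F²/μ` is paid by the energy, the rest is
  -- linear in time with `gain ≤ 2`. This yields equicontinuity although `F` has no uniform
  -- pointwise bound.
  · have hd : ∀ t ∈ Icc 0 T, HasDerivAt (fun t => -(τ t) + c / (4 * ν * μ) * E t - (c * μ / 2 + 2) * t)
        (-(-(c * F t) - gain G t) + c / (4 * ν * μ) * E' t - (c * μ / 2 + 2) * 1) t := fun t ht =>
      ((hτ t ht).neg.add ((hE' t ht).const_mul _)).sub ((hasDerivAt_id t).const_mul _)
    have hmono := antitoneOn_of_hasDerivAt_nonpos hd fun t ht => by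
      have h1 : F t ≤ (μ + F t ^ 2 / μ) / 2 := mul_le_young hμ
      have h2 : c / (4 * ν * μ) * E' t ≤ c / (4 * ν * μ) * (-(2 * (ν * F t ^ 2))) := by
        gcongr
        refine (hEd2 t ht).trans ?_
        nlinarith [hFZ t]
      have h3 : c / (4 * ν * μ) * (-(2 * (ν * F t ^ 2))) = -(c * (F t ^ 2 / μ) / 2) := by
        field_simp; ring
      have h4 := (le_abs_self _).trans (hgb t)
      rw [max_eq_right ht.1] at h4
      have h5 := mul_le_mul_of_nonneg_left h1 hcpos.le
      nlinarith
    have h1 := hmono hs ⟨hs.1.trans ht.1, ht.2⟩ ht.1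
    simp only at h1
    have h2 : E s ≤ K ^ 2 := (hEanti ⟨le_rfl, hT⟩ hs hs.1).trans hEK
    have h3 : c / (4 * ν * μ) * E s ≤ c * K ^ 2 / (4 * ν * μ) := by
      rw [div_mul_eq_mul_div]; gcongr
    have h4 : 0 ≤ c / (4 * ν * μ) * E t := by have := hE0 t; positivity
    linarith
  · refine (ofReal_add_lintegral_le (F := E) (q := fun s => 2 * (ν * Z s + gain G s * X s)) hE'
      ?_ (fun s _ => ?_) hEd (fun s _ => hE0 s) ht).trans (ENNReal.ofReal_le_ofReal hEK)
    · exact continuousOn_const.mul ((continuousOn_const.mul hZc).add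
        ((continuous_gain G).continuousOn.mul hXc))
    · have := mul_nonneg hν.le (hZ0 s)
      have := mul_nonneg (gain_pos G s).le (hX0 s)
      linarith
  -- Half of the dissipation `2νZ` pays for the growth of `e^{νt}`, the other half is kept. In the
  -- next estimate all of it is spent, on `e^{2νt}`.
  · have hd : ∀ t ∈ Icc 0 T, HasDerivAt (fun t => Real.exp (ν * t) * E t)
        (Real.exp (ν * t) * (ν * 1) * E t + Real.exp (ν * t) * E' t) t := fun t ht =>
      ((hasDerivAt_id t).const_mul ν).exp.mul (hE' t ht)
    have h1 := ofReal_add_lintegral_le (q := fun s => ν * (Real.exp (ν * s) * Z s)) hd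
      ?_ (fun s _ => ?_) (fun s hs => ?_) (fun s _ => ?_) ht
    · refine h1.trans (ENNReal.ofReal_le_ofReal ?_)
      simpa using hEK
    · exact continuousOn_const.mul (ContinuousOn.mul (by fun_prop) hZc)
    · have := hZ0 s; positivity
    · have h1 := hEd2 s hs
      have h2 : ν * E s ≤ ν * Z s := mul_le_mul_of_nonneg_left (hEZ s) hν.le
      have h3 : Real.exp (ν * s) * (ν * E s + E' s) ≤ Real.exp (ν * s) * -(ν * Z s) :=
        mul_le_mul_of_nonneg_left (by linarith) (Real.exp_pos _).le
      nlinarith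
    · have := hE0 s; positivity
  · have hd : ∀ t ∈ Icc 0 T, HasDerivAt (fun t => Real.exp (2 * ν * t) * E t)
        (Real.exp (2 * ν * t) * (2 * ν * 1) * E t + Real.exp (2 * ν * t) * E' t) t := fun t ht =>
      ((hasDerivAt_id t).const_mul (2 * ν)).exp.mul (hE' t ht)
    have hmono := antitoneOn_of_hasDerivAt_nonpos hd fun s hs => by
      have h1 := hEd2 s hs
      have h2 : ν * E s ≤ ν * Z s := mul_le_mul_of_nonneg_left (hEZ s) hν.le
      have h3 : Real.exp (2 * ν * s) * (2 * ν * E s + E' s) ≤ 0 :=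
        mul_nonpos_of_nonneg_of_nonpos (Real.exp_pos _).le (by linarith)
      nlinarith
    have h1 := hmono ⟨le_rfl, hT⟩ ht ht.1
    simp only [mul_zero, Real.exp_zero, one_mul] at h1
    rw [Real.exp_neg, inv_mul_eq_div, le_div_iff₀ (Real.exp_pos _), mul_comm]
    exact h1.trans hEK

end
end HydrostaticNS

namespace HydrostaticNS
noncomputable section

open Filter Topology

/-! ### Compactness tools -/

/-- A diagonal argument: a bounded equicontinuous countable family of sequences of functions on
the line has a subsequence that converges pointwise everywhere. -/
lemma exists_subseq_tendsto {ι : Type*} [Countable ι] (f : ℕ → ι → ℝ → ℂ)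
    (hb : ∀ i t, ∃ B, ∀ n, ‖f n i t‖ ≤ B)
    (he : ∀ i, ∀ ε > 0, ∃ δ > 0, ∀ n s t, |s - t| < δ → ‖f n i s - f n i t‖ ≤ ε) :
    ∃ φ : ℕ → ℕ, StrictMono φ ∧ ∀ i t, ∃ l, Tendsto (fun n => f (φ n) i t) atTop (𝓝 l) := by
  choose B hB using hb
  let g : ℕ → ι × ℚ → ℂ := fun n p => f n p.1 p.2
  have hcomp : IsCompact (Set.pi univ fun p : ι × ℚ => Metric.closedBall (0 : ℂ) (B p.1 p.2)) :=
    isCompact_univ_pi fun p => isCompact_closedBall _ _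
  obtain ⟨l, -, φ, hφ, hl⟩ := hcomp.tendsto_subseq (x := g) fun n p _ => by
    simpa [g] using hB p.1 p.2 n
  refine ⟨φ, hφ, fun i t => ?_⟩
  have hq : ∀ q : ℚ, CauchySeq fun n => f (φ n) i q := fun q =>
    ((tendsto_pi_nhds.1 hl) (i, q)).cauchySeq
  refine cauchySeq_tendsto_of_complete (Metric.cauchySeq_iff'.2 fun ε hε => ?_)
  obtain ⟨δ, hδ, h⟩ := he i (ε / 4) (by positivity)
  obtain ⟨q, hq1, hq2⟩ := exists_rat_btwn (show t < t + δ by linarith)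
  have hqt : |t - q| < δ := by rw [abs_sub_comm, abs_of_pos (by linarith)]; linarith
  have hqt' : |(q : ℝ) - t| < δ := by rw [abs_sub_comm]; exact hqt
  obtain ⟨N, hN⟩ := Metric.cauchySeq_iff'.1 (hq q) (ε / 4) (by positivity)
  refine ⟨N, fun n hn => ?_⟩
  have h1 := h (φ n) t q hqt
  have h2 := hN n hn
  have h3 := h (φ N) q t hqt'
  rw [dist_eq_norm] at h2 ⊢
  calc ‖f (φ n) i t - f (φ N) i t‖
      = ‖(f (φ n) i t - f (φ n) i q) + (f (φ n) i q - f (φ N) i q) + (f (φ N) i q - f (φ N) i t)‖ := by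
        congr 1; ring
    _ ≤ _ := norm_add₃_le
    _ < ε := by linarith

/-- Superadditivity of the lower limit, so that energy and dissipation may be passed to the limit
separately. -/
lemma ennreal_add_le_of_liminf {x y C : ℝ≥0∞} {u v : ℕ → ℝ≥0∞} (hx : x ≤ liminf u atTop)
    (hy : y ≤ liminf v atTop) (h : ∀ᶠ n in atTop, u n + v n ≤ C) : x + y ≤ C := by
  refine (add_le_add hx hy).trans ?_
  rw [liminf_eq_iSup_iInf_of_nat, liminf_eq_iSup_iInf_of_nat, ENNReal.iSup_add_iSup_of_monotone
    (fun m n h => biInf_mono fun i hi => h.trans hi) (fun m n h => biInf_mono fun i hi => h.trans hi)]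
  refine iSup_le fun n => ?_
  obtain ⟨m, h1, h2⟩ := (h.and (eventually_ge_atTop n)).exists
  exact (add_le_add (iInf₂_le m h2) (iInf₂_le m h2)).trans h1

/-- Fatou's lemma for counting measure. -/
lemma tsum_liminf_le {ι : Type*} (f : ℕ → ι → ℝ≥0∞) (F : ι → ℝ≥0∞)
    (h : ∀ i, Tendsto (fun n => f n i) atTop (𝓝 (F i))) :
    ∑' i, F i ≤ liminf (fun n => ∑' i, f n i) atTop := by
  rw [ENNReal.tsum_eq_iSup_sum]
  refine iSup_le fun S => ?_
  rw [← (tendsto_finsetSum S fun i _ => h i).liminf_eq]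
  exact liminf_le_liminf (.of_forall fun n => ENNReal.sum_le_tsum S)

section

variable {ι : Type*} {μ : Measure ℝ} [IsFiniteMeasure μ]
  {f : ℕ → ℝ → ι → ℂ} {F : ℝ → ι → ℂ} {w : ι → ℝ≥0∞}

lemma tendsto_lintegral_enorm_sub (hm : ∀ n i, Measurable fun s => f n s i)
    (hF : ∀ i, Measurable fun s => F s i)
    (hlim : ∀ i, ∀ᵐ s ∂μ, Tendsto (fun n => f n s i) atTop (𝓝 (F s i)))
    (hb : ∀ i, ∃ B : ℝ, ∀ᶠ n in atTop, ∀ᵐ s ∂μ, ‖f n s i‖ ≤ B) (i : ι) :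
    Tendsto (fun n => ∫⁻ s, ‖f n s i - F s i‖ₑ ∂μ) atTop (𝓝 0) := by
  obtain ⟨B, hB⟩ := hb i
  have h0 : ∫⁻ _ : ℝ, (0 : ℝ≥0∞) ∂μ = 0 := lintegral_zero
  rw [← h0]
  refine tendsto_lintegral_filter_of_dominated_convergence (fun _ => ENNReal.ofReal (2 * B)) ?_ ?_ ?_ ?_
  · exact .of_forall fun n => ((hm n i).sub (hF i)).enorm
  · filter_upwards [hB] with n hn
    have hall : ∀ᵐ s ∂μ, ∀ᶠ n in atTop, ‖f n s i‖ ≤ B := by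
      obtain ⟨N, hN⟩ := eventually_atTop.1 hB
      have : ∀ᵐ s ∂μ, ∀ n, N ≤ n → ‖f n s i‖ ≤ B := by
        rw [ae_all_iff]; intro n
        by_cases h : N ≤ n
        · filter_upwards [hN n h] with s hs _ using hs
        · exact .of_forall fun s h' => absurd h' h
      filter_upwards [this] with s hs
      exact eventually_atTop.2 ⟨N, hs⟩
    filter_upwards [hn, hall, hlim i] with s h1 h2 h3
    rw [← ofReal_norm]
    refine ENNReal.ofReal_le_ofReal ((norm_sub_le _ _).trans ?_)
    have h4 := le_of_tendsto h3.norm h2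
    linarith
  · simp [lintegral_const, ENNReal.mul_ne_top]
  · filter_upwards [hlim i] with s hs
    have := (tendsto_sub_nhds_zero_iff.2 hs).enorm
    simpa using this

/-- Passage to the limit in an integral of series, under a tightness condition. -/
lemma tendsto_integral_tsum [Countable ι] (hm : ∀ n i, Measurable fun s => f n s i)
    (hF : ∀ i, Measurable fun s => F s i)
    (hlim : ∀ i, ∀ᵐ s ∂μ, Tendsto (fun n => f n s i) atTop (𝓝 (F s i)))
    (hb : ∀ i, ∃ B : ℝ, ∀ᶠ n in atTop, ∀ᵐ s ∂μ, ‖f n s i‖ ≤ B)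
    (hw1 : ∀ i, 1 ≤ w i) (hw : ∀ L : ℕ, {i | w i ≤ L}.Finite) {M : ℝ≥0∞} (hMt : M ≠ ⊤)
    (hM : ∀ᶠ n in atTop, ∫⁻ s, ∑' i, w i * ‖f n s i‖ₑ ∂μ ≤ M) :
    Tendsto (fun n => ∫ s, ∑' i, f n s i ∂μ) atTop (𝓝 (∫ s, ∑' i, F s i ∂μ)) := by
  classical
  have mf : ∀ n, Measurable fun s => ∑' i, w i * ‖f n s i‖ₑ := fun n =>
    Measurable.tsum fun i => (hm n i).enorm.const_mul _
  have mF : Measurable fun s => ∑' i, w i * ‖F s i‖ₑ :=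
    Measurable.tsum fun i => (hF i).enorm.const_mul _
  have hMF : ∫⁻ s, ∑' i, w i * ‖F s i‖ₑ ∂μ ≤ M := by
    calc ∫⁻ s, ∑' i, w i * ‖F s i‖ₑ ∂μ
        ≤ ∫⁻ s, liminf (fun n => ∑' i, w i * ‖f n s i‖ₑ) atTop ∂μ := by
          refine lintegral_mono_ae ?_
          filter_upwards [ae_all_iff.2 hlim] with s hs
          -- Multiplication by an infinite weight is not continuous at zero, so this case is
          -- separated: a nonzero limit there makes the lower limit infinite.
          by_cases hwt : ∃ i, w i = ⊤ ∧ F s i ≠ 0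
          · obtain ⟨i, hi, hi0⟩ := hwt
            have : ∀ᶠ n in atTop, ⊤ ≤ ∑' i, w i * ‖f n s i‖ₑ := by
              filter_upwards [(hs i).eventually_ne hi0] with n hn
              refine le_trans (le_of_eq ?_) (ENNReal.le_tsum i)
              rw [hi, ENNReal.top_mul (by simpa using hn)]
            exact le_top.trans ((liminf_const (f := atTop (α := ℕ)) (⊤ : ℝ≥0∞)).symm.le.trans
              (liminf_le_liminf this))
          · push Not at hwt
            have : ∀ i, Tendsto (fun n => if w i = ⊤ then 0 else w i * ‖f n s i‖ₑ) atTop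
                (𝓝 (w i * ‖F s i‖ₑ)) := fun i => by
              split_ifs with h
              · rw [hwt i h]; simp
              · exact ENNReal.Tendsto.const_mul (hs i).enorm (Or.inr h)
            refine (tsum_liminf_le _ _ this).trans (liminf_le_liminf (.of_forall fun n =>
              ENNReal.tsum_le_tsum fun i => ?_))
            split_ifs <;> simp
      _ ≤ liminf (fun n => ∫⁻ s, ∑' i, w i * ‖f n s i‖ₑ ∂μ) atTop := lintegral_liminf_le mf
      _ ≤ liminf (fun _ => M) atTop := liminf_le_liminf hM
      _ = M := liminf_const M
  have key : ∀ {G : ℝ → ι → ℂ}, (∀ i, Measurable fun s => G s i) →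
      ∫⁻ s, ∑' i, w i * ‖G s i‖ₑ ∂μ ≤ M → Integrable (fun s => ∑' i, G s i) μ ∧
        ∀ᵐ s ∂μ, Summable fun i => G s i := fun {G} hG hGM => by
    have h1 : ∫⁻ s, ∑' i, ‖G s i‖ₑ ∂μ ≤ M := (lintegral_mono fun s =>
      ENNReal.tsum_le_tsum fun i => le_mul_of_one_le_left' (hw1 i)).trans hGM
    refine ⟨⟨(Measurable.tsum hG).aestronglyMeasurable, ?_⟩, ?_⟩
    · exact (lintegral_mono fun s => enorm_tsum_le _).trans_lt (h1.trans_lt hMt.lt_top)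
    · filter_upwards [ae_lt_top (Measurable.tsum fun i => (hG i).enorm)
        (h1.trans_lt hMt.lt_top).ne] with s hs
      exact summable_of_tsum_enorm hs.ne
  obtain ⟨iF, sF⟩ := key hF hMF
  refine tendsto_integral_of_L1 _ iF.1 (hM.mono fun n hn => (key (hm n) hn).1) ?_
  rw [ENNReal.tendsto_nhds_zero]
  intro ε hε
  -- Indices of weight greater than `L` contribute at most `2M/L` to the `L¹` distance; only
  -- finitely many others remain, and these converge one by one.
  have hL : Tendsto (fun L : ℕ => ((L : ℝ≥0∞))⁻¹ * (M + M)) atTop (𝓝 0) := by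
    simpa using ENNReal.Tendsto.mul_const ENNReal.tendsto_inv_nat_nhds_zero
      (Or.inr (ENNReal.add_ne_top.2 ⟨hMt, hMt⟩))
  have hε2 : 0 < ε / 2 := ENNReal.half_pos hε.ne'
  obtain ⟨L, hL1, hL0⟩ := ((ENNReal.tendsto_nhds_zero.1 hL (ε / 2) hε2).and
    (eventually_gt_atTop 0)).exists
  set S := (hw L).toFinset with hS
  have hSt : Tendsto (fun n => ∑ i ∈ S, ∫⁻ s, ‖f n s i - F s i‖ₑ ∂μ) atTop (𝓝 0) := by
    have := tendsto_finsetSum S fun i _ => tendsto_lintegral_enorm_sub hm hF hlim hb i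
    simpa using this
  filter_upwards [hM, ENNReal.tendsto_nhds_zero.1 hSt (ε / 2) hε2] with n hn hn2
  obtain ⟨-, sf⟩ := key (hm n) hn
  have me : ∀ i ∈ S, Measurable fun s => ‖f n s i - F s i‖ₑ := fun i _ => ((hm n i).sub (hF i)).enorm
  have mm : Measurable fun s => ∑' i, w i * ‖f n s i‖ₑ + ∑' i, w i * ‖F s i‖ₑ := (mf n).add mF
  calc ∫⁻ s, ‖∑' i, f n s i - ∑' i, F s i‖ₑ ∂μ
      ≤ ∫⁻ s, ((∑ i ∈ S, ‖f n s i - F s i‖ₑ) + (L : ℝ≥0∞)⁻¹ * (∑' i, w i * ‖f n s i‖ₑ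
          + ∑' i, w i * ‖F s i‖ₑ)) ∂μ := by
        refine lintegral_mono_ae ?_
        filter_upwards [sf, sF] with s h1 h2
        rw [← h1.tsum_sub h2]
        refine (enorm_tsum_le _).trans ?_
        rw [← ENNReal.tsum_add, ← ENNReal.tsum_mul_left]
        have e : ∑ i ∈ S, ‖f n s i - F s i‖ₑ = ∑' i, if i ∈ S then ‖f n s i - F s i‖ₑ else 0 := by
          rw [tsum_eq_sum (s := S) fun i hi => if_neg hi]
          exact Finset.sum_congr rfl fun i hi => (if_pos hi).symm
        rw [e, ← ENNReal.tsum_add]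
        refine ENNReal.tsum_le_tsum fun i => ?_
        by_cases hi : i ∈ S
        · rw [if_pos hi]; exact le_self_add
        · rw [if_neg hi, zero_add, ← mul_add, ← mul_assoc]
          have hi' : (L : ℝ≥0∞) ≤ w i := by
            simp only [hS, Finite.mem_toFinset, mem_ofPred_eq, not_le] at hi
            exact hi.le
          refine enorm_sub_le.trans (le_mul_of_one_le_left' ?_)
          rw [← ENNReal.inv_mul_cancel (a := (L : ℝ≥0∞)) (by exact_mod_cast hL0.ne') (by simp)]
          exact mul_le_mul_right hi' _
    _ = (∑ i ∈ S, ∫⁻ s, ‖f n s i - F s i‖ₑ ∂μ) + (L : ℝ≥0∞)⁻¹ *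
          (∫⁻ s, ∑' i, w i * ‖f n s i‖ₑ ∂μ + ∫⁻ s, ∑' i, w i * ‖F s i‖ₑ ∂μ) := by
        rw [lintegral_add_right _ (mm.const_mul _), lintegral_finsetSum _ me, lintegral_const_mul _ mm,
          lintegral_add_left (mf n)]
    _ ≤ ε / 2 + (L : ℝ≥0∞)⁻¹ * (M + M) := by gcongr
    _ ≤ ε / 2 + ε / 2 := by gcongr
    _ = ε := ENNReal.add_halves ε

end

/-! ### Bounds for the advection term by low norms -/

/-- For a fixed output mode the vertical derivative on one factor, divided by the wave number of the
other, is at most `1 + |m|` with `m` the output wave number. A single mode of the advection thus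
needs no vertical regularity. -/
lemma enorm_advTerm_le_qv {a b : ℤ × ℤ → ℂ} (j i : ℤ × ℤ) :
    ‖advTerm a b j i‖ₑ ≤ (2 + em j.2) * ((qv i.1 * ‖a i‖ₑ) * (qv (j - i).1 * ‖b (j - i)‖ₑ)) := by
  refine (enorm_advTerm_le a b j i).trans ?_
  have h1 : ‖a i‖ₑ * (wv (j - i).1 * ‖b (j - i)‖ₑ)
      ≤ (qv i.1 * ‖a i‖ₑ) * (qv (j - i).1 * ‖b (j - i)‖ₑ) :=
    mul_le_mul' (le_mul_of_one_le_left' (one_le_qv _)) (mul_le_mul_left (wv_le_qv _) _)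
  have h2 : im i.2 * em (j - i).2 ≤ 1 + em j.2 :=
    calc im i.2 * em (j - i).2 ≤ im i.2 * (em j.2 + em i.2) := by gcongr; exact em_le _ _
      _ = im i.2 * em i.2 + im i.2 * em j.2 := by ring
      _ ≤ 1 + 1 * em j.2 := by
        gcongr
        · exact im_mul_em_le _
        · exact im_le_one _
      _ = _ := by rw [one_mul]
  have h3 : wv i.1 * (im i.2 * ‖a i‖ₑ) * (em (j - i).2 * ‖b (j - i)‖ₑ)
      ≤ (1 + em j.2) * ((qv i.1 * ‖a i‖ₑ) * (qv (j - i).1 * ‖b (j - i)‖ₑ)) :=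
    calc _ = (im i.2 * em (j - i).2) * ((wv i.1 * ‖a i‖ₑ) * ‖b (j - i)‖ₑ) := by ring
      _ ≤ _ := mul_le_mul' h2 (mul_le_mul' (mul_le_mul_left (wv_le_qv _) _)
        (le_mul_of_one_le_left' (one_le_qv _)))
  calc _ ≤ _ := add_le_add h1 h3
    _ = _ := by ring

lemma qv_le_rpow {r : ℝ} (hr : 1 ≤ r) (k : ℤ) : qv k ≤ qv k ^ r := by
  simpa using qv_rpow_mono k hr

lemma tsum_enorm_advTerm_le_qv {r : ℝ} (hr : 1 ≤ r) (a b : ℤ × ℤ → ℂ) (j : ℤ × ℤ) :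
    ∑' i, ‖advTerm a b j i‖ₑ ≤ (2 + em j.2) *
      ((l2 fun j => qv j.1 ^ r * ‖a j‖ₑ) * l2 fun j => qv j.1 ^ r * ‖b j‖ₑ) := by
  refine (ENNReal.tsum_le_tsum fun i => enorm_advTerm_le_qv j i).trans ?_
  rw [ENNReal.tsum_mul_left]
  gcongr
  refine (conv_le_l2 (fun i => qv i.1 * ‖a i‖ₑ) (fun i => qv i.1 * ‖b i‖ₑ) j).trans ?_
  exact mul_le_mul' (l2_mono fun i => mul_le_mul_left (qv_le_rpow hr _) _)
    (l2_mono fun i => mul_le_mul_left (qv_le_rpow hr _) _)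

/-- The extra weight `q + |m|` gives tightness of the series. The horizontal part raises the first
factor to `q²`, admissible because `r ≥ 2`; the vertical part is controlled by the viscous
dissipation. -/
lemma tsum_weighted_advTerm_le {r : ℝ} (hr : 2 ≤ r) (a : ℤ × ℤ → ℂ) (j : ℤ × ℤ) :
    ∑' i, (qv i.1 + em i.2) * ‖advTerm a a j i‖ₑ ≤ (2 + em j.2) *
      (((l2 fun j => qv j.1 ^ r * ‖a j‖ₑ) + l2 fun j => qv j.1 ^ r * (em j.2 * ‖a j‖ₑ))
        * l2 fun j => qv j.1 ^ r * ‖a j‖ₑ) := by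
  have h1 : (1 : ℝ) ≤ r := by linarith
  have h2 : ∀ k : ℤ, qv k * qv k ≤ qv k ^ r := fun k => by
    rw [← sq]
    simpa using qv_rpow_mono k hr
  calc ∑' i, (qv i.1 + em i.2) * ‖advTerm a a j i‖ₑ
      ≤ ∑' i, (2 + em j.2) * ((qv i.1 ^ r * ‖a i‖ₑ + qv i.1 ^ r * (em i.2 * ‖a i‖ₑ)) *
          (qv (j - i).1 ^ r * ‖a (j - i)‖ₑ)) := by
        refine ENNReal.tsum_le_tsum fun i => ?_
        calc (qv i.1 + em i.2) * ‖advTerm a a j i‖ₑ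
            ≤ (qv i.1 + em i.2) * ((2 + em j.2) * ((qv i.1 * ‖a i‖ₑ) * (qv (j - i).1 * ‖a (j - i)‖ₑ))) := by
              gcongr; exact enorm_advTerm_le_qv j i
          _ = (2 + em j.2) * ((qv i.1 * qv i.1 * ‖a i‖ₑ + qv i.1 * (em i.2 * ‖a i‖ₑ)) *
              (qv (j - i).1 * ‖a (j - i)‖ₑ)) := by ring
          _ ≤ _ := by
            gcongr
            · exact h2 _
            · exact qv_le_rpow h1 _
            · exact qv_le_rpow h1 _
    _ = (2 + em j.2) * conv (fun i => qv i.1 ^ r * ‖a i‖ₑ + qv i.1 ^ r * (em i.2 * ‖a i‖ₑ))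
          (fun i => qv i.1 ^ r * ‖a i‖ₑ) j := by
        rw [ENNReal.tsum_mul_left, conv]
    _ ≤ _ := by
        refine mul_le_mul_right ((conv_le_l2 _ _ j).trans ?_) _
        exact mul_le_mul_left (l2_add_le _ _) _

end
end HydrostaticNS

namespace HydrostaticNS
noncomputable section

open Filter Topology

/-! ### Weighted square sums -/

/-- A weighted sum of squares of coefficients. -/
def esum (c : ℤ × ℤ → ℝ) (a : ℤ × ℤ → ℂ) : ℝ≥0∞ := ∑' j, ENNReal.ofReal (c j) * ‖a j‖ₑ ^ 2

lemma continuous_cE (r : ℝ) (j : ℤ × ℤ) : Continuous fun σ => cE r σ j := by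
  unfold cE; fun_prop

lemma ofReal_cE (r τ : ℝ) (j : ℤ × ℤ) : ENNReal.ofReal (cE r τ j) = aw r τ j.1 := by
  rw [cE, aw, gw, ENNReal.ofReal_add (mul_nonneg (Real.rpow_nonneg (waveNumber_nonneg _) _)
    (Real.exp_pos _).le) zero_le_one, ENNReal.ofReal_one]

lemma em_eq (m : ℤ) : em m = ENNReal.ofReal |(m : ℝ)| := by
  rw [em, ← ofReal_norm, Int.norm_eq_abs]

lemma ofReal_cX (r τ : ℝ) (j : ℤ × ℤ) : ENNReal.ofReal (cX r τ j) = gw (r + 1 / 2) τ j.1 := rfl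

lemma qv_rpow_mul_ew_sq_le {r : ℝ} (hr : 0 ≤ r) (τ : ℝ) (j : ℤ × ℤ) :
    (qv j.1 ^ r * ew τ j.1) ^ 2 ≤ ENNReal.ofReal (cE r τ j) := by
  rw [ofReal_cE, aw]
  rcases eq_or_ne j.1 0 with h | h
  · rw [h, qv_zero, ew, waveNumber_zero]; simp
  · rw [gw_eq r τ _ hr, qv_eq h]; exact le_self_add

lemma l2_qv_ew_le {r : ℝ} (hr : 0 ≤ r) (τ : ℝ) (a : ℤ × ℤ → ℂ) :
    (l2 fun j => qv j.1 ^ r * (ew τ j.1 * ‖a j‖ₑ)) ^ 2 ≤ esum (cE r τ) a := by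
  rw [l2_sq]
  refine ENNReal.tsum_le_tsum fun j => ?_
  calc _ = (qv j.1 ^ r * ew τ j.1) ^ 2 * ‖a j‖ₑ ^ 2 := by ring
    _ ≤ _ := mul_le_mul_left (qv_rpow_mul_ew_sq_le hr τ j) _

lemma l2_qv_em_ew_le {r : ℝ} (hr : 0 ≤ r) (τ : ℝ) (a : ℤ × ℤ → ℂ) :
    (l2 fun j => qv j.1 ^ r * (em j.2 * (ew τ j.1 * ‖a j‖ₑ))) ^ 2 ≤ esum (cZ r τ) a := by
  rw [l2_sq]
  refine ENNReal.tsum_le_tsum fun j => ?_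
  calc _ = (qv j.1 ^ r * (em j.2 * ew τ j.1)) ^ 2 * ‖a j‖ₑ ^ 2 := by ring
    _ = ENNReal.ofReal (cF r τ j) * ‖a j‖ₑ ^ 2 := by rw [ofReal_cF hr]
    _ ≤ _ := mul_le_mul_left (ENNReal.ofReal_le_ofReal (cF_le_cZ r τ j)) _

lemma l2_qv_le {r τ : ℝ} (hr : 0 ≤ r) (hτ : 0 ≤ τ) (a : ℤ × ℤ → ℂ) :
    (l2 fun j => qv j.1 ^ r * ‖a j‖ₑ) ^ 2 ≤ esum (cE r τ) a :=
  (pow_le_pow_left₀ zero_le (l2_mono fun _ => mul_le_mul_right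
    (le_mul_of_one_le_left' (one_le_ew hτ _)) _) 2).trans (l2_qv_ew_le hr τ a)

lemma l2_qv_em_le {r τ : ℝ} (hr : 0 ≤ r) (hτ : 0 ≤ τ) (a : ℤ × ℤ → ℂ) :
    (l2 fun j => qv j.1 ^ r * (em j.2 * ‖a j‖ₑ)) ^ 2 ≤ esum (cZ r τ) a :=
  (pow_le_pow_left₀ zero_le (l2_mono fun _ => mul_le_mul_right (mul_le_mul_right
    (le_mul_of_one_le_left' (one_le_ew hτ _)) _) _) 2).trans (l2_qv_em_ew_le hr τ a)

lemma enorm_sq_le_esum (r τ : ℝ) (a : ℤ × ℤ → ℂ) (j : ℤ × ℤ) : ‖a j‖ₑ ^ 2 ≤ esum (cE r τ) a := by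
  refine le_trans ?_ (ENNReal.le_tsum (f := fun j => ENNReal.ofReal (cE r τ j) * ‖a j‖ₑ ^ 2) j)
  refine le_mul_of_one_le_left' ?_
  rw [ofReal_cE, aw]; exact le_add_self

lemma norm_le_of_esum_le {r τ K : ℝ} (hK : 0 ≤ K) {a : ℤ × ℤ → ℂ}
    (h : esum (cE r τ) a ≤ ENNReal.ofReal (K ^ 2)) (j : ℤ × ℤ) : ‖a j‖ ≤ K := by
  have h1 := (enorm_sq_le_esum r τ a j).trans h
  rw [ENNReal.ofReal_pow hK] at h1
  have h2 := le_of_sq_le h1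
  rwa [← ofReal_norm, ENNReal.ofReal_le_ofReal_iff hK] at h2

lemma esum_le_liminf {c : ℕ → ℤ × ℤ → ℝ} {d : ℤ × ℤ → ℝ} {a : ℕ → ℤ × ℤ → ℂ} {b : ℤ × ℤ → ℂ}
    (hc : ∀ j, Tendsto (fun n => c n j) atTop (𝓝 (d j)))
    (ha : ∀ j, Tendsto (fun n => a n j) atTop (𝓝 (b j))) :
    esum d b ≤ liminf (fun n => esum (c n) (a n)) atTop := by
  refine tsum_liminf_le _ _ fun j => ?_
  have h1 : ‖b j‖ₑ ^ 2 ≠ ⊤ := ENNReal.pow_ne_top enorm_ne_top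
  exact ENNReal.Tendsto.mul (ENNReal.tendsto_ofReal (hc j)) (Or.inr h1)
    ((ENNReal.continuous_pow 2).tendsto _ |>.comp (ha j).enorm) (Or.inr ENNReal.ofReal_ne_top)

lemma measurable_esum {c : ℝ → ℤ × ℤ → ℝ} {a : ℝ → ℤ × ℤ → ℂ} {τ : ℝ → ℝ}
    (hc : ∀ j, Continuous fun σ => c σ j) (ha : ∀ j, Measurable fun t => a t j)
    (hτ : Measurable τ) : Measurable fun t => esum (c (τ t)) (a t) :=
  Measurable.tsum fun j => (((hc j).measurable.comp hτ).ennreal_ofReal).mul ((ha j).enorm.pow_const 2)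

/-- A Lipschitz constant for the coefficients of solutions. -/
def lipBound (ν K : ℝ) (j : ℤ × ℤ) : ℝ := (2 + |(j.2 : ℝ)|) * (K * K) + ν * (Real.pi * j.2) ^ 2 * K

/-- Only the energy enters, not the dissipation, so each coefficient has a bounded time derivative,
uniformly over the approximations. -/
lemma norm_flux_le {r τ ν K : ℝ} (hr : 1 ≤ r) (hτ : 0 ≤ τ) (hν : 0 ≤ ν) (hK : 0 ≤ K) {a : ℤ × ℤ → ℂ}
    (h : esum (cE r τ) a ≤ ENNReal.ofReal (K ^ 2)) (j : ℤ × ℤ) : ‖flux ν a j‖ ≤ lipBound ν K j := by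
  have hY : (l2 fun j => qv j.1 ^ r * ‖a j‖ₑ) ≤ ENNReal.ofReal K := by
    apply le_of_sq_le
    rw [← ENNReal.ofReal_pow hK]
    exact (l2_qv_le (by linarith) hτ a).trans h
  have h1 : ‖advec a a j‖ₑ ≤ ENNReal.ofReal ((2 + |(j.2 : ℝ)|) * (K * K)) := by
    rw [ENNReal.ofReal_mul (by positivity), ENNReal.ofReal_mul hK,
      ENNReal.ofReal_add zero_le_two (abs_nonneg _), ← em_eq, ENNReal.ofReal_ofNat]
    have : ‖advec a a j‖ₑ ≤ ∑' i, ‖advTerm a a j i‖ₑ := by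
      rw [advec]; split_ifs
      · simp
      · exact enorm_tsum_le _
    exact (this.trans (tsum_enorm_advTerm_le_qv hr a a j)).trans (by gcongr)
  rw [← ofReal_norm, ENNReal.ofReal_le_ofReal_iff (by positivity)] at h1
  rw [flux, lipBound]
  refine (norm_add_le _ _).trans (add_le_add h1 ?_)
  have e : (ν * (Real.pi * j.2) ^ 2 * a j : ℂ) = ((ν * (Real.pi * j.2) ^ 2 : ℝ) : ℂ) * a j := by
    push_cast; ring
  rw [e, norm_mul, Complex.norm_of_nonneg (by positivity)]
  exact mul_le_mul_of_nonneg_left (norm_le_of_esum_le hK h j) (by positivity)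

lemma measurable_advec {a b : ℝ → ℤ × ℤ → ℂ} (ha : ∀ j, Measurable fun t => a t j)
    (hb : ∀ j, Measurable fun t => b t j) (j : ℤ × ℤ) : Measurable fun t => advec (a t) (b t) j := by
  unfold advec advTerm
  split_ifs
  · exact measurable_const
  · exact Measurable.tsum fun i => ((ha i).mul (hb (j - i))).const_mul _

lemma measurable_flux {ν : ℝ} {a : ℝ → ℤ × ℤ → ℂ} (ha : ∀ j, Measurable fun t => a t j) (j : ℤ × ℤ) :
    Measurable fun t => flux ν (a t) j :=
  (measurable_advec ha ha j).add ((ha j).const_mul _)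

lemma intervalIntegrable_of_norm_le {f : ℝ → ℂ} {C x y : ℝ} (hf : Measurable f)
    (hC : ∀ s, ‖f s‖ ≤ C) : IntervalIntegrable f volume x y :=
  (intervalIntegrable_const (c := C)).mono_fun' hf.aestronglyMeasurable (.of_forall hC)

/-! ### Approximations on the whole line -/

/-- A Galerkin approximation on `[0,T]`, extended by constants. -/
structure IsGlobalApprox (r ν τ₀ K T : ℝ) (J : Finset (ℤ × ℤ)) (a₀ : ℤ × ℤ → ℂ)
    (a : ℝ → ℤ × ℤ → ℂ) (τ : ℝ → ℝ) : Prop where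
  initial : a 0 = a₀
  zero : ∀ t k, a t (k, 0) = 0
  conj : ∀ t j, a t (-j) = (starRingEnd ℂ) (a t j)
  even : ∀ t k m, a t (k, -m) = a t (k, m)
  lipschitz : ∀ j s t, ‖a s j - a t j‖ ≤ lipBound ν K j * |s - t|
  radius_zero : τ 0 = τ₀
  radius_ge : ∀ t, τ₀ - 2 * (triR r * K / ν) ≤ τ t
  radius_le : ∀ t, τ t ≤ τ₀
  radius_continuous : Continuous τ
  radius_modulus : ∀ μ > 0, ∀ s t, |τ s - τ t| ≤
    triR r * K ^ 2 / (4 * ν * μ) + (triR r * μ / 2 + 2) * |s - t|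
  bound : ∀ t, esum (cE r (τ t)) (a t) ≤ ENNReal.ofReal (K ^ 2)
  energy : ∀ t ∈ Icc 0 T, esum (cE r (τ t)) (a t) + 2 * ∫⁻ s in Ioo 0 t,
    (ENNReal.ofReal ν * esum (cZ r (τ s)) (a s)
      + ENNReal.ofReal (gain (triR r * K / ν) s) * esum (cX r (τ s)) (a s)) ≤ ENNReal.ofReal (K ^ 2)
  decay : ∀ t ∈ Icc 0 T, ENNReal.ofReal (Real.exp (ν * t)) * esum (cE r (τ t)) (a t)
    + ENNReal.ofReal ν * ∫⁻ s in Ioo 0 t, ENNReal.ofReal (Real.exp (ν * s)) * esum (cZ r (τ s)) (a s)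
      ≤ ENNReal.ofReal (K ^ 2)
  decay' : ∀ t ∈ Icc 0 T, esum (cE r (τ t)) (a t) ≤ ENNReal.ofReal (Real.exp (-(2 * ν * t)) * K ^ 2)
  duhamel : ∀ t ∈ Icc 0 T, ∀ j ∈ J, a t j = a₀ j - ∫ s in (0 : ℝ)..t, flux ν (a s) j

/-- Freezing the approximation outside `[0,T]` keeps the pointwise bounds and moduli of continuity
at all times, so that compactness can be applied on the whole line even though `T` varies along the
sequence. -/
lemma IsApprox.global {r ν τ₀ K T : ℝ} {J : Finset (ℤ × ℤ)} {a₀ : ℤ × ℤ → ℂ}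
    {a : ℝ → ℤ × ℤ → ℂ} {τ : ℝ → ℝ} (hr : 1 ≤ r) (hν : 0 < ν) (hK : 0 < K)
    (hsmall : 2 * (triR r * K / ν) < τ₀) (hT : 0 ≤ T) (hJ0 : ∀ j ∈ J, j.2 ≠ 0)
    (h : IsApprox r ν τ₀ K T J a₀ a τ) :
    IsGlobalApprox r ν τ₀ K T J a₀ (fun t => a (projIcc 0 T hT t)) (fun t => τ (projIcc 0 T hT t)) := by
  have hp : ∀ t, (projIcc 0 T hT t : ℝ) ∈ Icc 0 T := fun t => (projIcc 0 T hT t).2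
  have hpe : ∀ t ∈ Icc 0 T, (projIcc 0 T hT t : ℝ) = t := fun t ht => by rw [projIcc_of_mem hT ht]
  have h0 : (0 : ℝ) ∈ Icc 0 T := ⟨le_rfl, hT⟩
  have hE : ∀ (c : ℝ → ℤ × ℤ → ℝ) (_ : ∀ σ j, 0 ≤ c σ j) t,
      esum (c (τ t)) (a t) = ENNReal.ofReal (wsum J (c (τ t)) (a t)) := fun c hc t =>
    (ofReal_wsum (hc _) (h.support t)).symm
  have hd : ∀ t ∈ Icc 0 T, esum (cE r (τ t)) (a t) ≤ ENNReal.ofReal (Real.exp (-(2 * ν * t)) * K ^ 2) :=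
    fun t ht => by
      rw [hE _ (cE_nonneg r)]; exact ENNReal.ofReal_le_ofReal (h.decay' t ht)
  have hbd : ∀ t ∈ Icc 0 T, esum (cE r (τ t)) (a t) ≤ ENNReal.ofReal (K ^ 2) := fun t ht => by
    refine (hd t ht).trans (ENNReal.ofReal_le_ofReal (mul_le_of_le_one_left (sq_nonneg _) ?_))
    rw [Real.exp_le_one_iff]; have := ht.1; nlinarith [mul_nonneg hν.le this]
  have hpos : ∀ t ∈ Icc 0 T, 0 ≤ τ t := fun t ht => by linarith [h.radius_ge t ht]
  have hfl : ∀ t ∈ Icc 0 T, ∀ j, ‖flux ν (a t) j‖ ≤ lipBound ν K j := fun t ht j =>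
    norm_flux_le hr (hpos t ht) hν.le hK.le (hbd t ht) j
  have hpl : ∀ s t, |(projIcc 0 T hT s : ℝ) - projIcc 0 T hT t| ≤ |s - t| := fun s t => by
    have := (LipschitzWith.projIcc hT).dist_le_mul s t
    simpa [Subtype.dist_eq, Real.dist_eq] using this
  have hlip0 : ∀ j, 0 ≤ lipBound ν K j := fun j => by unfold lipBound; positivity
  have hdc : ∀ j ∈ J, ContinuousOn (fun t => a t j) (Icc 0 T) := fun j hj t ht =>
    (h.hasDerivAt t ht j hj).continuousAt.continuousWithinAt
  have hac : ∀ j, Continuous fun t => a (projIcc 0 T hT t) j := fun j => by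
    by_cases hj : j ∈ J
    · exact (hdc j hj).comp_continuous (continuous_subtype_val.comp continuous_projIcc) hp
    · simp only [h.support _ j hj]; exact continuous_const
  have hτc : Continuous fun t => τ (projIcc 0 T hT t) :=
    h.continuousOn.comp_continuous (continuous_subtype_val.comp continuous_projIcc) hp
  refine ⟨?_, fun t k => ?_, fun t j => h.conj _ (hp t) j, fun t k m => h.even _ (hp t) k m, ?_, ?_,
    fun t => h.radius_ge _ (hp t), fun t => ?_, hτc, ?_, fun t => hbd _ (hp t), fun t ht => ?_,
    fun t ht => ?_, fun t ht => ?_, fun t ht j hj => ?_⟩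
  · simp only [hpe 0 h0]; exact h.initial
  · exact h.support _ _ fun hj => hJ0 _ hj rfl
  · intro j s t
    by_cases hj : j ∈ J
    · refine ((convex_Icc 0 T).norm_image_sub_le_of_norm_hasDerivWithin_le (f' := fun t => -flux ν (a t) j)
        (C := lipBound ν K j) (fun x hx => (h.hasDerivAt x hx j hj).hasDerivWithinAt) (fun x hx => ?_) (hp t) (hp s)).trans ?_
      · rw [norm_neg]; exact hfl x hx j
      · exact mul_le_mul_of_nonneg_left (hpl s t) (hlip0 j)
    · simp only [h.support _ j hj, sub_self, norm_zero]
      exact mul_nonneg (hlip0 j) (abs_nonneg _)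
  · simp only [hpe 0 h0]; exact h.radius_zero
  · have := (h.radius_modulus 1 one_pos 0 h0 _ (hp t)).1
    rwa [h.radius_zero] at this
  · intro μ hμ
    have key : ∀ x ∈ Icc 0 T, ∀ y ∈ Icc x T, |τ x - τ y| ≤ triR r * K ^ 2 / (4 * ν * μ)
        + (triR r * μ / 2 + 2) * |x - y| := fun x hx y hy => by
      obtain ⟨h1, h2⟩ := h.radius_modulus μ hμ x hx y hy
      rw [abs_of_nonneg (by linarith), abs_of_nonpos (by linarith [hy.1]), neg_sub]
      exact h2
    have hc0 : 0 ≤ triR r * μ / 2 + 2 := by have := triR_pos r; positivity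
    intro s t
    refine le_trans ?_ (add_le_add_right (mul_le_mul_of_nonneg_left (hpl s t) hc0) _)
    rcases le_total (projIcc 0 T hT s : ℝ) (projIcc 0 T hT t) with hst | hst
    · exact key _ (hp s) _ ⟨hst, (hp t).2⟩
    · rw [abs_sub_comm, abs_sub_comm (projIcc 0 T hT s : ℝ)]
      exact key _ (hp t) _ ⟨hst, (hp s).2⟩
  · simp only [hpe t ht]
    refine le_trans (le_of_eq ?_) (h.energy t ht)
    rw [hE _ (cE_nonneg r), ← lintegral_const_mul' _ _ ENNReal.ofNat_ne_top]
    congr 1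
    refine setLIntegral_congr_fun measurableSet_Ioo fun s hs => ?_
    have hs' : s ∈ Icc 0 T := ⟨hs.1.le, hs.2.le.trans ht.2⟩
    simp only [hpe s hs']
    have hg := (gain_pos (triR r * K / ν) s).le
    have hZ := wsum_nonneg (J := J) (cZ_nonneg r (τ s)) (a s)
    have hX := wsum_nonneg (J := J) (cX_nonneg r (τ s)) (a s)
    rw [hE _ (cZ_nonneg r), hE _ (cX_nonneg r), ENNReal.ofReal_mul zero_le_two, ENNReal.ofReal_ofNat,
      ENNReal.ofReal_add (mul_nonneg hν.le hZ) (mul_nonneg hg hX), ENNReal.ofReal_mul hν.le,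
      ENNReal.ofReal_mul hg]
  · simp only [hpe t ht]
    refine le_trans (le_of_eq ?_) (h.decay t ht)
    rw [hE _ (cE_nonneg r), ← lintegral_const_mul' _ _ ENNReal.ofReal_ne_top,
      ENNReal.ofReal_mul (Real.exp_pos _).le]
    congr 1
    refine setLIntegral_congr_fun measurableSet_Ioo fun s hs => ?_
    have hs' : s ∈ Icc 0 T := ⟨hs.1.le, hs.2.le.trans ht.2⟩
    simp only [hpe s hs']
    rw [hE _ (cZ_nonneg r), ENNReal.ofReal_mul hν.le, ENNReal.ofReal_mul (Real.exp_pos _).le]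
  · simp only [hpe t ht]; exact hd t ht
  · have hfi : IntervalIntegrable (fun s => -flux ν (a (projIcc 0 T hT s)) j) volume 0 t := by
      exact (intervalIntegrable_of_norm_le (measurable_flux (fun i => (hac i).measurable) j)
        fun s => hfl _ (hp s) j).neg
    have h1 := intervalIntegral.integral_eq_sub_of_hasDerivAt_of_le (f := fun t => a t j)
      (f' := fun s => -flux ν (a (projIcc 0 T hT s)) j) ht.1
      ((hdc j hj).mono (Icc_subset_Icc_right ht.2)) (fun x hx => ?_) hfi
    · simp only [hpe t ht]
      rw [intervalIntegral.integral_neg, h.initial] at h1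
      rw [sub_eq_add_neg, h1]; ring
    · have hx' : x ∈ Icc 0 T := ⟨hx.1.le, hx.2.le.trans ht.2⟩
      rw [hpe x hx']
      exact h.hasDerivAt x hx' j hj

end
end HydrostaticNS

/-! ### Uniform approximations on growing time intervals and the limit object -/

namespace HydrostaticNS
noncomputable section

open Filter Topology

lemma esum_const_mul {k : ℝ} (hk : 0 ≤ k) (c : ℤ × ℤ → ℝ) (a : ℤ × ℤ → ℂ) :
    ENNReal.ofReal k * esum c a = esum (fun j => k * c j) a := by
  rw [esum, esum, ← ENNReal.tsum_mul_left]
  refine tsum_congr fun j => ?_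
  rw [ENNReal.ofReal_mul hk, mul_assoc]

lemma esum_add {c d : ℤ × ℤ → ℝ} (hc : ∀ j, 0 ≤ c j) (hd : ∀ j, 0 ≤ d j) (a : ℤ × ℤ → ℂ) :
    esum c a + esum d a = esum (fun j => c j + d j) a := by
  rw [esum, esum, esum, ← ENNReal.tsum_add]
  refine tsum_congr fun j => ?_
  rw [ENNReal.ofReal_add (hc j) (hd j), add_mul]

lemma lintegral_esum_le_liminf {c : ℕ → ℝ → ℤ × ℤ → ℝ} {d : ℝ → ℤ × ℤ → ℝ}
    {a : ℕ → ℝ → ℤ × ℤ → ℂ} {b : ℝ → ℤ × ℤ → ℂ} (hcm : ∀ n j, Measurable fun s => c n s j)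
    (ham : ∀ n j, Measurable fun s => a n s j)
    (hc : ∀ s j, Tendsto (fun n => c n s j) atTop (𝓝 (d s j)))
    (ha : ∀ s j, Tendsto (fun n => a n s j) atTop (𝓝 (b s j))) (S : Set ℝ) :
    ∫⁻ s in S, esum (d s) (b s) ≤ liminf (fun n => ∫⁻ s in S, esum (c n s) (a n s)) atTop :=
  (lintegral_mono fun s => esum_le_liminf (hc s) (ha s)).trans (lintegral_liminf_le fun n =>
    Measurable.tsum fun j => (hcm n j).ennreal_ofReal.mul ((ham n j).enorm.pow_const 2))

lemma lintegral_le_of_decay {ν t : ℝ} (hν : 0 < ν) {x C : ℝ≥0∞} {Z : ℝ → ℝ≥0∞}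
    (h : x + ENNReal.ofReal ν * ∫⁻ s in Ioo 0 t, ENNReal.ofReal (Real.exp (ν * s)) * Z s ≤ C) :
    ∫⁻ s in Ioo 0 t, Z s ≤ C / ENNReal.ofReal ν := by
  rw [ENNReal.le_div_iff_mul_le (Or.inl (by simpa using hν)) (Or.inl ENNReal.ofReal_ne_top), mul_comm]
  refine le_trans (mul_le_mul_right ?_ _) (le_add_self.trans h)
  refine setLIntegral_mono' measurableSet_Ioo fun s hs => le_mul_of_one_le_left' ?_
  rw [ENNReal.one_le_ofReal, Real.one_le_exp_iff]
  exact mul_nonneg hν.le hs.1.le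

lemma finite_weight_le (L : ℕ) : {i : ℤ × ℤ | qv i.1 + em i.2 ≤ L}.Finite := by
  refine ((finite_Icc (-(L : ℤ)) L).prod (finite_Icc (-(L : ℤ)) L)).subset fun i hi => ?_
  have h1 : wv i.1 ≤ L := ((wv_le_qv _).trans le_self_add).trans hi
  have h2 : em i.2 ≤ L := le_add_self.trans hi
  have e : ((L : ℕ) : ℝ≥0∞) = ENNReal.ofReal (L : ℝ) := (ENNReal.ofReal_natCast L).symm
  rw [e, wv, ENNReal.ofReal_le_ofReal_iff (by positivity)] at h1
  rw [e, em_eq, ENNReal.ofReal_le_ofReal_iff (by positivity)] at h2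
  have h3 : |(i.1 : ℝ)| ≤ L := by
    refine le_trans ?_ h1
    rw [waveNumber, abs_mul]
    refine le_mul_of_one_le_left (abs_nonneg _) ?_
    rw [abs_of_pos (by positivity)]
    linarith [Real.pi_gt_three]
  have h3' : |i.1| ≤ (L : ℤ) := by exact_mod_cast h3
  have h2' : |i.2| ≤ (L : ℤ) := by exact_mod_cast h2
  exact ⟨abs_le.1 h3', abs_le.1 h2'⟩

/-- The modes of the Galerkin space. -/
def modeBox (n : ℕ) : Finset (ℤ × ℤ) :=
  ((Finset.Icc (-(n : ℤ)) n) ×ˢ (Finset.Icc (-(n : ℤ)) n)).filter fun j => j.2 ≠ 0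

lemma mem_modeBox {n : ℕ} {j : ℤ × ℤ} : j ∈ modeBox n ↔ |j.1| ≤ n ∧ |j.2| ≤ n ∧ j.2 ≠ 0 := by
  simp only [modeBox, Finset.mem_filter, Finset.mem_product, Finset.mem_Icc, abs_le]
  tauto

lemma eventually_mem_modeBox {j : ℤ × ℤ} (hj : j.2 ≠ 0) : ∀ᶠ n : ℕ in atTop, j ∈ modeBox n := by
  filter_upwards [eventually_ge_atTop (max j.1.natAbs j.2.natAbs)] with n hn
  rw [mem_modeBox]
  refine ⟨?_, ?_, hj⟩
  · have := (le_max_left _ _).trans hn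
    rw [Int.abs_eq_natAbs]; omega
  · have := (le_max_right _ _).trans hn
    rw [Int.abs_eq_natAbs]; omega

lemma exists_isGlobalApprox {r ν τ₀ K : ℝ} (hr : 1 < r) (hν : 0 < ν) (hK : 0 < K)
    (hsmall : 2 * (triR r * K / ν) < τ₀) {a₀ : ℤ × ℤ → ℂ}
    (hn : ∀ j, a₀ (-j) = (starRingEnd ℂ) (a₀ j)) (hev : ∀ k m, a₀ (k, -m) = a₀ (k, m))
    (hE : esum (cE r τ₀) a₀ ≤ ENNReal.ofReal (K ^ 2)) (n : ℕ) :
    ∃ a τ, IsGlobalApprox r ν τ₀ K n (modeBox n) (fun j => if j ∈ modeBox n then a₀ j else 0) a τ := by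
  have hJn : ∀ j ∈ modeBox n, -j ∈ modeBox n := fun j hj => by
    simpa [mem_modeBox] using hj
  have hJr : ∀ j ∈ modeBox n, (j.1, -j.2) ∈ modeBox n := fun j hj => by
    simpa [mem_modeBox] using hj
  have hJ0 : ∀ j ∈ modeBox n, j.2 ≠ 0 := fun j hj => (mem_modeBox.1 hj).2.2
  suffices h : ∃ a τ, IsApprox r ν τ₀ K n (modeBox n) (fun j => if j ∈ modeBox n then a₀ j else 0) a τ by
    obtain ⟨a, τ, h⟩ := h
    exact ⟨_, _, h.global hr.le hν hK hsmall (Nat.cast_nonneg n) hJ0⟩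
  refine exists_isApprox hr hν hK hsmall (Nat.cast_nonneg n) hJn hJr hJ0
    (fun j hj => if_neg hj) (fun j => ?_) (fun k m => ?_) ?_
  · have : -j ∈ modeBox n ↔ j ∈ modeBox n := ⟨fun h => by simpa using hJn _ h, hJn j⟩
    simp only [this]
    split_ifs
    · exact hn j
    · simp
  · have : (k, -m) ∈ modeBox n ↔ (k, m) ∈ modeBox n :=
      ⟨fun h => by simpa using hJr _ h, hJr (k, m)⟩
    simp only [this, hev]
  · rw [← ENNReal.ofReal_le_ofReal_iff (sq_nonneg K), ofReal_wsum (cE_nonneg r τ₀) fun j hj => if_neg hj]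
    refine le_trans (ENNReal.tsum_le_tsum fun j => ?_) hE
    split_ifs
    · exact le_rfl
    · simp

/-- A solution of the equation in Fourier variables, with its radius of analyticity and the a
priori estimates. -/
structure IsSpectralSolution (r ν τ₀ K : ℝ) (a₀ : ℤ × ℤ → ℂ) (a : ℝ → ℤ × ℤ → ℂ) (τ : ℝ → ℝ) :
    Prop where
  initial : a 0 = a₀
  zero : ∀ t k, a t (k, 0) = 0
  conj : ∀ t j, a t (-j) = (starRingEnd ℂ) (a t j)
  even : ∀ t k m, a t (k, -m) = a t (k, m)
  continuous : ∀ j, Continuous fun t => a t j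
  radius_zero : τ 0 = τ₀
  radius_ge : ∀ t, τ₀ - 2 * (triR r * K / ν) ≤ τ t
  radius_continuous : Continuous τ
  bound : ∀ t, esum (cE r (τ t)) (a t) ≤ ENNReal.ofReal (K ^ 2)
  energy : ∀ t, 0 ≤ t → esum (cE r (τ t)) (a t) + 2 * ∫⁻ s in Ioo 0 t,
    (ENNReal.ofReal ν * esum (cZ r (τ s)) (a s)
      + ENNReal.ofReal (gain (triR r * K / ν) s) * esum (cX r (τ s)) (a s)) ≤ ENNReal.ofReal (K ^ 2)
  decay : ∀ t, 0 ≤ t → ENNReal.ofReal (Real.exp (ν * t)) * esum (cE r (τ t)) (a t)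
    + ENNReal.ofReal ν * ∫⁻ s in Ioo 0 t, ENNReal.ofReal (Real.exp (ν * s)) * esum (cZ r (τ s)) (a s)
      ≤ ENNReal.ofReal (K ^ 2)
  decay' : ∀ t, 0 ≤ t → esum (cE r (τ t)) (a t) ≤ ENNReal.ofReal (Real.exp (-(2 * ν * t)) * K ^ 2)
  duhamel : ∀ t, 0 ≤ t → ∀ j, a t j = a₀ j - ∫ s in (0 : ℝ)..t, flux ν (a s) j

/-- A modulus of continuity that is uniform in the family. -/
lemma exists_modulus {A B ε : ℝ} (hA : 0 ≤ A) (hB : 0 ≤ B) (hε : 0 < ε) :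
    ∃ μ > 0, ∃ δ > 0, A / μ + (B * μ + 2) * δ ≤ ε := by
  -- First `μ` is taken large to make `A/μ` at most `ε/2`, then `δ` small in terms of `μ`.
  refine ⟨2 * A / ε + 1, by positivity, (ε / 2) / (B * (2 * A / ε + 1) + 2), by positivity, ?_⟩
  have h1 : A / (2 * A / ε + 1) ≤ ε / 2 := by
    rw [div_le_iff₀ (by positivity)]
    have : ε / 2 * (2 * A / ε + 1) = A + ε / 2 := by field_simp
    rw [this]; linarith
  have h2 : (B * (2 * A / ε + 1) + 2) * ((ε / 2) / (B * (2 * A / ε + 1) + 2)) = ε / 2 := by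
    field_simp
  linarith

lemma norm_advTerm_le {K : ℝ} (hK : 0 ≤ K) {a : ℤ × ℤ → ℂ} (ha : ∀ j, ‖a j‖ ≤ K) (j i : ℤ × ℤ) :
    ‖advTerm a a j i‖ ≤
      ‖2 * Real.pi * Complex.I * (((j - i).1 : ℂ) - i.1 * (j - i).2 / i.2)‖ * (K * K) := by
  rw [advTerm, norm_mul, norm_mul (a i)]
  exact mul_le_mul_of_nonneg_left (mul_le_mul (ha _) (ha _) (norm_nonneg _) hK) (norm_nonneg _)

lemma lintegral_advTerm_le {r ν K t : ℝ} (hr : 2 ≤ r) (hK : 0 ≤ K) {a : ℝ → ℤ × ℤ → ℂ}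
    {τ : ℝ → ℝ} (hτ : ∀ s, 0 ≤ τ s) (hb : ∀ s, esum (cE r (τ s)) (a s) ≤ ENNReal.ofReal (K ^ 2))
    (hz : ∫⁻ s in Ioo 0 t, esum (cZ r (τ s)) (a s) ≤ ENNReal.ofReal (K ^ 2) / ENNReal.ofReal ν)
    (j : ℤ × ℤ) :
    ∫⁻ s in Ioo 0 t, ∑' i, (qv i.1 + em i.2) * ‖advTerm (a s) (a s) j i‖ₑ
      ≤ (2 + em j.2) * ENNReal.ofReal K * ((ENNReal.ofReal K + 1) * volume (Ioo 0 t)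
          + ENNReal.ofReal (K ^ 2) / ENNReal.ofReal ν) := by
  have h0 : (0 : ℝ) ≤ r := by linarith
  calc _ ≤ ∫⁻ s in Ioo 0 t, (2 + em j.2) * ENNReal.ofReal K * ((ENNReal.ofReal K + 1)
          + esum (cZ r (τ s)) (a s)) := by
        refine lintegral_mono fun s => (tsum_weighted_advTerm_le hr (a s) j).trans ?_
        have hY : (l2 fun j => qv j.1 ^ r * ‖a s j‖ₑ) ≤ ENNReal.ofReal K := by
          apply le_of_sq_le
          rw [← ENNReal.ofReal_pow hK]
          exact (l2_qv_le h0 (hτ s) _).trans (hb s)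
        -- The square of this quantity is what the dissipation controls in time, and `F ≤ 1 + F²`.
        have hF : (l2 fun j => qv j.1 ^ r * (em j.2 * ‖a s j‖ₑ)) ≤ 1 + esum (cZ r (τ s)) (a s) := by
          refine le_trans ?_ (add_le_add_right (l2_qv_em_le h0 (hτ s) (a s)) 1)
          set F := l2 fun j => qv j.1 ^ r * (em j.2 * ‖a s j‖ₑ)
          rcases le_total F 1 with h | h
          · exact h.trans le_self_add
          · exact (le_self_pow h two_ne_zero).trans le_add_self
        calc _ ≤ (2 + em j.2) * ((ENNReal.ofReal K + (1 + esum (cZ r (τ s)) (a s))) * ENNReal.ofReal K) := by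
              gcongr
          _ = _ := by ring
    _ = (2 + em j.2) * ENNReal.ofReal K * ((ENNReal.ofReal K + 1) * volume (Ioo 0 t)
          + ∫⁻ s in Ioo 0 t, esum (cZ r (τ s)) (a s)) := by
        rw [lintegral_const_mul' _ _ (ENNReal.mul_ne_top (ENNReal.add_ne_top.2
          ⟨ENNReal.ofNat_ne_top, em_ne_top _⟩) ENNReal.ofReal_ne_top), lintegral_add_left measurable_const,
          setLIntegral_const]
    _ ≤ _ := by gcongr

end
end HydrostaticNS

/-! ### Passage to the limit in the Galerkin approximations -/

namespace HydrostaticNS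
noncomputable section

open Filter Topology

/-- Pointwise convergence of the coefficients gives convergence of each term of the quadratic
series; tightness, from the bound on the weighted series integrated in time, gives convergence of
its sum. The viscous part involves one coefficient and is dominated. -/
lemma tendsto_flux_integral {r ν τ₀ K t : ℝ} (hr : 2 ≤ r) (hν : 0 < ν) (hK : 0 < K)
    (hsmall : 2 * (triR r * K / ν) < τ₀) {N : ℕ → ℝ} {J : ℕ → Finset (ℤ × ℤ)} {b : ℕ → ℤ × ℤ → ℂ}
    {A : ℕ → ℝ → ℤ × ℤ → ℂ} {Θ : ℕ → ℝ → ℝ} (h : ∀ n, IsGlobalApprox r ν τ₀ K (N n) (J n) (b n) (A n) (Θ n))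
    {a : ℝ → ℤ × ℤ → ℂ} (hlim : ∀ s j, Tendsto (fun n => A n s j) atTop (𝓝 (a s j)))
    (hac : ∀ j, Continuous fun s => a s j)
    (ht : 0 ≤ t) (hN : ∀ᶠ n in atTop, t ≤ N n) {j : ℤ × ℤ} (hj : j.2 ≠ 0)
    (hfl : ∀ s, ‖advec (a s) (a s) j‖ ≤ lipBound 0 K j) :
    Tendsto (fun n => ∫ s in (0 : ℝ)..t, flux ν (A n s) j) atTop (𝓝 (∫ s in (0 : ℝ)..t, flux ν (a s) j)) := by
  have hτ : ∀ n s, 0 ≤ Θ n s := fun n s => by linarith [(h n).radius_ge s]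
  have hlip : ∀ n j, Continuous fun s => A n s j := fun n j =>
    (LipschitzWith.of_dist_le' (K := lipBound ν K j) fun x y => by
      rw [dist_eq_norm, Real.dist_eq]; exact (h n).lipschitz j x y).continuous
  have hnorm : ∀ n s j, ‖A n s j‖ ≤ K := fun n s j => norm_le_of_esum_le hK.le ((h n).bound s) j
  have hadv : ∀ n s, ‖advec (A n s) (A n s) j‖ ≤ lipBound 0 K j := fun n s => by
    simpa [flux] using norm_flux_le (ν := 0) (by linarith) (hτ n s) le_rfl hK.le ((h n).bound s) j
  have hsplit : ∀ {d : ℝ → ℤ × ℤ → ℂ}, (∀ j, Continuous fun s => d s j) →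
      (∀ s, ‖advec (d s) (d s) j‖ ≤ lipBound 0 K j) →
      ∫ s in (0 : ℝ)..t, flux ν (d s) j = (∫ s in Ioo 0 t, ∑' i, advTerm (d s) (d s) j i)
        + ∫ s in (0 : ℝ)..t, (ν * (Real.pi * j.2) ^ 2 * d s j : ℂ) := fun {d} hd hb => by
    simp only [flux]
    rw [intervalIntegral.integral_add, intervalIntegral.integral_of_le ht, integral_Ioc_eq_integral_Ioo]
    · simp only [advec, if_neg hj]
    · exact intervalIntegrable_of_norm_le (measurable_advec (fun i => (hd i).measurable)
        (fun i => (hd i).measurable) j) hb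
    · exact ((hd j).const_mul _).intervalIntegrable _ _
  simp only [hsplit (hlip _) (hadv _)]
  rw [hsplit hac hfl]
  refine Tendsto.add ?_ ?_
  · refine tendsto_integral_tsum (w := fun i => qv i.1 + em i.2)
      (M := (2 + em j.2) * ENNReal.ofReal K * ((ENNReal.ofReal K + 1) * volume (Ioo 0 t)
          + ENNReal.ofReal (K ^ 2) / ENNReal.ofReal ν)) (fun n i => ?_) (fun i => ?_)
      (fun i => .of_forall fun s => ?_) (fun i => ?_) (fun i => (one_le_qv _).trans le_self_add)
      finite_weight_le ?_ ?_
    · exact (((hlip n i).mul (hlip n (j - i))).const_mul _).measurable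
    · exact (((hac i).mul (hac (j - i))).const_mul _).measurable
    · exact ((hlim s i).mul (hlim s (j - i))).const_mul _
    · exact ⟨_, .of_forall fun n => .of_forall fun s => norm_advTerm_le hK.le (hnorm n s) j i⟩
    · have : ENNReal.ofReal ν ≠ 0 := by simpa using hν
      exact ENNReal.mul_ne_top (ENNReal.mul_ne_top (ENNReal.add_ne_top.2 ⟨ENNReal.ofNat_ne_top, em_ne_top _⟩)
        ENNReal.ofReal_ne_top) (ENNReal.add_ne_top.2 ⟨ENNReal.mul_ne_top (ENNReal.add_ne_top.2
          ⟨ENNReal.ofReal_ne_top, ENNReal.one_ne_top⟩) (by simp), ENNReal.div_ne_top ENNReal.ofReal_ne_top this⟩)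
    · filter_upwards [hN] with n hn
      exact lintegral_advTerm_le hr hK.le (hτ n) (h n).bound
        (lintegral_le_of_decay hν ((h n).decay t ⟨ht, hn⟩)) j
  · refine intervalIntegral.tendsto_integral_filter_of_dominated_convergence
      (fun _ => ‖(ν * (Real.pi * j.2) ^ 2 : ℂ)‖ * K) ?_ ?_ ?_ ?_
    · exact .of_forall fun n => ((hlip n j).const_mul _).aestronglyMeasurable
    · refine .of_forall fun n => .of_forall fun s _ => ?_
      rw [norm_mul]
      exact mul_le_mul_of_nonneg_left (hnorm n s j) (norm_nonneg _)
    · exact intervalIntegrable_const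
    · exact .of_forall fun s _ => (hlim s j).const_mul _

/-- The approximation with index `n` lives on the box of side `n` and on the interval `[0,n]`, so a
single diagonal subsequence serves all modes and all times. Estimates pass to the limit by lower
semicontinuity, the equation by `tendsto_flux_integral`. -/
theorem exists_isSpectralSolution {r ν τ₀ K : ℝ} (hr : 2 ≤ r) (hν : 0 < ν) (hK : 0 < K)
    (hsmall : 2 * (triR r * K / ν) < τ₀) {a₀ : ℤ × ℤ → ℂ} (h0 : ∀ k, a₀ (k, 0) = 0)
    (hn : ∀ j, a₀ (-j) = (starRingEnd ℂ) (a₀ j)) (hev : ∀ k m, a₀ (k, -m) = a₀ (k, m))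
    (hE : esum (cE r τ₀) a₀ ≤ ENNReal.ofReal (K ^ 2)) :
    ∃ a τ, IsSpectralSolution r ν τ₀ K a₀ a τ := by
  choose A Θ h using exists_isGlobalApprox (by linarith) hν hK hsmall hn hev hE
  have hnorm : ∀ n s j, ‖A n s j‖ ≤ K := fun n s j => norm_le_of_esum_le hK.le ((h n).bound s) j
  have hlip0 : ∀ j, 0 ≤ lipBound ν K j := fun j => by unfold lipBound; positivity
  have htri := triR_pos r
  have hG : 0 < triR r * K / ν := by positivity
  have hmod : ∀ ε > 0, ∃ δ > 0, ∀ n s t, |s - t| < δ → |Θ n s - Θ n t| ≤ ε := fun ε hε => by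
    obtain ⟨μ, hμ, δ, hδ, hle⟩ := exists_modulus (A := triR r * K ^ 2 / (4 * ν)) (B := triR r / 2)
      (by positivity) (by positivity) hε
    refine ⟨δ, hδ, fun n s t hst => ((h n).radius_modulus μ hμ s t).trans (le_trans ?_ hle)⟩
    rw [div_div, div_mul_eq_mul_div]
    gcongr
  -- The radius is adjoined to the coefficients as the component `none`, so that one extraction
  -- makes both converge. This is needed because the limiting norms carry the limiting radius.
  have hb : ∀ (i : Option (ℤ × ℤ)) (t : ℝ), ∃ B, ∀ n, ‖i.elim (Θ n t : ℂ) fun j => A n t j‖ ≤ B := by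
    intro i t
    cases i with
    | none =>
      refine ⟨τ₀, fun n => ?_⟩
      simp only [Option.elim, Complex.norm_real, Real.norm_eq_abs]
      rw [abs_of_nonneg (by linarith [(h n).radius_ge t])]
      exact (h n).radius_le t
    | some j => exact ⟨K, fun n => hnorm n t j⟩
  have he : ∀ (i : Option (ℤ × ℤ)), ∀ ε > 0, ∃ δ > 0, ∀ n s t, |s - t| < δ →
      ‖(i.elim (Θ n s : ℂ) fun j => A n s j) - i.elim (Θ n t : ℂ) fun j => A n t j‖ ≤ ε := by
    intro i ε hε
    cases i with
    | none =>
      obtain ⟨δ, hδ, hd⟩ := hmod ε hε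
      refine ⟨δ, hδ, fun n s t hst => ?_⟩
      simp only [Option.elim]
      rw [← Complex.ofReal_sub, Complex.norm_real]
      exact hd n s t hst
    | some j =>
      refine ⟨ε / (lipBound ν K j + 1), by have := hlip0 j; positivity, fun n s t hst => ?_⟩
      refine ((h n).lipschitz j s t).trans ?_
      have := hlip0 j
      rw [lt_div_iff₀ (by positivity)] at hst
      nlinarith [abs_nonneg (s - t)]
  obtain ⟨φ, hφ, hl⟩ := exists_subseq_tendsto _ hb he
  choose l hl using hl
  set a : ℝ → ℤ × ℤ → ℂ := fun t j => l (some j) t with ha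
  set τ : ℝ → ℝ := fun t => (l none t).re with hτ
  have cA : ∀ s j, Tendsto (fun n => A (φ n) s j) atTop (𝓝 (a s j)) := fun s j => hl (some j) s
  have cΘ : ∀ s, Tendsto (fun n => Θ (φ n) s) atTop (𝓝 (τ s)) := fun s => by
    have := (Complex.continuous_re.tendsto _).comp (hl none s)
    simpa [Function.comp_def] using this
  have hτpos : ∀ s, τ₀ - 2 * (triR r * K / ν) ≤ τ s := fun s =>
    ge_of_tendsto' (cΘ s) fun n => (h (φ n)).radius_ge s
  have hac : ∀ j, Continuous fun s => a s j := fun j =>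
    (LipschitzWith.of_dist_le' (K := lipBound ν K j) fun x y => by
      rw [dist_eq_norm, Real.dist_eq]
      exact le_of_tendsto' ((cA x j).sub (cA y j)).norm fun n => (h (φ n)).lipschitz j x y).continuous
  have hτc : Continuous τ := by
    refine Metric.continuous_iff.2 fun x ε hε => ?_
    obtain ⟨δ, hδ, hd⟩ := hmod (ε / 2) (by positivity)
    refine ⟨δ, hδ, fun y hy => ?_⟩
    rw [Real.dist_eq] at hy ⊢
    have : |τ y - τ x| ≤ ε / 2 :=
      le_of_tendsto' ((cΘ y).sub (cΘ x)).abs fun n => hd (φ n) y x hy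
    linarith
  have hφt : ∀ t : ℝ, ∀ᶠ n in atTop, t ≤ (φ n : ℝ) := fun t =>
    (tendsto_natCast_atTop_atTop.comp hφ.tendsto_atTop).eventually_ge_atTop t
  have cW : ∀ {c : ℝ → ℤ × ℤ → ℝ}, (∀ j, Continuous fun σ => c σ j) → ∀ s j,
      Tendsto (fun n => c (Θ (φ n) s) j) atTop (𝓝 (c (τ s) j)) := fun hc s j =>
    ((hc j).tendsto _).comp (cΘ s)
  have hΘm : ∀ n, Measurable (Θ n) := fun n => (h n).radius_continuous.measurable
  have hAm : ∀ n j, Measurable fun s => A n s j := fun n j =>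
    (LipschitzWith.of_dist_le' (K := lipBound ν K j) fun x y => by
      rw [dist_eq_norm, Real.dist_eq]; exact (h n).lipschitz j x y).continuous.measurable
  have hEl : ∀ t, esum (cE r (τ t)) (a t) ≤ liminf (fun n => esum (cE r (Θ (φ n) t)) (A (φ n) t)) atTop :=
    fun t => esum_le_liminf (cW (continuous_cE r) t) (cA t)
  have hbd : ∀ t, esum (cE r (τ t)) (a t) ≤ ENNReal.ofReal (K ^ 2) := fun t => by
    refine (hEl t).trans ((liminf_le_liminf (.of_forall fun n => (h (φ n)).bound t)).trans ?_)
    rw [liminf_const]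
  have hzero : ∀ t k, a t (k, 0) = 0 := fun t k => by
    refine tendsto_nhds_unique (cA t (k, 0)) ?_
    simp only [(h _).zero]; exact tendsto_const_nhds
  have hinit : a 0 = a₀ := by
    ext j
    by_cases hj : j.2 = 0
    · obtain ⟨k, m⟩ := j
      obtain rfl : m = 0 := hj
      rw [hzero, h0]
    · refine tendsto_nhds_unique (cA 0 j) (tendsto_const_nhds.congr' ?_)
      filter_upwards [hφ.tendsto_atTop.eventually (eventually_mem_modeBox hj)] with n hn
      rw [(h (φ n)).initial]; exact (if_pos hn).symm
  refine ⟨a, τ, hinit, hzero, fun t j => ?_, fun t k m => ?_, hac, ?_, hτpos, hτc, hbd, fun t ht => ?_,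
    fun t ht => ?_, fun t ht => ?_, fun t ht j => ?_⟩
  · refine tendsto_nhds_unique (cA t (-j)) ?_
    simp only [(h _).conj]
    exact (Complex.continuous_conj.tendsto _).comp (cA t j)
  · refine tendsto_nhds_unique (cA t (k, -m)) ?_
    simp only [(h _).even]
    exact cA t (k, m)
  · refine tendsto_nhds_unique (cΘ 0) ?_
    simp only [(h _).radius_zero]; exact tendsto_const_nhds
  · have e : ∀ (σ s : ℝ) (b : ℤ × ℤ → ℂ), 2 * (ENNReal.ofReal ν * esum (cZ r σ) b
        + ENNReal.ofReal (gain (triR r * K / ν) s) * esum (cX r σ) b)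
        = esum (fun j => 2 * (ν * cZ r σ j + gain (triR r * K / ν) s * cX r σ j)) b := fun σ s b => by
      have hg := (gain_pos (triR r * K / ν) s).le
      rw [esum_const_mul hν.le, esum_const_mul hg, esum_add
        (fun j => mul_nonneg hν.le (cZ_nonneg r σ j)) (fun j => mul_nonneg hg (cX_nonneg r σ j)),
        ← esum_const_mul zero_le_two, ENNReal.ofReal_ofNat]
    rw [← lintegral_const_mul' _ _ ENNReal.ofNat_ne_top]
    simp only [e]
    have hcont : ∀ s j, Continuous fun σ => 2 * (ν * cZ r σ j + gain (triR r * K / ν) s * cX r σ j) :=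
      fun s j => by have := continuous_cZ r j; have := continuous_cX r j; fun_prop
    refine ennreal_add_le_of_liminf (hEl t) (lintegral_esum_le_liminf
      (c := fun n s j => 2 * (ν * cZ r (Θ (φ n) s) j + gain (triR r * K / ν) s * cX r (Θ (φ n) s) j))
      (a := fun n => A (φ n)) (fun n j => ?_) (fun n => hAm (φ n))
      (fun s j => ((hcont s j).tendsto _).comp (cΘ s)) cA _) ?_
    · have h1 := (continuous_cZ r j).measurable.comp (hΘm (φ n))
      have h2 := (continuous_cX r j).measurable.comp (hΘm (φ n))
      exact ((h1.const_mul ν).add ((continuous_gain _).measurable.mul h2)).const_mul 2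
    · filter_upwards [hφt t] with n hn
      have := (h (φ n)).energy t ⟨ht, hn⟩
      rw [← lintegral_const_mul' _ _ ENNReal.ofNat_ne_top] at this
      simpa only [e] using this
  · have e : ∀ (σ s : ℝ) (b : ℤ × ℤ → ℂ), ENNReal.ofReal ν * (ENNReal.ofReal (Real.exp (ν * s)) *
        esum (cZ r σ) b) = esum (fun j => ν * (Real.exp (ν * s) * cZ r σ j)) b := fun σ s b => by
      rw [esum_const_mul (Real.exp_pos _).le, esum_const_mul hν.le]
    rw [← lintegral_const_mul' _ _ ENNReal.ofReal_ne_top, esum_const_mul (Real.exp_pos _).le]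
    simp only [e]
    refine ennreal_add_le_of_liminf (u := fun n => esum (fun j => Real.exp (ν * t) * cE r (Θ (φ n) t) j)
        (A (φ n) t)) (esum_le_liminf (fun j => (cW (continuous_cE r) t j).const_mul _) (cA t))
      (lintegral_esum_le_liminf
      (c := fun n s j => ν * (Real.exp (ν * s) * cZ r (Θ (φ n) s) j))
      (a := fun n => A (φ n)) (fun n j => ?_) (fun n => hAm (φ n))
      (fun s j => ((cW (continuous_cZ r) s j).const_mul _).const_mul _) cA _) ?_
    · have h1 := (continuous_cZ r j).measurable.comp (hΘm (φ n))
      have h2 : Measurable fun s : ℝ => Real.exp (ν * s) := by fun_prop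
      exact (h2.mul h1).const_mul ν
    · filter_upwards [hφt t] with n hn
      have := (h (φ n)).decay t ⟨ht, hn⟩
      rw [← lintegral_const_mul' _ _ ENNReal.ofReal_ne_top, esum_const_mul (Real.exp_pos _).le] at this
      simpa only [e] using this
  · have : ∀ᶠ n in atTop, esum (cE r (Θ (φ n) t)) (A (φ n) t) ≤
        ENNReal.ofReal (Real.exp (-(2 * ν * t)) * K ^ 2) := by
      filter_upwards [hφt t] with n hn using (h (φ n)).decay' t ⟨ht, hn⟩
    refine (hEl t).trans ((liminf_le_liminf this).trans ?_)
    rw [liminf_const]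
  -- Modes with `m = 0` belong to no box; for them both sides vanish identically.
  · by_cases hj : j.2 = 0
    · obtain ⟨k, m⟩ := j
      obtain rfl : m = 0 := hj
      simp [flux, advec, hzero, h0]
    · have hc := tendsto_flux_integral (t := t) hr hν hK hsmall (fun n => h (φ n)) cA hac ht (hφt t) hj
        fun s => by
          simpa [flux] using norm_flux_le (ν := 0) (by linarith) (by linarith [hτpos s]) le_rfl hK.le (hbd s) j
      refine tendsto_nhds_unique (cA t j) (((tendsto_const_nhds (x := a₀ j)).sub hc).congr' ?_)
      filter_upwards [hφt t, hφ.tendsto_atTop.eventually (eventually_mem_modeBox hj)] with n hn hm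
      rw [(h (φ n)).duhamel t ⟨ht, hn⟩ j hm, if_pos hm]

end
end HydrostaticNS

namespace HydrostaticNS
noncomputable section

/-! ### Absolutely continuous functions -/

lemma absolutelyContinuousOnInterval_const {E : Type*} [NormedAddCommGroup E] [NormedSpace ℝ E]
    (c : E) (x y : ℝ) : AbsolutelyContinuousOnInterval (fun _ : ℝ => c) x y :=
  contDiffOn_const.absolutelyContinuousOnInterval

lemma absolutelyContinuousOnInterval_of_dist_le {E F : Type*} [PseudoMetricSpace E]
    [PseudoMetricSpace F] {f : ℝ → E} {g : ℝ → F} {x y C : ℝ}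
    (hf : AbsolutelyContinuousOnInterval f x y)
    (h : ∀ s ∈ uIcc x y, ∀ t ∈ uIcc x y, dist (g s) (g t) ≤ C * dist (f s) (f t)) :
    AbsolutelyContinuousOnInterval g x y := by
  rw [absolutelyContinuousOnInterval_iff] at hf ⊢
  intro ε hε
  obtain ⟨δ, hδ, H⟩ := hf (ε / (|C| + 1)) (by positivity)
  refine ⟨δ, hδ, fun E hE hEδ => ?_⟩
  have h1 := H E hE hEδ
  rw [lt_div_iff₀ (by positivity)] at h1
  refine lt_of_le_of_lt ?_ h1
  rw [Finset.sum_mul]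
  refine Finset.sum_le_sum fun i hi => (h _ ?_ _ ?_).trans ?_
  · exact (hE.1 i hi).1
  · exact (hE.1 i hi).2
  · have := dist_nonneg (x := f (E.2 i).1) (y := f (E.2 i).2)
    nlinarith [le_abs_self C]

/-- Reduction to the real-valued statement through real and imaginary parts. -/
lemma absolutelyContinuousOnInterval_primitive {f : ℝ → ℂ} {x y : ℝ}
    (hf : IntervalIntegrable f volume x y) :
    AbsolutelyContinuousOnInterval (fun t => ∫ s in x..t, f s) x y := by
  have hre : IntervalIntegrable (fun s => (f s).re) volume x y :=
    ⟨hf.1.re, hf.2.re⟩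
  have him : IntervalIntegrable (fun s => (f s).im) volume x y :=
    ⟨hf.1.im, hf.2.im⟩
  have h := ((hre.absolutelyContinuousOnInterval_intervalIntegral left_mem_uIcc).smul
    (absolutelyContinuousOnInterval_const (1 : ℂ) x y)).add
    ((him.absolutelyContinuousOnInterval_intervalIntegral left_mem_uIcc).smul
    (absolutelyContinuousOnInterval_const Complex.I x y))
  have e : ∀ t ∈ uIcc x y, ((∫ s in x..t, (f s).re) • (1 : ℂ) + (∫ s in x..t, (f s).im) • Complex.I)
      = ∫ s in x..t, f s := fun t ht => by
    have hft : IntervalIntegrable f volume x t := hf.mono_set (uIcc_subset_uIcc_left ht)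
    have e1 : (∫ s in x..t, (f s).re) = (∫ s in x..t, f s).re :=
      Complex.reCLM.intervalIntegral_comp_comm hft
    have e2 : (∫ s in x..t, (f s).im) = (∫ s in x..t, f s).im :=
      Complex.imCLM.intervalIntegral_comp_comm hft
    rw [e1, e2, Complex.real_smul, Complex.real_smul, mul_one]
    exact Complex.re_add_im _
  refine absolutelyContinuousOnInterval_of_dist_le (C := 1) h fun s hs t ht => ?_
  rw [one_mul, ← e s hs, ← e t ht]
  rfl

/-- The fundamental theorem of calculus for absolutely continuous functions. -/
lemma integral_eq_sub_of_absolutelyContinuousOnInterval {f f' : ℝ → ℂ} {x y : ℝ}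
    (hf : AbsolutelyContinuousOnInterval f x y) (hf' : IntervalIntegrable f' volume x y)
    (hd : ∀ᵐ t, t ∈ uIcc x y → HasDerivAt f (f' t) t) : ∫ t in x..y, f' t = f y - f x := by
  obtain ⟨C, hC⟩ := (hf.sub (absolutelyContinuousOnInterval_primitive hf')).const_of_ae_hasDerivAt_zero (by
    filter_upwards [hd, hf'.ae_hasDerivAt_integral] with t h1 h2 ht
    simpa using (h1 ht).sub (h2 ht x left_mem_uIcc))
  have h1 := hC x left_mem_uIcc
  have h2 := hC y right_mem_uIcc
  simp only [Pi.sub_apply, intervalIntegral.integral_same, sub_zero] at h1 h2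
  rw [h1, ← h2]; ring

/-- Integration by parts in time. -/
lemma integral_deriv_mul_add {f f' p p' : ℝ → ℂ} {T : ℝ} (hT : 0 ≤ T)
    (hf' : IntervalIntegrable f' volume 0 T)
    (hf : ∀ t ∈ Icc 0 T, f t = f 0 + ∫ s in (0 : ℝ)..t, f' s)
    (hp : ∀ t, HasDerivAt p (p' t) t) (hp' : Continuous p') :
    ∫ t in (0 : ℝ)..T, (f' t * p t + f t * p' t) = f T * p T - f 0 * p 0 := by
  have hpc : Continuous p := continuous_iff_continuousAt.2 fun t => (hp t).continuousAt
  set F : ℝ → ℂ := fun t => f 0 + ∫ s in (0 : ℝ)..t, f' s with hF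
  have hFac : AbsolutelyContinuousOnInterval F 0 T :=
    (absolutelyContinuousOnInterval_const (f 0) 0 T).add (absolutelyContinuousOnInterval_primitive hf')
  have hpac : AbsolutelyContinuousOnInterval p 0 T :=
    (contDiff_one_iff_deriv.2 ⟨fun t => (hp t).differentiableAt, by
      rwa [funext fun t => (hp t).deriv]⟩).contDiffOn.absolutelyContinuousOnInterval
  have hI : IntervalIntegrable (fun t => f' t * p t + F t * p' t) volume 0 T :=
    (hf'.mul_continuousOn hpc.continuousOn).add
      ((hFac.continuousOn.mul hp'.continuousOn).intervalIntegrable)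
  have h := integral_eq_sub_of_absolutelyContinuousOnInterval (hFac.smul hpac) hI (by
    filter_upwards [hf'.ae_hasDerivAt_integral] with t h1 ht
    exact ((h1 ht 0 left_mem_uIcc).const_add (f 0)).mul (hp t))
  have e : ∫ t in (0 : ℝ)..T, (f' t * p t + f t * p' t) = ∫ t in (0 : ℝ)..T, (f' t * p t + F t * p' t) :=
    intervalIntegral.integral_congr fun t ht => by
      rw [uIcc_of_le hT] at ht
      simp only [hF, ← hf t ht]
  rw [e, h]
  simp only [Pi.smul_apply', smul_eq_mul]
  have h1 : F T = f T := (hf T ⟨hT, le_rfl⟩).symm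
  have h2 : F 0 = f 0 := (hf 0 ⟨le_rfl, hT⟩).symm
  rw [h1, h2]

end
end HydrostaticNS

namespace HydrostaticNS
noncomputable section

/-! ### Norms in Fourier variables -/

lemma analyticNorm_sq_eq_esum (r τ : ℝ) (f : ChannelL2) :
    analyticNorm r τ f ^ 2 = esum (cE r τ) (coefE (cx f)) := by
  simp only [analyticNorm_sq, esum, ofReal_cE]

lemma analyticSq_eq_esum (r τ : ℝ) (f : ChannelL2) :
    analyticSq (r + 1 / 2) τ f = esum (cX r τ) (coefE (cx f)) := by
  simp only [analyticSq_eq, esum, ofReal_cX]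

lemma analyticNormDz_sq_eq_esum (r τ : ℝ) (f : ChannelL2) :
    analyticNormDz r τ f ^ 2 = esum (cZ r τ) (coefE (cx f)) := by
  rw [analyticNormDz_sq, esum, ← ENNReal.tsum_mul_left]
  refine tsum_congr fun j => ?_
  rw [cZ, ENNReal.ofReal_mul (cE_nonneg _ _ _), ofReal_cE, ← sq_abs, abs_mul, abs_of_pos Real.pi_pos,
    ENNReal.ofReal_pow (by positivity), ENNReal.ofReal_mul Real.pi_pos.le, ← em_eq, piE]
  ring

lemma esum_mono {c d : ℤ × ℤ → ℝ} (h : ∀ j, c j ≤ d j) (a : ℤ × ℤ → ℂ) : esum c a ≤ esum d a :=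
  ENNReal.tsum_le_tsum fun j => mul_le_mul_left (ENNReal.ofReal_le_ofReal (h j)) _

lemma rpow_mul_exp_le_cE {r s σ τ : ℝ} (hs : 0 ≤ s) (hsr : s ≤ 2 * r) (hσ : σ ≤ τ)
    (j : ℤ × ℤ) : waveNumber j.1 ^ s * Real.exp (2 * σ * waveNumber j.1) ≤ cE r τ j := by
  have hw := waveNumber_nonneg j.1
  have he : Real.exp (2 * σ * waveNumber j.1) ≤ Real.exp (2 * τ * waveNumber j.1) := by
    gcongr
  rcases eq_or_ne j.1 0 with h | h
  · rw [cE, h, waveNumber_zero]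
    simp only [mul_zero, Real.exp_zero, mul_one]
    have h1 : (0 : ℝ) ≤ 0 ^ (2 * r) := Real.rpow_nonneg le_rfl _
    have h2 : (0 : ℝ) ^ s ≤ 1 := Real.rpow_le_one le_rfl zero_le_one hs
    linarith
  · rw [cE]
    have h1 : waveNumber j.1 ^ s ≤ waveNumber j.1 ^ (2 * r) :=
      Real.rpow_le_rpow_of_exponent_le (one_le_waveNumber h) hsr
    have := mul_le_mul h1 he (Real.exp_pos _).le (Real.rpow_nonneg hw _)
    linarith

lemma cE_le_two_mul {r s τ : ℝ} (hs : 0 ≤ s) (hsr : s ≤ r) (hτ : 0 ≤ τ) (j : ℤ × ℤ) :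
    cE s 0 j ≤ 2 * cE r τ j := by
  have h1 := rpow_mul_exp_le_cE (r := r) (s := 2 * s) (by linarith) (by linarith) hτ j
  have h2 : 1 ≤ cE r τ j := by
    rw [cE]
    have := mul_nonneg (Real.rpow_nonneg (waveNumber_nonneg j.1) (2 * r))
      (Real.exp_pos (2 * τ * waveNumber j.1)).le
    linarith
  rw [cE]; linarith

lemma add_sq_le_two_mul (x y : ℝ≥0∞) : (x + y) ^ 2 ≤ 2 * (x ^ 2 + y ^ 2) := by
  wlog h : x ≤ y generalizing x y
  · rw [add_comm x, add_comm (x ^ 2)]; exact this y x (le_of_not_ge h)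
  obtain ⟨d, rfl⟩ := exists_add_of_le h
  calc (x + (x + d)) ^ 2 ≤ (x + (x + d)) ^ 2 + d ^ 2 := le_self_add
    _ = _ := by ring

/-! ### Time derivatives in Fourier variables -/

/-- The cosine coefficients that correspond to the even coefficients `c`. -/
def cosOf (c : ℤ × ℤ → ℂ) (k : ℤ) (n : ℕ) : ℂ :=
  (if n = 0 then 1 else (Real.sqrt 2 : ℂ)) * c (k, (n : ℤ))

lemma analyticWeight_zero (b : ℤ → ℕ → ℂ) : analyticWeight 0 0 b = b := by
  ext k n; simp [analyticWeight]

/-- The dual weight `1/(1 + w² + π²n²)` is at most `1/n²`, which is the square of the vertical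
primitive's factor. The `2` is the square of the normalisation of the cosines. -/
lemma dualSq_analyticWeight_le {s σ : ℝ} (hs : 0 ≤ s) {c : ℤ × ℤ → ℂ} (h0 : ∀ k, c (k, 0) = 0) :
    dualSq (analyticWeight s σ (cosOf c))
      ≤ 2 * (l2 fun j => im j.2 * (wv j.1 ^ s * (ew σ j.1 * ‖c j‖ₑ))) ^ 2 := by
  rw [l2_sq, ← ENNReal.tsum_mul_left, ENNReal.tsum_prod', dualSq]
  refine ENNReal.tsum_le_tsum fun k => ?_
  refine le_trans (ENNReal.tsum_le_tsum fun n => ?_) (ENNReal.tsum_comp_le_tsum_of_injective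
    (f := fun n : ℕ => (n : ℤ)) Nat.cast_injective
    fun m : ℤ => 2 * (im m * (wv k ^ s * (ew σ k * ‖c (k, m)‖ₑ))) ^ 2)
  rcases Nat.eq_zero_or_pos n with rfl | hn
  · simp [analyticWeight, cosOf, h0]
  · have hn0 : (n : ℤ) ≠ 0 := by exact_mod_cast hn.ne'
    have e1 : ‖analyticWeight s σ (cosOf c) k n‖ₑ ^ 2 = 2 * (wv k ^ s * (ew σ k * ‖c (k, n)‖ₑ)) ^ 2 := by
      rw [analyticWeight, cosOf, if_neg hn.ne', enorm_mul, enorm_mul, ← ofReal_norm (Real.sqrt 2 : ℂ),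
        Complex.norm_of_nonneg (Real.sqrt_nonneg 2), ← ofReal_norm ((_ : ℝ) : ℂ),
        Complex.norm_of_nonneg (mul_nonneg (Real.rpow_nonneg (waveNumber_nonneg k) s) (Real.exp_pos _).le),
        ENNReal.ofReal_mul (Real.rpow_nonneg (waveNumber_nonneg k) s),
        ← ENNReal.ofReal_rpow_of_nonneg (waveNumber_nonneg k) hs]
      have : ENNReal.ofReal (Real.sqrt 2) ^ 2 = 2 := by
        rw [← ENNReal.ofReal_pow (Real.sqrt_nonneg 2), Real.sq_sqrt zero_le_two, ENNReal.ofReal_ofNat]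
      calc _ = ENNReal.ofReal (Real.sqrt 2) ^ 2 * (wv k ^ s * (ew σ k * ‖c (k, n)‖ₑ)) ^ 2 := by
            rw [wv, ew]; ring
        _ = _ := by rw [this]
    have e2 : em n ^ 2 ≤ ENNReal.ofReal (1 + waveNumber k ^ 2 + (Real.pi * (n : ℝ)) ^ 2) := by
      rw [em_eq, ← ENNReal.ofReal_pow (abs_nonneg _), sq_abs]
      refine ENNReal.ofReal_le_ofReal ?_
      push_cast
      have h1 : (n : ℝ) ^ 2 ≤ (Real.pi * n) ^ 2 := by
        rw [mul_pow]
        exact le_mul_of_one_le_left (sq_nonneg _) (by nlinarith [Real.pi_gt_three])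
      nlinarith [sq_nonneg (waveNumber k)]
    refine ENNReal.div_le_of_le_mul ?_
    rw [e1]
    set W := wv k ^ s * (ew σ k * ‖c (k, n)‖ₑ)
    calc 2 * W ^ 2 = 2 * ((im n * em n) * W) ^ 2 := by rw [im_mul_em hn0, one_mul]
      _ = 2 * (im n * W) ^ 2 * em n ^ 2 := by ring
      _ ≤ _ := by gcongr

/-- The constant in the bounds of the time derivative. -/
def dualE (r : ℝ) : ℝ≥0∞ := 2 * (cV * cH (r - 1)) + 2 ^ (r - 1 / 2) * (5 * (cV * cH (r - 1)))

lemma dualE_ne_top {r : ℝ} (hr : 3 / 2 < r) : dualE r ≠ ⊤ := by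
  have h := ENNReal.mul_ne_top cV_ne_top (cH_ne_top (s := r - 1) (by linarith))
  exact ENNReal.add_ne_top.2 ⟨ENNReal.mul_ne_top ENNReal.ofNat_ne_top h, ENNReal.mul_ne_top
    (ENNReal.rpow_ne_top_of_nonneg (by linarith) ENNReal.ofNat_ne_top)
    (ENNReal.mul_ne_top ENNReal.ofNat_ne_top h)⟩

lemma enorm_flux_le {ν : ℝ} (hν : 0 ≤ ν) (a : ℤ × ℤ → ℂ) (j : ℤ × ℤ) :
    ‖flux ν a j‖ₑ ≤ maj (moduli a) (moduli a) j
      + ENNReal.ofReal (ν * Real.pi ^ 2) * (em j.2 * (em j.2 * ‖a j‖ₑ)) := by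
  rw [flux]
  refine (enorm_add_le _ _).trans (add_le_add (enorm_advec_le a a j) (le_of_eq ?_))
  have e : (ν * (Real.pi * j.2) ^ 2 * a j : ℂ) = ((ν * Real.pi ^ 2 : ℝ) : ℂ) * ((j.2 : ℂ) * ((j.2 : ℂ) * a j)) := by
    push_cast; ring
  rw [e, enorm_mul, enorm_mul, enorm_mul, enorm_intCast, ← ofReal_norm ((_ : ℝ) : ℂ),
    Complex.norm_of_nonneg (by positivity)]

/-- The viscous term has two vertical derivatives, one of which the dual norm removes; what is left
is the dissipation norm. For the advection the gain `1/m` is not needed and is bounded by `1`. -/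
lemma l2_dual_flux_le {r ν : ℝ} (hr : 3 / 2 < r) (hν : 0 ≤ ν) {a : ℤ × ℤ → ℂ} (h0 : ∀ k, a (k, 0) = 0) :
    (l2 fun j => im j.2 * ‖flux ν a j‖ₑ) ≤
      (dualE r * (l2 fun j => qv j.1 ^ r * ‖a j‖ₑ) + ENNReal.ofReal (ν * Real.pi ^ 2))
        * l2 fun j => qv j.1 ^ r * (em j.2 * ‖a j‖ₑ) := by
  have h00 : ∀ k, moduli a (k, 0) = 0 := fun k => by simp [h0]
  calc (l2 fun j => im j.2 * ‖flux ν a j‖ₑ)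
      ≤ l2 fun j => maj (moduli a) (moduli a) j
          + ENNReal.ofReal (ν * Real.pi ^ 2) * (qv j.1 ^ r * (em j.2 * ‖a j‖ₑ)) := by
        refine l2_mono fun j => ?_
        calc _ ≤ im j.2 * (maj (moduli a) (moduli a) j
              + ENNReal.ofReal (ν * Real.pi ^ 2) * (em j.2 * (em j.2 * ‖a j‖ₑ))) := by
              gcongr; exact enorm_flux_le hν a j
          _ = im j.2 * maj (moduli a) (moduli a) j
              + ENNReal.ofReal (ν * Real.pi ^ 2) * ((im j.2 * em j.2) * (em j.2 * ‖a j‖ₑ)) := by ring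
          _ ≤ 1 * maj (moduli a) (moduli a) j
              + ENNReal.ofReal (ν * Real.pi ^ 2) * (qv j.1 ^ r * (em j.2 * ‖a j‖ₑ)) := by
              gcongr
              · exact im_le_one _
              · exact (im_mul_em_le _).trans ((one_le_qv _).trans (qv_le_rpow (by linarith) _))
          _ = _ := by rw [one_mul]
    _ ≤ l2 (maj (moduli a) (moduli a)) + ENNReal.ofReal (ν * Real.pi ^ 2)
          * l2 fun j => qv j.1 ^ r * (em j.2 * ‖a j‖ₑ) := by
        refine (l2_add_le _ _).trans ?_
        rw [l2_const_mul]
    _ ≤ dualE r * ((l2 fun j => qv j.1 ^ r * ‖a j‖ₑ) * (l2 fun j => qv j.1 ^ r * (em j.2 * ‖a j‖ₑ)))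
          + ENNReal.ofReal (ν * Real.pi ^ 2) * l2 fun j => qv j.1 ^ r * (em j.2 * ‖a j‖ₑ) := by
        gcongr
        exact (l2_maj_le hr h00).trans (mul_le_mul_left le_self_add _)
    _ = _ := by ring

/-- Here, unlike in the unweighted case, the gain `1/m` is essential for the advection, through
`l2_dual_maj_le`. -/
lemma l2_dual_weighted_flux_le {r ν τ : ℝ} (hr : 3 / 2 < r) (hν : 0 ≤ ν) (hτ : 0 ≤ τ)
    {a : ℤ × ℤ → ℂ} (h0 : ∀ k, a (k, 0) = 0) :
    (l2 fun j => im j.2 * (wv j.1 ^ (r - 1 / 2) * (ew τ j.1 * ‖flux ν a j‖ₑ))) ≤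
      (dualE r * (l2 fun j => qv j.1 ^ r * (ew τ j.1 * ‖a j‖ₑ)) + ENNReal.ofReal (ν * Real.pi ^ 2))
        * ((l2 fun j => qv j.1 ^ r * (em j.2 * (ew τ j.1 * ‖a j‖ₑ)))
          + l2 fun j => wv j.1 ^ (r + 1 / 2) * (ew τ j.1 * ‖a j‖ₑ)) := by
  set D : ℤ × ℤ → ℝ≥0∞ := fun j => ew τ j.1 * ‖a j‖ₑ with hD
  have h00 : ∀ k, D (k, 0) = 0 := fun k => by simp [hD, h0]
  set Y := l2 fun j => qv j.1 ^ r * D j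
  set F := l2 fun j => qv j.1 ^ r * (em j.2 * D j)
  set X := l2 fun j => wv j.1 ^ (r + 1 / 2) * D j
  calc _ ≤ l2 fun j => im j.2 * (wv j.1 ^ (r - 1 / 2) * maj D D j)
          + ENNReal.ofReal (ν * Real.pi ^ 2) * (qv j.1 ^ r * (em j.2 * D j)) := by
        refine l2_mono fun j => ?_
        calc _ ≤ im j.2 * (wv j.1 ^ (r - 1 / 2) * (ew τ j.1 * (maj (moduli a) (moduli a) j
              + ENNReal.ofReal (ν * Real.pi ^ 2) * (em j.2 * (em j.2 * ‖a j‖ₑ))))) := by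
              gcongr; exact enorm_flux_le hν a j
          _ = im j.2 * (wv j.1 ^ (r - 1 / 2) * (ew τ j.1 * maj (moduli a) (moduli a) j))
              + ENNReal.ofReal (ν * Real.pi ^ 2) * (((im j.2 * em j.2) * wv j.1 ^ (r - 1 / 2)) *
                (em j.2 * D j)) := by simp only [hD]; ring
          _ ≤ _ := by
              gcongr
              · exact ew_mul_maj_le hτ _ _ j
              · calc im j.2 * em j.2 * wv j.1 ^ (r - 1 / 2) ≤ 1 * qv j.1 ^ (r - 1 / 2) := by
                      gcongr
                      · exact im_mul_em_le _
                      · linarith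
                      · exact wv_le_qv _
                  _ ≤ qv j.1 ^ r := by rw [one_mul]; exact qv_rpow_mono _ (by linarith)
    _ ≤ (l2 fun j => im j.2 * (wv j.1 ^ (r - 1 / 2) * maj D D j)) + ENNReal.ofReal (ν * Real.pi ^ 2) * F := by
        refine (l2_add_le _ _).trans ?_
        rw [l2_const_mul]
    _ ≤ dualE r * (Y * (F + X)) + ENNReal.ofReal (ν * Real.pi ^ 2) * (F + X) := by
        gcongr
        · exact (l2_dual_maj_le hr h00).trans (mul_le_mul_left le_add_self _)
        · exact le_self_add
    _ = _ := by ring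

lemma l2_wv_ew_sq_eq {r : ℝ} (hr : 0 ≤ r) (τ : ℝ) (a : ℤ × ℤ → ℂ) :
    (l2 fun j => wv j.1 ^ (r + 1 / 2) * (ew τ j.1 * ‖a j‖ₑ)) ^ 2 = esum (cX r τ) a := by
  rw [l2_sq, esum]
  refine tsum_congr fun j => ?_
  rw [ofReal_cX, gw_eq _ _ _ (by linarith)]
  ring

end
end HydrostaticNS

/-! ### Regularity class of the constructed solution -/

namespace HydrostaticNS
noncomputable section

lemma gain_anti {G s t : ℝ} (hG : 0 < G) (h : s ≤ t) : gain G t ≤ gain G s := by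
  unfold gain; gcongr

lemma one_le_gain {G t : ℝ} (hG : 0 < G) (h : t ≤ G / 4) : 1 ≤ gain G t := by
  have h1 := Real.add_one_le_exp (-(2 * t / G))
  have h2 : 2 * t / G ≤ 1 / 2 := by rw [div_le_iff₀ hG]; linarith
  unfold gain; linarith

namespace IsSpectralSolution

variable {r ν τ₀ K : ℝ} {a₀ : ℤ × ℤ → ℂ} {a : ℝ → ℤ × ℤ → ℂ} {τ : ℝ → ℝ}

lemma measurable_esum (h : IsSpectralSolution r ν τ₀ K a₀ a τ) {c : ℝ → ℤ × ℤ → ℝ}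
    (hc : ∀ j, Continuous fun σ => c σ j) : Measurable fun t => esum (c (τ t)) (a t) :=
  HydrostaticNS.measurable_esum hc (fun j => (h.continuous j).measurable) h.radius_continuous.measurable

/-- The additional dissipation rate decays in time but is bounded below on `[0,T]` by its final
value, so the norm of order `r + 1/2` is square integrable on every bounded interval. -/
lemma lintegral_dissipation_ne_top (h : IsSpectralSolution r ν τ₀ K a₀ a τ) (hν : 0 < ν) (hK : 0 < K)
    {T : ℝ} (hT : 0 ≤ T) :
    ∫⁻ t in Ioo 0 T, (1 + esum (cZ r (τ t)) (a t) + esum (cX r (τ t)) (a t)) ≠ ⊤ := by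
  have mZ := h.measurable_esum (continuous_cZ r)
  have hG : 0 < triR r * K / ν := by have := triR_pos r; positivity
  have m1 : Measurable fun t => 1 + esum (cZ r (τ t)) (a t) := measurable_const.add mZ
  rw [lintegral_add_left m1, lintegral_add_left measurable_const, setLIntegral_const]
  refine ENNReal.add_ne_top.2 ⟨ENNReal.add_ne_top.2 ⟨by simp, ?_⟩, ?_⟩
  · have hν' : ENNReal.ofReal ν ≠ 0 := by simpa using hν
    exact ((lintegral_le_of_decay hν (h.decay T hT)).trans_lt
      (ENNReal.div_lt_top ENNReal.ofReal_ne_top hν')).ne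
  · have hg : ENNReal.ofReal (gain (triR r * K / ν) T) ≠ 0 := by simpa using gain_pos _ _
    have h1 : ENNReal.ofReal (gain (triR r * K / ν) T) * ∫⁻ t in Ioo 0 T, esum (cX r (τ t)) (a t)
        ≤ ENNReal.ofReal (K ^ 2) := by
      rw [← lintegral_const_mul' _ _ ENNReal.ofReal_ne_top]
      calc _ ≤ ∫⁻ s in Ioo 0 T, (ENNReal.ofReal ν * esum (cZ r (τ s)) (a s)
            + ENNReal.ofReal (gain (triR r * K / ν) s) * esum (cX r (τ s)) (a s)) := by
            refine setLIntegral_mono' measurableSet_Ioo fun s hs => le_trans ?_ le_add_self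
            exact mul_le_mul_left (ENNReal.ofReal_le_ofReal (gain_anti hG hs.2.le)) _
        _ ≤ 2 * _ := le_mul_of_one_le_left' one_le_two
        _ ≤ _ := le_add_self.trans (h.energy T hT)
    intro htop
    rw [htop, ENNReal.mul_top hg] at h1
    exact ENNReal.ofReal_ne_top (top_le_iff.1 h1)

theorem isWeakSolution (h : IsSpectralSolution r ν τ₀ K a₀ a τ) (hr : 2 ≤ r) (hν : 0 < ν) (hK : 0 < K)
    (hτ : ∀ t, 0 < τ t) {u : ℝ → ChannelL2} (hu : ∀ t, coefE (cx (u t)) = a t) {T : ℝ} (hT : 0 < T)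
    (heq : SolvesEquation ν T u) : IsWeakSolution r ν T (u 0) τ u := by
  have hQ := h.lintegral_dissipation_ne_top hν hK hT.le
  have h0r : (0 : ℝ) ≤ r := by linarith
  -- Every integral in the definition of a weak solution is dominated by a constant multiple of the
  -- integral of `1 + Z + X`, which is finite.
  have key : ∀ {A : ℝ≥0∞} {f : ℝ → ℝ≥0∞}, A ≠ ⊤ →
      (∀ t, f t ≤ A * (1 + esum (cZ r (τ t)) (a t) + esum (cX r (τ t)) (a t))) →
      ∫⁻ t in Ioo 0 T, f t < ⊤ := fun {A f} hA hf => by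
    refine (lintegral_mono hf).trans_lt ?_
    rw [lintegral_const_mul' _ _ hA]
    exact ENNReal.mul_lt_top hA.lt_top hQ.lt_top
  have haux : ∀ A B z x : ℝ≥0∞, A + B * z ≤ (A + B) * (1 + z + x) := fun A B z x =>
    calc A + B * z ≤ A + B * z + (A * (z + x) + B * (1 + x)) := le_self_add
      _ = _ := by ring
  have hk : ENNReal.ofReal K ≠ ⊤ := ENNReal.ofReal_ne_top
  have hb : ∀ t, esum (cE r (τ t)) (a t) ≤ ENNReal.ofReal K ^ 2 := fun t => by
    rw [← ENNReal.ofReal_pow hK.le]; exact h.bound t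
  have hE : ∀ {s : ℝ}, 0 ≤ s → s ≤ r → ∀ t, esum (cE s 0) (a t) ≤ 2 * esum (cE r (τ t)) (a t) :=
    fun hs hsr t => by
      have := esum_const_mul zero_le_two (cE r (τ t)) (a t)
      rw [ENNReal.ofReal_ofNat] at this
      rw [this]
      exact esum_mono (cE_le_two_mul hs hsr (hτ t).le) _
  have hZ : ∀ t, esum (cZ 0 0) (a t) ≤ 2 * esum (cZ r (τ t)) (a t) := fun t => by
    have := esum_const_mul zero_le_two (cZ r (τ t)) (a t)
    rw [ENNReal.ofReal_ofNat] at this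
    rw [this]
    refine esum_mono (fun j => ?_) _
    rw [cZ, cZ, ← mul_assoc]
    exact mul_le_mul_of_nonneg_right (cE_le_two_mul le_rfl h0r (hτ t).le j) (sq_nonneg _)
  have hNE : ∀ t, analyticNorm r (τ t) (u t) ^ 2 ≤ ENNReal.ofReal K ^ 2 := fun t => by
    rw [analyticNorm_sq_eq_esum, hu]; exact hb t
  have hflux : ∀ {s σ : ℝ} (t : ℝ), 0 ≤ s →
      (l2 fun j => im j.2 * (wv j.1 ^ s * (ew σ j.1 * ‖flux ν (a t) j‖ₑ))) ≤
        (dualE r * ENNReal.ofReal K + ENNReal.ofReal (ν * Real.pi ^ 2)) *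
          ((l2 fun j => qv j.1 ^ r * (em j.2 * (ew (τ t) j.1 * ‖a t j‖ₑ)))
            + l2 fun j => wv j.1 ^ (r + 1 / 2) * (ew (τ t) j.1 * ‖a t j‖ₑ)) →
      dualSq (analyticWeight s σ (cosOf fun j => -flux ν (a t) j)) ≤
        2 * ((dualE r * ENNReal.ofReal K + ENNReal.ofReal (ν * Real.pi ^ 2)) ^ 2 * 2)
          * (1 + esum (cZ r (τ t)) (a t) + esum (cX r (τ t)) (a t)) := fun {s σ} t hs hle => by
    refine (dualSq_analyticWeight_le hs fun k => by simp [flux, advec, h.zero]).trans ?_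
    simp only [enorm_neg]
    refine (mul_le_mul_right (pow_le_pow_left₀ zero_le hle 2) 2).trans ?_
    rw [mul_pow, mul_assoc 2, mul_assoc (_ ^ 2)]
    gcongr
    refine (add_sq_le_two_mul _ _).trans ?_
    rw [l2_wv_ew_sq_eq h0r]
    gcongr
    exact (l2_qv_em_ew_le h0r _ _).trans le_add_self
  have hY : ∀ t, (l2 fun j => qv j.1 ^ r * (ew (τ t) j.1 * ‖a t j‖ₑ)) ≤ ENNReal.ofReal K := fun t =>
    le_of_sq_le ((l2_qv_ew_le h0r _ _).trans (hb t))
  have hCt : 2 * ((dualE r * ENNReal.ofReal K + ENNReal.ofReal (ν * Real.pi ^ 2)) ^ 2 * 2) ≠ ⊤ := by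
    have := dualE_ne_top (r := r) (by linarith)
    finiteness
  refine ⟨h.radius_continuous.continuousOn, fun t _ => hτ t, rfl, fun t _ => ?_, ⟨ENNReal.ofReal K,
    hk.lt_top, .of_forall fun t => le_of_sq_le (hNE t)⟩, ?_, ?_, ?_,
    ⟨fun t => cosOf fun j => -flux ν (a t) j, ?_, ?_, ?_⟩, heq⟩
  · rw [zeroVerticalMean_iff, hu]; exact h.zero t
  · refine key (A := 2 * (2 * ENNReal.ofReal K ^ 2 + 2)) (by finiteness) fun t => ?_
    calc sobolevNorm (u t) ^ 2 ≤ 2 * (analyticNorm 1 0 (u t) ^ 2 + analyticNormDz 0 0 (u t) ^ 2) :=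
          add_sq_le_two_mul _ _
      _ ≤ 2 * (2 * ENNReal.ofReal K ^ 2 + 2 * esum (cZ r (τ t)) (a t)) := by
          rw [analyticNorm_sq_eq_esum, analyticNormDz_sq_eq_esum, hu]
          gcongr
          · exact (hE zero_le_one (by linarith) t).trans (mul_le_mul_right (hb t) _)
          · exact hZ t
      _ ≤ 2 * ((2 * ENNReal.ofReal K ^ 2 + 2) * (1 + esum (cZ r (τ t)) (a t) + esum (cX r (τ t)) (a t))) := by
          gcongr
          exact haux _ _ _ _
      _ = _ := by rw [mul_assoc]
  · refine key (A := 2 * (ENNReal.ofReal K ^ 2 + 2)) (by finiteness) fun t => ?_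
    have h1 := hNE t
    calc analyticNormOne r (τ t) (u t) ^ 2
        ≤ 2 * ((analyticNorm r (τ t) (u t) + 0) ^ 2 + analyticNormDz r (τ t) (u t) ^ 2) := by
          rw [add_zero]; exact add_sq_le_two_mul _ _
      _ ≤ 2 * (ENNReal.ofReal K ^ 2 + 2 * esum (cZ r (τ t)) (a t)) := by
          rw [analyticNormDz_sq_eq_esum, hu, add_zero]
          gcongr
          exact le_mul_of_one_le_left' one_le_two
      _ ≤ 2 * ((ENNReal.ofReal K ^ 2 + 2) * (1 + esum (cZ r (τ t)) (a t) + esum (cX r (τ t)) (a t))) := by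
          gcongr
          exact haux _ _ _ _
      _ = _ := by rw [mul_assoc]
  · refine key (A := ENNReal.ofReal K ^ 2 + 1) (by finiteness) fun t => ?_
    calc analyticNorm (r + 1 / 2) (τ t) (u t) ^ 2
        ≤ ENNReal.ofReal K ^ 2 + esum (cX r (τ t)) (a t) := by
          rw [analyticNorm, rpow_half_sq, analyticSq_eq_esum, hu, add_comm]
          refine add_le_add_left (le_trans ?_ (hNE t)) _
          rw [analyticNorm, rpow_half_sq]
          exact le_add_self
      _ ≤ _ := by
          have := haux (ENNReal.ofReal K ^ 2) 1 (esum (cX r (τ t)) (a t)) (esum (cZ r (τ t)) (a t))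
          rwa [one_mul, add_right_comm 1] at this
  · intro k n
    have hfi : ∀ t, IntervalIntegrable (fun t => flux ν (a t) (k, n)) volume 0 t := fun t =>
      intervalIntegrable_of_norm_le (measurable_flux (fun j => (h.continuous j).measurable) _) fun s =>
        norm_flux_le (by linarith) (hτ s).le hν.le hK.le (h.bound s) _
    refine ⟨(hfi T).neg.const_mul _, fun t ht => ?_⟩
    simp only [cosOf, cosCoeff_eq, hu]
    rw [intervalIntegral.integral_const_mul, intervalIntegral.integral_neg, h.duhamel t ht.1, h.initial]
    ring
  · refine key hCt fun t => ?_
    beta_reduce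
    rw [← analyticWeight_zero (cosOf _)]
    refine hflux t le_rfl ?_
    have e : ∀ j, wv j.1 ^ (0 : ℝ) * (ew 0 j.1 * ‖flux ν (a t) j‖ₑ) = ‖flux ν (a t) j‖ₑ := fun j => by
      simp [ew]
    simp only [e]
    refine (l2_dual_flux_le (r := r) (by linarith) hν.le (h.zero t)).trans ?_
    have hm : ∀ x, ‖a t x‖ₑ ≤ ew (τ t) x.1 * ‖a t x‖ₑ := fun x =>
      le_mul_of_one_le_left' (one_le_ew (hτ t).le _)
    refine mul_le_mul' (add_le_add_left (mul_le_mul_right (le_trans ?_ (hY t)) _) _)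
      (le_trans ?_ le_self_add)
    · exact l2_mono fun j => mul_le_mul_right (hm j) _
    · exact l2_mono fun j => mul_le_mul_right (mul_le_mul_right (hm j) _) _
  · refine key hCt fun t => hflux t (by linarith) ?_
    refine (l2_dual_weighted_flux_le (r := r) (by linarith) hν.le (hτ t).le (h.zero t)).trans ?_
    gcongr
    exact hY t

end IsSpectralSolution

end
end HydrostaticNS

namespace HydrostaticNS
noncomputable section

/-! ### Test functions in space and time -/

lemma l2_coefE_le {g : UnitAddCircle × ℝ → ℝ} (hg : MemLp g 2 channelMeasure) {M : ℝ}
    (hM : ∀ x, ∀ z ∈ Icc (0 : ℝ) 1, |g (x, z)| ≤ M) :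
    (l2 fun j => ‖coefE (cx g) j‖ₑ) ≤ ENNReal.ofReal M ∧
      (l2 fun j => ‖coefO (cx g) j‖ₑ) ≤ ENNReal.ofReal M := by
  have hb : ∀ᵐ p : T2, ‖ev (cx g) p‖ ≤ M := by
    filter_upwards [ae_snd_norm] with p hp
    rw [ev, cx, Complex.norm_real]
    exact hM _ _ ⟨hp.2.1.le, hp.2.2.le⟩
  have key : ∀ {h : T2 → ℂ}, (∀ᵐ p, ‖h p‖ ≤ M) → ∫⁻ p, ‖h p‖ₑ ^ 2 ≤ ENNReal.ofReal M ^ 2 := fun {h} hh => by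
    calc _ ≤ ∫⁻ _ : T2, ENNReal.ofReal M ^ 2 := by
          refine lintegral_mono_ae ?_
          filter_upwards [hh] with p hp
          rw [← ofReal_norm]
          gcongr
      _ = _ := by simp
  constructor
  · apply le_of_sq_le
    rw [l2_sq]
    exact (tsum_enorm_tc_sq (memLp_ev (memLp_cx hg))).le.trans (key hb)
  · apply le_of_sq_le
    rw [l2_sq]
    refine (tsum_enorm_tc_sq (memLp_od (memLp_cx hg))).le.trans (key ?_)
    filter_upwards [hb] with p hp using (norm_od_le _ p).trans hp

section

variable {T : ℝ} {φ : ℝ → UnitAddCircle → ℝ → ℝ}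

/-- The derivative in time. -/
def timeD (φ : ℝ → UnitAddCircle → ℝ → ℝ) (t : ℝ) (x : UnitAddCircle) (z : ℝ) : ℝ :=
  deriv (fun s => φ s x z) t

lemma exists_bound_of_support {G : ℝ → UnitAddCircle → ℝ → ℝ} {a b : ℝ}
    (hc : Continuous fun q : ℝ × ℝ × ℝ => G q.1 q.2.1 q.2.2)
    (hs : ∀ t x z, t ∉ Icc a b → G t x z = 0) :
    ∃ M, 0 ≤ M ∧ ∀ t x, ∀ z ∈ Icc (0 : ℝ) 1, |G t x z| ≤ M := by
  obtain ⟨M, hM⟩ := (isCompact_Icc.prod (isCompact_Icc.prod isCompact_Icc) :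
    IsCompact (Icc a b ×ˢ (Icc (-(1 / 2) : ℝ) (1 / 2) ×ˢ Icc (0 : ℝ) 1))).exists_bound_of_continuousOn
      hc.continuousOn
  refine ⟨max M 0, le_max_right _ _, fun t x z hz => ?_⟩
  by_cases ht : t ∈ Icc a b
  · obtain ⟨y, hy, rfl, -⟩ := exists_rep x
    exact (hM (t, y, z) ⟨ht, ⟨hy.1.le, hy.2⟩, hz⟩).trans (le_max_left _ _)
  · rw [hs t x z ht, abs_zero]; exact le_max_right _ _

lemma IsSpaceTimeTest.smoothT (hφ : IsSpaceTimeTest T φ) (t : ℝ) : SmoothT (φ t) :=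
  hφ.smooth.comp (contDiff_const.prodMk contDiff_id : ContDiff ℝ ∞ fun q : ℝ × ℝ => (t, q))

lemma IsSpaceTimeTest.hasDerivAt_lift (hφ : IsSpaceTimeTest T φ) (t y z : ℝ) :
    HasDerivAt (fun s => φ s y z) (fderiv ℝ (fun q : ℝ × ℝ × ℝ => φ q.1 q.2.1 q.2.2) (t, y, z) (1, 0, 0)) t :=
  (hφ.smooth.differentiable (by simp) (t, y, z)).hasFDerivAt.comp_hasDerivAt (f := fun s : ℝ => (s, y, z)) t
    ((hasDerivAt_id t).prodMk ((hasDerivAt_const t y).prodMk (hasDerivAt_const t z)))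

lemma IsSpaceTimeTest.hasDerivAt_snd (hφ : IsSpaceTimeTest T φ) (t y z : ℝ) :
    HasDerivAt (φ t y) (fderiv ℝ (fun q : ℝ × ℝ × ℝ => φ q.1 q.2.1 q.2.2) (t, y, z) (0, 0, 1)) z :=
  (hφ.smooth.differentiable (by simp) (t, y, z)).hasFDerivAt.comp_hasDerivAt (f := fun s : ℝ => (t, y, s)) z
    ((hasDerivAt_const z t).prodMk ((hasDerivAt_const z y).prodMk (hasDerivAt_id z)))

lemma IsSpaceTimeTest.hasDerivAt (hφ : IsSpaceTimeTest T φ) (t : ℝ) (x : UnitAddCircle) (z : ℝ) :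
    HasDerivAt (fun s => φ s x z) (timeD φ t x z) t := by
  obtain ⟨y, -, rfl, -⟩ := exists_rep x
  exact (hφ.hasDerivAt_lift t y z).differentiableAt.hasDerivAt

lemma IsSpaceTimeTest.continuous_timeD_lift (hφ : IsSpaceTimeTest T φ) :
    Continuous fun q : ℝ × ℝ × ℝ => timeD φ q.1 q.2.1 q.2.2 := by
  have e : (fun q : ℝ × ℝ × ℝ => timeD φ q.1 q.2.1 q.2.2) = fun q =>
      fderiv ℝ (fun q : ℝ × ℝ × ℝ => φ q.1 q.2.1 q.2.2) q (1, 0, 0) :=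
    funext fun q => (hφ.hasDerivAt_lift q.1 q.2.1 q.2.2).deriv
  rw [e]
  exact (hφ.smooth.continuous_fderiv (by simp)).clm_apply continuous_const

lemma IsSpaceTimeTest.continuous_timeD (hφ : IsSpaceTimeTest T φ) (t : ℝ) :
    Continuous fun q : UnitAddCircle × ℝ => timeD φ t q.1 q.2 :=
  continuous_of_lift (g := fun q => timeD φ t q.1 q.2)
    (hφ.continuous_timeD_lift.comp (by fun_prop : Continuous fun q : ℝ × ℝ => (t, q)))

lemma IsSpaceTimeTest.exists_bound (hφ : IsSpaceTimeTest T φ) :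
    ∃ M, 0 ≤ M ∧ ∀ t x, ∀ z ∈ Icc (0 : ℝ) 1, |timeD φ t x z| ≤ M ∧ |deriv (φ t x) z| ≤ M := by
  obtain ⟨a, b, -, -, hs⟩ := hφ.support
  obtain ⟨M, hM0, hM⟩ := exists_bound_of_support hφ.continuous_timeD_lift (a := a) (b := b)
    fun t x z ht => by
      have : (fun s => φ s x z) =ᶠ[nhds t] fun _ => 0 := by
        filter_upwards [isClosed_Icc.isOpen_compl.mem_nhds ht] with s hs' using hs s x z hs'
      rw [timeD, this.deriv_eq, deriv_const]
  have hc : Continuous fun q : ℝ × ℝ × ℝ => deriv (φ q.1 q.2.1) q.2.2 := by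
    have e : (fun q : ℝ × ℝ × ℝ => deriv (φ q.1 q.2.1) q.2.2) = fun q =>
        fderiv ℝ (fun q : ℝ × ℝ × ℝ => φ q.1 q.2.1 q.2.2) q (0, 0, 1) :=
      funext fun q => (hφ.hasDerivAt_snd q.1 q.2.1 q.2.2).deriv
    rw [e]
    exact (hφ.smooth.continuous_fderiv (by simp)).clm_apply continuous_const
  obtain ⟨M', -, hM'⟩ := exists_bound_of_support (G := fun t x z => deriv (φ t x) z) hc (a := a) (b := b)
    fun t x z ht => by
      have : φ t x = fun _ => 0 := funext fun z => hs t x z ht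
      rw [this, deriv_const]
  exact ⟨max M M', hM0.trans (le_max_left _ _), fun t x z hz =>
    ⟨(hM t x z hz).trans (le_max_left _ _), (hM' t x z hz).trans (le_max_right _ _)⟩⟩

lemma IsSpaceTimeTest.hasDerivAt_coefE (hφ : IsSpaceTimeTest T φ) (t : ℝ) (j : ℤ × ℤ) :
    HasDerivAt (fun s => coefE (cx fun q => φ s q.1 q.2) j) (coefE (cx fun q => timeD φ t q.1 q.2) j) t := by
  obtain ⟨k, m⟩ := j
  obtain ⟨M, -, hM⟩ := hφ.exists_bound
  set e : UnitAddCircle × ℝ → ℂ := fun q => fourier (-k) q.1 * (Real.cos (Real.pi * m * q.2) : ℝ) with he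
  have hec : Continuous e := by fun_prop
  have hc : ∀ s, Continuous (cx fun q : UnitAddCircle × ℝ => φ s q.1 q.2) := fun s =>
    continuous_cx (hφ.smoothT s).continuous_uncurry
  have hd : ∀ s, Continuous (cx fun q : UnitAddCircle × ℝ => timeD φ s q.1 q.2) := fun s =>
    continuous_cx (hφ.continuous_timeD s)
  simp only [coefE_eq (integrable_of_continuous (hc _)), coefE_eq (integrable_of_continuous (hd _))]
  have hen : ∀ q, ‖e q‖ ≤ 1 := fun q => by
    rw [he, norm_mul, Complex.norm_real, fourier_apply, Circle.norm_coe, one_mul]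
    exact Real.abs_cos_le_one _
  refine (hasDerivAt_integral_of_dominated_loc_of_deriv_le (μ := channelMeasure) (s := univ)
    (F := fun s q => cx (fun q => φ s q.1 q.2) q * e q)
    (F' := fun s q => cx (fun q => timeD φ s q.1 q.2) q * e q) (bound := fun _ => M)
    Filter.univ_mem (.of_forall fun s => ((hc s).mul hec).aestronglyMeasurable)
    (integrable_of_continuous ((hc t).mul hec)) ((hd t).mul hec).aestronglyMeasurable ?_
    (integrable_const _) ?_).2
  · filter_upwards [ae_channel_mem] with q hq s _
    rw [norm_mul, cx, Complex.norm_real]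
    exact (mul_le_of_le_one_right (norm_nonneg _) (hen q)).trans (hM s q.1 q.2 ⟨hq.2.1.le, hq.2.2.le⟩).1
  · exact .of_forall fun q s _ => ((hφ.hasDerivAt s q.1 q.2).ofReal_comp).mul_const _

lemma IsSpaceTimeTest.continuous_coefE_timeD (hφ : IsSpaceTimeTest T φ) (j : ℤ × ℤ) :
    Continuous fun s => coefE (cx fun q => timeD φ s q.1 q.2) j := by
  obtain ⟨k, m⟩ := j
  obtain ⟨M, -, hM⟩ := hφ.exists_bound
  have hd : ∀ s, Continuous (cx fun q : UnitAddCircle × ℝ => timeD φ s q.1 q.2) := fun s =>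
    continuous_cx (hφ.continuous_timeD s)
  simp only [coefE_eq (integrable_of_continuous (hd _))]
  refine continuous_of_dominated (bound := fun _ => M) (fun s => ?_) (fun s => ?_) (integrable_const _)
    (.of_forall fun q => ?_)
  · exact ((hd s).mul (by fun_prop)).aestronglyMeasurable
  · filter_upwards [ae_channel_mem] with q hq
    rw [norm_mul, norm_mul, cx, Complex.norm_real, Complex.norm_real, fourier_apply, Circle.norm_coe, one_mul]
    exact (mul_le_of_le_one_right (norm_nonneg _) (Real.abs_cos_le_one _)).trans
      (hM s q.1 q.2 ⟨hq.2.1.le, hq.2.2.le⟩).1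
  · obtain ⟨x, z⟩ := q
    obtain ⟨y, -, rfl, -⟩ := exists_rep x
    exact (Complex.continuous_ofReal.comp (hφ.continuous_timeD_lift.comp
      (by fun_prop : Continuous fun s : ℝ => (s, y, z)))).mul continuous_const

end

end
end HydrostaticNS

/-! ### The constructed solution satisfies the weak formulation -/

namespace HydrostaticNS
noncomputable section

/-- The factor `1 = (1/m) · m` moves one vertical derivative from the flux to the smooth test
function. -/
lemma enorm_term_le {a c p q : ℤ × ℤ → ℂ} (h0 : ∀ j, j.2 = 0 → c j = 0) :
    ∑' j, ‖-(a j * p (-j)) + c j * q (-j)‖ₑ ≤ (l2 fun j => ‖a j‖ₑ) * (l2 fun j => ‖p j‖ₑ)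
      + (l2 fun j => im j.2 * ‖c j‖ₑ) * l2 fun j => em j.2 * ‖q j‖ₑ := by
  have e1 := l2_comp_equiv (Equiv.neg (ℤ × ℤ)) fun j => ‖p j‖ₑ
  have e2 := l2_comp_equiv (Equiv.neg (ℤ × ℤ)) fun j => em j.2 * ‖q j‖ₑ
  simp only [Equiv.neg_apply] at e1 e2
  rw [← e1, ← e2]
  refine le_trans ?_ (add_le_add (tsum_mul_le_l2 _ _) (tsum_mul_le_l2 _ _))
  rw [← ENNReal.tsum_add]
  refine ENNReal.tsum_le_tsum fun j => (enorm_add_le _ _).trans ?_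
  rw [enorm_neg, enorm_mul, enorm_mul]
  refine add_le_add le_rfl ?_
  by_cases hj : j.2 = 0
  · simp [h0 j hj]
  · have e3 : em (-j).2 = em j.2 := by rw [em, em, Prod.snd_neg, enorm_neg]
    rw [e3]
    calc ‖c j‖ₑ * ‖q (-j)‖ₑ = (im j.2 * em j.2) * (‖c j‖ₑ * ‖q (-j)‖ₑ) := by rw [im_mul_em hj, one_mul]
      _ ≤ _ := le_of_eq (by ring)

lemma flux_zero {ν : ℝ} {a : ℤ × ℤ → ℂ} {j : ℤ × ℤ} (hj : j.2 = 0) : flux ν a j = 0 := by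
  simp [flux, advec, hj]

/-- At almost every time the spatial integral is the series of `hasSum_weak_formulation`. Summation
and time integration are exchanged by absolute convergence, and each mode then gives zero by
integration by parts in time. -/
theorem IsSpectralSolution.solvesEquation {r ν τ₀ K : ℝ} {a₀ : ℤ × ℤ → ℂ} {a : ℝ → ℤ × ℤ → ℂ} {τ : ℝ → ℝ}
    (h : IsSpectralSolution r ν τ₀ K a₀ a τ) (hr : 2 ≤ r) (hν : 0 < ν) (hK : 0 < K)
    (hτ : ∀ t, 0 < τ t) {u : ℝ → ChannelL2} (hu : ∀ t, coefE (cx (u t)) = a t) {T : ℝ} (hT : 0 < T) :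
    SolvesEquation ν T u := by
  have h0r : (0 : ℝ) ≤ r := by linarith
  have hQ := h.lintegral_dissipation_ne_top hν hK hT.le
  have mQ : Measurable fun t => 1 + esum (cZ r (τ t)) (a t) + esum (cX r (τ t)) (a t) :=
    (measurable_const.add (h.measurable_esum (continuous_cZ r))).add (h.measurable_esum (continuous_cX r))
  have hk : ENNReal.ofReal K ≠ ⊤ := ENNReal.ofReal_ne_top
  have hY : ∀ t, (l2 fun j => qv j.1 ^ r * ‖a t j‖ₑ) ≤ ENNReal.ofReal K := fun t => by
    apply le_of_sq_le
    rw [← ENNReal.ofReal_pow hK.le]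
    exact (l2_qv_le h0r (hτ t).le _).trans (h.bound t)
  have hF : ∀ t, (l2 fun j => qv j.1 ^ r * (em j.2 * ‖a t j‖ₑ)) ≤
      1 + esum (cZ r (τ t)) (a t) + esum (cX r (τ t)) (a t) := fun t => by
    refine le_trans ?_ ((add_le_add_right (l2_qv_em_le h0r (hτ t).le (a t)) 1).trans le_self_add)
    set F := l2 fun j => qv j.1 ^ r * (em j.2 * ‖a t j‖ₑ)
    rcases le_total F 1 with h | h
    · exact h.trans le_self_add
    · exact (le_self_pow h two_ne_zero).trans le_add_self
  have hX : ∀ t, ∃ g, HasWeakDerivX (u t) g := fun t => by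
    refine exists_hasWeakDerivX ?_
    rw [hu, ← l2_sq]
    refine ENNReal.pow_ne_top (ne_top_of_le_ne_top hk ((l2_mono fun j => ?_).trans (hY t)))
    exact mul_le_mul_left ((wv_le_qv _).trans (qv_le_rpow (by linarith) _)) _
  have hFae : ∀ᵐ t ∂(volume.restrict (Ioo 0 T)), (l2 fun j => qv j.1 ^ r * (em j.2 * ‖a t j‖ₑ)) ≠ ⊤ := by
    filter_upwards [ae_lt_top mQ hQ] with t ht using ne_top_of_le_ne_top ht.ne (hF t)
  have hZ : ∀ᵐ t ∂(volume.restrict (Ioo 0 T)), ∃ g, HasWeakDerivZ (u t) g := by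
    filter_upwards [hFae] with t ht
    refine exists_hasWeakDerivZ ?_
    rw [hu, ← l2_sq]
    refine ENNReal.pow_ne_top (ne_top_of_le_ne_top ht (l2_mono fun j => ?_))
    exact le_mul_of_one_le_left' ((one_le_qv _).trans (qv_le_rpow (by linarith) _))
  choose ux hux using hX
  -- A vertical derivative exists only for almost every time; elsewhere the value `0` is taken, on a
  -- null set.
  have hZ' : ∀ t, ∃ g, (∃ g, HasWeakDerivZ (u t) g) → HasWeakDerivZ (u t) g := fun t => by
    by_cases ht : ∃ g, HasWeakDerivZ (u t) g
    · exact ⟨ht.choose, fun _ => ht.choose_spec⟩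
    · exact ⟨0, fun h => absurd h ht⟩
  choose uz huz using hZ'
  refine ⟨ux, uz, ?_, fun φ hφ => ?_⟩
  · filter_upwards [hZ] with t ht
    exact ⟨hux t, huz t ht⟩
  set P : ℝ → ℤ × ℤ → ℂ := fun t => coefE (cx fun q => φ t q.1 q.2) with hP
  set P' : ℝ → ℤ × ℤ → ℂ := fun t => coefE (cx fun q => timeD φ t q.1 q.2) with hP'
  have hPd : ∀ j t, HasDerivAt (fun s => P s j) (P' t j) t := fun j t => hφ.hasDerivAt_coefE t j
  have hPc : ∀ j, Continuous fun t => P t j := fun j => continuous_iff_continuousAt.2 fun t =>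
    (hPd j t).continuousAt
  have hPc' : ∀ j, Continuous fun t => P' t j := fun j => hφ.continuous_coefE_timeD j
  obtain ⟨M, hM0, hM⟩ := hφ.exists_bound
  have hC : dualE r * ENNReal.ofReal K + ENNReal.ofReal (ν * Real.pi ^ 2) ≠ ⊤ := by
    have := dualE_ne_top (r := r) (by linarith)
    finiteness
  set C := dualE r * ENNReal.ofReal K + ENNReal.ofReal (ν * Real.pi ^ 2) with hCdef
  have hl2a : ∀ t, (l2 fun j => ‖a t j‖ₑ) ≤ ENNReal.ofReal K := fun t =>
    (l2_mono fun j => le_mul_of_one_le_left' ((one_le_qv _).trans (qv_le_rpow (by linarith) _))).trans (hY t)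
  have hl2P' : ∀ t, (l2 fun j => ‖P' t j‖ₑ) ≤ ENNReal.ofReal M := fun t =>
    (l2_coefE_le (memLp_of_continuous (hφ.continuous_timeD t) 2) fun x z hz => (hM t x z hz).1).1
  have hl2P : ∀ t, (l2 fun j => em j.2 * ‖P t j‖ₑ) ≤ ENNReal.ofReal M := fun t => by
    refine le_trans (l2_mono fun j => ?_) (l2_coefE_le (memLp_of_continuous (hφ.smoothT t).continuous_deriv 2)
      fun x z hz => (hM t x z hz).2).2
    obtain ⟨k, m⟩ := j
    rw [(hφ.smoothT t).coefO_deriv, enorm_pi_mul]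
    refine le_mul_of_one_le_left' ?_
    rw [piE, ENNReal.one_le_ofReal]
    linarith [Real.pi_gt_three]
  have hl2f : ∀ t, (l2 fun j => im j.2 * ‖flux ν (a t) j‖ₑ) ≤
      C * (1 + esum (cZ r (τ t)) (a t) + esum (cX r (τ t)) (a t)) := fun t =>
    (l2_dual_flux_le (r := r) (by linarith) hν.le (h.zero t)).trans
      (mul_le_mul' (add_le_add_left (mul_le_mul_right (hY t) _) _) (hF t))
  set c : ℤ × ℤ → ℝ → ℂ := fun j t => -(a t j * P' t (-j)) + flux ν (a t) j * P t (-j) with hc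
  have hcm : ∀ j, Measurable (c j) := fun j =>
    ((h.continuous j).mul (hPc' (-j))).measurable.neg.add
      ((measurable_flux (fun i => (h.continuous i).measurable) j).mul (hPc (-j)).measurable)
  -- The flux is measured in the dual norm, where it is integrable in time, and the test function by
  -- its uniformly bounded vertical derivative.
  have hsum : ∑' j, ∫⁻ t in Ioo 0 T, ‖c j t‖ₑ ≠ ⊤ := by
    rw [← lintegral_tsum fun j => (hcm j).enorm.aemeasurable]
    have : ∀ t, ∑' j, ‖c j t‖ₑ ≤ (ENNReal.ofReal K + C) * ENNReal.ofReal M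
        * (1 + esum (cZ r (τ t)) (a t) + esum (cX r (τ t)) (a t)) := fun t => by
      refine (enorm_term_le fun j hj => flux_zero hj).trans ((add_le_add (mul_le_mul' (hl2a t) (hl2P' t))
        (mul_le_mul' (hl2f t) (hl2P t))).trans ?_)
      calc _ ≤ ENNReal.ofReal K * ENNReal.ofReal M * (1 + (esum (cZ r (τ t)) (a t) + esum (cX r (τ t)) (a t)))
            + C * (1 + esum (cZ r (τ t)) (a t) + esum (cX r (τ t)) (a t)) * ENNReal.ofReal M := by
            exact add_le_add (le_mul_of_one_le_right' le_self_add) le_rfl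
        _ = _ := by ring
    refine ne_top_of_le_ne_top ?_ (lintegral_mono this)
    rw [lintegral_const_mul _ mQ]
    finiteness
  have hinner : ∀ᵐ t ∂(volume.restrict (Ioo 0 T)), ∑' j, c j t = ((∫ p,
        (- u t p * deriv (fun s => φ s p.1 p.2) t
          + (u t p * ux t p - (∫ s in (0 : ℝ)..p.2, ux t (p.1, s)) *
            uz t p) * φ t p.1 p.2
          + (∫ s in Ioo (0 : ℝ) 1, u t (p.1, s) ^ 2) * derivX (fun x => φ t x p.2) p.1
          + ν * uz t p
            * deriv (φ t p.1) p.2) ∂channelMeasure : ℝ) : ℂ) := by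
    filter_upwards [hZ, hFae] with t ht htF
    have hm : l2 (maj (moduli (coefE (cx (u t)))) (moduli (coefE (cx (u t))))) ≠ ⊤ := by
      rw [hu]
      refine ne_top_of_le_ne_top ?_ (l2_maj_le (r := r) (by linarith) fun k => by simp [h.zero])
      have h1 := cH_ne_top (s := r - 1) (by linarith)
      have h2 := cV_ne_top
      have h3 := ne_top_of_le_ne_top hk (hY t)
      finiteness
    have hw := hasSum_weak_formulation (ν := ν) (hux t) (huz t ht) (fun k => by rw [hu, h.zero])
      hm (hφ.continuous_timeD t) (hφ.smoothT t)
    rw [hu] at hw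
    exact hw.tsum_eq
  obtain ⟨s₁, s₂, hs1, hs2, hs⟩ := hφ.support
  have hP0 : ∀ t, t ∉ Icc s₁ s₂ → ∀ j, P t j = 0 := fun t ht j => by
    have : (cx fun q : UnitAddCircle × ℝ => φ t q.1 q.2) = fun _ => 0 := by
      ext q; simp [cx, hs t q.1 q.2 ht]
    obtain ⟨k, m⟩ := j
    simp only [hP]
    rw [this, coefE_eq (h := fun _ => 0) (integrable_zero _ _ _)]
    simp
  -- The integrand is, up to sign, the derivative of the product of the coefficients of `u` and of
  -- the test function; the latter vanish at both ends of the time interval.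
  have hzero : ∀ j, ∫ t in Ioo 0 T, c j t = 0 := fun j => by
    have hib := integral_deriv_mul_add (f := fun t => a t j) (f' := fun t => -flux ν (a t) j)
      (p := fun t => P t (-j)) (p' := fun t => P' t (-j)) hT.le
      (intervalIntegrable_of_norm_le (measurable_flux (fun i => (h.continuous i).measurable) j)
        fun s => norm_flux_le (by linarith) (hτ s).le hν.le hK.le (h.bound s) j).neg
      (fun t ht => by
        rw [intervalIntegral.integral_neg, h.duhamel t ht.1, h.initial]; ring)
      (hPd (-j)) (hPc' (-j))
    rw [hP0 T (fun hh => by linarith [hh.2]), hP0 0 (fun hh => by linarith [hh.1])] at hib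
    rw [← integral_Ioc_eq_integral_Ioo, ← intervalIntegral.integral_of_le hT.le, ← neg_inj,
      ← intervalIntegral.integral_neg]
    simp only [mul_zero, sub_zero] at hib
    rw [neg_zero, ← hib]
    refine intervalIntegral.integral_congr fun t _ => ?_
    simp only [hc]; ring
  rw [← Complex.ofReal_inj, ← integral_complex_ofReal, ← integral_congr_ae hinner,
    integral_tsum (fun j => (hcm j).aestronglyMeasurable) hsum]
  simp [hzero]

end
end HydrostaticNS

namespace HydrostaticNS
noncomputable section

open Filter Topology

/-! ### From weak solutions to Fourier coefficients -/

lemma coefE_eq_cosCoeff (f : ChannelL2) (j : ℤ × ℤ) :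
    coefE (cx f) j = (if j.2 = 0 then 1 else ((Real.sqrt 2 : ℂ))⁻¹) * cosCoeff f j.1 j.2.natAbs := by
  obtain ⟨k, m⟩ := j
  have h2 : (Real.sqrt 2 : ℂ) ≠ 0 := by simp
  have e : coefE (cx f) (k, (m.natAbs : ℤ)) = coefE (cx f) (k, m) := by
    rcases Int.natAbs_eq m with h | h
    · rw [← h]
    · conv_rhs => rw [h]
      rw [coefE_neg_snd]
  rw [cosCoeff_eq, e]
  simp only [Int.natAbs_eq_zero]
  split_ifs
  · simp
  · rw [inv_mul_cancel_left₀ h2]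

lemma coefE_fourier_mul_cos (k m : ℤ) (j : ℤ × ℤ) :
    coefE (fun q => fourier k q.1 * (Real.cos (Real.pi * m * q.2) : ℝ)) j
      = ((if (k, m) = j then 1 else 0) + if (k, -m) = j then 1 else 0) / 2 := by
  have e : ev (fun q => fourier k q.1 * (Real.cos (Real.pi * m * q.2) : ℝ))
      = fun p => (1 / 2 : ℂ) * (chr (k, m) p + chr (k, -m) p) := by
    ext p
    have h := fourier_add_fourier_neg m p.2
    simp only [ev, fold, chr]
    rw [← mul_add, h]
    ring
  have hi : ∀ i, Integrable (fun p => chr i p * chr (-j) p) := fun i =>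
    (memLp_chr i).integrable (by norm_num) |>.mul_chr _
  rw [coefE, e, tc]
  simp only [mul_assoc, add_mul]
  rw [integral_const_mul, integral_add (hi _) (hi _)]
  have h1 := tc_chr (k, m) j
  have h2 := tc_chr (k, -m) j
  rw [tc] at h1 h2
  rw [h1, h2]; ring

/-- Test functions are real, so a complex mode is assembled from the tests with its real and its
imaginary part. -/
lemma coefE_re_add_im (k m : ℤ) (θ : ℝ) (j : ℤ × ℤ) :
    coefE (cx fun q => θ * ((fourier k q.1 : ℂ).re * Real.cos (Real.pi * m * q.2))) j
      + Complex.I * coefE (cx fun q => θ * ((fourier k q.1 : ℂ).im * Real.cos (Real.pi * m * q.2))) j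
      = θ * (((if (k, m) = j then 1 else 0) + if (k, -m) = j then 1 else 0) / 2) := by
  obtain ⟨k', m'⟩ := j
  have c1 : Continuous (cx fun q : UnitAddCircle × ℝ =>
      θ * ((fourier k q.1 : ℂ).re * Real.cos (Real.pi * m * q.2))) := by unfold cx; fun_prop
  have c2 : Continuous (cx fun q : UnitAddCircle × ℝ =>
      θ * ((fourier k q.1 : ℂ).im * Real.cos (Real.pi * m * q.2))) := by unfold cx; fun_prop
  have c3 : Continuous fun q : UnitAddCircle × ℝ =>
      (fourier k q.1 : ℂ) * (Real.cos (Real.pi * m * q.2) : ℝ) := by fun_prop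
  rw [← coefE_fourier_mul_cos, coefE_eq (integrable_of_continuous c1), coefE_eq (integrable_of_continuous c2),
    coefE_eq (integrable_of_continuous c3), ← integral_const_mul, ← integral_const_mul]
  refine (integral_add (integrable_of_continuous (c1.mul (by fun_prop)))
    ((integrable_of_continuous (c2.mul (by fun_prop))).const_mul _)).symm.trans ?_
  congr 1 with q
  simp only [cx, Pi.mul_apply]
  conv_rhs => rw [← Complex.re_add_im (fourier k q.1)]
  push_cast
  ring

/-- A cosine test sees the average of the modes `m` and `-m`; for an even family that average is the
value itself. -/
lemma hasSum_point_pairing {f : ℤ × ℤ → ℂ} (he : ∀ k m, f (k, -m) = f (k, m)) (k m : ℤ) :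
    HasSum (fun j => f j * (((if (-k, m) = -j then 1 else 0) + if (-k, -m) = -j then 1 else 0) / 2))
      (f (k, m)) := by
  have h1 : ∀ n : ℤ, HasSum (fun j => f j * ((if (-k, n) = -j then 1 else 0) / 2)) (f (k, m) / 2) ∨
      f (k, -n) ≠ f (k, m) := fun n => by
    by_cases hn : f (k, -n) = f (k, m)
    · left
      have := hasSum_single (f := fun j => f j * ((if (-k, n) = -j then 1 else 0) / 2)) (k, -n) fun j hj => by
        rw [if_neg, zero_div, mul_zero]
        intro h
        exact hj (by rw [← neg_neg j, ← h]; simp)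
      have e : (-k, n) = -((k, -n) : ℤ × ℤ) := by simp
      rw [if_pos e, hn] at this
      convert this using 1
      ring
    · exact Or.inr hn
  have h2 := ((h1 m).resolve_right (by simp [he])).add ((h1 (-m)).resolve_right (by simp))
  rw [add_halves] at h2
  exact h2.congr_fun fun j => by ring

/-- A solution in Fourier variables, in the regularity class of weak solutions. -/
structure IsCoefSolution (r ν T : ℝ) (a : ℝ → ℤ × ℤ → ℂ) (τ : ℝ → ℝ) : Prop where
  zero : ∀ t k, a t (k, 0) = 0
  continuous : ∀ j, Continuous fun t => a t j
  radius_continuous : Continuous τ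
  radius_pos : ∀ t, 0 < τ t
  bound : ∃ M : ℝ, 0 ≤ M ∧ ∀ᵐ t ∂(volume.restrict (Ioo 0 T)), esum (cE r (τ t)) (a t) ≤ ENNReal.ofReal (M ^ 2)
  dissipation : ∫⁻ t in Ioo 0 T, esum (cZ r (τ t)) (a t) ≠ ⊤
  duhamel : ∀ j, IntervalIntegrable (fun s => flux ν (a s) j) volume 0 T ∧
    ∀ t ∈ Icc 0 T, a t j = a 0 j - ∫ s in (0 : ℝ)..t, flux ν (a s) j

lemma exists_Icc_of_isCompact {S : Set ℝ} {T : ℝ} (hT : 0 < T) (hS : IsCompact S) (h : S ⊆ Ioo 0 T) :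
    ∃ a b : ℝ, 0 < a ∧ b < T ∧ S ⊆ Icc a b := by
  rcases S.eq_empty_or_nonempty with rfl | hne
  · exact ⟨T / 2, T / 2, by linarith, by linarith, empty_subset _⟩
  · obtain ⟨a, ha⟩ := hS.exists_isLeast hne
    obtain ⟨b, hb⟩ := hS.exists_isGreatest hne
    exact ⟨a, b, (h ha.1).1, (h hb.1).2, fun s hs => ⟨ha.2 hs, hb.2 hs⟩⟩

lemma isSpaceTimeTest_mul {T : ℝ} (hT : 0 < T) {θ : ℝ → ℝ} (hθ : ContDiff ℝ ∞ θ) (hc : HasCompactSupport θ)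
    (hs : tsupport θ ⊆ Ioo 0 T) {A : UnitAddCircle → ℝ} (hA : ContDiff ℝ ∞ fun s : ℝ => A s) (m : ℤ) :
    IsSpaceTimeTest T fun t x z => θ t * (A x * Real.cos (Real.pi * m * z)) := by
  obtain ⟨a, b, ha, hb, hab⟩ := exists_Icc_of_isCompact hT hc hs
  refine ⟨?_, a, b, ha, hb, fun t x z ht => ?_⟩
  · have h1 : ContDiff ℝ ∞ fun q : ℝ × ℝ × ℝ => θ q.1 := hθ.comp contDiff_fst
    have h2 : ContDiff ℝ ∞ fun q : ℝ × ℝ × ℝ => A q.2.1 := hA.comp (contDiff_fst.comp contDiff_snd)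
    have h3 : ContDiff ℝ ∞ fun q : ℝ × ℝ × ℝ => Real.cos (Real.pi * m * q.2.2) := by fun_prop
    exact h1.mul (h2.mul h3)
  · rw [image_eq_zero_of_notMem_tsupport fun h => ht (hab h), zero_mul]

end
end HydrostaticNS

/-! ### Weak solutions satisfy the integral equations mode by mode -/

namespace HydrostaticNS
noncomputable section

open Filter Topology

lemma l2_maj_ne_top {r τ : ℝ} (hr : 3 / 2 < r) (hτ : 0 ≤ τ) {a : ℤ × ℤ → ℂ} (h0 : ∀ k, a (k, 0) = 0)
    (hE : esum (cE r τ) a ≠ ⊤) (hZ : esum (cZ r τ) a ≠ ⊤) : l2 (maj (moduli a) (moduli a)) ≠ ⊤ := by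
  have hsq : ∀ {x y : ℝ≥0∞}, x ^ 2 ≤ y → y ≠ ⊤ → x ≠ ⊤ := fun h hy hx => by
    rw [hx] at h; simp at h; exact hy h
  refine ne_top_of_le_ne_top ?_ (l2_maj_le hr fun k => by simp [h0])
  have h1 := cH_ne_top (s := r - 1) (by linarith)
  have h2 := cV_ne_top
  have h3 := hsq (l2_qv_le (by linarith) hτ a) hE
  have h4 := hsq (l2_qv_em_le (by linarith) hτ a) hZ
  exact ENNReal.mul_ne_top (ENNReal.mul_ne_top ENNReal.ofNat_ne_top (ENNReal.mul_ne_top h2 h1))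
    (ENNReal.mul_ne_top h3 h4)

/-- The weak formulation tested with one mode. -/
lemma weak_formulation_mode {ν : ℝ} {u ux uz : ChannelL2} (hx : HasWeakDerivX u ux)
    (hz : HasWeakDerivZ u uz) (h0 : ∀ k, coefE (cx u) (k, 0) = 0)
    (hm : l2 (maj (moduli (coefE (cx u))) (moduli (coefE (cx u)))) ≠ ⊤) (θ θ' : ℝ) (k m : ℤ) :
    let I : (UnitAddCircle → ℝ) → ℝ := fun A => ∫ p, (- u p * (θ' * (A p.1 * Real.cos (Real.pi * m * p.2)))
          + (u p * ux p - (∫ s in (0 : ℝ)..p.2, ux (p.1, s)) * uz p) * (θ * (A p.1 * Real.cos (Real.pi * m * p.2)))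
          + (∫ s in Ioo (0 : ℝ) 1, u (p.1, s) ^ 2) *
            derivX (fun x => θ * (A x * Real.cos (Real.pi * m * p.2))) p.1
          + ν * uz p * deriv (fun z => θ * (A p.1 * Real.cos (Real.pi * m * z))) p.2) ∂channelMeasure
    (I (fun x => (fourier (-k) x : ℂ).re) + Complex.I * I (fun x => (fourier (-k) x : ℂ).im) : ℂ)
      = -(θ' * coefE (cx u) (k, m)) + θ * flux ν (coefE (cx u)) (k, m) := by
  intro I
  have hc1 : Continuous fun q : UnitAddCircle × ℝ =>
      θ' * ((fourier (-k) q.1 : ℂ).re * Real.cos (Real.pi * m * q.2)) := by fun_prop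
  have hc2 : Continuous fun q : UnitAddCircle × ℝ =>
      θ' * ((fourier (-k) q.1 : ℂ).im * Real.cos (Real.pi * m * q.2)) := by fun_prop
  have hs : ∀ {A : UnitAddCircle → ℝ}, (ContDiff ℝ ∞ fun s : ℝ => A s) →
      SmoothT fun x z => θ * (A x * Real.cos (Real.pi * m * z)) := fun {A} hA => by
    have h2 : ContDiff ℝ ∞ fun q : ℝ × ℝ => A q.1 := hA.comp contDiff_fst
    have h3 : ContDiff ℝ ∞ fun q : ℝ × ℝ => Real.cos (Real.pi * m * q.2) := by fun_prop
    exact contDiff_const.mul (h2.mul h3)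
  have h1 := hasSum_weak_formulation (ν := ν) hx hz h0 hm
    (χ := fun x z => θ' * ((fourier (-k) x : ℂ).re * Real.cos (Real.pi * m * z))) hc1 (hs (A := fun x => (fourier (-k) x : ℂ).re) (contDiff_fourier_re (-k)))
  have h2 := hasSum_weak_formulation (ν := ν) hx hz h0 hm
    (χ := fun x z => θ' * ((fourier (-k) x : ℂ).im * Real.cos (Real.pi * m * z))) hc2 (hs (A := fun x => (fourier (-k) x : ℂ).im) (contDiff_fourier_im (-k)))
  have h3 := h1.add (h2.mul_left Complex.I)
  have heven : ∀ k m, flux ν (coefE (cx u)) (k, -m) = flux ν (coefE (cx u)) (k, m) := fun k m => by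
    have e := advec_refl (coefE (cx u)) (coefE (cx u)) (k, m)
    simp only [coefE_neg_snd, Prod.mk.eta] at e
    rw [flux, flux, ← e, coefE_neg_snd]
    push_cast; ring
  have h4 := (hasSum_point_pairing (coefE_neg_snd (cx u)) k m).mul_left (-(θ' : ℂ))
  have h5 := (hasSum_point_pairing heven k m).mul_left (θ : ℂ)
  have h6 := h3.unique ((h4.add h5).congr_fun fun j => ?_)
  · rw [← neg_mul]; exact h6
  · have e1 := coefE_re_add_im (-k) m θ' (-j)
    have e2 := coefE_re_add_im (-k) m θ (-j)
    linear_combination (-coefE (cx u) j) * e1 + flux ν (coefE (cx u)) j * e2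

/-- Testing with a mode times a function of time identifies the weak time derivative `g` of each
coefficient with minus the flux, almost everywhere; absolute continuity of the coefficients then
yields the integral equation at every time. The solution is frozen outside `[0,T]` to obtain
functions on the whole line. -/
theorem IsWeakSolution.isCoefSolution {r ν T : ℝ} {u₀ : ChannelL2} {τ : ℝ → ℝ} {u : ℝ → ChannelL2}
    (h : IsWeakSolution r ν T u₀ τ u) (hr : 2 ≤ r) (hν : 0 < ν) (hT : 0 < T) :
    IsCoefSolution r ν T (fun t => coefE (cx (u (projIcc 0 T hT.le t)))) (fun t => τ (projIcc 0 T hT.le t)) := by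
  have hp : ∀ t, (projIcc 0 T hT.le t : ℝ) ∈ Icc 0 T := fun t => (projIcc 0 T hT.le t).2
  have hpe : ∀ t ∈ Icc 0 T, (projIcc 0 T hT.le t : ℝ) = t := fun t ht => by rw [projIcc_of_mem hT.le ht]
  set a : ℝ → ℤ × ℤ → ℂ := fun t => coefE (cx (u (projIcc 0 T hT.le t))) with ha
  set σ : ℝ → ℝ := fun t => τ (projIcc 0 T hT.le t) with hσ
  obtain ⟨b, hb, -, -⟩ := h.timeDeriv
  set g : ℤ × ℤ → ℝ → ℂ := fun j t =>
    (if j.2 = 0 then 1 else ((Real.sqrt 2 : ℂ))⁻¹) * b t j.1 j.2.natAbs with hg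
  have hgi : ∀ j, IntervalIntegrable (g j) volume 0 T := fun j => (hb _ _).1.const_mul _
  have hag : ∀ j, ∀ t ∈ Icc 0 T, a t j = a 0 j + ∫ s in (0 : ℝ)..t, g j s := fun j t ht => by
    simp only [ha, hg, hpe t ht, hpe 0 ⟨le_rfl, hT.le⟩, coefE_eq_cosCoeff]
    rw [(hb _ _).2 t ht, intervalIntegral.integral_const_mul]
    ring
  have hac : ∀ j, Continuous fun t => a t j := fun j => by
    have h1 : ContinuousOn (fun t => a 0 j + ∫ s in (0 : ℝ)..t, g j s) (Icc 0 T) := by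
      have := intervalIntegral.continuousOn_primitive_interval' (hgi j) left_mem_uIcc
      rw [uIcc_of_le hT.le] at this
      exact continuousOn_const.add this
    have h2 := h1.comp_continuous (continuous_subtype_val.comp continuous_projIcc) hp
    refine h2.congr fun t => ?_
    have := hag j _ (hp t)
    simp only [ha, hpe _ (hp t)] at this ⊢
    exact this.symm
  have hσc : Continuous σ :=
    h.radius_continuous.comp_continuous (continuous_subtype_val.comp continuous_projIcc) hp
  have hσp : ∀ t, 0 < σ t := fun t => h.radius_pos _ (hp t)
  have hz : ∀ t k, a t (k, 0) = 0 := fun t => zeroVerticalMean_iff.1 (h.zeroMean _ (hp t))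
  have hin : ∀ᵐ t ∂(volume.restrict (Ioo 0 T)), t ∈ Ioo 0 T := ae_restrict_mem measurableSet_Ioo
  have hbd : ∃ M : ℝ, 0 ≤ M ∧ ∀ᵐ t ∂(volume.restrict (Ioo 0 T)),
      esum (cE r (σ t)) (a t) ≤ ENNReal.ofReal (M ^ 2) := by
    obtain ⟨M, hM, hMb⟩ := h.bounded
    refine ⟨M.toReal, ENNReal.toReal_nonneg, ?_⟩
    filter_upwards [hMb, hin] with t ht hti
    rw [ENNReal.ofReal_pow ENNReal.toReal_nonneg, ENNReal.ofReal_toReal hM.ne]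
    simp only [ha, hσ, hpe t ⟨hti.1.le, hti.2.le⟩]
    rw [← analyticNorm_sq_eq_esum]
    exact pow_le_pow_left₀ zero_le ht 2
  have hZ : ∫⁻ t in Ioo 0 T, esum (cZ r (σ t)) (a t) ≠ ⊤ := by
    refine ne_top_of_le_ne_top h.sqInt_vertical.ne (setLIntegral_mono' measurableSet_Ioo fun t ht => ?_)
    simp only [ha, hσ, hpe t ⟨ht.1.le, ht.2.le⟩]
    rw [← analyticNormDz_sq_eq_esum]
    exact pow_le_pow_left₀ zero_le le_add_self 2
  have mZ : Measurable fun t => esum (cZ r (σ t)) (a t) :=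
    measurable_esum (continuous_cZ r) (fun j => (hac j).measurable) hσc.measurable
  have hZae := ae_lt_top mZ hZ
  have hfm : ∀ j, Measurable fun t => flux ν (a t) j := measurable_flux fun j => (hac j).measurable
  have hfi : ∀ j, IntervalIntegrable (fun s => flux ν (a s) j) volume 0 T := fun j => by
    obtain ⟨M, hM0, hM⟩ := hbd
    rw [intervalIntegrable_iff_integrableOn_Ioo_of_le hT.le]
    refine Integrable.of_bound (hfm j).aestronglyMeasurable (lipBound ν M j) ?_
    filter_upwards [hM] with t ht
    exact norm_flux_le (by linarith) (hσp t).le hν.le hM0 ht j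
  refine ⟨hz, hac, hσc, hσp, hbd, hZ, fun j => ⟨hfi j, fun t ht => ?_⟩⟩
  obtain ⟨ux, uz, hxz, heq⟩ := h.equation
  have key : ∀ θ : ℝ → ℝ, ContDiff ℝ ∞ θ → HasCompactSupport θ → tsupport θ ⊆ Ioo 0 T →
      ∫ t, θ t • (g j t + flux ν (a t) j) = 0 := fun θ hθ hc hs => by
    obtain ⟨k, m⟩ := j
    have hθd : ∀ t, HasDerivAt θ (deriv θ t) t := fun t => (hθ.differentiable (by simp) t).hasDerivAt
    have hθc : Continuous (deriv θ) := hθ.continuous_deriv (by simp)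
    have hθi : Integrable (fun t => -(((deriv θ t : ℝ) : ℂ) * a t (k, m)) + θ t * flux ν (a t) (k, m))
        (volume.restrict (Ioo 0 T)) := by
      have i1 : IntervalIntegrable (fun t => ((deriv θ t : ℝ) : ℂ) * a t (k, m)) volume 0 T :=
        ((Complex.continuous_ofReal.comp hθc).mul (hac (k, m))).intervalIntegrable _ _
      have i2 : IntervalIntegrable (fun t => (θ t : ℂ) * flux ν (a t) (k, m)) volume 0 T :=
        (hfi (k, m)).continuousOn_mul (Complex.continuous_ofReal.comp hθ.continuous).continuousOn
      have := i1.neg.add i2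
      rwa [intervalIntegrable_iff_integrableOn_Ioo_of_le hT.le] at this
    set I : ℝ → (UnitAddCircle → ℝ) → ℝ := fun t A => ∫ p,
        (- u t p * (deriv θ t * (A p.1 * Real.cos (Real.pi * m * p.2)))
          + (u t p * ux t p - (∫ s in (0 : ℝ)..p.2, ux t (p.1, s)) * uz t p) *
            (θ t * (A p.1 * Real.cos (Real.pi * m * p.2)))
          + (∫ s in Ioo (0 : ℝ) 1, u t (p.1, s) ^ 2) *
            derivX (fun x => θ t * (A x * Real.cos (Real.pi * m * p.2))) p.1
          + ν * uz t p * deriv (fun z => θ t * (A p.1 * Real.cos (Real.pi * m * z))) p.2) ∂channelMeasure with hI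
    have hI0 : ∀ A : UnitAddCircle → ℝ, (ContDiff ℝ ∞ fun s : ℝ => A s) → ∫ t in Ioo 0 T, I t A = 0 :=
      fun A hA => by
        refine Eq.trans ?_ (heq _ (isSpaceTimeTest_mul hT hθ hc hs hA m))
        simp only [hI, ((hθd _).mul_const _).deriv]
    have hIae : ∀ᵐ t ∂(volume.restrict (Ioo 0 T)), (I t (fun x => (fourier (-k) x : ℂ).re)
        + Complex.I * I t (fun x => (fourier (-k) x : ℂ).im) : ℂ)
        = -(((deriv θ t : ℝ) : ℂ) * a t (k, m)) + θ t * flux ν (a t) (k, m) := by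
      obtain ⟨M, hM0, hM⟩ := hbd
      filter_upwards [hxz, hin, hM, hZae] with t ht hti hMt hZt
      have hpt := hpe t ⟨hti.1.le, hti.2.le⟩
      have e : a t = coefE (cx (u t)) := by simp only [ha, hpt]
      have := weak_formulation_mode (ν := ν) ht.1 ht.2 (fun k => by rw [← e]; exact hz t k)
        (by rw [← e]
            exact l2_maj_ne_top (by linarith) (hσp t).le (hz t)
              (ne_top_of_le_ne_top ENNReal.ofReal_ne_top hMt) hZt.ne) (θ t) (deriv θ t) k m
      rw [e]
      exact this
    have hZ0 : ∫ t in Ioo 0 T, (-(((deriv θ t : ℝ) : ℂ) * a t (k, m)) + θ t * flux ν (a t) (k, m)) = 0 := by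
      apply Complex.ext
      · have e1 := integral_re hθi
        simp only [RCLike.re_to_complex] at e1
        refine e1.symm.trans (Eq.trans (integral_congr_ae ?_) (hI0 (fun x => (fourier (-k) x : ℂ).re) (contDiff_fourier_re (-k))))
        filter_upwards [hIae] with t ht
        rw [← ht]; simp
      · have e1 := integral_im hθi
        simp only [RCLike.im_to_complex] at e1
        refine e1.symm.trans (Eq.trans (integral_congr_ae ?_) (hI0 (fun x => (fourier (-k) x : ℂ).im) (contDiff_fourier_im (-k))))
        filter_upwards [hIae] with t ht
        rw [← ht]; simp
    have hnot : ∀ t, t ∉ Ioo 0 T → θ t = 0 := fun t ht =>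
      image_eq_zero_of_notMem_tsupport fun h => ht (hs h)
    have hib := integral_deriv_mul_add (f := fun t => a t (k, m)) (f' := g (k, m)) (p := fun t => (θ t : ℂ))
      (p' := fun t => ((deriv θ t : ℝ) : ℂ)) hT.le (hgi _) (hag _) (fun t => (hθd t).ofReal_comp)
      (Complex.continuous_ofReal.comp hθc)
    rw [hnot 0 (by simp), hnot T (by simp), Complex.ofReal_zero, mul_zero, mul_zero, sub_zero,
      intervalIntegral.integral_of_le hT.le, integral_Ioc_eq_integral_Ioo] at hib
    have hib' : Integrable (fun t => g (k, m) t * (θ t : ℂ) + a t (k, m) * ((deriv θ t : ℝ) : ℂ))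
        (volume.restrict (Ioo 0 T)) := by
      have := ((hgi (k, m)).mul_continuousOn (Complex.continuous_ofReal.comp hθ.continuous).continuousOn).add
        (((hac (k, m)).mul (Complex.continuous_ofReal.comp hθc)).intervalIntegrable 0 T)
      rwa [intervalIntegrable_iff_integrableOn_Ioo_of_le hT.le] at this
    have hsum := integral_add hib' hθi
    rw [hib, hZ0, add_zero] at hsum
    rw [← setIntegral_eq_integral_of_forall_compl_eq_zero (s := Ioo 0 T) fun t ht => by rw [hnot t ht, zero_smul],
      ← hsum]
    refine integral_congr_ae (.of_forall fun t => ?_)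
    simp only [Complex.real_smul]
    ring
  have hloc : LocallyIntegrableOn (fun t => g j t + flux ν (a t) j) (Ioo 0 T) := by
    have := (hgi j).add (hfi j)
    rw [intervalIntegrable_iff_integrableOn_Ioo_of_le hT.le] at this
    exact this.locallyIntegrableOn
  -- The fundamental lemma of the calculus of variations.
  have hae := isOpen_Ioo.ae_eq_zero_of_integral_contDiff_smul_eq_zero hloc key
  rw [hag j t ht, sub_eq_add_neg, ← intervalIntegral.integral_neg]
  congr 1
  rw [intervalIntegral.integral_of_le ht.1, intervalIntegral.integral_of_le ht.1, integral_Ioc_eq_integral_Ioo,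
    integral_Ioc_eq_integral_Ioo]
  refine integral_congr_ae ?_
  filter_upwards [ae_restrict_of_ae hae, ae_restrict_mem measurableSet_Ioo] with s hs hst
  exact eq_neg_of_add_eq_zero_left (hs ⟨hst.1, hst.2.trans_le ht.2⟩)

end
end HydrostaticNS

namespace HydrostaticNS
noncomputable section


/-! ### The difference of two solutions -/

lemma esum_sub_le (c : ℤ × ℤ → ℝ) (a b : ℤ × ℤ → ℂ) : esum c (a - b) ≤ 2 * (esum c a + esum c b) := by
  rw [esum, esum, esum, ← ENNReal.tsum_add, ← ENNReal.tsum_mul_left]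
  refine ENNReal.tsum_le_tsum fun j => ?_
  calc ENNReal.ofReal (c j) * ‖(a - b) j‖ₑ ^ 2
      ≤ ENNReal.ofReal (c j) * (2 * (‖a j‖ₑ ^ 2 + ‖b j‖ₑ ^ 2)) := by
        gcongr
        exact (pow_le_pow_left₀ zero_le enorm_sub_le 2).trans (add_sq_le_two_mul _ _)
    _ = _ := by ring

/-- Bilinearity: the difference is the advection of `a` by `a - b` plus the advection of `a - b` by
`b`. Finiteness of the majorants is needed to subtract the series termwise. -/
lemma enorm_advec_sub_le {a b : ℤ × ℤ → ℂ} {j : ℤ × ℤ} (ha : maj (moduli a) (moduli a) j ≠ ⊤)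
    (hb : maj (moduli b) (moduli b) j ≠ ⊤) :
    ‖advec a a j - advec b b j‖ₑ
      ≤ maj (moduli (a - b)) (moduli a) j + maj (moduli b) (moduli (a - b)) j := by
  have hsum : ∀ {c : ℤ × ℤ → ℂ}, maj (moduli c) (moduli c) j ≠ ⊤ → Summable (advTerm c c j) := fun h =>
    summable_of_tsum_enorm (ne_top_of_le_ne_top h (tsum_enorm_advTerm_le _ _ _))
  rw [advec, advec]
  split_ifs
  · simp
  · rw [← (hsum ha).tsum_sub (hsum hb)]
    refine (enorm_tsum_le _).trans (le_trans (ENNReal.tsum_le_tsum fun i => ?_) (ENNReal.tsum_add.trans_le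
      (add_le_add (tsum_enorm_advTerm_le (a - b) a j) (tsum_enorm_advTerm_le b (a - b) j))))
    have e : advTerm a a j i - advTerm b b j i = advTerm (a - b) a j i + advTerm b (a - b) j i := by
      simp only [advTerm, Pi.sub_apply]; ring
    rw [e]
    exact enorm_add_le _ _

/-- The constant in the estimate for the difference of two solutions. -/
def stabE (r ν : ℝ) : ℝ≥0∞ :=
  4 * (3 * (cV * (cH (r - 1) + cH (r - 1 / 2))))
    + 2 * ((3 * (cV * (cH (r - 1) + cH (r - 1 / 2)))) * (ENNReal.ofReal (√ν))⁻¹) ^ 2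

lemma stabE_ne_top {r ν : ℝ} (hr : 3 / 2 < r) (hν : 0 < ν) : stabE r ν ≠ ⊤ := by
  have h1 := cH_ne_top (s := r - 1) (by linarith)
  have h2 := cH_ne_top (s := r - 1 / 2) (by linarith)
  have h3 := cV_ne_top
  have h4 : (ENNReal.ofReal (√ν))⁻¹ ≠ ⊤ := ENNReal.inv_ne_top.2 (by simpa using hν)
  rw [stabE]
  finiteness

/-- The two terms of the difference are estimated by `tsum_mul_maj_left_le` and
`tsum_mul_maj_right_le`. The first summand on the right is to be paid by the shrinking radius, whose
rate is allowed to depend on the dissipation `Z` of the two solutions, the second by the viscosity.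
-/
lemma tsum_mul_advec_sub_le {r ν τ : ℝ} (hr : 3 / 2 < r) (hν : 0 < ν) (hτ : 0 ≤ τ) {a b : ℤ × ℤ → ℂ}
    (ha0 : ∀ k, a (k, 0) = 0) (hb0 : ∀ k, b (k, 0) = 0) {Z : ℝ≥0∞}
    (ha : ∀ j, maj (moduli a) (moduli a) j ≠ ⊤) (hb : ∀ j, maj (moduli b) (moduli b) j ≠ ⊤)
    (hZa : esum (cZ r τ) a ≤ Z) (hZb : esum (cZ r τ) b ≤ Z) :
    ∑' j, 2 * (ew τ j.1 ^ 2 * ‖(a - b) j‖ₑ * ‖advec a a j - advec b b j‖ₑ)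
      ≤ stabE r ν * (1 + Z) * l2 (fun j => qv j.1 ^ (1 / 2 : ℝ) * (ew τ j.1 * ‖(a - b) j‖ₑ)) ^ 2
        + 2 * ENNReal.ofReal ν * l2 (fun j => em j.2 * (ew τ j.1 * ‖(a - b) j‖ₑ)) ^ 2 := by
  set c := 3 * (cV * (cH (r - 1) + cH (r - 1 / 2))) with hc
  set D : ℤ × ℤ → ℝ≥0∞ := fun j => ew τ j.1 * ‖(a - b) j‖ₑ with hD
  set Ua : ℤ × ℤ → ℝ≥0∞ := fun j => ew τ j.1 * ‖a j‖ₑ with hUa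
  set Ub : ℤ × ℤ → ℝ≥0∞ := fun j => ew τ j.1 * ‖b j‖ₑ with hUb
  set Q := l2 fun j : ℤ × ℤ => qv j.1 ^ (1 / 2 : ℝ) * D j with hQ
  set P := l2 fun j : ℤ × ℤ => em j.2 * D j with hP
  set φ := Z ^ (1 / 2 : ℝ) with hφ
  have hφ2 : φ ^ 2 = Z := rpow_half_sq Z
  have hFa : (l2 fun j => qv j.1 ^ r * (em j.2 * Ua j)) ≤ φ := le_of_sq_le (by
    rw [hφ2]; exact (l2_qv_em_ew_le (by linarith) τ a).trans hZa)
  have hFb : (l2 fun j => qv j.1 ^ r * (em j.2 * Ub j)) ≤ φ := le_of_sq_le (by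
    rw [hφ2]; exact (l2_qv_em_ew_le (by linarith) τ b).trans hZb)
  have hDQ : l2 D ≤ Q := l2_mono fun j => le_mul_of_one_le_left'
    (ENNReal.one_le_rpow (one_le_qv _) (by norm_num))
  have h1 := tsum_mul_maj_left_le (D := D) (U := Ua) (r := r) fun k => by simp [hUa, ha0]
  have h2 := tsum_mul_maj_right_le (D := D) (U := Ub) (r := r) fun k => by simp [hUb, hb0]
  set s := ENNReal.ofReal (√ν) with hs
  have hs0 : s ≠ 0 := by simpa [hs] using hν
  have hs2 : s ^ 2 = ENNReal.ofReal ν := by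
    rw [hs, ← ENNReal.ofReal_pow (Real.sqrt_nonneg _), Real.sq_sqrt hν.le]
  have hφ1 : φ ≤ 1 + Z := by
    rw [← hφ2]
    rcases le_total φ 1 with h | h
    · exact h.trans le_self_add
    · exact (le_self_pow₀ h two_ne_zero).trans le_add_self
  have hXY : ∀ X Y : ℝ≥0∞, X * Y ≤ X ^ 2 + Y ^ 2 := fun X Y => by
    rcases le_total X Y with h | h
    · exact (mul_le_mul_left h Y).trans (by rw [← sq]; exact le_add_self)
    · exact (mul_le_mul_right h X).trans (by rw [← sq]; exact le_self_add)
  -- Young's inequality balanced with `√ν`, so that the vertical derivative of the difference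
  -- appears with the viscosity as its coefficient.
  have h3 : c * (φ * (Q * P)) ≤ (c * s⁻¹) ^ 2 * (Z * Q ^ 2) + ENNReal.ofReal ν * P ^ 2 := by
    calc c * (φ * (Q * P)) = (c * s⁻¹ * (φ * Q)) * (s * P) := by
          rw [show c * s⁻¹ * (φ * Q) * (s * P) = (s⁻¹ * s) * (c * (φ * (Q * P))) by ring,
            ENNReal.inv_mul_cancel hs0 ENNReal.ofReal_ne_top, one_mul]
      _ ≤ _ := hXY _ _
      _ = _ := by rw [mul_pow, mul_pow φ, hφ2, mul_pow s, hs2]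
  calc ∑' j, 2 * (ew τ j.1 ^ 2 * ‖(a - b) j‖ₑ * ‖advec a a j - advec b b j‖ₑ)
      ≤ ∑' j, 2 * (D j * maj D Ua j + D j * maj Ub D j) := by
        refine ENNReal.tsum_le_tsum fun j => ?_
        gcongr
        calc ew τ j.1 ^ 2 * ‖(a - b) j‖ₑ * ‖advec a a j - advec b b j‖ₑ
            ≤ ew τ j.1 ^ 2 * ‖(a - b) j‖ₑ *
              (maj (moduli (a - b)) (moduli a) j + maj (moduli b) (moduli (a - b)) j) := by
              gcongr; exact enorm_advec_sub_le (ha j) (hb j)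
          _ = D j * (ew τ j.1 * maj (moduli (a - b)) (moduli a) j)
              + D j * (ew τ j.1 * maj (moduli b) (moduli (a - b)) j) := by rw [hD]; ring
          _ ≤ _ := by
              gcongr
              · exact ew_mul_maj_le hτ _ _ j
              · exact ew_mul_maj_le hτ _ _ j
    _ = 2 * (∑' j, D j * maj D Ua j + ∑' j, D j * maj Ub D j) := by
        rw [ENNReal.tsum_mul_left, ENNReal.tsum_add]
    _ ≤ 2 * (c * (φ * Q ^ 2) + c * (φ * (Q ^ 2 + Q * P))) := by
        gcongr
        · exact h1.trans (by gcongr)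
        · exact h2.trans (by gcongr)
    _ = 4 * c * φ * Q ^ 2 + 2 * (c * (φ * (Q * P))) := by ring
    _ ≤ 4 * c * (1 + Z) * Q ^ 2 + 2 * ((c * s⁻¹) ^ 2 * ((1 + Z) * Q ^ 2) + ENNReal.ofReal ν * P ^ 2) := by
        gcongr
        exact h3.trans (by gcongr; exact le_add_self)
    _ = _ := by rw [stabE, ← hc, ← hs]; ring

/-- The energy identity for one coefficient, with a weight that decreases in time. -/
lemma exp_mul_sq_add_lintegral_le {x t q μ ρ₀ : ℝ} (hxt : x ≤ t) (hq : 0 ≤ q) (hμ : 0 ≤ μ) {p : ℝ → ℝ}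
    (hp : IntervalIntegrable p volume x t) (hp0 : ∀ s, 0 ≤ p s) {d N : ℝ → ℂ}
    (hN : IntervalIntegrable N volume x t) (hdc : Continuous d)
    (hd : ∀ s ∈ Icc x t, d s = - ∫ v in x..s, (N v + μ * d v)) :
    let E : ℝ → ℝ := fun s => Real.exp (2 * (ρ₀ - ∫ v in x..s, p v) * q)
    ENNReal.ofReal (E t * ‖d t‖ ^ 2)
        + ∫⁻ s in Ioo x t, ENNReal.ofReal ((2 * p s * q + 2 * μ) * (E s * ‖d s‖ ^ 2))
      ≤ ∫⁻ s in Ioo x t, ENNReal.ofReal (2 * (E s * ‖d s‖ * ‖N s‖)) := by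
  intro E
  have hIcc : uIcc x t = Icc x t := uIcc_of_le hxt
  have hE0 : ∀ s, 0 < E s := fun s => Real.exp_pos _
  set I : ℝ → ℝ := fun s => ∫ v in x..s, p v with hI
  have hIac : AbsolutelyContinuousOnInterval I x t :=
    hp.absolutelyContinuousOnInterval_intervalIntegral left_mem_uIcc
  have hI0 : ∀ s ∈ uIcc x t, 0 ≤ I s := fun s hs => by
    rw [hIcc] at hs
    exact intervalIntegral.integral_nonneg hs.1 fun v _ => hp0 v
  -- The exponent never exceeds its initial value, and below it the exponential is Lipschitz; hence
  -- the weight inherits absolute continuity from the primitive of `p`.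
  have hexp : ∀ u v : ℝ, u ≤ 2 * ρ₀ * q → v ≤ 2 * ρ₀ * q →
      |Real.exp u - Real.exp v| ≤ Real.exp (2 * ρ₀ * q) * |u - v| := by
    have H : ∀ u v : ℝ, v ≤ u → u ≤ 2 * ρ₀ * q →
        |Real.exp u - Real.exp v| ≤ Real.exp (2 * ρ₀ * q) * |u - v| := fun u v huv hu => by
      have h1 : Real.exp v = Real.exp u * Real.exp (v - u) := by rw [← Real.exp_add]; ring_nf
      have h2 := Real.add_one_le_exp (v - u)
      have h3 := Real.exp_le_exp.2 hu
      have h4 := Real.exp_pos u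
      rw [abs_of_nonneg (sub_nonneg.2 (Real.exp_le_exp.2 huv)), abs_of_nonneg (sub_nonneg.2 huv), h1]
      nlinarith
    intro u v hu hv
    rcases le_total v u with h | h
    · exact H u v h hu
    · rw [abs_sub_comm, abs_sub_comm u]; exact H v u h hv
  have hEac : AbsolutelyContinuousOnInterval E x t := by
    refine absolutelyContinuousOnInterval_of_dist_le (C := Real.exp (2 * ρ₀ * q) * (2 * q)) hIac fun u hu v hv => ?_
    have h1 := hI0 u hu
    have h2 := hI0 v hv
    refine (hexp (2 * (ρ₀ - I u) * q) (2 * (ρ₀ - I v) * q) (by nlinarith) (by nlinarith)).trans (le_of_eq ?_)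
    rw [show 2 * (ρ₀ - I u) * q - 2 * (ρ₀ - I v) * q = -(2 * q) * (I u - I v) by ring, abs_mul, abs_neg,
      abs_of_nonneg (by positivity : (0 : ℝ) ≤ 2 * q), Real.dist_eq]
    ring
  have hEc : ContinuousOn E (uIcc x t) := hEac.continuousOn
  have hNd : IntervalIntegrable (fun v => N v + μ * d v) volume x t :=
    hN.add ((continuous_const.mul hdc).intervalIntegrable x t)
  set f : ℝ → ℂ := fun s => - ∫ v in x..s, (N v + μ * d v) with hf
  have hfd : ∀ s ∈ uIcc x t, f s = d s := fun s hs => (hd s (hIcc ▸ hs)).symm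
  have hfac : AbsolutelyContinuousOnInterval f x t := (absolutelyContinuousOnInterval_primitive hNd).neg
  have hfac' : AbsolutelyContinuousOnInterval (fun s => (starRingEnd ℂ) (f s)) x t :=
    absolutelyContinuousOnInterval_of_dist_le (C := 1) hfac fun u _ v _ => by
      rw [one_mul, dist_eq_norm, dist_eq_norm, ← map_sub, RCLike.norm_conj]
  set A : ℝ → ℝ := fun s => (2 * p s * q + 2 * μ) * (E s * ‖d s‖ ^ 2) with hA
  set B : ℝ → ℝ := fun s => -(2 * (E s * (N s * (starRingEnd ℂ) (d s)).re)) with hB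
  have hAi : IntervalIntegrable A volume x t :=
    (((hp.const_mul 2).mul_const q).add intervalIntegrable_const).mul_continuousOn
      (hEc.mul (by fun_prop))
  have hre : IntervalIntegrable (fun s => (N s * (starRingEnd ℂ) (d s)).re) volume x t := by
    have := hN.mul_continuousOn (g := fun s => (starRingEnd ℂ) (d s)) (by fun_prop)
    exact ⟨this.1.re, this.2.re⟩
  have hBi : IntervalIntegrable B volume x t := ((hre.continuousOn_mul hEc).const_mul 2).neg
  -- The rate `p` is merely integrable, so the weight is differentiable only almost everywhere;
  -- absolute continuity makes the fundamental theorem of calculus available all the same.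
  have hder : ∀ᵐ s, s ∈ uIcc x t → HasDerivAt (E • (f • fun s => (starRingEnd ℂ) (f s)))
      (((-A s + B s : ℝ) : ℂ)) s := by
    filter_upwards [hp.ae_hasDerivAt_integral, hNd.ae_hasDerivAt_integral] with s h1 h2 hs
    have h3 : HasDerivAt E (E s * (2 * (-p s) * q)) s :=
      ((((h1 hs x left_mem_uIcc).const_sub ρ₀).const_mul 2).mul_const q).exp
    have h4 : HasDerivAt f (-(N s + μ * d s)) s := (h2 hs x left_mem_uIcc).neg
    have h5 : HasDerivAt (fun s => (starRingEnd ℂ) (f s)) ((starRingEnd ℂ) (-(N s + μ * d s))) s := h4.star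
    refine (h3.smul (h4.mul h5)).congr_deriv ?_
    simp only [Pi.mul_apply, hfd s hs]
    have e1 : (‖d s‖ ^ 2 : ℝ) = (d s * (starRingEnd ℂ) (d s)).re := by
      rw [Complex.mul_conj, Complex.ofReal_re, Complex.normSq_eq_norm_sq]
    apply Complex.ext
    · simp only [hA, hB, e1]
      simp
      ring
    · simp
      ring
  have hftc := integral_eq_sub_of_absolutelyContinuousOnInterval (hEac.smul (hfac.smul hfac'))
    (f' := fun s => ((-A s + B s : ℝ) : ℂ)) (by
      have := hAi.neg.add hBi
      exact ⟨this.1.ofReal, this.2.ofReal⟩) hder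
  have hfx : f x = 0 := by simp [hf]
  have hadd := intervalIntegral.integral_add hAi.neg hBi
  have hreal : E t * ‖d t‖ ^ 2 + ∫ s in x..t, A s = ∫ s in x..t, B s := by
    simp only [Pi.neg_apply, intervalIntegral.integral_neg] at hadd
    rw [intervalIntegral.integral_ofReal, hadd] at hftc
    simp only [Pi.smul_apply', hfx, smul_zero, sub_zero, zero_smul, hfd t right_mem_uIcc] at hftc
    have e2 : E t • d t • (starRingEnd ℂ) (d t) = ((E t * ‖d t‖ ^ 2 : ℝ) : ℂ) := by
      rw [smul_eq_mul, Complex.mul_conj, Complex.normSq_eq_norm_sq, Complex.real_smul]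
      push_cast; ring
    rw [e2] at hftc
    have := Complex.ofReal_injective hftc
    linarith
  have hCi : IntervalIntegrable (fun s => 2 * (E s * ‖d s‖ * ‖N s‖)) volume x t :=
    (hN.norm.continuousOn_mul (hEc.mul (by fun_prop : ContinuousOn (fun s => ‖d s‖) _))).const_mul 2
  have hBC : ∫ s in x..t, B s ≤ ∫ s in x..t, 2 * (E s * ‖d s‖ * ‖N s‖) :=
    intervalIntegral.integral_mono_on hxt hBi hCi fun s _ => by
      have h1 := Complex.abs_re_le_norm (N s * (starRingEnd ℂ) (d s))
      rw [norm_mul, RCLike.norm_conj] at h1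
      have h2 := neg_abs_le (N s * (starRingEnd ℂ) (d s)).re
      have h3 := hE0 s
      simp only [hB]
      nlinarith
  have hA0 : ∀ s, 0 ≤ A s := fun s => by
    have := hp0 s
    have := (hE0 s).le
    simp only [hA]
    positivity
  rw [← ofReal_integral_eq_lintegral_ofReal ((intervalIntegrable_iff_integrableOn_Ioo_of_le hxt).1 hAi)
      (.of_forall hA0), ← ofReal_integral_eq_lintegral_ofReal
      ((intervalIntegrable_iff_integrableOn_Ioo_of_le hxt).1 hCi)
      (.of_forall fun s => by have := (hE0 s).le; positivity),
    ← integral_Ioc_eq_integral_Ioo, ← integral_Ioc_eq_integral_Ioo, ← intervalIntegral.integral_of_le hxt,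
    ← intervalIntegral.integral_of_le hxt, ← ENNReal.ofReal_add (by have := (hE0 t).le; positivity)
      (intervalIntegral.integral_nonneg hxt fun s _ => hA0 s)]
  exact ENNReal.ofReal_le_ofReal (hreal.le.trans hBC)

end
end HydrostaticNS

/-! ### Uniqueness -/

namespace HydrostaticNS
noncomputable section


open Filter Topology

lemma cE_mono {r σ τ : ℝ} (h : σ ≤ τ) (j : ℤ × ℤ) : cE r σ j ≤ cE r τ j := by
  have hw := waveNumber_nonneg j.1
  unfold cE
  gcongr

lemma cZ_mono {r σ τ : ℝ} (h : σ ≤ τ) (j : ℤ × ℤ) : cZ r σ j ≤ cZ r τ j :=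
  mul_le_mul_of_nonneg_right (cE_mono h j) (sq_nonneg _)

variable {r ν T : ℝ} {a b : ℝ → ℤ × ℤ → ℂ} {σ₁ σ₂ : ℝ → ℝ}

lemma IsCoefSolution.ae_maj_ne_top (h : IsCoefSolution r ν T a σ₁) (hr : 3 / 2 < r) :
    ∀ᵐ t ∂(volume.restrict (Ioo 0 T)), ∀ j, maj (moduli (a t)) (moduli (a t)) j ≠ ⊤ := by
  obtain ⟨M, -, hM⟩ := h.bound
  have mZ : Measurable fun t => esum (cZ r (σ₁ t)) (a t) :=
    measurable_esum (continuous_cZ r) (fun j => (h.continuous j).measurable) h.radius_continuous.measurable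
  filter_upwards [hM, ae_lt_top mZ h.dissipation] with t h1 h2 j
  exact ne_top_of_le_ne_top (l2_maj_ne_top hr (h.radius_pos t).le (h.zero t)
    (ne_top_of_le_ne_top ENNReal.ofReal_ne_top h1) h2.ne) (le_l2 _ j)

set_option maxHeartbeats 400000 in
/-- Two solutions that agree at a time agree as long as the loss of analyticity in the estimate
for their difference does not exceed their radii. -/
lemma IsCoefSolution.eq_of_integral_le (ha : IsCoefSolution r ν T a σ₁) (hb : IsCoefSolution r ν T b σ₂)
    (hr : 3 / 2 < r) (hν : 0 < ν) {ρ₀ : ℝ} (h1 : ∀ t ∈ Icc 0 T, ρ₀ ≤ σ₁ t) (h2 : ∀ t ∈ Icc 0 T, ρ₀ ≤ σ₂ t)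
    {Z : ℝ → ℝ≥0∞} (hZ : Z = fun t => esum (cZ r (σ₁ t)) (a t) + esum (cZ r (σ₂ t)) (b t)) {p : ℝ → ℝ}
    (hp : ∀ x y, IntervalIntegrable p volume x y) (hp0 : ∀ s, 0 ≤ p s)
    (hpZ : ∀ᵐ s ∂(volume.restrict (Ioo 0 T)), ENNReal.ofReal (p s) = stabE r ν * (1 + Z s))
    {x t : ℝ} (hx : 0 ≤ x) (hxt : x ≤ t) (ht : t ≤ T) (hab : a x = b x) (hpt : ∫ s in x..t, p s ≤ ρ₀) :
    a t = b t := by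
  set ρ : ℝ → ℝ := fun s => ρ₀ - ∫ v in x..s, p v with hρ
  have hρc : Continuous ρ := continuous_const.sub (intervalIntegral.continuous_primitive hp x)
  have hρ0 : ∀ s ∈ Icc x t, 0 ≤ ρ s := fun s hs => by
    have e := intervalIntegral.integral_add_adjacent_intervals (hp x s) (hp s t)
    have := intervalIntegral.integral_nonneg (f := p) (μ := volume) hs.2 fun v _ => hp0 v
    simp only [hρ]; linarith
  have hρ1 : ∀ s ∈ Icc x t, ρ s ≤ ρ₀ := fun s hs => by
    have := intervalIntegral.integral_nonneg (f := p) (μ := volume) hs.1 fun v _ => hp0 v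
    simp only [hρ]; linarith
  have hsub : Ioo x t ⊆ Ioo 0 T := Ioo_subset_Ioo hx ht
  have hIcc : ∀ s ∈ Icc x t, s ∈ Icc 0 T := fun s hs => ⟨hx.trans hs.1, hs.2.trans ht⟩
  set d : ℝ → ℤ × ℤ → ℂ := fun s => a s - b s with hd
  set N : ℤ × ℤ → ℝ → ℂ := fun j s => advec (a s) (a s) j - advec (b s) (b s) j with hN
  have hdc : ∀ j, Continuous fun s => d s j := fun j => (ha.continuous j).sub (hb.continuous j)
  have hNm : ∀ j, Measurable (N j) := fun j =>
    (measurable_advec (fun j => (ha.continuous j).measurable) (fun j => (ha.continuous j).measurable) j).sub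
      (measurable_advec (fun j => (hb.continuous j).measurable) (fun j => (hb.continuous j).measurable) j)
  have hfx : ∀ j s, flux ν (a s) j - flux ν (b s) j = N j s + ((ν * (Real.pi * j.2) ^ 2 : ℝ) : ℂ) * d s j :=
    fun j s => by simp only [flux, hN, hd, Pi.sub_apply]; push_cast; ring
  have hfi : ∀ j, IntervalIntegrable (fun s => flux ν (a s) j - flux ν (b s) j) volume 0 T := fun j =>
    (ha.duhamel j).1.sub (hb.duhamel j).1
  have hNi : ∀ j, IntervalIntegrable (N j) volume x t := fun j => by
    have h3 := (hfi j).sub ((continuous_const (y := ((ν * (Real.pi * j.2) ^ 2 : ℝ) : ℂ))).mul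
      (hdc j) |>.intervalIntegrable 0 T)
    refine (h3.mono_set ?_).congr fun s _ => ?_
    · rw [uIcc_of_le hxt, uIcc_of_le (hx.trans (hxt.trans ht))]
      exact Icc_subset_Icc hx ht
    · simp only [hfx]; simp
  have hdd : ∀ j, ∀ s ∈ Icc x t, d s j = - ∫ v in x..s, (N j v + ((ν * (Real.pi * j.2) ^ 2 : ℝ) : ℂ) * d v j) :=
    fun j s hs => by
      have hT0 : uIcc 0 T = Icc 0 T := uIcc_of_le (hx.trans (hxt.trans ht))
      have i1 : ∀ {f : ℝ → ℂ}, IntervalIntegrable f volume 0 T → ∀ u ∈ Icc 0 T,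
          IntervalIntegrable f volume 0 u := fun hf u hu =>
        hf.mono_set (uIcc_subset_uIcc_left (hT0 ▸ hu))
      have hsT := hIcc s hs
      have hxT := hIcc x ⟨le_rfl, hxt⟩
      have e0 : ∀ u ∈ Icc 0 T, d u j = d 0 j - ∫ v in (0 : ℝ)..u, (flux ν (a v) j - flux ν (b v) j) :=
        fun u hu => by
          rw [intervalIntegral.integral_sub (i1 (ha.duhamel j).1 u hu) (i1 (hb.duhamel j).1 u hu)]
          simp only [hd, Pi.sub_apply, (ha.duhamel j).2 u hu, (hb.duhamel j).2 u hu]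
          ring
      have e1 := e0 s hsT
      have e2 := e0 x hxT
      have e3 : d x j = 0 := by simp [hd, hab]
      have e4 := intervalIntegral.integral_interval_sub_left (i1 (hfi j) s hsT) (i1 (hfi j) x hxT)
      rw [e3] at e2
      simp only [← hfx]
      rw [← e4, e1]
      linear_combination -e2
  -- The weight uses `1 + |2πk|` in place of `|2πk|`, so that the shrinking `ρ` produces damping at
  -- `k = 0` too, as the inhomogeneous factor `q^{1/2}` requires.
  set E : ℤ × ℤ → ℝ → ℝ := fun j s => Real.exp (2 * ρ s * (1 + waveNumber j.1)) with hE
  have hEc : ∀ j, Continuous (E j) := fun j => by fun_prop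
  have key : ∀ j, ENNReal.ofReal (E j t * ‖d t j‖ ^ 2)
      + ∫⁻ s in Ioo x t, ENNReal.ofReal ((2 * p s * (1 + waveNumber j.1) + 2 * (ν * (Real.pi * j.2) ^ 2))
          * (E j s * ‖d s j‖ ^ 2))
      ≤ ∫⁻ s in Ioo x t, ENNReal.ofReal (2 * (E j s * ‖d s j‖ * ‖N j s‖)) := fun j => by
    have e1 : 0 ≤ 1 + waveNumber j.1 := by linarith [waveNumber_nonneg j.1]
    have e2 : 0 ≤ ν * (Real.pi * j.2) ^ 2 := by positivity
    have h := exp_mul_sq_add_lintegral_le (q := 1 + waveNumber j.1) (μ := ν * (Real.pi * j.2) ^ 2) (ρ₀ := ρ₀)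
      (d := fun s => d s j) hxt e1 e2 (hp x t) hp0 (hNi j)
      (hdc j) (hdd j)
    exact h
  have hpm : AEMeasurable p (volume.restrict (Ioo x t)) :=
    ((intervalIntegrable_iff_integrableOn_Ioo_of_le hxt).1 (hp x t)).aestronglyMeasurable.aemeasurable
  have hsum := ENNReal.tsum_le_tsum key
  have hm1 : ∀ j, AEMeasurable (fun s => ENNReal.ofReal ((2 * p s * (1 + waveNumber j.1)
      + 2 * (ν * (Real.pi * j.2) ^ 2)) * (E j s * ‖d s j‖ ^ 2))) (volume.restrict (Ioo x t)) := fun j =>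
    ((((hpm.const_mul 2).mul_const _).add_const _).mul
      ((hEc j).mul ((hdc j).norm.pow 2)).aemeasurable).ennreal_ofReal
  have hm2 : ∀ j, AEMeasurable (fun s => ENNReal.ofReal (2 * (E j s * ‖d s j‖ * ‖N j s‖)))
      (volume.restrict (Ioo x t)) := fun j =>
    ((((hEc j).mul (hdc j).norm).measurable.mul (hNm j).norm).const_mul 2).ennreal_ofReal.aemeasurable
  -- The energy identity is used mode by mode and summed afterwards as an inequality in `ℝ≥0∞`;
  -- differentiability of the infinite sum is never needed.
  rw [ENNReal.tsum_add, ← lintegral_tsum hm1, ← lintegral_tsum hm2] at hsum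
  set R : ℝ → ℝ≥0∞ := fun s => ENNReal.ofReal (Real.exp (2 * ρ s)) *
    (stabE r ν * (1 + Z s) * l2 (fun j => qv j.1 ^ (1 / 2 : ℝ) * (ew (ρ s) j.1 * ‖d s j‖ₑ)) ^ 2
        + 2 * ENNReal.ofReal ν * l2 (fun j => em j.2 * (ew (ρ s) j.1 * ‖d s j‖ₑ)) ^ 2) with hR
  have hew : ∀ j s, ENNReal.ofReal (E j s) = ENNReal.ofReal (Real.exp (2 * ρ s)) * ew (ρ s) j.1 ^ 2 := fun j s => by
    rw [ew, ← ENNReal.ofReal_pow (Real.exp_pos _).le, ← ENNReal.ofReal_mul (Real.exp_pos _).le, ← Real.exp_nat_mul,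
      ← Real.exp_add]
    simp only [hE]
    congr 2
    push_cast; ring
  have hin : ∀ᵐ s ∂(volume.restrict (Ioo x t)), s ∈ Ioo x t := ae_restrict_mem measurableSet_Ioo
  have hmono : ∀ {P : ℝ → Prop}, (∀ᵐ s ∂(volume.restrict (Ioo 0 T)), P s) →
      ∀ᵐ s ∂(volume.restrict (Ioo x t)), P s := fun h => ae_restrict_of_ae_restrict_of_subset hsub h
  have hZab : ∀ s ∈ Ioo x t, esum (cZ r (ρ s)) (a s) ≤ Z s ∧ esum (cZ r (ρ s)) (b s) ≤ Z s := fun s hs => by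
    have hs' := Ioo_subset_Icc_self hs
    rw [hZ]
    exact ⟨(esum_mono (cZ_mono ((hρ1 s hs').trans (h1 s (hIcc s hs')))) _).trans le_self_add,
      (esum_mono (cZ_mono ((hρ1 s hs').trans (h2 s (hIcc s hs')))) _).trans le_add_self⟩
  have hRle : ∫⁻ s in Ioo x t, ∑' j, ENNReal.ofReal (2 * (E j s * ‖d s j‖ * ‖N j s‖)) ≤ ∫⁻ s in Ioo x t, R s := by
    refine lintegral_mono_ae ?_
    filter_upwards [hin, hmono (ha.ae_maj_ne_top hr), hmono (hb.ae_maj_ne_top hr)] with s hs hm1 hm2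
    have h3 := tsum_mul_advec_sub_le (r := r) hr hν (hρ0 s (Ioo_subset_Icc_self hs)) (ha.zero s) (hb.zero s) hm1 hm2
      (hZab s hs).1 (hZab s hs).2
    refine le_trans (le_of_eq ?_) (mul_le_mul_right h3 (ENNReal.ofReal (Real.exp (2 * ρ s))))
    rw [← ENNReal.tsum_mul_left]
    refine tsum_congr fun j => ?_
    have hE0 : 0 ≤ E j s := (Real.exp_pos _).le
    rw [ENNReal.ofReal_mul two_pos.le, ENNReal.ofReal_mul (mul_nonneg hE0 (norm_nonneg _)), ENNReal.ofReal_mul hE0,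
      ofReal_norm, ofReal_norm, hew, ENNReal.ofReal_ofNat]
    ring
  -- The dissipation from the loss of radius and from viscosity dominates the bound for the
  -- nonlinearity, because `q ≤ 1 + |2πk|` and `m² ≤ (πm)²`.
  have hleR : ∫⁻ s in Ioo x t, R s ≤ ∫⁻ s in Ioo x t, ∑' j, ENNReal.ofReal
      ((2 * p s * (1 + waveNumber j.1) + 2 * (ν * (Real.pi * j.2) ^ 2)) * (E j s * ‖d s j‖ ^ 2)) := by
    refine lintegral_mono_ae ?_
    filter_upwards [hmono hpZ] with s hs
    simp only [hR, ← hs, l2_sq]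
    rw [← ENNReal.tsum_mul_left, ← ENNReal.tsum_mul_left, ← ENNReal.tsum_add, ← ENNReal.tsum_mul_left]
    refine ENNReal.tsum_le_tsum fun j => ?_
    have hE0 : 0 ≤ E j s := (Real.exp_pos _).le
    have hw := waveNumber_nonneg j.1
    have hq : qv j.1 = ENNReal.ofReal (max 1 (waveNumber j.1)) := by
      rw [qv, wv, ← ENNReal.ofReal_one, ENNReal.ofReal_max]
    have hps := hp0 s
    have hc : ENNReal.ofReal (p s) * qv j.1 + 2 * ENNReal.ofReal ν * em j.2 ^ 2
        ≤ ENNReal.ofReal (2 * p s * (1 + waveNumber j.1) + 2 * (ν * (Real.pi * j.2) ^ 2)) := by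
      rw [hq, em_eq, ← ENNReal.ofReal_mul hps, ← ENNReal.ofReal_pow (abs_nonneg _), sq_abs,
        ← ENNReal.ofReal_ofNat, ← ENNReal.ofReal_mul two_pos.le, ← ENNReal.ofReal_mul (by positivity),
        ← ENNReal.ofReal_add (by positivity) (by positivity)]
      refine ENNReal.ofReal_le_ofReal ?_
      have h3 : max 1 (waveNumber j.1) ≤ 1 + waveNumber j.1 := max_le (by linarith) (by linarith)
      have h4 : (j.2 : ℝ) ^ 2 ≤ (Real.pi * j.2) ^ 2 := by
        rw [mul_pow]
        exact le_mul_of_one_le_left (sq_nonneg _) (one_le_pow₀ (by linarith [Real.pi_gt_three]))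
      nlinarith [mul_le_mul_of_nonneg_left h3 hps, mul_le_mul_of_nonneg_left h4 hν.le, mul_nonneg hps hw]
    rw [ENNReal.ofReal_mul (p := _ + _) (by positivity), ENNReal.ofReal_mul hE0, ENNReal.ofReal_pow (norm_nonneg _),
      ofReal_norm, hew, mul_pow, rpow_half_sq]
    refine le_trans (le_of_eq ?_) (mul_le_mul_left hc _)
    ring
  -- Finiteness permits cancelling this integral from both sides. It follows from the bounds of the
  -- two separate solutions, since `ρ` lies below both radii.
  have hRfin : ∫⁻ s in Ioo x t, R s ≠ ⊤ := by
    obtain ⟨M₁, -, hM₁⟩ := ha.bound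
    obtain ⟨M₂, -, hM₂⟩ := hb.bound
    set e₀ := ENNReal.ofReal (Real.exp (2 * ρ₀))
    set M := 2 * (ENNReal.ofReal (M₁ ^ 2) + ENNReal.ofReal (M₂ ^ 2))
    have hle : ∫⁻ s in Ioo x t, R s ≤ ∫⁻ s in Ioo x t,
        (e₀ * M * ENNReal.ofReal (p s) + e₀ * (2 * ENNReal.ofReal ν) * (2 * Z s)) := by
      refine lintegral_mono_ae ?_
      filter_upwards [hin, hmono hpZ, hmono hM₁, hmono hM₂] with s hs hps h3 h4
      have hs' := Ioo_subset_Icc_self hs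
      have hQ : l2 (fun j : ℤ × ℤ => qv j.1 ^ (1 / 2 : ℝ) * (ew (ρ s) j.1 * ‖d s j‖ₑ)) ^ 2 ≤ M := by
        calc _ ≤ (l2 fun j => qv j.1 ^ r * (ew (ρ s) j.1 * ‖d s j‖ₑ)) ^ 2 := by
              refine pow_le_pow_left₀ zero_le (l2_mono fun j => ?_) 2
              gcongr ?_ * _
              exact qv_rpow_mono _ (by linarith)
          _ ≤ esum (cE r (ρ s)) (d s) := l2_qv_ew_le (by linarith) _ _
          _ ≤ 2 * (esum (cE r (ρ s)) (a s) + esum (cE r (ρ s)) (b s)) := esum_sub_le _ _ _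
          _ ≤ M := by
              refine mul_le_mul_right (add_le_add ?_ ?_) _
              · exact (esum_mono (cE_mono ((hρ1 s hs').trans (h1 s (hIcc s hs')))) _).trans h3
              · exact (esum_mono (cE_mono ((hρ1 s hs').trans (h2 s (hIcc s hs')))) _).trans h4
      have hP : l2 (fun j : ℤ × ℤ => em j.2 * (ew (ρ s) j.1 * ‖d s j‖ₑ)) ^ 2 ≤ 2 * Z s := by
        calc _ ≤ (l2 fun j => qv j.1 ^ r * (em j.2 * (ew (ρ s) j.1 * ‖d s j‖ₑ))) ^ 2 :=
              pow_le_pow_left₀ zero_le (l2_mono fun j => le_mul_of_one_le_left'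
                (ENNReal.one_le_rpow (one_le_qv _) (by linarith))) 2
          _ ≤ esum (cZ r (ρ s)) (d s) := l2_qv_em_ew_le (by linarith) _ _
          _ ≤ 2 * (esum (cZ r (ρ s)) (a s) + esum (cZ r (ρ s)) (b s)) := esum_sub_le _ _ _
          _ ≤ 2 * Z s := by
              rw [hZ]
              refine mul_le_mul_right (add_le_add ?_ ?_) _
              · exact esum_mono (cZ_mono ((hρ1 s hs').trans (h1 s (hIcc s hs')))) _
              · exact esum_mono (cZ_mono ((hρ1 s hs').trans (h2 s (hIcc s hs')))) _
      have he : ENNReal.ofReal (Real.exp (2 * ρ s)) ≤ e₀ := by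
        refine ENNReal.ofReal_le_ofReal (Real.exp_le_exp.2 ?_)
        linarith [hρ1 s hs']
      simp only [hR, ← hps]
      calc _ ≤ e₀ * (ENNReal.ofReal (p s) * M + 2 * ENNReal.ofReal ν * (2 * Z s)) := by gcongr
        _ = _ := by ring
    refine ne_top_of_le_ne_top ?_ hle
    have hpi : ∫⁻ s in Ioo x t, ENNReal.ofReal (p s) ≠ ⊤ :=
      ((hasFiniteIntegral_iff_ofReal (.of_forall hp0)).1
        ((intervalIntegrable_iff_integrableOn_Ioo_of_le hxt).1 (hp x t)).2).ne
    have m1 : Measurable fun s => esum (cZ r (σ₁ s)) (a s) :=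
      measurable_esum (continuous_cZ r) (fun j => (ha.continuous j).measurable) ha.radius_continuous.measurable
    have m2 : Measurable fun s => esum (cZ r (σ₂ s)) (b s) :=
      measurable_esum (continuous_cZ r) (fun j => (hb.continuous j).measurable) hb.radius_continuous.measurable
    have mZ : Measurable Z := by rw [hZ]; exact m1.add m2
    have hZi : ∫⁻ s in Ioo x t, Z s ≠ ⊤ := by
      refine ne_top_of_le_ne_top ?_ (lintegral_mono_set hsub)
      rw [hZ, lintegral_add_left m1]
      exact ENNReal.add_ne_top.2 ⟨ha.dissipation, hb.dissipation⟩
    rw [lintegral_add_right _ (by fun_prop), lintegral_const_mul' _ _ (by finiteness),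
      lintegral_const_mul' _ _ (by finiteness), lintegral_const_mul' _ _ (by finiteness)]
    finiteness
  have hzero : ∑' j, ENNReal.ofReal (E j t * ‖d t j‖ ^ 2) = 0 := by
    have h3 := (add_le_add_right hleR _).trans (hsum.trans hRle)
    have h4 : ∑' j, ENNReal.ofReal (E j t * ‖d t j‖ ^ 2) + ∫⁻ s in Ioo x t, R s ≤ 0 + ∫⁻ s in Ioo x t, R s := by
      rwa [zero_add]
    exact le_antisymm ((ENNReal.add_le_add_iff_right hRfin).1 h4) zero_le
  rw [ENNReal.tsum_eq_zero] at hzero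
  funext j
  have h3 := ENNReal.ofReal_eq_zero.1 (hzero j)
  have h4 : ‖d t j‖ ^ 2 ≤ 0 := by
    have := Real.exp_pos (2 * ρ t * (1 + waveNumber j.1))
    by_contra hcon
    push Not at hcon
    exact absurd h3 (not_le.2 (mul_pos this hcon))
  have h5 : d t j = 0 := by
    rw [← norm_eq_zero]; nlinarith [norm_nonneg (d t j)]
  exact sub_eq_zero.1 h5

/-- Solutions are determined by their initial values. -/
theorem IsCoefSolution.unique (ha : IsCoefSolution r ν T a σ₁) (hb : IsCoefSolution r ν T b σ₂)
    (hr : 3 / 2 < r) (hν : 0 < ν) (hT : 0 < T) (hab : a 0 = b 0) : ∀ t ∈ Icc 0 T, a t = b t := by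
  obtain ⟨x₁, -, hx₁⟩ := isCompact_Icc.exists_isMinOn (nonempty_Icc.2 hT.le) ha.radius_continuous.continuousOn
  obtain ⟨x₂, -, hx₂⟩ := isCompact_Icc.exists_isMinOn (nonempty_Icc.2 hT.le) hb.radius_continuous.continuousOn
  set ρ₀ := min (σ₁ x₁) (σ₂ x₂) with hρ₀
  have hρ₀p : 0 < ρ₀ := lt_min (ha.radius_pos _) (hb.radius_pos _)
  set Z : ℝ → ℝ≥0∞ := fun t => esum (cZ r (σ₁ t)) (a t) + esum (cZ r (σ₂ t)) (b t) with hZ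
  have m1 : Measurable fun s => esum (cZ r (σ₁ s)) (a s) :=
    measurable_esum (continuous_cZ r) (fun j => (ha.continuous j).measurable) ha.radius_continuous.measurable
  have m2 : Measurable fun s => esum (cZ r (σ₂ s)) (b s) :=
    measurable_esum (continuous_cZ r) (fun j => (hb.continuous j).measurable) hb.radius_continuous.measurable
  have mZ : Measurable Z := m1.add m2
  have hZi : ∫⁻ s in Ioo 0 T, Z s ≠ ⊤ := by
    rw [hZ, lintegral_add_left m1]
    exact ENNReal.add_ne_top.2 ⟨ha.dissipation, hb.dissipation⟩
  have hκ := stabE_ne_top hr hν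
  -- Cutting off outside `(0,T)` makes the rate integrable on every interval of the line, so its
  -- primitive is continuous everywhere.
  set g : ℝ → ℝ := (Ioo 0 T).indicator fun s => (Z s).toReal with hg
  have hg0 : ∀ s, 0 ≤ g s := fun s => indicator_nonneg (fun _ _ => ENNReal.toReal_nonneg) s
  have hgi : Integrable g := (integrable_indicator_iff measurableSet_Ioo).2
    (integrable_toReal_of_lintegral_ne_top mZ.aemeasurable hZi)
  set p : ℝ → ℝ := fun s => (stabE r ν).toReal * (1 + g s) with hp
  have hpi : ∀ x y, IntervalIntegrable p volume x y := fun x y =>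
    ((intervalIntegrable_const).add hgi.intervalIntegrable).const_mul _
  have hp0 : ∀ s, 0 ≤ p s := fun s => mul_nonneg ENNReal.toReal_nonneg (by linarith [hg0 s])
  have hpZ : ∀ᵐ s ∂(volume.restrict (Ioo 0 T)), ENNReal.ofReal (p s) = stabE r ν * (1 + Z s) := by
    filter_upwards [ae_lt_top mZ hZi, ae_restrict_mem measurableSet_Ioo] with s h1 h2
    simp only [hp, hg, indicator_of_mem h2]
    rw [ENNReal.ofReal_mul ENNReal.toReal_nonneg, ENNReal.ofReal_add zero_le_one ENNReal.toReal_nonneg,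
      ENNReal.ofReal_toReal hκ, ENNReal.ofReal_toReal h1.ne, ENNReal.ofReal_one]
  -- The set of agreement is closed and contains `0`. From any of its points it extends to the
  -- right, since `∫ p` stays below the common radius `ρ₀` for a short time.
  refine IsClosed.Icc_subset_of_forall_mem_nhdsWithin (s := {t | a t = b t}) (IsClosed.inter ?_ isClosed_Icc) hab
    fun x hx => ?_
  · have e : {t | a t = b t} = ⋂ j, {t | a t j = b t j} := by ext t; simp [funext_iff]
    rw [e]
    exact isClosed_iInter fun j => isClosed_eq (ha.continuous j) (hb.continuous j)
  · have hc : ContinuousAt (fun t => ∫ s in x..t, p s) x :=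
      (intervalIntegral.continuous_primitive hpi x).continuousAt
    have h3 : ∀ᶠ t in 𝓝 x, ∫ s in x..t, p s < ρ₀ := hc.eventually_lt_const (by simpa using hρ₀p)
    filter_upwards [nhdsWithin_le_nhds h3, nhdsWithin_le_nhds (Iio_mem_nhds hx.2.2), self_mem_nhdsWithin]
      with t h4 h5 h6
    exact ha.eq_of_integral_le hb hr hν (fun t ht => (min_le_left _ _).trans (hx₁ ht))
      (fun t ht => (min_le_right _ _).trans (hx₂ ht)) hZ hpi hp0 hpZ hx.2.1 (le_of_lt h6) (le_of_lt h5) hx.1 h4.le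

end
end HydrostaticNS

/-! ### Zero data and the proof of the theorem -/

namespace HydrostaticNS
noncomputable section


/-- The construction divides by `K`, so zero data is treated apart; the bound `1` plays no role
other than being positive. -/
lemma isSpectralSolution_zero {r ν τ₀ : ℝ} (hν : 0 < ν) :
    IsSpectralSolution r ν τ₀ 1 0 (fun _ => 0) (fun _ => τ₀) where
  initial := rfl
  zero _ _ := rfl
  conj := by simp
  even _ _ _ := rfl
  continuous _ := continuous_const
  radius_zero := rfl
  radius_ge t := by
    have := triR_pos r
    exact sub_le_self _ (by positivity)
  radius_continuous := continuous_const
  bound := by simp [esum]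
  energy := by simp [esum]
  decay := by simp [esum]
  decay' := by simp [esum]
  duhamel t _ j := by
    have e : flux ν 0 j = 0 := by simp [flux, advec, advTerm]
    simp [e]

end
end HydrostaticNS

theorem theorem6p1 (r : ℝ) (hr : 2 < r) :
    ∃ C : ℝ, 0 < C ∧
      ∀ (ν τ₀ : ℝ), 0 < ν → 0 < τ₀ →
      ∀ u₀ : HydrostaticNS.ChannelL2, ZeroVerticalMean u₀ →
        analyticNorm r τ₀ u₀ < ENNReal.ofReal (ν * τ₀ / C) →
        ∃ (u : ℝ → HydrostaticNS.ChannelL2) (τ : ℝ → ℝ),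
          -- `u` is a weak solution on every time interval, with radius of analyticity `τ`
          (∀ T : ℝ, 0 < T → IsWeakSolution r ν T u₀ τ u) ∧
          -- the radius starts at `τ₀` and stays above a fixed positive number
          τ 0 = τ₀ ∧
          0 < τ₀ - C / ν * (analyticNorm r τ₀ u₀).toReal ∧
          (∀ t : ℝ, 0 ≤ t → τ₀ - C / ν * (analyticNorm r τ₀ u₀).toReal ≤ τ t) ∧
          -- energy inequalities of Leray-Hopf type
          (∃ T : ℝ, 0 < T ∧ EnergyInequality r ν 1 T τ₀ u₀ τ u) ∧
          (∀ T : ℝ, 0 < T → ∃ κ : ℝ, 0 < κ ∧ EnergyInequality r ν κ T τ₀ u₀ τ u) ∧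
          -- exponential decay
          (∀ t : ℝ, 0 ≤ t →
            ENNReal.ofReal (Real.exp (ν * t)) * analyticNorm r (τ t) (u t) ^ 2
              + ENNReal.ofReal ν * ∫⁻ s in Set.Ioo 0 t,
                  ENNReal.ofReal (Real.exp (ν * s)) * analyticNormDz r (τ s) (u s) ^ 2
              ≤ analyticNorm r τ₀ u₀ ^ 2) ∧
          (∀ t : ℝ, 0 ≤ t →
            analyticNorm r (τ t) (u t)
              ≤ ENNReal.ofReal (Real.exp (-(ν * t))) * analyticNorm r τ₀ u₀) ∧
          -- uniqueness
          (∀ (T : ℝ) (σ : ℝ → ℝ) (v : ℝ → HydrostaticNS.ChannelL2), 0 < T →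
            IsWeakSolution r ν T u₀ σ v → ∀ t ∈ Set.Icc 0 T, v t = u t) := by
  have hC := triR_pos r
  -- The factor `2` accounts for the two equal losses of radius, one caused by the nonlinearity and
  -- one granted to the extra dissipation.
  refine ⟨2 * triR r, by linarith, fun ν τ₀ hν hτ₀ u₀ hu₀ hsm => ?_⟩
  set K := (analyticNorm r τ₀ u₀).toReal with hK
  have hnt : analyticNorm r τ₀ u₀ ≠ ⊤ := (hsm.trans_le le_top).ne
  have hKn : analyticNorm r τ₀ u₀ = ENNReal.ofReal K := (ENNReal.ofReal_toReal hnt).symm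
  have hK0 : 0 ≤ K := ENNReal.toReal_nonneg
  have hKsm : 2 * triR r / ν * K < τ₀ := by
    rw [hKn, ENNReal.ofReal_lt_ofReal_iff (by positivity), lt_div_iff₀ (by linarith)] at hsm
    rw [div_mul_eq_mul_div, div_lt_iff₀ hν]
    linarith
  have hKe : 2 * (triR r * K / ν) = 2 * triR r / ν * K := by ring
  have hE2 : analyticNorm r τ₀ u₀ ^ 2 = ENNReal.ofReal (K ^ 2) := by rw [hKn, ENNReal.ofReal_pow hK0]
  set a₀ := coefE (cx u₀) with ha₀
  have hEa : esum (cE r τ₀) a₀ = ENNReal.ofReal (K ^ 2) := by rw [← analyticNorm_sq_eq_esum, hE2]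
  -- The last alternative records that either `K'` is the true size of the data or the solution
  -- vanishes identically, in which case every inequality is trivial.
  have H : ∃ a τ K', 0 < K' ∧ IsSpectralSolution r ν τ₀ K' a₀ a τ ∧ (∀ t, τ₀ - 2 * triR r / ν * K ≤ τ t) ∧
      (K' = K ∨ ∀ t, a t = 0) := by
    rcases hK0.eq_or_lt' with h0 | h0
    · have hz : a₀ = 0 := by
        funext j
        have h1 := norm_le_of_esum_le (K := 0) le_rfl (hEa.le.trans (by rw [h0])) j
        exact norm_le_zero_iff.1 h1
      refine ⟨fun _ => 0, fun _ => τ₀, 1, one_pos, by rw [hz]; exact isSpectralSolution_zero hν, fun t => ?_, .inr fun _ => rfl⟩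
      rw [h0, mul_zero, sub_zero]
    · have H' := exists_isSpectralSolution hr.le hν h0 (hKe ▸ hKsm) (zeroVerticalMean_iff.1 hu₀) (coefE_neg_cx _)
        (coefE_neg_snd _) hEa.le
      obtain ⟨a, τ, h⟩ := H'
      exact ⟨a, τ, K, h0, h, fun t => hKe ▸ h.radius_ge t, .inl rfl⟩
  obtain ⟨a, τ, K', hK', h, hge, hor⟩ := H
  have hpos : ∀ t, 0 < τ t := fun t => (sub_pos.2 hKsm).trans_le (hge t)
  have H : ∀ t, ∃ f : ChannelL2, ∀ j, coefE (cx f) j = a t j := fun t => by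
    refine exists_coefE_eq (ne_top_of_le_ne_top (ENNReal.ofReal_ne_top (r := K' ^ 2))
      (le_trans (ENNReal.tsum_le_tsum fun j => ?_) (h.bound t))) (h.even t) (h.conj t)
    refine le_mul_of_one_le_left' ?_
    rw [ENNReal.one_le_ofReal, cE]
    have := waveNumber_nonneg j.1
    exact le_add_of_nonneg_left (by positivity)
  choose u hu' using H
  have hu : ∀ t, coefE (cx (u t)) = a t := fun t => funext (hu' t)
  have hu0 : u 0 = u₀ := eq_of_coefE_eq fun j => by rw [hu, h.initial]
  have hweak : ∀ T : ℝ, 0 < T → IsWeakSolution r ν T u₀ τ u := fun T hT => by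
    have := h.isWeakSolution hr.le hν hK' hpos hu hT (h.solvesEquation hr.le hν hK' hpos hu hT)
    rwa [hu0] at this
  have hz0 : ∀ {c : ℤ × ℤ → ℝ}, esum c 0 = 0 := by simp [esum]
  have henergy : ∀ T κ : ℝ, (K' = K → ∀ s ∈ Set.Icc 0 T, κ ≤ gain (triR r * K / ν) s) →
      EnergyInequality r ν κ T τ₀ u₀ τ u := fun T κ hκ t ht => by
    simp only [analyticNorm_sq_eq_esum, analyticNormDz_sq_eq_esum, analyticSq_eq_esum, hu, ← ha₀, hEa]
    rcases hor with rfl | h0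
    · refine le_trans (add_le_add_right (mul_le_mul_right ?_ _) _) (h.energy t ht.1)
      refine MeasureTheory.setLIntegral_mono' measurableSet_Ioo fun s hs => ?_
      gcongr
      exact hκ rfl s ⟨hs.1.le, hs.2.le.trans ht.2⟩
    · simp [h0, hz0]
  refine ⟨u, τ, hweak, h.radius_zero, sub_pos.2 hKsm, fun t _ => hge t, ?_, ?_, fun t ht => ?_, fun t ht => ?_,
    fun T σ v hT hv t ht => ?_⟩
  · by_cases hKK : K' = K
    · have hG : 0 < triR r * K / ν := by rw [← hKK]; positivity
      -- The dissipation rate starts at `2` and is still at least `1` up to time `G/4`, with `G =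
      -- triR r * K / ν`.
      exact ⟨triR r * K / ν / 4, by positivity, henergy _ _ fun _ s hs => one_le_gain hG hs.2⟩
    · exact ⟨1, one_pos, henergy _ _ fun h' => absurd h' hKK⟩
  · intro T _
    by_cases hKK : K' = K
    -- The rate decreases, so its value at `T` is an admissible `κ` on `[0,T]`.
    · have hG : 0 < triR r * K / ν := by rw [← hKK]; positivity
      exact ⟨gain (triR r * K / ν) T, gain_pos _ _, henergy _ _ fun _ s hs => gain_anti hG hs.2⟩
    · exact ⟨1, one_pos, henergy _ _ fun h' => absurd h' hKK⟩
  · simp only [analyticNorm_sq_eq_esum, analyticNormDz_sq_eq_esum, hu, ← ha₀, hEa]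
    rcases hor with rfl | h0
    · exact h.decay t ht
    · simp [h0, hz0]
  · refine le_of_sq_le ?_
    rw [mul_pow, hE2, analyticNorm_sq_eq_esum, hu, ← ENNReal.ofReal_pow (Real.exp_pos _).le,
      ← ENNReal.ofReal_mul (by positivity), ← Real.exp_nat_mul]
    rcases hor with rfl | h0
    · refine (h.decay' t ht).trans (le_of_eq ?_)
      congr 3
      push_cast; ring
    · simp [h0, hz0]
  · have h1 := hv.isCoefSolution hr.le hν hT
    have h2 := (hweak T hT).isCoefSolution hr.le hν hT
    have h3 := h1.unique h2 (by linarith) hν hT (by simp only [Set.projIcc_left, hv.initial, hu0]) t ht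
    refine eq_of_coefE_eq fun j => ?_
    simpa only [Set.projIcc_of_mem hT.le ht] using congrFun h3 j
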